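/- Let $N\ge 2$, let $h$ be a formal parameter, and let $G=(g_{ij})$ be a nonsingular complex $N\times N$ matrix with $G^t=G$ ($\mathfrak g_N=\mathfrak o_N$) or $G^t=-G$ ($\mathfrak g_N=\mathfrak{sp}_N$). **R-matrix.** Let $R(u)=1-\frac hu P$ on $\mathbb C^N\otimes\mathbb C^N$, where $P$ is the permutation operator, let $g(u)\in 1+u^{-1}\mathbb C[[u^{-1}]]$ be the unique series with $g(u+N)=g(u)(1-u^{-2})$, and let $\overline R(u)=g(u/h)R(u)$. The transpose of $\overline R$ in one tensor factor is denoted by $\overline R^t$. **Double Yangian.** $\mathrm{DY}(\mathfrak{gl}_N)$ is the ($h$-torsion free) associative $\mathbb C[[h]]$-algebra generated by a central element $C$ and by $t_{ij}^{(\pm r)}$ ($1\le i,j\le N$, $r\ge1$), with the relations $$R(u-v)T_1(u)T_2(v)=T_2(v)T_1(u)R(u-v),\qquad R(u-v)T_1^+(u)T_2^+(v)=T_2^+(v)T_1^+(u)R(u-v),$$ $$\overline R(u-v+hC/2)T_1(u)T_2^+(v)=T_2^+(v)T_1(u)\overline R(u-v-hC/2)$$ (expanded in negative powers of $u$), where $T(u)$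 and $T^+(u)$ have the entries $t_{ij}(u)=\delta_{ij}+h\sum_{r\ge1}t_{ij}^{(r)}u^{-r}$ and $t^+_{ij}(u)=\delta_{ij}-h\sum_{r\ge1}t_{ij}^{(-r)}u^{r-1}$. That is, the powers of $h$ which divide the coefficients of the relations are cancelled. For $c\in\mathbb C$ let $\mathrm{DY}_c(\mathfrak{gl}_N)$ be the quotient by $C=c$, and let the vacuum module $\mathcal V_c(\mathfrak{gl}_N)$ be the $h$-adic completion of the quotient of $\mathrm{DY}_c(\mathfrak{gl}_N)$ by the left ideal generated by all $t_{ij}^{(r)}$, $r\ge1$. Its vacuum vector $1$ is the class of the unit. **Twisted series.** Let $S^+(u)=T^+(u)\,G\,T^{+t}(-u)$ and $S(u)=T(u+hc)\,G\,T^t(-u)$. Let $\mathrm Y^+(\mathfrak g_N)\subset\mathrm{DY}(\mathfrak{gl}_N)$ be the subalgebra generated by all elements $s_{ij}^{(-r)}$ given by $s^+_{ij}(u)=g_{ij}-h\sum_{r\ge1}s_{ij}^{(-r)}u^{r-1}$, and let $\mathrm Y^+(\mathfrak g_N)_h$ be its $h$-adic completion. **Series attached to tableaux.** Let $\nu$ be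 a partition of $n$ with at most $N$ parts and $\mathcal U$ a standard $\nu$-tableau. Let $c_k=j-i$ be the content of the box $(i,j)$ occupied by $k$, and let $\mathcal E_{\mathcal U}$ be the image in $\mathrm{End}\,(\mathbb C^N)^{\otimes n}$ of the primitive idempotent of $\mathbb C[\mathfrak S_n]$ associated with $\mathcal U$ through the orthonormal Young basis. At the critical level $c=-N/2$ set $$\mathbb A_\nu(u)=\mathrm{tr}_{1,\dots,n}\;\mathcal E_{\mathcal U}\,\Big(\prod_{i=1}^{n} S_i^+(u+hc_i)\prod_{j=i+1}^{n}\overline R^{\,t}_{ij}(-2u-hc_i-hc_j)\Big)\Big(\prod_{i=1}^{n} S_i(u+hc_i-\tfrac{hN}4)\prod_{j=i+1}^{n}\overline R^{\,t}_{ij}(-2u-hc_i-hc_j+hN)\Big)^{-1},$$ where all products are ordered from left to right and all $\overline R^{\,t}_{ij}$ are expanded in negative powers of $u$. Let $\mathbb M_\nu(u)=\mathbb A_\nu(u)1\in\mathcal V_{-N/2}(\mathfrak{gl}_N)[[u^{\pm1}]]$. Since $S(u)1=G\otimes1$, this series is the image under $x\mapsto x1$ of the series $$\mathbb M_\nu(u)=\mathrm{tr}_{1,\dots,n}\;\mathcal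 E_{\mathcal U}\,\Big(\prod_{i=1}^{n} S_i^+(u+hc_i)\prod_{j=i+1}^{n}\overline R^{\,t}_{ij}(-2u-hc_i-hc_j)\Big)\Big(\prod_{i=1}^{n} G_i\prod_{j=i+1}^{n}\overline R^{\,t}_{ij}(-2u-hc_i-hc_j+hN)\Big)^{-1}$$ in $\mathrm Y^+(\mathfrak g_N)_h[[u^{\pm1}]]$, denoted by the same symbol. **Corollary 4.5.** For every $\nu$ and $\mathcal U$ as above, the series $\mathbb M_\nu(u)\in\mathrm Y^+(\mathfrak g_N)_h[[u^{\pm1}]]$ satisfies $\mathbb M_\nu(u)\,1=\mathbb A_\nu(u)\,1$ in $\mathcal V_{-N/2}(\mathfrak{gl}_N)[[u^{\pm1}]]$. All coefficients of all the series $\mathbb M_\nu(u)$, for all partitions $\nu$ with at most $N$ parts and all standard $\nu$-tableaux $\mathcal U$, pairwise commute in $\mathrm Y^+(\mathfrak g_N)_h$. In particular, the $\mathbb C[[h]]$-subalgebra of $\mathrm Y^+(\mathfrak g_N)_h$ generated by them is commutative. -/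

import Mathlib

noncomputable section

namespace TwistedYangian

/-- The base ring `ℂ[[h]]`. -/
abbrev Ch : Type := PowerSeries ℂ

section Base

variable (A : Type*) [Ring A] [Algebra Ch A]

/-- The formal parameter `h` in a `ℂ[[h]]`-algebra. -/
def hPar : A := algebraMap Ch A PowerSeries.X

/-- The complex constants in a `ℂ[[h]]`-algebra. -/
def cst : ℂ →+* A := (algebraMap Ch A).comp PowerSeries.C

end Base

/-! ### Scalar series and the Yang R-matrix -/

/-- Substitution `g(y)` of a power series `y` without constant term into a complex power series
`g`; the coefficients of `y` lie in a possibly noncommutative ring `B`, to which the complex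
numbers map by `φ`. -/
def substSeries {B : Type*} [Ring B] (φ : ℂ →+* B) (g : PowerSeries ℂ) (y : PowerSeries B) :
    PowerSeries B :=
  PowerSeries.mk fun n =>
    ∑ k ∈ Finset.range (n + 1), φ (PowerSeries.coeff k g) * PowerSeries.coeff n (y ^ k)

/-- `shiftInv a β` is `u / (a u + β h)`, expanded in negative powers of `u`, as a power series in
`w = h / u`. -/
def shiftInv (a β : ℂ) : PowerSeries ℂ := (PowerSeries.C a + PowerSeries.C β * PowerSeries.X)⁻¹

/-- `1 / (u + N)` as a power series in `x = 1 / u`. -/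
def shiftVar (N : ℕ) : PowerSeries ℂ := PowerSeries.X * shiftInv 1 N

/-- The coefficients of the series `g(u) ∈ 1 + u⁻¹ ℂ[[u⁻¹]]` with `g(u + N) = g(u) (1 - u⁻²)`;
see `gSeries_spec`. -/
def gCoeff (N : ℕ) : ℕ → ℂ
  | 0 => 1
  | m + 1 => (gCoeff N m + ∑ k : Fin (m + 1),
      gCoeff N k * PowerSeries.coeff (m + 2) (shiftVar N ^ (k : ℕ))) / ((m + 1) * N)
termination_by m => m
decreasing_by all_goals omega

/-- The series `g(u)`, as a power series in `x = u⁻¹`. -/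
def gSeries (N : ℕ) : PowerSeries ℂ := PowerSeries.mk (gCoeff N)

theorem constCoeff_shiftInv (N : ℕ) : PowerSeries.constantCoeff (shiftInv 1 N) = 1 := by
  simp [shiftInv]

theorem coeff_one_shiftInv (N : ℕ) : PowerSeries.coeff 1 (shiftInv 1 (N : ℂ)) = -N := by
  have h : (PowerSeries.C (1 : ℂ) + PowerSeries.C (N : ℂ) * PowerSeries.X) * shiftInv 1 N = 1 := by
    apply PowerSeries.mul_inv_cancel
    simp
  rw [add_mul, map_one, one_mul, mul_assoc] at h
  have h1 := congrArg (PowerSeries.coeff 1) h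
  rw [map_add, PowerSeries.coeff_C_mul, PowerSeries.coeff_one,
    show (1 : ℕ) = 0 + 1 from rfl, PowerSeries.coeff_succ_X_mul,
    PowerSeries.coeff_zero_eq_constantCoeff_apply, constCoeff_shiftInv] at h1
  simp at h1
  linear_combination h1

theorem coeff_shiftVar_pow (N k n : ℕ) :
    PowerSeries.coeff (n + k) (shiftVar N ^ k) = PowerSeries.coeff n (shiftInv 1 N ^ k) := by
  rw [shiftVar, mul_pow, PowerSeries.coeff_X_pow_mul]

theorem constCoeff_shiftInv_pow (N k : ℕ) : PowerSeries.coeff 0 (shiftInv 1 N ^ k) = 1 := by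
  rw [PowerSeries.coeff_zero_eq_constantCoeff_apply, map_pow, constCoeff_shiftInv, one_pow]

theorem coeff_one_shiftInv_pow (N k : ℕ) :
    PowerSeries.coeff 1 (shiftInv 1 (N : ℂ) ^ k) = -(k * N) := by
  induction k with
  | zero => simp [PowerSeries.coeff_one]
  | succ k ih =>
    have h0 := constCoeff_shiftInv_pow N k
    have h1 := constCoeff_shiftInv N
    have h2 := coeff_one_shiftInv N
    rw [← PowerSeries.coeff_zero_eq_constantCoeff_apply] at h1
    rw [pow_succ, PowerSeries.coeff_mul]
    simp only [Finset.Nat.antidiagonal_succ, Finset.Nat.antidiagonal_zero, Finset.sum_cons,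
      Finset.map_singleton, Finset.sum_singleton, h0, h2, ih,
      Function.Embedding.prodMap, Function.Embedding.coeFn_mk, Prod.map]
    simp [h1]
    ring

/-- The defining property of `g(u)`: its constant term is `1`, and `g(u + N) = g(u) (1 - u⁻²)`. -/
theorem gSeries_spec (N : ℕ) (hN : N ≠ 0) :
    PowerSeries.constantCoeff (gSeries N) = 1 ∧
      substSeries (RingHom.id ℂ) (gSeries N) (shiftVar N) =
        gSeries N * (1 - PowerSeries.X ^ 2) := by
  constructor
  · rw [← PowerSeries.coeff_zero_eq_constantCoeff_apply, gSeries, PowerSeries.coeff_mk, gCoeff]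
  · ext n
    rw [substSeries, PowerSeries.coeff_mk, mul_sub, mul_one, map_sub, PowerSeries.coeff_mul_X_pow']
    simp only [gSeries, PowerSeries.coeff_mk, RingHom.id_apply]
    match n with
    | 0 => simp
    | 1 =>
      have h := coeff_shiftVar_pow N 1 0
      rw [constCoeff_shiftInv_pow] at h
      simp only [zero_add] at h
      rw [pow_one] at h
      simp [Finset.sum_range_succ, PowerSeries.coeff_one, h]
    | m + 2 =>
      have h0 := coeff_shiftVar_pow N (m + 2) 0
      rw [constCoeff_shiftInv_pow, zero_add] at h0
      have h1 := coeff_shiftVar_pow N (m + 1) 1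
      rw [coeff_one_shiftInv_pow, show 1 + (m + 1) = m + 2 by ring] at h1
      rw [Finset.sum_range_succ, Finset.sum_range_succ, h0, h1]
      have hg : gCoeff N (m + 1) = (gCoeff N m + ∑ k : Fin (m + 1),
          gCoeff N k * PowerSeries.coeff (m + 2) (shiftVar N ^ (k : ℕ))) / ((m + 1) * N) := by
        rw [gCoeff]
      rw [Fin.sum_univ_eq_sum_range
        (fun k => gCoeff N k * PowerSeries.coeff (m + 2) (shiftVar N ^ k))] at hg
      have hN' : (N : ℂ) ≠ 0 := Nat.cast_ne_zero.mpr hN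
      have hm : (m : ℂ) + 1 ≠ 0 := by exact_mod_cast Nat.succ_ne_zero m
      rw [eq_div_iff (mul_ne_zero hm hN')] at hg
      simp only [le_add_iff_nonneg_left, zero_le, if_true, Nat.add_sub_cancel]
      push_cast
      linear_combination -hg

section RMatrix

variable {N : ℕ}

/-- The permutation operator `P = ∑ e_ij ⊗ e_ji` on `ℂ^N ⊗ ℂ^N`. -/
def permMat (N : ℕ) (R : Type*) [Ring R] : Matrix (Fin N × Fin N) (Fin N × Fin N) R :=
  Matrix.of fun p q => if p.1 = q.2 ∧ p.2 = q.1 then 1 else 0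

/-- The transposition applied on the second tensor factor. -/
def partialTranspose {R : Type*} (X : Matrix (Fin N × Fin N) (Fin N × Fin N) R) :
    Matrix (Fin N × Fin N) (Fin N × Fin N) R :=
  Matrix.of fun p q => X (p.1, q.2) (q.1, p.2)

/-- The normalized Yang R-matrix `g(x/h) (1 - (h/x) P)`, where `y` stands for `h/x`. -/
def normR (N : ℕ) {B : Type*} [Ring B] (φ : ℂ →+* B) (y : PowerSeries B) :
    Matrix (Fin N × Fin N) (Fin N × Fin N) (PowerSeries B) :=
  substSeries φ (gSeries N) y • (1 - y • permMat N (PowerSeries B))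

/-- The matrix `R̄ᵗ(a u + β h)`, where `a ≠ 0`, expanded in negative powers of `u`. Its entries are
power series in `w = h / u`. -/
def RBarT (N : ℕ) (a β : ℂ) : Matrix (Fin N × Fin N) (Fin N × Fin N) (PowerSeries ℂ) :=
  partialTranspose (normR N (RingHom.id ℂ) (PowerSeries.X * shiftInv a β))

end RMatrix

/-! ### The double Yangian -/

/-- Generators of the double Yangian: `C`, `t_ij^{(-r-1)}` and `t_ij^{(r+1)}` for `r ≥ 0`. -/
inductive DYGen (N : ℕ) : Type
  | central : DYGen N
  | tNeg (i j : Fin N) (r : ℕ) : DYGen N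
  | tPos (i j : Fin N) (r : ℕ) : DYGen N

/-- The free `ℂ[[h]]`-algebra on the generators. -/
abbrev FreeDY (N : ℕ) : Type := FreeAlgebra Ch (DYGen N)

section Series

variable {N : ℕ} {A : Type*} [Ring A] [Algebra Ch A]

/-- `T(u) = 1 + h ∑ t^{(r)} u^{-r}`, a power series in `u⁻¹`; `t r` stands for `t^{(r+1)}`. -/
def posSeries (t : Fin N → Fin N → ℕ → A) : Matrix (Fin N) (Fin N) (PowerSeries A) :=
  Matrix.of fun i j => (if i = j then 1 else 0) +
    PowerSeries.X * PowerSeries.mk fun r => hPar A * t i j r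

/-- `T⁺(u) = 1 - h ∑ t^{(-r)} u^{r-1}`, a power series in `u`; `t r` stands for `t^{(-r-1)}`. -/
def negSeries (t : Fin N → Fin N → ℕ → A) : Matrix (Fin N) (Fin N) (PowerSeries A) :=
  Matrix.of fun i j => (if i = j then 1 else 0) - PowerSeries.mk fun r => hPar A * t i j r

/-- `X(u)` on the first tensor factor; the outer variable belongs to `u`, the inner one to `v`. -/
def first (X : Matrix (Fin N) (Fin N) (PowerSeries A)) :
    Matrix (Fin N × Fin N) (Fin N × Fin N) (PowerSeries (PowerSeries A)) :=
  Matrix.of fun p q => if p.2 = q.2 then PowerSeries.map PowerSeries.C (X p.1 q.1) else 0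

/-- `X(v)` on the second tensor factor; the outer variable belongs to `u`, the inner one to `v`. -/
def second (X : Matrix (Fin N) (Fin N) (PowerSeries A)) :
    Matrix (Fin N × Fin N) (Fin N × Fin N) (PowerSeries (PowerSeries A)) :=
  Matrix.of fun p q => if p.1 = q.1 then PowerSeries.C (X p.2 q.2) else 0

/-- The outer variable. -/
def outerVar (A : Type*) [Ring A] : PowerSeries (PowerSeries A) := PowerSeries.X

/-- The inner variable. -/
def innerVar (A : Type*) [Ring A] : PowerSeries (PowerSeries A) := PowerSeries.C PowerSeries.X

/-- Scalars of `A` as constant series. -/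
def const2 (a : A) : PowerSeries (PowerSeries A) := PowerSeries.C (PowerSeries.C a)

/-- `u⁻¹ v⁻¹ (u - v) R(u - v) = v⁻¹ - u⁻¹ - h u⁻¹ v⁻¹ P`; outer variable `u⁻¹`, inner `v⁻¹`. -/
def clearedRPos (N : ℕ) (A : Type*) [Ring A] [Algebra Ch A] :
    Matrix (Fin N × Fin N) (Fin N × Fin N) (PowerSeries (PowerSeries A)) :=
  (innerVar A - outerVar A) • (1 : Matrix _ _ _) -
    (const2 (hPar A) * outerVar A * innerVar A) • permMat N _

/-- `(u - v) R(u - v) = u - v - h P`; outer variable `u`, inner variable `v`. -/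
def clearedRNeg (N : ℕ) (A : Type*) [Ring A] [Algebra Ch A] :
    Matrix (Fin N × Fin N) (Fin N × Fin N) (PowerSeries (PowerSeries A)) :=
  (outerVar A - innerVar A) • (1 : Matrix _ _ _) - const2 (hPar A) • permMat N _

/-- `R̄(u - v + h z)` expanded in negative powers of `u`; outer variable `u⁻¹`, inner variable `v`.
Here `h / (u - v + h z) = ∑ h (v - h z)^l u^{-l-1}`. -/
def mixedR (N : ℕ) (z : A) :
    Matrix (Fin N × Fin N) (Fin N × Fin N) (PowerSeries (PowerSeries A)) :=
  normR N (PowerSeries.C.comp (cst A))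
    (PowerSeries.X * PowerSeries.mk fun l =>
      PowerSeries.C (hPar A) * (PowerSeries.X - PowerSeries.C (hPar A * z)) ^ l)

end Series

/-- The central element in the free algebra. -/
def freeC (N : ℕ) : FreeDY N := FreeAlgebra.ι Ch DYGen.central

/-- `T(u)` over the free algebra. -/
def freeT (N : ℕ) : Matrix (Fin N) (Fin N) (PowerSeries (FreeDY N)) :=
  posSeries fun i j r => FreeAlgebra.ι Ch (DYGen.tPos i j r)

/-- `T⁺(u)` over the free algebra. -/
def freeTPlus (N : ℕ) : Matrix (Fin N) (Fin N) (PowerSeries (FreeDY N)) :=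
  negSeries fun i j r => FreeAlgebra.ι Ch (DYGen.tNeg i j r)

/-- The relations of the double Yangian, coefficient by coefficient: `C` is central, and
`R(u-v) T₁(u) T₂(v) = T₂(v) T₁(u) R(u-v)`,
`R(u-v) T⁺₁(u) T⁺₂(v) = T⁺₂(v) T⁺₁(u) R(u-v)`,
`R̄(u-v+hC/2) T₁(u) T⁺₂(v) = T⁺₂(v) T₁(u) R̄(u-v-hC/2)`;
the first two are multiplied by `u - v`. -/
inductive DYRel (N : ℕ) : FreeDY N → FreeDY N → Prop
  | central (x : FreeDY N) : DYRel N (freeC N * x) (x * freeC N)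
  | pos (p q : Fin N × Fin N) (a b : ℕ) : DYRel N
      (PowerSeries.coeff b (PowerSeries.coeff a
        ((clearedRPos N (FreeDY N) * first (freeT N) * second (freeT N)) p q)))
      (PowerSeries.coeff b (PowerSeries.coeff a
        ((second (freeT N) * first (freeT N) * clearedRPos N (FreeDY N)) p q)))
  | neg (p q : Fin N × Fin N) (a b : ℕ) : DYRel N
      (PowerSeries.coeff b (PowerSeries.coeff a
        ((clearedRNeg N (FreeDY N) * first (freeTPlus N) * second (freeTPlus N)) p q)))
      (PowerSeries.coeff b (PowerSeries.coeff a
        ((second (freeTPlus N) * first (freeTPlus N) * clearedRNeg N (FreeDY N)) p q)))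
  | mixed (p q : Fin N × Fin N) (a b : ℕ) : DYRel N
      (PowerSeries.coeff b (PowerSeries.coeff a
        ((mixedR N (cst _ (1 / 2) * freeC N) * first (freeT N) * second (freeTPlus N)) p q)))
      (PowerSeries.coeff b (PowerSeries.coeff a
        ((second (freeTPlus N) * first (freeT N) * mixedR N (-(cst _ (1 / 2) * freeC N))) p q)))

/-- The relations hold up to `h`-torsion: `h ^ k * x` and `h ^ k * y` coincide modulo the ideal
generated by the relations. Every coefficient of the `RTT` relations is a multiple of `h ^ 2`, and
the double Yangian is defined by the relations from which these powers of `h` are cancelled. -/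
def TorsionRel (N : ℕ) (x y : FreeDY N) : Prop :=
  ∃ k : ℕ, RingQuot.mkRingHom (DYRel N) (hPar _ ^ k * x) =
    RingQuot.mkRingHom (DYRel N) (hPar _ ^ k * y)

/-- The double Yangian `DY(gl_N)`: the `h`-torsion-free algebra over `ℂ[[h]]` defined by the
generators and relations above. -/
def DY (N : ℕ) : Type := RingQuot (TorsionRel N)

instance (N : ℕ) : Ring (DY N) := inferInstanceAs (Ring (RingQuot (TorsionRel N)))

instance (N : ℕ) : Algebra Ch (DY N) := inferInstanceAs (Algebra Ch (RingQuot (TorsionRel N)))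

/-- The projection from the free algebra. -/
def toDY (N : ℕ) : FreeDY N →ₐ[Ch] DY N := RingQuot.mkAlgHom Ch (TorsionRel N)

/-- The generator `t_ij^{(-r-1)}` of the double Yangian. -/
def tNeg {N : ℕ} (i j : Fin N) (r : ℕ) : DY N := toDY N (FreeAlgebra.ι Ch (DYGen.tNeg i j r))

/-- The generator `t_ij^{(r+1)}` of the double Yangian. -/
def tPos {N : ℕ} (i j : Fin N) (r : ℕ) : DY N := toDY N (FreeAlgebra.ι Ch (DYGen.tPos i j r))

/-- The double Yangian `DY_c(gl_N)` at the level `c`: the quotient by the ideal generated by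
`C - c`. -/
def DYLevel (N : ℕ) (c : ℂ) : Type :=
  RingQuot fun x y : DY N => x = toDY N (freeC N) ∧ y = cst (DY N) c

instance (N : ℕ) (c : ℂ) : Ring (DYLevel N c) :=
  inferInstanceAs (Ring (RingQuot fun x y : DY N => x = toDY N (freeC N) ∧ y = cst (DY N) c))

instance (N : ℕ) (c : ℂ) : Algebra Ch (DYLevel N c) :=
  inferInstanceAs
    (Algebra Ch (RingQuot fun x y : DY N => x = toDY N (freeC N) ∧ y = cst (DY N) c))

/-- The projection to the double Yangian at the level `c`. -/
def toLevel (N : ℕ) (c : ℂ) : DY N →ₐ[Ch] DYLevel N c :=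
  RingQuot.mkAlgHom Ch fun x y : DY N => x = toDY N (freeC N) ∧ y = cst (DY N) c

/-! ### The algebra `Y⁺(g_N)` -/

section Twisted

variable {N : ℕ} (G : Matrix (Fin N) (Fin N) ℂ)

/-- `S⁺(u) = T⁺(u) G T⁺ᵗ(-u)` over the double Yangian. -/
def sPlusSeries : Matrix (Fin N) (Fin N) (PowerSeries (DY N)) :=
  negSeries tNeg * G.map (fun z => PowerSeries.C (cst (DY N) z)) *
    (Matrix.of fun i j => PowerSeries.mk fun r =>
      (-1) ^ r * PowerSeries.coeff r (negSeries (A := DY N) tNeg j i))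

/-- The element `s_ij^{(-r-1)}` given by `s⁺_ij(u) = g_ij - h ∑ s_ij^{(-r)} u^{r-1}`;
see `coeff_sPlusSeries`. -/
def sNeg (i j : Fin N) (r : ℕ) : DY N :=
  ∑ k, tNeg i k r * cst (DY N) (G k j) + (-1) ^ r * ∑ k, cst (DY N) (G i k) * tNeg j k r -
    hPar (DY N) * ∑ p ∈ Finset.HasAntidiagonal.antidiagonal r, (-1) ^ p.2 *
      ∑ k, ∑ l, tNeg i k p.1 * cst (DY N) (G k l) * tNeg j l p.2

/-- `s⁺_ij(u) = g_ij - h ∑ s_ij^{(-r)} u^{r-1}`. -/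
theorem coeff_sPlusSeries (i j : Fin N) (r : ℕ) :
    PowerSeries.coeff r (sPlusSeries G i j) =
      (if r = 0 then cst (DY N) (G i j) else 0) - hPar (DY N) * sNeg G i j r := by
  have hc : ∀ x : DY N, x * hPar (DY N) = hPar (DY N) * x := fun x => (Algebra.commutes _ x).symm
  have hl : ∀ x y : DY N, x * (hPar (DY N) * y) = hPar (DY N) * (x * y) := fun x y => by
    rw [← mul_assoc, hc, mul_assoc]
  have hs : ∀ (n : ℕ) (x y : DY N), x * ((-1) ^ n * y) = (-1) ^ n * (x * y) := fun n x y => by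
    rw [← mul_assoc, ((Commute.neg_one_right x).pow_right n).eq, mul_assoc]
  set Θ : Matrix (Fin N) (Fin N) (PowerSeries (DY N)) :=
    Matrix.of fun i j => PowerSeries.mk fun r => hPar (DY N) * tNeg i j r with hΘ
  set Θ' : Matrix (Fin N) (Fin N) (PowerSeries (DY N)) :=
    Matrix.of fun i j => PowerSeries.mk fun r => (-1) ^ r * (hPar (DY N) * tNeg j i r) with hΘ'
  set G' : Matrix (Fin N) (Fin N) (PowerSeries (DY N)) :=
    G.map (fun z => PowerSeries.C (cst (DY N) z)) with hG'
  have h1 : negSeries (A := DY N) tNeg = 1 - Θ := by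
    ext1 i j
    simp [negSeries, hΘ, Matrix.one_apply]
  have h2 : (Matrix.of fun i j => PowerSeries.mk fun r =>
      (-1) ^ r * PowerSeries.coeff r (negSeries (A := DY N) tNeg j i)) = 1 - Θ' := by
    ext i j n
    rw [h1]
    rcases eq_or_ne i j with rfl | h
    · by_cases hn : n = 0 <;> simp [hΘ, hΘ', PowerSeries.coeff_one, hn, mul_sub]
    · simp [hΘ, hΘ', h, h.symm, mul_sub]
  have h3 : sPlusSeries G = G' - Θ * G' - G' * Θ' + Θ * G' * Θ' := by
    rw [sPlusSeries, h2, h1]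
    noncomm_ring
  rw [h3]
  have hm : ∀ (f : ℕ → DY N) (a : DY N), PowerSeries.mk f * PowerSeries.C a =
      PowerSeries.mk fun n => f n * a := by
    intro f a
    ext n
    rw [PowerSeries.coeff_mul_C, PowerSeries.coeff_mk, PowerSeries.coeff_mk]
  simp only [Matrix.add_apply, Matrix.sub_apply, Matrix.mul_apply, map_add, map_sub, map_sum,
    Finset.sum_mul, hG', hΘ, hΘ', Matrix.map_apply, Matrix.of_apply, PowerSeries.coeff_C,
    hm, PowerSeries.coeff_C_mul]
  simp only [PowerSeries.coeff_mul, PowerSeries.coeff_mk, sNeg, mul_sub, mul_add, Finset.mul_sum]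
  have e1 : ∑ x, hPar (DY N) * tNeg i x r * cst (DY N) (G x j) =
      ∑ x, hPar (DY N) * (tNeg i x r * cst (DY N) (G x j)) :=
    Finset.sum_congr rfl fun x _ => mul_assoc _ _ _
  have e2 : ∑ x, cst (DY N) (G i x) * ((-1) ^ r * (hPar (DY N) * tNeg j x r)) =
      ∑ x, hPar (DY N) * ((-1) ^ r * (cst (DY N) (G i x) * tNeg j x r)) :=
    Finset.sum_congr rfl fun x _ => by rw [hs, hl, hl]
  have e3 : ∑ l, ∑ k, ∑ p ∈ Finset.HasAntidiagonal.antidiagonal r,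
      hPar (DY N) * tNeg i k p.1 * cst (DY N) (G k l) *
        ((-1) ^ p.2 * (hPar (DY N) * tNeg j l p.2)) =
      ∑ p ∈ Finset.HasAntidiagonal.antidiagonal r, ∑ k, ∑ l, hPar (DY N) * (hPar (DY N) *
        ((-1) ^ p.2 * (tNeg i k p.1 * cst (DY N) (G k l) * tNeg j l p.2))) := by
    rw [Finset.sum_comm]
    conv_rhs => rw [Finset.sum_comm]
    refine Finset.sum_congr rfl fun k _ => ?_
    rw [Finset.sum_comm]
    refine Finset.sum_congr rfl fun p _ => Finset.sum_congr rfl fun l _ => ?_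
    rw [hs, hl, hl, mul_assoc (hPar (DY N)), mul_assoc (hPar (DY N)), hl]
  rw [e1, e2, e3]
  abel

/-- The algebra `Y⁺(g_N)`: the subalgebra generated by the elements `s_ij^{(-r)}`, `r ≥ 1`. -/
def YPlus : Subalgebra Ch (DY N) :=
  Algebra.adjoin Ch {x | ∃ i j r, x = sNeg G i j r}

/-- `s_ij^{(-r-1)}` as an element of `Y⁺(g_N)`. -/
def sGen (i j : Fin N) (r : ℕ) : YPlus G :=
  ⟨sNeg G i j r, Algebra.subset_adjoin ⟨i, j, r, rfl⟩⟩

end Twisted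

/-! ### The `h`-adic completion -/

section Completion

variable (A : Type*) [Ring A] [Algebra Ch A]

/-- The two-sided ideal `h^k A`. -/
def hIdeal (k : ℕ) : Ideal A := Ideal.span {hPar A ^ k}

theorem hPar_mul_comm (x : A) : hPar A * x = x * hPar A := Algebra.commutes _ _

theorem hPar_pow_mul_comm (k : ℕ) (x : A) : hPar A ^ k * x = x * hPar A ^ k :=
  (Commute.pow_left (hPar_mul_comm A x) k).eq

theorem mem_hIdeal {k : ℕ} {x : A} : x ∈ hIdeal A k ↔ ∃ y, x = hPar A ^ k * y := by
  rw [hIdeal, Ideal.mem_span_singleton']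
  constructor
  · rintro ⟨y, rfl⟩
    exact ⟨y, (hPar_pow_mul_comm A k y).symm⟩
  · rintro ⟨y, rfl⟩
    exact ⟨y, (hPar_pow_mul_comm A k y).symm⟩

instance (k : ℕ) : (hIdeal A k).IsTwoSided where
  mul_mem_of_left b h := by
    obtain ⟨y, rfl⟩ := (mem_hIdeal A).1 h
    exact (mem_hIdeal A).2 ⟨y * b, mul_assoc _ _ _⟩

theorem hIdeal_succ_le (k : ℕ) : hIdeal A (k + 1) ≤ hIdeal A k := by
  intro x hx
  obtain ⟨y, rfl⟩ := (mem_hIdeal A).1 hx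
  exact (mem_hIdeal A).2 ⟨hPar A * y, by rw [pow_succ, mul_assoc]⟩

/-- The quotient `A / h^k A`. -/
abbrev ModH (k : ℕ) : Type _ := A ⧸ hIdeal A k

/-- The projection `A / h^(k+1) A → A / h^k A`. -/
def ModH.step (k : ℕ) : ModH A (k + 1) →ₐ[Ch] ModH A k :=
  Ideal.Quotient.factorₐ Ch (hIdeal_succ_le A k)

/-- The `h`-adic completion of the algebra `A`: the inverse limit of the algebras `A / h^k A`. -/
def HCompletion : Subalgebra Ch (∀ k, ModH A k) where
  carrier := {x | ∀ k, ModH.step A k (x (k + 1)) = x k}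
  mul_mem' hx hy k := by simp only [Pi.mul_apply, map_mul, hx k, hy k]
  add_mem' hx hy k := by simp only [Pi.add_apply, map_add, hx k, hy k]
  algebraMap_mem' r k := by simp only [Pi.algebraMap_apply, AlgHom.commutes]

end Completion

/-! ### Standard tableaux and the idempotents -/

/-- A standard tableau of shape `ν` (with entries `0, …, n - 1`): `box p` is the box (row, column)
occupied by `p`; the entries increase along the rows and down the columns. -/
structure StandardTableau (ν : YoungDiagram) where
  /-- The box occupied by an entry. -/
  box : Fin ν.card ≃ ν.cells
  /-- The entries increase along the rows and down the columns. -/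
  increasing : ∀ p q : Fin ν.card, (box p : ℕ × ℕ) ≤ (box q : ℕ × ℕ) → p ≤ q

namespace StandardTableau

variable {ν : YoungDiagram} (U : StandardTableau ν)

/-- The content `j - i` of the box `(i, j)` occupied by `p`. -/
def content (p : Fin ν.card) : ℤ := ((U.box p : ℕ × ℕ).2 : ℤ) - ((U.box p : ℕ × ℕ).1 : ℤ)

/-- The Jucys–Murphy element `x_k = ∑_{i < k} (i k)` of the group algebra. -/
def jucysMurphy {n : ℕ} (k : Fin n) : MonoidAlgebra ℂ (Equiv.Perm (Fin n)) :=
  ∑ i ∈ Finset.univ.filter (· < k), MonoidAlgebra.single (Equiv.swap i k) 1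

/-- The primitive idempotent `e_U`. The vectors `v_T` of the orthonormal Young basis are
characterized by `x_k v_T = c_k(T) v_T`, and `e_U` acts on the irreducible representations as the
projection to the line of `v_U` along the other `v_T`; since `c_k(T)` lies between `-(k-1)` and
`k-1` for `k = 1, …, n`, this is the product of all `(x_k - a) / (c_k(U) - a)` with
`|a| ≤ k-1`, `a ≠ c_k(U)`. -/
def idempotent : MonoidAlgebra ℂ (Equiv.Perm (Fin ν.card)) :=
  ((List.finRange ν.card).map fun k : Fin ν.card =>
    ((((List.range (2 * (k : ℕ) + 1)).map fun m => (m : ℤ) - (k : ℤ)).filter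
      fun a => a ≠ U.content k).map fun a =>
        ((U.content k : ℂ) - (a : ℂ))⁻¹ •
          (jucysMurphy k - algebraMap ℂ _ (a : ℂ))).prod).prod

/-- The operator `E_U` on `(ℂ^N)^{⊗ n}`: the image of `e_U` under the action of the symmetric group
which permutes the tensor factors. -/
def idempotentMat (N : ℕ) : Matrix (Fin ν.card → Fin N) (Fin ν.card → Fin N) ℂ :=
  Matrix.of fun a b =>
    ∑ σ : Equiv.Perm (Fin ν.card), if a = b ∘ σ.symm then U.idempotent.coeff σ else 0

end StandardTableau

/-! ### Matrices on tensor powers -/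

section Tensor

variable {N n : ℕ} {R : Type*} [Ring R]

/-- The matrix `X` on the `i`-th tensor factor of `(ℂ^N)^{⊗ n}`. -/
def site (i : Fin n) (X : Matrix (Fin N) (Fin N) R) :
    Matrix (Fin n → Fin N) (Fin n → Fin N) R :=
  Matrix.of fun a b => if ∀ k, k ≠ i → a k = b k then X (a i) (b i) else 0

/-- The matrix `X` on the tensor factors `i ≠ j` of `(ℂ^N)^{⊗ n}`. -/
def sites (i j : Fin n) (X : Matrix (Fin N × Fin N) (Fin N × Fin N) R) :
    Matrix (Fin n → Fin N) (Fin n → Fin N) R :=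
  Matrix.of fun a b => if ∀ k, k ≠ i → k ≠ j → a k = b k then X (a i, a j) (b i, b j) else 0

/-- The ordered product of the `S_i R_{i,i+1} ⋯ R_{i,n}` over `i = 1, …, n`. -/
def bracket (S : Fin n → Matrix (Fin N) (Fin N) R)
    (Q : Fin n → Fin n → Matrix (Fin N × Fin N) (Fin N × Fin N) R) :
    Matrix (Fin n → Fin N) (Fin n → Fin N) R :=
  ((List.finRange n).map fun i =>
    site i (S i) * (((List.finRange n).filter fun j => i < j).map fun j =>
      sites i j (Q i j)).prod).prod

end Tensor

/-! ### Series modulo `h^k` -/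

section Laurent

variable {N : ℕ} {B : Type*} [Ring B] [Algebra Ch B]

/-- A power series in `w = h / u` as a Laurent polynomial in `u`, over an algebra with
`h ^ k = 0`. -/
def wLaurent (k : ℕ) (B : Type*) [Ring B] [Algebra Ch B] (f : PowerSeries ℂ) : LaurentSeries B :=
  ∑ n ∈ Finset.range k,
    HahnSeries.single (-(n : ℤ)) (cst B (PowerSeries.coeff n f) * hPar B ^ n)

/-- `S⁺(u + β h) = G - h ∑ s^{(-r-1)} (u + β h)^r` as a Laurent series in `u`, over an algebra with
`h ^ k = 0`; `s r` stands for `s^{(-r-1)}`. -/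
def sPlusShift (k : ℕ) (G : Matrix (Fin N) (Fin N) ℂ) (s : Fin N → Fin N → ℕ → B) (β : ℂ) :
    Matrix (Fin N) (Fin N) (LaurentSeries B) :=
  Matrix.of fun i j => HahnSeries.ofPowerSeries ℤ B
    (PowerSeries.C (cst B (G i j)) - PowerSeries.mk fun m =>
      hPar B * ∑ d ∈ Finset.range k,
        cst B (((m + d).choose m : ℂ) * β ^ d) * hPar B ^ d * s i j (m + d))

/-- `E_U S⁺_[n](u_ν)` as a matrix of Laurent series in `u`, over an algebra with `h ^ k = 0`. -/
def sPlusPart (k : ℕ) (G : Matrix (Fin N) (Fin N) ℂ) (s : Fin N → Fin N → ℕ → B)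
    {ν : YoungDiagram} (U : StandardTableau ν) :
    Matrix (Fin ν.card → Fin N) (Fin ν.card → Fin N) (LaurentSeries B) :=
  (U.idempotentMat N).map (fun z => HahnSeries.C (cst B z)) *
    bracket (fun i => sPlusShift k G s (U.content i : ℂ))
      (fun i j => (RBarT N (-2) (-((U.content i : ℂ) + U.content j))).map (wLaurent k B))

end Laurent

/-- The result of replacing every `S_i` by `G_i` in `S_[n](u_ν + h c / 2)` at the level `c`: the
ordered product of the `G_i ∏_{j > i} R̄ᵗ_ij(-2u - h (c_i + c_j) - 2 h c)`. -/
def vacuumFactor {N : ℕ} (G : Matrix (Fin N) (Fin N) ℂ) (c : ℂ) {ν : YoungDiagram}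
    (U : StandardTableau ν) :
    Matrix (Fin ν.card → Fin N) (Fin ν.card → Fin N) (PowerSeries ℂ) :=
  bracket (fun _ => G.map PowerSeries.C)
    (fun i j => RBarT N (-2) (-((U.content i : ℂ) + U.content j) - 2 * c))

section MSeries

variable {N : ℕ} (G : Matrix (Fin N) (Fin N) ℂ) (c : ℂ) {ν : YoungDiagram}
  (U : StandardTableau ν)

/-- The series `tr E_U S⁺_[n](u_ν) D(u)⁻¹`, with `D(u)` the `vacuumFactor`, over an algebra with
`h ^ k = 0`. -/
def mLaurent {B : Type*} [Ring B] [Algebra Ch B] (k : ℕ) (s : Fin N → Fin N → ℕ → B) :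
    LaurentSeries B :=
  Matrix.trace (sPlusPart k G s U * ((vacuumFactor G c U)⁻¹).map (wLaurent k B))

end MSeries

/-! ### Compatibility of the truncations -/

section Compatibility

variable {N : ℕ} {B B' : Type*} [Ring B] [Algebra Ch B] [Ring B'] [Algebra Ch B']

/-- The coefficientwise map of Laurent series. -/
def laurentMap (f : B →ₐ[Ch] B') : LaurentSeries B →+* LaurentSeries B' where
  toFun x := HahnSeries.map x f
  map_one' := by
    ext n
    simp only [HahnSeries.map_coeff, HahnSeries.coeff_one]
    split_ifs <;> simp
  map_mul' x y := HahnSeries.map_mul ((f : B →+* B') : B →ₙ+* B')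
  map_zero' := by ext n; simp
  map_add' x y := by ext n; simp

theorem laurentMap_coeff (f : B →ₐ[Ch] B') (x : LaurentSeries B) (n : ℤ) :
    (laurentMap f x).coeff n = f (x.coeff n) := rfl

theorem map_cst (f : B →ₐ[Ch] B') (z : ℂ) : f (cst B z) = cst B' z := f.commutes _

theorem map_hPar (f : B →ₐ[Ch] B') : f (hPar B) = hPar B' := f.commutes _

theorem laurentMap_wLaurent (f : B →ₐ[Ch] B') {k : ℕ} (hk : hPar B' ^ k = 0) (g : PowerSeries ℂ) :
    laurentMap f (wLaurent (k + 1) B g) = wLaurent k B' g := by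
  ext n
  rw [laurentMap_coeff, wLaurent, wLaurent, Finset.sum_range_succ]
  simp only [HahnSeries.coeff_add, HahnSeries.coeff_sum, map_add, map_sum]
  have h0 : f ((HahnSeries.single (-(k : ℤ))
      (cst B (PowerSeries.coeff k g) * hPar B ^ k)).coeff n) = 0 := by
    rw [HahnSeries.coeff_single]
    split_ifs
    · rw [map_mul, map_pow, map_hPar, hk, mul_zero]
    · exact map_zero f
  rw [h0, add_zero]
  refine Finset.sum_congr rfl fun i _ => ?_
  rw [HahnSeries.coeff_single, HahnSeries.coeff_single]
  split_ifs
  · rw [map_mul, map_pow, map_hPar, map_cst]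
  · exact map_zero f

theorem laurentMap_sPlusShift (f : B →ₐ[Ch] B') {k : ℕ} (hk : hPar B' ^ k = 0)
    (G : Matrix (Fin N) (Fin N) ℂ) (s : Fin N → Fin N → ℕ → B) (s' : Fin N → Fin N → ℕ → B')
    (hs : ∀ i j r, f (s i j r) = s' i j r) (β : ℂ) :
    (sPlusShift (k + 1) G s β).map (laurentMap f) = sPlusShift k G s' β := by
  ext i j n
  simp only [Matrix.map_apply, laurentMap_coeff, sPlusShift, Matrix.of_apply]
  by_cases hn : 0 ≤ n
  · lift n to ℕ using hn
    rw [HahnSeries.ofPowerSeries_apply_coeff, HahnSeries.ofPowerSeries_apply_coeff]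
    simp only [map_sub, PowerSeries.coeff_C, PowerSeries.coeff_mk, Finset.sum_range_succ, map_mul,
      map_add, map_sum, map_pow, map_hPar, map_cst, hs, hk]
    congr 1
    · split_ifs
      · exact map_cst f _
      · exact map_zero f
    · simp
  · have hm : n ∉ Set.range (Nat.castOrderEmbedding : ℕ ↪o ℤ) := by
      rintro ⟨m, hm⟩
      apply hn
      rw [← hm]
      exact Int.natCast_nonneg m
    rw [HahnSeries.ofPowerSeries_apply, HahnSeries.ofPowerSeries_apply,
      HahnSeries.embDomain_of_notMem_range hm, HahnSeries.embDomain_of_notMem_range hm, map_zero]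

theorem map_site {n : ℕ} {R R' : Type*} [Ring R] [Ring R'] (f : R →+* R') (i : Fin n)
    (X : Matrix (Fin N) (Fin N) R) : (site i X).map f = site i (X.map f) := by
  ext a b
  simp only [site, Matrix.map_apply, Matrix.of_apply]
  split_ifs <;> simp

theorem map_sites {n : ℕ} {R R' : Type*} [Ring R] [Ring R'] (f : R →+* R') (i j : Fin n)
    (X : Matrix (Fin N × Fin N) (Fin N × Fin N) R) :
    (sites i j X).map f = sites i j (X.map f) := by
  ext a b
  simp only [sites, Matrix.map_apply, Matrix.of_apply]
  split_ifs <;> simp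

theorem map_bracket {n : ℕ} {R R' : Type*} [Ring R] [Ring R'] (f : R →+* R')
    (S : Fin n → Matrix (Fin N) (Fin N) R)
    (Q : Fin n → Fin n → Matrix (Fin N × Fin N) (Fin N × Fin N) R) :
    (bracket S Q).map f = bracket (fun i => (S i).map f) (fun i j => (Q i j).map f) := by
  have key : ∀ X : Matrix (Fin n → Fin N) (Fin n → Fin N) R, X.map f = f.mapMatrix X :=
    fun _ => rfl
  rw [key, bracket, bracket, map_list_prod, List.map_map]
  congr 1
  refine List.map_congr_left fun i _ => ?_
  rw [Function.comp_apply, map_mul, map_list_prod, List.map_map, ← key, map_site]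
  congr 2
  refine List.map_congr_left fun j _ => ?_
  rw [Function.comp_apply, ← key, map_sites]

theorem laurentMap_mLaurent (f : B →ₐ[Ch] B') {k : ℕ} (hk : hPar B' ^ k = 0)
    (G : Matrix (Fin N) (Fin N) ℂ) (c : ℂ) {ν : YoungDiagram} (U : StandardTableau ν)
    (s : Fin N → Fin N → ℕ → B) (s' : Fin N → Fin N → ℕ → B')
    (hs : ∀ i j r, f (s i j r) = s' i j r) :
    laurentMap f (mLaurent G c U (k + 1) s) = mLaurent G c U k s' := by
  have hw : ∀ (m : Type) (X : Matrix m m (PowerSeries ℂ)),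
      (X.map (wLaurent (k + 1) B)).map (laurentMap f) = X.map (wLaurent k B') := by
    intro m X
    ext1 a b
    exact laurentMap_wLaurent f hk _
  have hE : ((U.idempotentMat N).map (fun z => HahnSeries.C (Γ := ℤ) (cst B z))).map (laurentMap f)
      = (U.idempotentMat N).map (fun z => HahnSeries.C (Γ := ℤ) (cst B' z)) := by
    ext a b n
    simp only [Matrix.map_apply, laurentMap_coeff, HahnSeries.C_apply, HahnSeries.coeff_single]
    split_ifs
    · exact map_cst f _
    · exact map_zero f
  have ht : ∀ X : Matrix (Fin ν.card → Fin N) (Fin ν.card → Fin N) (LaurentSeries B),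
      laurentMap f X.trace = (X.map (laurentMap f)).trace := by
    intro X
    simp [Matrix.trace]
  rw [mLaurent, mLaurent, ht, sPlusPart, sPlusPart, Matrix.map_mul, Matrix.map_mul, hE,
    map_bracket, hw]
  simp only [hw, laurentMap_sPlusShift f hk G s s' hs]

end Compatibility

/-! ### The series `M_ν(u)` -/

theorem hPar_pow_modH (A : Type*) [Ring A] [Algebra Ch A] (k : ℕ) : hPar (ModH A k) ^ k = 0 := by
  rw [← map_hPar (Ideal.Quotient.mkₐ Ch (hIdeal A k)), ← map_pow]
  exact Ideal.Quotient.eq_zero_iff_mem.2 ((mem_hIdeal A).2 ⟨1, (mul_one _).symm⟩)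

section MSeries

variable {N : ℕ} (G : Matrix (Fin N) (Fin N) ℂ) (c : ℂ) {ν : YoungDiagram}
  (U : StandardTableau ν)

/-- The element `s_ij^{(-r-1)}` modulo `h^k`. -/
def sGenModH (k : ℕ) (i j : Fin N) (r : ℕ) : ModH (YPlus G) k :=
  Ideal.Quotient.mk (hIdeal (YPlus G) k) (sGen G i j r)

/-- The coefficient of `u^a` in the series `M_ν(u) = A_ν(u) 1` with coefficients in the completed
algebra `Y⁺(g_N)_h`. Since `S(u)` acts on the vacuum vector by `G`, this is the coefficient of
`tr E_U S⁺_[n](u_ν) D(u)⁻¹`, where `D(u)` is `S_[n](u_ν + h c / 2)` with every `S_i` replaced by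
`G_i`. -/
def mCoeff (a : ℤ) : HCompletion (YPlus G) :=
  ⟨fun k => (mLaurent G c U k (sGenModH G k)).coeff a, fun k => by
    have h := laurentMap_mLaurent (ModH.step (YPlus G) k) (hPar_pow_modH _ k) G c U
      (sGenModH G (k + 1)) (sGenModH G k) (fun i j r => rfl)
    exact congrArg (fun x => x.coeff a) h⟩

end MSeries

/-! ### The vacuum module and the action of `A_ν(u)` on the vacuum vector -/

section Vacuum

variable (N : ℕ) (c : ℂ)

/-- The left ideal of `DY_c(gl_N) / h^k` generated by the elements `t_ij^{(r)}`, `r ≥ 1`. -/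
def vacuumIdeal (k : ℕ) : Ideal (ModH (DYLevel N c) k) :=
  Ideal.span {x | ∃ i j r, x = Ideal.Quotient.mk _ (toLevel N c (tPos i j r))}

/-- The quotient `V_c / h^k V_c` of the vacuum module. -/
abbrev VacuumModH (k : ℕ) : Type := ModH (DYLevel N c) k ⧸ vacuumIdeal N c k

/-- The class `x 1` in `V_c / h^k V_c` of an element `x` of `DY_c(gl_N)`. -/
def vacuumClass (k : ℕ) : DYLevel N c →+ VacuumModH N c k :=
  (Submodule.mkQ (vacuumIdeal N c k)).toAddMonoidHom.comp
    (Ideal.Quotient.mk (hIdeal (DYLevel N c) k)).toAddMonoidHom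

/-- The vacuum module `V_c(gl_N)`: the `h`-adic completion of the quotient of `DY_c(gl_N)` by the
left ideal generated by the `t_ij^{(r)}`, `r ≥ 1`, i.e. the module of all families of elements of
`V_c / h^k V_c` such that any two consecutive ones have a common representative. -/
def VacuumModule : AddSubgroup (∀ k, VacuumModH N c k) where
  carrier := {x | ∀ k, ∃ y, x (k + 1) = vacuumClass N c (k + 1) y ∧ x k = vacuumClass N c k y}
  add_mem' hx hy k := by
    obtain ⟨y, h1, h2⟩ := hx k
    obtain ⟨z, h3, h4⟩ := hy k
    exact ⟨y + z, by rw [map_add, Pi.add_apply, h1, h3], by rw [map_add, Pi.add_apply, h2, h4]⟩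
  zero_mem' k := ⟨0, by simp, by simp⟩
  neg_mem' hx k := by
    obtain ⟨y, h1, h2⟩ := hx k
    exact ⟨-y, by rw [map_neg, Pi.neg_apply, h1], by rw [map_neg, Pi.neg_apply, h2]⟩

variable {N} (G : Matrix (Fin N) (Fin N) ℂ)

/-- The map from `Y⁺(g_N)` to the double Yangian at the level `c`. -/
def yPlusToLevel : YPlus G →ₐ[Ch] DYLevel N c := (toLevel N c).comp (YPlus G).val

theorem hIdeal_le_comap (k : ℕ) : hIdeal (YPlus G) k ≤
    (hIdeal (DYLevel N c) k).comap (yPlusToLevel c G : YPlus G →+* DYLevel N c) := by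
  intro x hx
  obtain ⟨y, rfl⟩ := (mem_hIdeal _).1 hx
  refine (mem_hIdeal _).2 ⟨yPlusToLevel c G y, ?_⟩
  rw [RingHom.coe_coe, map_mul, map_pow, map_hPar]

/-- The map `Y⁺(g_N) / h^k → DY_c(gl_N) / h^k`. -/
def yPlusToLevelModH (k : ℕ) : ModH (YPlus G) k →+* ModH (DYLevel N c) k :=
  Ideal.quotientMap _ (yPlusToLevel c G : YPlus G →+* DYLevel N c) (hIdeal_le_comap c G k)

/-- The map `x ↦ x 1` from the completed algebra `Y⁺(g_N)_h` to the vacuum module. -/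
def actOnVacuum (x : HCompletion (YPlus G)) : VacuumModule N c :=
  ⟨fun k => Submodule.Quotient.mk (yPlusToLevelModH c G k (x.1 k)), by
    intro k
    obtain ⟨y, hy⟩ := Ideal.Quotient.mk_surjective (x.1 (k + 1))
    refine ⟨yPlusToLevel c G y, ?_, ?_⟩
    · change Submodule.Quotient.mk (yPlusToLevelModH c G (k + 1) (x.1 (k + 1))) = _
      rw [← hy]
      rfl
    · change Submodule.Quotient.mk (yPlusToLevelModH c G k (x.1 k)) = _
      rw [← x.2 k, ← hy]
      rfl⟩

variable (N)

/-- A power series in `w = h / u` as a power series in `u⁻¹` over `DY_c(gl_N)`. -/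
def wPower (f : PowerSeries ℂ) : PowerSeries (DYLevel N c) :=
  PowerSeries.mk fun n => cst _ (PowerSeries.coeff n f) * hPar _ ^ n

/-- `T(a u + β h) = 1 + h ∑ t^{(r+1)} (a u + β h)^{-r-1}`, a power series in `u⁻¹`. -/
def tShift (a β : ℂ) : Matrix (Fin N) (Fin N) (PowerSeries (DYLevel N c)) :=
  Matrix.of fun i j => (if i = j then 1 else 0) + PowerSeries.mk fun m =>
    hPar _ * ∑ r ∈ Finset.range m, toLevel N c (tPos i j r) *
      (cst _ (PowerSeries.coeff (m - (r + 1)) (shiftInv a β ^ (r + 1))) * hPar _ ^ (m - (r + 1)))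

variable {N}

/-- `S(u + β h) = T(u + β h + h c) G Tᵗ(-u - β h)`, a power series in `u⁻¹`. -/
def sShift (β : ℂ) : Matrix (Fin N) (Fin N) (PowerSeries (DYLevel N c)) :=
  tShift N c 1 (β + c) * G.map (fun z => PowerSeries.C (cst _ z)) *
    (tShift N c (-1) (-β)).transpose

variable {ν : YoungDiagram} (U : StandardTableau ν)

/-- The inverse `S_[n](u_ν + h c / 2)⁻¹`, a matrix of power series in `u⁻¹`. -/
def sBracketInv : Matrix (Fin ν.card → Fin N) (Fin ν.card → Fin N) (PowerSeries (DYLevel N c)) :=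
  Ring.inverse (bracket (fun i => sShift c G ((U.content i : ℂ) + c / 2))
    (fun i j => (RBarT N (-2) (-((U.content i : ℂ) + U.content j) - 2 * c)).map (wPower N c)))

/-- The coefficient of `u^a` in `A_ν(u) 1`, where `1` is the vacuum vector and
`A_ν(u) = tr E_U S⁺_[n](u_ν) S_[n](u_ν + h c / 2)⁻¹`. The component in `V_c / h^k V_c` is a sum
with finitely many nonzero terms. -/
def aVacuumCoeff (a : ℤ) (k : ℕ) : VacuumModH N c k :=
  ∑ p, ∑ q, ∑ᶠ m : ℕ,
    (sPlusPart k G (fun i j r => (Ideal.Quotient.mk (hIdeal (DYLevel N c) k)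
      (toLevel N c (sNeg G i j r)) : ModH (DYLevel N c) k)) U p q).coeff (a + m) •
      vacuumClass N c k (PowerSeries.coeff m (sBracketInv c G U q p))

end Vacuum

end TwistedYangian

end

noncomputable section

namespace TwistedYangian

/-! ### Ordered products -/

section OrderedProducts

variable {A I : Type*} [Ring A]

/-! Commutativity. Work modulo `h ^ k`, with Laurent series in `u` whose coefficients are Laurent
series in `v`. The coefficient at `u^a v^b` of a product of a series in `u` and a series in `v` is
the product of coefficients, so it suffices that the two series attached to two tableaux commute. On
the sites of the first tableau let `E` be the idempotent, `S` the ordered product of the `S⁺_i` and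
the transposed R-matrices, and `D` the inverse of the same product with `G_i` for `S⁺_i` and
arguments shifted by `h N`; primes refer to the second tableau. Under the trace, the product `Q` of
the transposed R-matrices linking the two sets of sites can be inserted together with a product `Q'`
with the negated arguments, at the cost of an invertible scalar (`trace_cross`). This turns the
product of two traces into one trace of `E E' (S Q S') (D' Q' D)`, where `S Q S'` is the ordered
product over all sites (`br_append`).

The transposed permutation satisfies `Q_ij² = N Q_ij`, so factors with arguments `x` and `h N - x`
are inverse up to a scalar (`contR_mul_contR`). At `c = -N/2` the numerical product has precisely
the arguments `h N - z_i - z_j`, hence `D' Q' D` is, up to a scalar, the inverse of the numerical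
product over all sites: this is the role of the critical level. The reflection equations for `S⁺`
and for `G` now allow a product of Yang R-matrices to carry the whole expression to the one with the
two sets of sites exchanged (`cross_mul_br`). The trace does not see this conjugation, because `E
E'` absorbs every factor (`BlockPair.trace_mul_comm`).

Absorption means `e * x = e * x * e`: right multiplication by `x` preserves the elements `y` with `y
* e = y`, so the property passes to products. For a row of R-matrices it holds because the
Jucys–Murphy elements act on `E` by contents and the row collapses to a unit commuting with `E`
(`HasContents.mul_prod_cont`, `HasContents.mul_prod_perm`). For `S` it comes from the reflection
equation at arguments which differ by integral multiples of `h`: there the R-matrix becomes an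
intertwiner `d s + 1` between ordered products with permuted contents, and an induction over the
Jucys–Murphy elements shows that `E S` has the weight of the tableau on the right
(`JucysMurphy.weight_mul`). At such arguments a common factor `h` has to be cancelled, which absence
of torsion permits when passing from `h ^ (k + 1)` to `h ^ k`.

The reflection equation for `S⁺` is Sklyanin's consequence of the `RTT` relation and the symmetry of
`G` (`reflEq_of_rtt`).

Action on the vacuum. The entries of `T(u) - 1` lie in the left ideal killing the vacuum vector. So
the ordered product of the `S_i` is congruent modulo this ideal to the numerical one, and since the
latter has central entries, the inverses are congruent too (`CongrMod.inverse`). -/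

theorem list_prod_absorb {e : A} (he : e * e = e) (l : List A)
    (hl : ∀ x ∈ l, e * x = e * x * e) : e * l.prod = e * l.prod * e := by
  induction l with
  | nil => simp [he]
  | cons x t ih =>
    have hx := hl x (by simp)
    have ht := ih fun y hy => hl y (by simp [hy])
    rw [List.prod_cons, ← mul_assoc, hx, mul_assoc (e * x), ht]
    simp only [mul_assoc, he]

/-- The ordered product of the `f i j` over `i` in the first and `j` in the second list. -/
def cross (f : I → I → A) (l m : List I) : A :=
  (l.map fun i => (m.map (f i)).prod).prod

@[simp] theorem cross_nil_left (f : I → I → A) (m : List I) : cross f [] m = 1 := rfl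

@[simp] theorem cross_nil_right (f : I → I → A) (l : List I) : cross f l [] = 1 := by
  simp [cross]

theorem cross_cons_left (f : I → I → A) (a : I) (l m : List I) :
    cross f (a :: l) m = (m.map (f a)).prod * cross f l m := rfl

/-- Factors whose indices both differ commute, so a rectangular product taken row by row can be
taken column by column. -/
theorem cross_comm (f : I → I → A) (l m : List I) (hl : l.Nodup) (hm : m.Nodup)
    (h : ∀ i ∈ l, ∀ i' ∈ l, ∀ j ∈ m, ∀ j' ∈ m, i ≠ i' → j ≠ j' → Commute (f i j) (f i' j')) :
    cross f l m = cross (fun j i => f i j) m l := by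
  induction l with
  | nil => simp
  | cons a l ih =>
    rw [List.nodup_cons] at hl
    rw [cross_cons_left, ih hl.2 fun i hi i' hi' => h i (by simp [hi]) i' (by simp [hi'])]
    simp only [cross, List.map_cons, List.prod_cons]
    clear ih
    induction m with
    | nil => simp
    | cons b m ihm =>
      rw [List.nodup_cons] at hm
      have hc : Commute (m.map (f a)).prod (l.map fun i => f i b).prod := by
        refine Commute.list_prod_left _ _ fun z hz => Commute.list_prod_right _ _ fun w hw => ?_
        obtain ⟨j, hj, rfl⟩ := List.mem_map.1 hz
        obtain ⟨i, hi, rfl⟩ := List.mem_map.1 hw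
        exact h a (by simp) i (by simp [hi]) j (by simp [hj]) b (by simp)
          (fun e => hl.1 (e ▸ hi)) (fun e => hm.1 (e ▸ hj))
      simp only [List.map_cons, List.prod_cons]
      rw [← ihm hm.2 fun i hi i' hi' j hj j' hj' =>
        h i hi i' hi' j (by simp [hj]) j' (by simp [hj'])]
      rw [mul_assoc, ← mul_assoc (m.map (f a)).prod, hc.eq]
      simp only [mul_assoc]

/-- The ordered product of the `s i ∏ q i j`, where `j` runs over the entries of the list after
`i`. -/
def br (s : I → A) (q : I → I → A) : List I → A
  | [] => 1
  | i :: t => s i * (t.map (q i)).prod * br s q t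

/-- Operators `s i` at the site `i` and `q i j` at the sites `i` and `j`: operators at disjoint sets
of sites commute, if one of them is a `q i j`. -/
structure SiteOps (s : I → A) (q : I → I → A) : Prop where
  comm_s : ∀ i j k, i ≠ j → i ≠ k → j ≠ k → Commute (s i) (q j k)
  comm_q : ∀ i j k l, i ≠ j → k ≠ l → i ≠ k → i ≠ l → j ≠ k → j ≠ l → Commute (q i j) (q k l)

theorem commute_br {s : I → A} {q : I → I → A} {x : A} (l : List I) (hl : l.Nodup)
    (hs : ∀ i ∈ l, Commute x (s i)) (hq : ∀ i ∈ l, ∀ j ∈ l, i ≠ j → Commute x (q i j)) :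
    Commute x (br s q l) := by
  induction l with
  | nil => exact Commute.one_right x
  | cons a t ih =>
    rw [List.nodup_cons] at hl
    refine ((hs a (by simp)).mul_right (Commute.list_prod_right _ _ fun y hy => ?_)).mul_right
      (ih hl.2 (fun i hi => hs i (by simp [hi])) fun i hi j hj => hq i (by simp [hi]) j
        (by simp [hj]))
    obtain ⟨j, hj, rfl⟩ := List.mem_map.1 hy
    exact hq a (by simp) j (by simp [hj]) fun e => hl.1 (e ▸ hj)

/-- The part of the row of `a` that reaches into `m` acts on `a` and on sites of `m` only, hence
commutes with everything that remains on `l` and can be collected between the two ordered products.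
-/
theorem br_append {s : I → A} {q : I → I → A} (h : SiteOps s q) (l m : List I)
    (hlm : (l ++ m).Nodup) :
    br s q (l ++ m) = br s q l * cross q l m * br s q m := by
  induction l with
  | nil => simp [br]
  | cons a l ih =>
    rw [List.cons_append, List.nodup_cons, List.mem_append, not_or] at hlm
    have hlm' := List.nodup_append.1 hlm.2
    have hc : Commute (m.map (q a)).prod (br s q l) := by
      refine commute_br l hlm'.1 (fun i hi => ?_) fun i hi j hj hij => ?_
      · refine Commute.list_prod_left _ _ fun y hy => ?_
        obtain ⟨k, hk, rfl⟩ := List.mem_map.1 hy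
        exact (h.comm_s i a k (fun e => hlm.1.1 (e ▸ hi)) (hlm'.2.2 i hi k hk)
          (fun e => hlm.1.2 (e ▸ hk))).symm
      · refine Commute.list_prod_left _ _ fun y hy => ?_
        obtain ⟨k, hk, rfl⟩ := List.mem_map.1 hy
        exact h.comm_q a k i j (fun e => hlm.1.2 (e ▸ hk)) hij (fun e => hlm.1.1 (e ▸ hi))
          (fun e => hlm.1.1 (e ▸ hj)) (hlm'.2.2 i hi k hk).symm (hlm'.2.2 j hj k hk).symm
    rw [List.cons_append, br, br, ih hlm.2, cross_cons_left, List.map_append, List.prod_append]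
    calc _ = s a * (l.map (q a)).prod * ((m.map (q a)).prod * br s q l) * cross q l m
          * br s q m := by simp only [mul_assoc]
      _ = _ := by rw [hc.eq]; simp only [mul_assoc]

/-- An element `r` which exchanges the sites `a` and `b`. -/
structure Swaps (s : I → A) (q : I → I → A) (a b : I) (r : A) : Prop where
  ne : a ≠ b
  comm_s : ∀ i, i ≠ a → i ≠ b → Commute r (s i)
  comm_q : ∀ i j, i ≠ j → i ≠ a → i ≠ b → j ≠ a → j ≠ b → Commute r (q i j)
  left : ∀ i, i ≠ a → i ≠ b → r * (q i a * q i b) = q i b * q i a * r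
  right : ∀ j, j ≠ a → j ≠ b → r * (q a j * q b j) = q b j * q a j * r
  refl : r * (s a * q a b * s b) = s b * q b a * s a * r

theorem br_cons_cons {s : I → A} {q : I → I → A} (h : SiteOps s q) {a b : I} {t : List I}
    (hl : (a :: b :: t).Nodup) : br s q (a :: b :: t) =
      s a * q a b * s b * (t.map fun j => q a j * q b j).prod * br s q t := by
  simp only [List.nodup_cons, List.mem_cons, not_or] at hl
  obtain ⟨⟨hab, hat⟩, hbt, ht⟩ := hl
  have hc : Commute (t.map (q a)).prod (s b) := by
    refine Commute.list_prod_left _ _ fun y hy => ?_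
    obtain ⟨k, hk, rfl⟩ := List.mem_map.1 hy
    exact (h.comm_s b a k (Ne.symm hab) (fun e => hbt (e ▸ hk)) (fun e => hat (e ▸ hk))).symm
  have hp : (t.map fun j => q a j * q b j).prod = (t.map (q a)).prod * (t.map (q b)).prod := by
    clear hc
    induction t with
    | nil => simp
    | cons c t ih =>
      simp only [List.nodup_cons, List.mem_cons, not_or] at ht hat hbt
      have hc : Commute (q b c) (t.map (q a)).prod := by
        refine Commute.list_prod_right _ _ fun y hy => ?_
        obtain ⟨k, hk, rfl⟩ := List.mem_map.1 hy
        exact h.comm_q b c a k hbt.1 (fun e => hat.2 (e ▸ hk)) (Ne.symm hab)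
          (fun e => hbt.2 (e ▸ hk)) (Ne.symm hat.1) fun e => ht.1 (e ▸ hk)
      simp only [List.map_cons, List.prod_cons]
      rw [ih hat.2 hbt.2 ht.2, mul_assoc (q a c), ← mul_assoc (q b c), hc.eq]
      simp only [mul_assoc]
  rw [br, br, hp, List.map_cons, List.prod_cons]
  calc _ = s a * q a b * ((t.map (q a)).prod * s b) * (t.map (q b)).prod * br s q t := by
        simp only [mul_assoc]
    _ = _ := by rw [hc.eq]; simp only [mul_assoc]

/-- Sites before `a` contribute `q i a * q i b`, which `r` turns around by `left`. Then `r` meets `s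
a * q a b * s b`, where the reflection equation applies, and `right` handles the rows going to the
later sites. -/
theorem Swaps.mul_br {s : I → A} {q : I → I → A} (h : SiteOps s q) {a b : I} {r : A}
    (hr : Swaps s q a b r) (p t : List I) (hl : (p ++ a :: b :: t).Nodup) :
    r * br s q (p ++ a :: b :: t) = br s q (p ++ b :: a :: t) * r := by
  induction p with
  | nil =>
    simp only [List.nil_append] at hl ⊢
    rw [br_cons_cons h hl, br_cons_cons h (((List.Perm.swap b a t).nodup_iff).1 hl)]
    simp only [List.nodup_cons, List.mem_cons, not_or] at hl
    obtain ⟨⟨hab, hat⟩, hbt, ht⟩ := hl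
    have hca : ∀ j ∈ t, j ≠ a ∧ j ≠ b := fun j hj =>
      ⟨fun e => hat (e ▸ hj), fun e => hbt (e ▸ hj)⟩
    have e2 : r * (t.map fun j => q a j * q b j).prod =
        (t.map fun j => q b j * q a j).prod * r := by
      clear hat hbt ht
      induction t with
      | nil => simp
      | cons c t ih =>
        simp only [List.map_cons, List.prod_cons]
        rw [← mul_assoc, hr.right c (hca c (by simp)).1 (hca c (by simp)).2, mul_assoc,
          ih (fun j hj => hca j (by simp [hj]))]
        simp only [mul_assoc]
    have e3 : Commute r (br s q t) := commute_br t ht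
      (fun i hi => hr.comm_s i (hca i hi).1 (hca i hi).2) fun i hi j hj hij =>
      hr.comm_q i j hij (hca i hi).1 (hca i hi).2 (hca j hj).1 (hca j hj).2
    rw [← mul_assoc, ← mul_assoc, hr.refl, mul_assoc _ r, e2, mul_assoc, mul_assoc _ r, e3.eq]
    simp only [mul_assoc]
  | cons i p ih =>
    rw [List.cons_append, List.nodup_cons] at hl
    obtain ⟨hi, hl⟩ := hl
    simp only [List.mem_append, List.mem_cons, not_or] at hi
    have hn := List.nodup_append.1 hl
    rw [List.cons_append, List.cons_append, br, br]
    have h1 := hr.comm_s i hi.2.1 hi.2.2.1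
    have h2 : ∀ l : List I, (∀ j ∈ l, j ≠ i ∧ j ≠ a ∧ j ≠ b) → Commute r (l.map (q i)).prod := by
      intro l hl
      refine Commute.list_prod_right _ _ fun y hy => ?_
      obtain ⟨k, hk, rfl⟩ := List.mem_map.1 hy
      exact hr.comm_q i k (hl k hk).1.symm hi.2.1 hi.2.2.1 (hl k hk).2.1 (hl k hk).2.2
    have hp := h2 p fun j hj => ⟨fun e => hi.1 (e ▸ hj), hn.2.2 j hj a (by simp),
      hn.2.2 j hj b (by simp)⟩
    have ht := h2 t fun j hj => by
      have h3 := hn.2.1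
      simp only [List.nodup_cons, List.mem_cons, not_or] at h3
      exact ⟨fun e => hi.2.2.2 (e ▸ hj), fun e => h3.1.2 (e ▸ hj), fun e => h3.2.1 (e ▸ hj)⟩
    simp only [List.map_append, List.map_cons, List.prod_append, List.prod_cons]
    calc _ = (r * s i) * (p.map (q i)).prod * (q i a * q i b) * (t.map (q i)).prod *
          br s q (p ++ a :: b :: t) := by simp only [mul_assoc]
      _ = s i * (r * (p.map (q i)).prod) * (q i a * q i b) * (t.map (q i)).prod *
          br s q (p ++ a :: b :: t) := by rw [h1.eq]; simp only [mul_assoc]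
      _ = s i * (p.map (q i)).prod * (r * (q i a * q i b)) * (t.map (q i)).prod *
          br s q (p ++ a :: b :: t) := by rw [hp.eq]; simp only [mul_assoc]
      _ = s i * (p.map (q i)).prod * (q i b * q i a) * (r * (t.map (q i)).prod) *
          br s q (p ++ a :: b :: t) := by
        rw [hr.left i hi.2.1 hi.2.2.1]; simp only [mul_assoc]
      _ = s i * (p.map (q i)).prod * (q i b * q i a) * (t.map (q i)).prod *
          (r * br s q (p ++ a :: b :: t)) := by rw [ht.eq]; simp only [mul_assoc]
      _ = _ := by rw [ih hl]; simp only [mul_assoc]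

/-- The site `a` moves past the list `m` one neighbour at a time. The exchange with the first
neighbour acts first and therefore stands rightmost, whence the reversed list. -/
theorem row_mul_br {s : I → A} {q r : I → I → A} (h : SiteOps s q) (a : I) (m : List I)
    (hr : ∀ b ∈ m, Swaps s q a b (r a b)) (p t : List I) (hl : (p ++ a :: (m ++ t)).Nodup) :
    (m.reverse.map (r a)).prod * br s q (p ++ a :: (m ++ t)) =
      br s q (p ++ m ++ a :: t) * (m.reverse.map (r a)).prod := by
  induction m generalizing p with
  | nil => simp
  | cons b m ih =>
    have h1 := (hr b (by simp)).mul_br h p (m ++ t) (by simpa using hl)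
    have h2 := ih (fun c hc => hr c (by simp [hc])) (p ++ [b]) (by
      refine (List.Perm.nodup_iff ?_).1 hl
      simpa using List.Perm.append_left p (List.Perm.swap b a (m ++ t)))
    simp only [List.append_assoc, List.cons_append, List.nil_append] at h1 h2
    simp only [List.reverse_cons, List.map_append, List.prod_append, List.map_cons, List.map_nil,
      List.prod_singleton, List.cons_append, List.append_assoc]
    rw [mul_assoc, h1, ← mul_assoc, h2, mul_assoc]

/-- The elements of `l` travel past all of `m`, the last one first. -/
theorem cross_mul_br {s : I → A} {q r : I → I → A} (h : SiteOps s q) (l m : List I)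
    (hr : ∀ a ∈ l, ∀ b ∈ m, Swaps s q a b (r a b)) (hl : (l ++ m).Nodup) :
    cross r l m.reverse * br s q (l ++ m) = br s q (m ++ l) * cross r l m.reverse := by
  -- The prefix `p` holds the sites of the first list which have not yet moved.
  have key : ∀ l p : List I, (p ++ (l ++ m)).Nodup → (∀ a ∈ l, ∀ b ∈ m, Swaps s q a b (r a b)) →
      cross r l m.reverse * br s q (p ++ (l ++ m)) = br s q (p ++ (m ++ l)) *
        cross r l m.reverse := by
    intro l
    induction l with
    | nil => intro p _ _; simp
    | cons a l ih =>
      intro p hp hr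
      have h1 := ih (p ++ [a]) (by simpa using hp) fun c hc => hr c (by simp [hc])
      have h2 := row_mul_br h a m (hr a (by simp)) p l (by
        refine (List.Perm.nodup_iff ?_).1 hp
        exact List.Perm.append_left p (List.Perm.cons a List.perm_append_comm))
      simp only [List.append_assoc, List.cons_append, List.nil_append] at h1 h2 ⊢
      rw [cross_cons_left, mul_assoc, h1, ← mul_assoc, h2, mul_assoc]
  simpa using key l [] (by simpa using hl) hr

end OrderedProducts

/-! ### Matrix units on several sites -/

section MatrixUnits

variable {K A I : Type*} [CommRing K] [Ring A] [Algebra K A] {N : ℕ}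

/-- Commuting families of matrix units, one for each site. -/
structure MatrixUnits (e : I → Fin N → Fin N → A) : Prop where
  mul (i : I) (k l m n : Fin N) : e i k l * e i m n = if l = m then e i k n else 0
  one (i : I) : ∑ k, e i k k = 1
  comm (i j : I) (k l m n : Fin N) : i ≠ j → Commute (e i k l) (e j m n)

/-- The permutation operator on the sites `i` and `j`. -/
def perm (e : I → Fin N → Fin N → A) (i j : I) : A := ∑ k, ∑ l, e i k l * e j l k

/-- The partially transposed permutation operator on the sites `i` and `j`. -/
def cont (e : I → Fin N → Fin N → A) (i j : I) : A := ∑ k, ∑ l, e i k l * e j k l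

variable {e : I → Fin N → Fin N → A} (he : MatrixUnits e)

theorem commute_cont {e : I → Fin N → Fin N → A} {x : A} {i j : I} (hi : ∀ k l, Commute x (e i k l))
    (hj : ∀ k l, Commute x (e j k l)) : Commute x (cont e i j) :=
  Commute.sum_right _ _ _ fun a _ => Commute.sum_right _ _ _ fun b _ =>
    (hi a b).mul_right (hj a b)

theorem commute_perm {e : I → Fin N → Fin N → A} {x : A} {i j : I} (hi : ∀ k l, Commute x (e i k l))
    (hj : ∀ k l, Commute x (e j k l)) : Commute x (perm e i j) :=
  Commute.sum_right _ _ _ fun a _ => Commute.sum_right _ _ _ fun b _ =>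
    (hi a b).mul_right (hj b a)

namespace MatrixUnits

include he

theorem perm_comm {i j : I} (h : i ≠ j) : perm e i j = perm e j i := by
  rw [perm, Finset.sum_comm]
  exact Finset.sum_congr rfl fun k _ => Finset.sum_congr rfl fun l _ => he.comm _ _ _ _ _ _ h

theorem cont_comm {i j : I} (h : i ≠ j) : cont e i j = cont e j i :=
  Finset.sum_congr rfl fun k _ => Finset.sum_congr rfl fun l _ => he.comm _ _ _ _ _ _ h

theorem perm_mul_unit {i j : I} (h : i ≠ j) (k l : Fin N) :
    perm e i j * e i k l = e j k l * perm e i j := by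
  have h1 : perm e i j * e i k l = ∑ a, e i a l * e j k a := by
    simp only [perm, Finset.sum_mul]
    refine Finset.sum_congr rfl fun a _ => ?_
    rw [Finset.sum_eq_single k]
    · rw [mul_assoc, (he.comm j i k a k l h.symm).eq, ← mul_assoc, he.mul, if_pos rfl]
    · intro b _ hb
      rw [mul_assoc, (he.comm j i b a k l h.symm).eq, ← mul_assoc, he.mul, if_neg hb, zero_mul]
    · simp
  have h2 : e j k l * perm e i j = ∑ a, e i a l * e j k a := by
    simp only [perm, Finset.mul_sum]
    refine Finset.sum_congr rfl fun a _ => ?_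
    rw [Finset.sum_eq_single l]
    · rw [← mul_assoc, (he.comm j i k l a l h.symm).eq, mul_assoc, he.mul, if_pos rfl]
    · intro b _ hb
      rw [← mul_assoc, (he.comm j i k l a b h.symm).eq, mul_assoc, he.mul, if_neg (Ne.symm hb),
        mul_zero]
    · simp
  rw [h1, h2]

theorem perm_mul_self {i j : I} (h : i ≠ j) : perm e i j * perm e i j = 1 := by
  have h1 : ∀ k l a b, e i k l * e j l k * (e i a b * e j b a) =
      if l = a then (if k = b then e i k k * e j l l else 0) else 0 := by
    intro k l a b
    rw [mul_assoc, ← mul_assoc (e j l k), (he.comm j i l k a b h.symm).eq, mul_assoc, ← mul_assoc,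
      he.mul, he.mul]
    split_ifs with h1 h2
    · subst h1 h2; rfl
    · rw [mul_zero]
    · rw [zero_mul]
    · rw [zero_mul]
  simp only [perm, Finset.sum_mul, Finset.mul_sum, h1]
  simp [← Finset.sum_mul, he.one]

theorem unit_mul_cont {i j : I} (h : i ≠ j) (k l : Fin N) :
    e j k l * cont e i j = ∑ b, e i l b * e j k b := by
  rw [cont, Finset.mul_sum, Finset.sum_eq_single l]
  · rw [Finset.mul_sum]
    refine Finset.sum_congr rfl fun b _ => ?_
    rw [← mul_assoc, (he.comm j i k l l b h.symm).eq, mul_assoc, he.mul, if_pos rfl]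
  · intro a _ ha
    rw [Finset.mul_sum]
    refine Finset.sum_eq_zero fun b _ => ?_
    rw [← mul_assoc, (he.comm j i k l a b h.symm).eq, mul_assoc, he.mul, if_neg (Ne.symm ha),
      mul_zero]
  · simp

theorem unit_mul_perm (i j : I) (k l : Fin N) :
    e i k l * perm e i j = ∑ b, e i k b * e j b l := by
  rw [perm, Finset.mul_sum, Finset.sum_eq_single l]
  · rw [Finset.mul_sum]
    refine Finset.sum_congr rfl fun b _ => ?_
    rw [← mul_assoc, he.mul, if_pos rfl]
  · intro a _ ha
    rw [Finset.mul_sum]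
    refine Finset.sum_eq_zero fun b _ => ?_
    rw [← mul_assoc, he.mul, if_neg (Ne.symm ha), zero_mul]
  · simp

/-- This is the transpose in the site `m` of the relation `P_jm P_im = P_im P_ij`. It trades a
product of two transposed operators for a permutation operator, which is how Jucys–Murphy elements
appear in products of transposed R-matrices. -/
theorem cont_mul_cont {i j m : I} (hij : i ≠ j) (him : i ≠ m) (hjm : j ≠ m) :
    cont e i m * cont e j m = cont e i m * perm e i j := by
  conv_lhs => enter [1]; rw [cont]
  conv_rhs => enter [1]; rw [cont]
  simp only [Finset.sum_mul]
  refine Finset.sum_congr rfl fun k _ => ?_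
  simp only [mul_assoc, he.unit_mul_cont hjm, Finset.mul_sum]
  have h1 : ∀ b, e i k b * (e m k b * perm e i j) = ∑ l, e i k l * (e j l b * e m k b) := by
    intro b
    rw [(he.comm i m k b k b him).left_comm, he.unit_mul_perm, Finset.mul_sum]
    refine Finset.sum_congr rfl fun l _ => ?_
    rw [(he.comm m i k b k l him.symm).left_comm, (he.comm m j k b l b hjm.symm).eq]
  simp only [h1]
  exact Finset.sum_comm

/-- The transposed permutation operator is `N` times a projection of rank one; this is the origin of
all shifts by `h N`. -/
theorem cont_mul_self {i j : I} (h : i ≠ j) : cont e i j * cont e i j = (N : K) • cont e i j := by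
  conv_lhs => enter [1]; rw [cont]
  have h1 : ∀ k l, e i k l * e j k l * cont e i j = ∑ b, e i k b * e j k b := by
    intro k l
    rw [mul_assoc, he.unit_mul_cont h, Finset.mul_sum]
    refine Finset.sum_congr rfl fun b _ => ?_
    rw [← mul_assoc, he.mul, if_pos rfl]
  simp only [Finset.sum_mul, h1, Finset.sum_const, Finset.card_univ, Fintype.card_fin]
  rw [← Finset.smul_sum, Nat.cast_smul_eq_nsmul]
  rfl

theorem perm_commute_unit {i j m : I} (hi : m ≠ i) (hj : m ≠ j) (k l : Fin N) :
    Commute (perm e i j) (e m k l) :=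
  Commute.sum_left _ _ _ fun a _ => Commute.sum_left _ _ _ fun b _ =>
    (he.comm i m a b k l hi.symm).mul_left (he.comm j m b a k l hj.symm)

theorem cont_commute_unit {i j m : I} (hi : m ≠ i) (hj : m ≠ j) (k l : Fin N) :
    Commute (cont e i j) (e m k l) :=
  Commute.sum_left _ _ _ fun a _ => Commute.sum_left _ _ _ fun b _ =>
    (he.comm i m a b k l hi.symm).mul_left (he.comm j m a b k l hj.symm)


theorem perm_mul_cont {i j m : I} (hij : i ≠ j) (him : i ≠ m) (hjm : j ≠ m) :
    perm e i j * cont e i m = cont e j m * perm e i j := by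
  simp only [cont, Finset.mul_sum, Finset.sum_mul]
  refine Finset.sum_congr rfl fun k _ => Finset.sum_congr rfl fun l _ => ?_
  rw [← mul_assoc, he.perm_mul_unit hij, mul_assoc,
    (he.perm_commute_unit him.symm hjm.symm k l).eq, mul_assoc]

theorem perm_mul_cont' {i j m : I} (hij : i ≠ j) (him : i ≠ m) (hjm : j ≠ m) :
    perm e i j * cont e j m = cont e i m * perm e i j := by
  rw [he.perm_comm hij, he.perm_mul_cont hij.symm hjm him]

theorem perm_mul_perm {i j m : I} (hij : i ≠ j) (him : i ≠ m) (hjm : j ≠ m) :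
    perm e i j * perm e i m = perm e j m * perm e i j := by
  conv_lhs => enter [2]; rw [perm]
  conv_rhs => enter [1]; rw [perm]
  simp only [Finset.mul_sum, Finset.sum_mul]
  refine Finset.sum_congr rfl fun k _ => Finset.sum_congr rfl fun l _ => ?_
  rw [← mul_assoc, he.perm_mul_unit hij, mul_assoc,
    (he.perm_commute_unit him.symm hjm.symm l k).eq, mul_assoc]

end MatrixUnits

/-- The cleared form `x - h Pᵗ` of the transposed R-matrix. -/
def contR (e : I → Fin N → Fin N → A) (h : K) (x : I → I → K) (i j : I) : A :=
  x i j • 1 - h • cont e i j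

/-- The cleared form `d - ε P` of the R-matrix. -/
def permR (e : I → Fin N → Fin N → A) (d ε : K) (i j : I) : A := d • 1 - ε • perm e i j

theorem commute_contR {e : I → Fin N → Fin N → A} {h : K} {x : I → I → K} {y : A} {i j : I}
    (hc : Commute y (cont e i j)) : Commute y (contR e h x i j) :=
  (((Commute.one_right y).smul_right _)).sub_right (hc.smul_right _)

theorem commute_permR {e : I → Fin N → Fin N → A} {d ε : K} {y : A} {i j : I}
    (hc : Commute y (perm e i j)) : Commute y (permR e d ε i j) :=
  (((Commute.one_right y).smul_right _)).sub_right (hc.smul_right _)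

include he

theorem siteOps_contR {s : I → A} (hs : ∀ i j, i ≠ j → ∀ k l, Commute (s i) (e j k l)) (h : K)
    (x : I → I → K) : SiteOps s (contR e h x) where
  comm_s i j k hij hik _ := commute_contR (commute_cont (hs i j hij)
    (hs i k hik))
  comm_q i j k l _ _ hik hil hjk hjl := commute_contR (commute_cont
    (fun a b => (commute_contR (he.cont_commute_unit hik.symm hjk.symm a b).symm).symm)
    fun a b => (commute_contR (he.cont_commute_unit hil.symm hjl.symm a b).symm).symm)

/-- The Yang–Baxter equation transposed in the site `j`. The coefficient `ε` is kept free since two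
normalizations occur: `ε = h` with `d` a difference of arguments, and `ε = 1` with `d` an integer,
after a factor `h` has been cancelled. -/
theorem permR_mul_contR_mul_contR {d ε h : K} {x : I → I → K} {a b j : I} (hab : a ≠ b)
    (haj : a ≠ j) (hbj : b ≠ j) (H : ε * (x b j - x a j) = d * h) :
    permR e d ε a b * (contR e h x a j * contR e h x b j) =
      contR e h x b j * contR e h x a j * permR e d ε a b := by
  have h1 := he.cont_mul_cont hab haj hbj
  have h2 := he.cont_mul_cont hab.symm hbj haj
  rw [← he.perm_comm hab] at h2
  have h3 := he.perm_mul_cont hab haj hbj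
  have h4 := he.perm_mul_cont' hab haj hbj
  have h5 := he.perm_mul_self hab
  simp only [permR, contR]
  generalize cont e a j = Q at *
  generalize cont e b j = R at *
  generalize perm e a b = P at *
  have h6 : P * (Q * P) = R := by rw [← mul_assoc, h3, mul_assoc, h5, mul_one]
  simp only [mul_sub, sub_mul, smul_mul_assoc, mul_smul_comm, mul_one, one_mul, h1, h2, h3, h4, h6,
    mul_assoc, h5, smul_sub]
  -- With all products reduced, the two sides differ by a multiple of `R P - Q P`, whose coefficient
  -- is `h` times the difference of the two sides of `H`.
  linear_combination (norm := module) (h • H) • (R * P - Q * P)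

/-- The cleared R-matrix exchanges the sites `a` and `b`, if the reflection equation holds. -/
theorem swaps_permR {s : I → A} (hs : ∀ i j, i ≠ j → ∀ k l, Commute (s i) (e j k l))
    {h d ε : K} {x : I → I → K} (hx : ∀ i j, x i j = x j i) {a b : I} (hab : a ≠ b)
    (H : ∀ j, ε * (x b j - x a j) = d * h)
    (hr : permR e d ε a b * (s a * contR e h x a b * s b) =
      s b * contR e h x a b * s a * permR e d ε a b) :
    Swaps s (contR e h x) a b (permR e d ε a b) := by
  have hsym : ∀ i j, i ≠ j → contR e h x i j = contR e h x j i := fun i j hij => by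
    rw [contR, contR, hx, he.cont_comm hij]
  refine ⟨hab, fun i hia hib => ?_, fun i j _ hia hib hja hjb => ?_, fun i hia hib => ?_,
    fun j hja hjb => ?_, ?_⟩
  · exact (commute_permR (commute_perm (hs i a hia) (hs i b hib))).symm
  · exact commute_contR (commute_cont
      (fun k l => (commute_permR (he.perm_commute_unit hia hib k l).symm).symm)
      fun k l => (commute_permR (he.perm_commute_unit hja hjb k l).symm).symm)
  · rw [hsym i a hia, hsym i b hib]
    exact permR_mul_contR_mul_contR he hab hia.symm hib.symm (H i)
  · exact permR_mul_contR_mul_contR he hab hja.symm hjb.symm (H j)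
  · rw [hr, hsym a b hab]

end MatrixUnits

/-! ### Rows of R-matrices multiplied by an idempotent with given contents -/

section Absorption

variable {K A I : Type*} [CommRing K] [Ring A] [Algebra K A] {N : ℕ}

theorem isUnit_smul_one_sub {w h : K} (hw : IsUnit w) (hh : IsNilpotent h) (x : A) :
    IsUnit (w • (1 : A) - h • x) := by
  have h1 : IsUnit (w • (1 : A)) := by
    rw [← Algebra.algebraMap_eq_smul_one]
    exact hw.map _
  have h2 : IsNilpotent (-(h • x)) := by
    obtain ⟨k, hk⟩ := hh
    exact IsNilpotent.neg ⟨k, by rw [smul_pow, hk, zero_smul]⟩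
  rw [sub_eq_add_neg]
  exact h2.isUnit_add_left_of_commute h1
    ((((Commute.one_right x).smul_right w).smul_left h).neg_left)

theorem prod_map_mul_reverse_prod (f g : I → A) (σ : I → K) (l : List I)
    (h : ∀ i ∈ l, f i * g i = σ i • 1) :
    (l.map f).prod * (l.reverse.map g).prod = (l.map σ).prod • 1 := by
  induction l with
  | nil => simp
  | cons a l ih =>
    simp only [List.map_cons, List.prod_cons, List.reverse_cons, List.map_append, List.prod_append,
      List.map_nil, List.prod_nil, mul_one]
    rw [mul_assoc, ← mul_assoc _ _ (g a), ih fun i hi => h i (by simp [hi]), smul_mul_assoc,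
      one_mul, mul_smul_comm, h a (by simp), smul_smul, mul_comm]

theorem cross_mul_reverse (f g : I → I → A) (σ : I → I → K) (l m : List I)
    (h : ∀ i ∈ l, ∀ j ∈ m, f i j * g i j = σ i j • 1) :
    cross f l m * cross g l.reverse m.reverse = cross σ l m • 1 :=
  prod_map_mul_reverse_prod _ _ _ l fun i hi => prod_map_mul_reverse_prod _ _ _ m (h i hi)

theorem isUnit_list_prod {M : Type*} [CommMonoid M] (l : List M) (h : ∀ x ∈ l, IsUnit x) :
    IsUnit l.prod := by
  induction l with
  | nil => simp
  | cons a l ih =>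
    rw [List.prod_cons]
    exact (h a (by simp)).mul (ih fun x hx => h x (by simp [hx]))

theorem isUnit_cross (σ : I → I → K) (l m : List I) (h : ∀ i ∈ l, ∀ j ∈ m, IsUnit (σ i j)) :
    IsUnit (cross σ l m) := by
  refine isUnit_list_prod _ fun x hx => ?_
  obtain ⟨i, hi, rfl⟩ := List.mem_map.1 hx
  refine isUnit_list_prod _ fun x hx => ?_
  obtain ⟨j, hj, rfl⟩ := List.mem_map.1 hx
  exact h i hi j hj

/-- If `E F V = κ E` with a unit `κ`, where `E` is an idempotent which commutes with the unit `V`,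
and if `F G` is an invertible scalar, then `F` and `G` preserve the right ideal of `E`. -/
theorem absorb_of_mul_eq {E F G V : A} {κ σ : K} (hE : E * E = E) (hV : IsUnit V)
    (hc : Commute E V) (hκ : IsUnit κ) (h : E * F * V = κ • E) (hFG : F * G = σ • 1) :
    E * F = E * F * E ∧ E * G = E * G * E := by
  obtain ⟨V, rfl⟩ := hV
  obtain ⟨κ, rfl⟩ := hκ
  have hc' : Commute E (↑V⁻¹ : A) := hc.units_inv_right
  have h1 : E * F = (κ : K) • (E * (↑V⁻¹ : A)) := by
    rw [← smul_mul_assoc, ← h, Units.mul_inv_cancel_right]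
  constructor
  · rw [h1, smul_mul_assoc, mul_assoc, ← hc'.eq, ← mul_assoc, hE]
  · have h2 : (κ : K) • (↑V⁻¹ * (E * G) : A) = σ • E := by
      rw [← mul_assoc, ← hc'.eq, ← smul_mul_assoc, ← h1, mul_assoc, hFG, mul_smul_comm, mul_one]
    have h3 : E * G = (↑κ⁻¹ * σ : K) • ((V : A) * E) := by
      rw [mul_smul, ← mul_smul_comm, ← h2, mul_smul_comm, Units.mul_inv_cancel_left, smul_smul,
        Units.inv_mul, one_smul]
    rw [h3, smul_mul_assoc, mul_assoc, hE]

/-- Conjugation by `x` permutes the summands: it exchanges two of them and fixes the others. -/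
theorem commute_list_sum {x : A} {i j : I} (f : I → A) (l : List I) (hl : l.Nodup)
    (hi : i ∈ l) (hj : j ∈ l) (hij : i ≠ j) (h1 : x * f i = f j * x) (h2 : x * f j = f i * x)
    (h3 : ∀ k ∈ l, k ≠ i → k ≠ j → Commute x (f k)) : Commute x (l.map f).sum := by
  classical
  have hp : l.Perm (i :: j :: (l.erase i).erase j) :=
    (List.perm_cons_erase hi).trans
      (List.Perm.cons i (List.perm_cons_erase ((List.mem_erase_of_ne hij.symm).2 hj)))
  rw [(hp.map f).sum_eq, List.map_cons, List.map_cons, List.sum_cons, List.sum_cons, ← add_assoc]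
  refine Commute.add_right ?_ (Commute.list_sum_right _ _ fun y hy => ?_)
  · rw [commute_iff_eq, mul_add, add_mul, h1, h2, add_comm]
  · obtain ⟨k, hk, rfl⟩ := List.mem_map.1 hy
    rw [(hl.erase i).mem_erase_iff, hl.mem_erase_iff] at hk
    exact h3 k hk.2.2 hk.2.1 hk.1

variable {e : I → Fin N → Fin N → A}

/-- The Jucys–Murphy elements of the sites in the list `l` act on `E` from the right by the
scalars `c`. -/
def HasContents (e : I → Fin N → Fin N → A) (E : A) (l : List I) (c : I → K) : Prop :=
  ∀ p n s, l = p ++ n :: s → E * (p.map fun i => perm e i n).sum = c n • E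

variable (he : MatrixUnits e)

include he

theorem MatrixUnits.perm_commute_sum_perm {i j b : I} {l : List I} (hl : l.Nodup) (hi : i ∈ l)
    (hj : j ∈ l) (hij : i ≠ j) (hb : b ∉ l) :
    Commute (perm e i j) (l.map fun k => perm e k b).sum := by
  have hne : ∀ k ∈ l, k ≠ b := fun k hk e => hb (e ▸ hk)
  refine commute_list_sum _ l hl hi hj hij (he.perm_mul_perm hij (hne i hi) (hne j hj)) ?_
    fun k hk hki hkj => ?_
  · rw [he.perm_comm hij, he.perm_mul_perm hij.symm (hne j hj) (hne i hi)]
  · exact commute_perm (he.perm_commute_unit hki hkj)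
      (he.perm_commute_unit (hne i hi).symm (hne j hj).symm)

theorem MatrixUnits.perm_commute_sum_cont {i j b : I} {l : List I} (hl : l.Nodup) (hi : i ∈ l)
    (hj : j ∈ l) (hij : i ≠ j) (hb : b ∉ l) :
    Commute (perm e i j) (l.map fun k => cont e k b).sum := by
  have hne : ∀ k ∈ l, k ≠ b := fun k hk e => hb (e ▸ hk)
  refine commute_list_sum _ l hl hi hj hij (he.perm_mul_cont hij (hne i hi) (hne j hj)) ?_
    fun k hk hki hkj => ?_
  · exact he.perm_mul_cont' hij (hne i hi) (hne j hj)
  · exact commute_cont (he.perm_commute_unit hki hkj)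
      (he.perm_commute_unit (hne i hi).symm (hne j hj).symm)

/-- For `i` before `n` one has `Q_ib Q_nb = P_in Q_nb`, so `(∑ Q_ib) Q_nb` is the Jucys–Murphy
element of `n` times `Q_nb`, and next to `E` it becomes `c n • Q_nb`. Every quadratic term thus
becomes linear, and the product collapses to a single factor with the sum of the `Q_ib`. The extra
`w` on the left replaces a division. -/
theorem HasContents.mul_prod_cont {E : A} {l : List I} {c : I → K} (hl : l.Nodup)
    (hE : HasContents e E l c) {b : I} (hb : b ∉ l) (w h : K) :
    w • (E * (l.map fun i => (w - h * c i) • 1 - h • cont e i b).prod) =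
      (l.map fun i => w - h * c i).prod • (E * (w • 1 - h • (l.map fun i => cont e i b).sum)) := by
  have key : ∀ p s, l = p ++ s →
      w • (E * (p.map fun i => (w - h * c i) • 1 - h • cont e i b).prod) =
      (p.map fun i => w - h * c i).prod •
        (E * (w • 1 - h • (p.map fun i => cont e i b).sum)) := by
    intro p
    induction p using List.reverseRecOn with
    | nil => intro s _; simp
    | append_singleton p n ih =>
      intro s hs
      have h1 := ih (n :: s) (by simpa using hs)
      have h2 := hE p n s (by simpa using hs)
      have hn : n ∉ p ∧ n ≠ b ∧ ∀ k ∈ p, k ≠ b := by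
        rw [hs] at hl hb
        simp only [List.append_assoc, List.mem_append, not_or, List.singleton_append,
          List.mem_cons] at hl hb
        exact ⟨fun hn => (List.nodup_append.1 hl).2.2 n hn n (by simp) rfl, Ne.symm hb.2.1,
          fun k hk e => hb.1 (e ▸ hk)⟩
      have h3 : (p.map fun i => cont e i b).sum * cont e n b =
          (p.map fun i => perm e i n).sum * cont e n b := by
        rw [← List.sum_map_mul_right, ← List.sum_map_mul_right]
        congr 1
        refine List.map_congr_left fun i hi => ?_
        have hin : i ≠ n := fun e => hn.1 (e ▸ hi)
        rw [he.cont_mul_cont hin (hn.2.2 i hi) hn.2.1, he.perm_mul_cont' hin (hn.2.2 i hi) hn.2.1]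
      have h4 : E * ((p.map fun i => cont e i b).sum * cont e n b) = c n • (E * cont e n b) := by
        rw [h3, ← mul_assoc, h2, smul_mul_assoc]
      simp only [List.map_append, List.prod_append, List.map_cons, List.map_nil, List.prod_cons,
        List.prod_nil, mul_one, List.sum_append, List.sum_cons, List.sum_nil, add_zero]
      rw [← mul_assoc, ← smul_mul_assoc, h1, mul_smul, smul_mul_assoc, mul_assoc]
      congr 1
      simp only [mul_sub, sub_mul, mul_add, smul_mul_assoc, mul_smul_comm, mul_one, one_mul, h4,
        smul_sub, smul_add]
      module
  exact key l [] (by simp)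

/-- The row acts on `E` as a multiple of the inverse of `V = w + h ∑ P_ib`. In the inductive step
let `V'` be the element for the shorter list, `P = P_nb`, and `W = w + h x` with `x` the
Jucys–Murphy element of `n`. Then `P V'⁻¹ = W⁻¹ P`, and for `y = E V⁻¹` one has `y W = t y` with `t
= w + h c n`. Hence `E V'⁻¹ = y + h t⁻¹ y P`, and multiplication by the next factor `t - h P` leaves
a multiple of `y`, since `P² = 1`. -/
theorem HasContents.mul_prod_perm {l : List I} {c : I → K} (hl : l.Nodup) {b : I} (hb : b ∉ l)
    {w h : K} (hw : IsUnit w) (hh : IsNilpotent h) (ht : ∀ i ∈ l, IsUnit (w + h * c i)) :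
    ∃ κ : K, IsUnit κ ∧ ∀ E : A, HasContents e E l c →
      E * (l.map fun i => (w + h * c i) • 1 - h • perm e i b).prod *
        (w • 1 - (-h) • (l.map fun i => perm e i b).sum) = κ • E := by
  have key : ∀ p s, l = p ++ s → ∃ κ : K, IsUnit κ ∧ ∀ E : A, HasContents e E l c →
      E * (p.map fun i => (w + h * c i) • 1 - h • perm e i b).prod *
        (w • 1 - (-h) • (p.map fun i => perm e i b).sum) = κ • E := by
    intro p
    induction p using List.reverseRecOn with
    | nil => intro s _; exact ⟨w, hw, by simp⟩
    | append_singleton p n ih =>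
      intro s hs
      obtain ⟨κ, hκ, h1⟩ := ih (n :: s) (by simpa using hs)
      have hnl : n ∈ l := by rw [hs]; simp
      obtain ⟨t, htn⟩ := ht n hnl
      have ht2 : IsUnit ((t : K) * t - h * h) := by
        obtain ⟨k, hk⟩ := hh
        rw [sub_eq_add_neg]
        refine IsNilpotent.isUnit_add_left_of_commute ?_ (t.isUnit.mul t.isUnit) (Commute.all _ _)
        exact IsNilpotent.neg ⟨k, by rw [mul_pow, hk, zero_mul]⟩
      refine ⟨κ * ↑t⁻¹ * ((t : K) * t - h * h), (hκ.mul (Units.isUnit _)).mul ht2, fun E hE => ?_⟩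
      have hn : n ∉ p ∧ n ≠ b ∧ (∀ k ∈ p, k ≠ b) ∧ p.Nodup := by
        rw [hs] at hl hb
        simp only [List.append_assoc, List.mem_append, not_or, List.singleton_append,
          List.mem_cons] at hl hb
        exact ⟨fun hn => (List.nodup_append.1 hl).2.2 n hn n (by simp) rfl, Ne.symm hb.2.1,
          fun k hk e => hb.1 (e ▸ hk), (List.nodup_append.1 hl).1⟩
      have h2 := hE p n s (by simpa using hs)
      simp only [List.map_append, List.prod_append, List.map_cons, List.map_nil, List.prod_cons,
        List.prod_nil, mul_one, List.sum_append, List.sum_cons, List.sum_nil, add_zero]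
      set x := (p.map fun i => perm e i n).sum with hx
      set X := (p.map fun i => perm e i b).sum with hX
      set P := perm e n b with hP
      obtain ⟨V', hV'⟩ := isUnit_smul_one_sub (A := A) hw hh.neg X
      obtain ⟨V, hV⟩ := isUnit_smul_one_sub (A := A) hw hh.neg (X + P)
      obtain ⟨W, hW⟩ := isUnit_smul_one_sub (A := A) hw hh.neg x
      -- Conjugation by `P_nb` replaces the site `b` by `n`, so it takes the sum of the `P_ib` to
      -- the Jucys–Murphy element of `n`.
      have hPX : P * X = x * P := by
        rw [hX, hx, ← List.sum_map_mul_right, ← List.sum_map_mul_left]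
        congr 1
        refine List.map_congr_left fun i hi => ?_
        have hin : i ≠ n := fun e => hn.1 (e ▸ hi)
        have hib := hn.2.2.1 i hi
        rw [hP, he.perm_comm hn.2.1, he.perm_comm hib,
          he.perm_mul_perm hn.2.1.symm hib.symm hin.symm, he.perm_comm hin.symm]
      have hPV : P * (V' : A) = W * P := by
        rw [hV', hW]
        simp only [mul_sub, sub_mul, smul_mul_assoc, mul_smul_comm, mul_one, one_mul, hPX]
      have hPV' : P * (↑V'⁻¹ : A) = ↑W⁻¹ * P := by
        rw [Units.eq_inv_mul_iff_mul_eq, ← mul_assoc, ← hPV, Units.mul_inv_cancel_right]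
      have hPP : P * P = 1 := he.perm_mul_self hn.2.1
      -- The sum over `p` and `n` is symmetric in these sites, hence commutes with the
      -- transpositions which make up `x`. This makes `E V⁻¹` an eigenvector of `x` along with `E`.
      have hc : Commute (X + P) x := by
        have h3 : (X + P) = ((p ++ [n]).map fun i => perm e i b).sum := by simp [hX, hP]
        rw [h3]
        refine Commute.list_sum_right _ _ fun y hy => ?_
        obtain ⟨i, hi, rfl⟩ := List.mem_map.1 hy
        refine (he.perm_commute_sum_perm ?_ (by simp [hi]) (by simp)
          (fun e' : i = n => hn.1 (e' ▸ hi)) ?_).symm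
        · rw [List.nodup_append]
          exact ⟨hn.2.2.2, by simp, fun a ha b hb => by
            rw [List.mem_singleton] at hb; rintro rfl; exact hn.1 (hb ▸ ha)⟩
        · simp only [List.mem_append, List.mem_singleton, not_or]
          exact ⟨fun hb => hn.2.2.1 b hb rfl, hn.2.1.symm⟩
      have hVx : Commute (V : A) x := by
        rw [hV]
        exact ((Commute.one_left x).smul_left w).sub_left (hc.smul_left _)
      have hVx' : Commute (↑V⁻¹ : A) x := hVx.units_inv_left
      set y := E * (↑V⁻¹ : A) with hy
      have hyx : y * x = c n • y := by
        rw [hy, mul_assoc, hVx'.eq, ← mul_assoc, h2, smul_mul_assoc]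
      have hyW : y * (↑W⁻¹ : A) = (↑t⁻¹ : K) • y := by
        rw [Units.mul_inv_eq_iff_eq_mul, hW, smul_mul_assoc]
        simp only [mul_sub, mul_smul_comm, mul_one, hyx]
        have h3 : w • y - (-h) • c n • y = (t : K) • y := by
          rw [htn]; module
        rw [h3, smul_smul, Units.inv_mul, one_smul]
      have hyV : y * V * (↑V'⁻¹ : A) = y + (h * ↑t⁻¹) • (y * P) := by
        have h3 : (V : A) = V' + h • P := by
          rw [hV, hV']
          module
        rw [h3, mul_add, add_mul, Units.mul_inv_cancel_right, mul_smul_comm, smul_mul_assoc,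
          mul_assoc y P, hPV', ← mul_assoc, hyW, smul_mul_assoc, smul_smul]
      have hF : E * (p.map fun i => (w + h * c i) • 1 - h • perm e i b).prod =
          κ • (E * (↑V'⁻¹ : A)) := by
        have h3 := h1 E hE
        rw [← hV'] at h3
        rw [← smul_mul_assoc, ← h3, Units.mul_inv_cancel_right]
      have hyE : y * V = E := by rw [hy, Units.inv_mul_cancel_right]
      have hfin : E * (↑V'⁻¹ : A) * ((t : K) • 1 - h • P) =
          (↑t⁻¹ * ((t : K) * t - h * h)) • y := by
        have h4 : ↑t⁻¹ * ((t : K) * t - h * h) = t - h * (h * ↑t⁻¹) := by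
          rw [mul_sub, Units.inv_mul_cancel_left]; ring
        rw [h4]
        rw [← hyE, hyV]
        simp only [mul_sub, add_mul, smul_mul_assoc, mul_smul_comm, mul_one, mul_assoc, hPP]
        have h3 : h * ↑t⁻¹ * t = h := by rw [mul_assoc, Units.inv_mul, mul_one]
        simp only [smul_add, smul_smul, mul_comm (t : K), h3]
        module
      rw [← mul_assoc, hF, smul_mul_assoc, smul_mul_assoc, ← htn, hfin, ← hV, smul_mul_assoc, hyE,
        smul_smul, mul_assoc]
  obtain ⟨κ, hκ, h1⟩ := key l [] (by simp)
  exact ⟨κ, hκ, h1⟩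

end Absorption

/-! ### Products of traces -/

section Traces

variable {K A I M : Type*} [CommRing K] [Ring A] [Algebra K A] {N : ℕ}
  [AddCommGroup M] [Module K M] (τ : A →ₗ[K] M) {e : I → Fin N → Fin N → A}

/-- The functional `τ` is invariant under cyclic permutations of the factor `x`. -/
def Cyc (x : A) : Prop := ∀ F, τ (x * F) = τ (F * x)

variable {τ}

theorem Cyc.mul {x y : A} (hx : Cyc τ x) (hy : Cyc τ y) : Cyc τ (x * y) := fun F => by
  rw [mul_assoc, hx, mul_assoc, hy, mul_assoc]

theorem Cyc.one : Cyc τ (1 : A) := fun F => by rw [one_mul, mul_one]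

theorem Cyc.sub {x y : A} (hx : Cyc τ x) (hy : Cyc τ y) : Cyc τ (x - y) := fun F => by
  rw [sub_mul, mul_sub, map_sub, map_sub, hx, hy]

theorem Cyc.smul {x : A} (hx : Cyc τ x) (a : K) : Cyc τ (a • x) := fun F => by
  rw [smul_mul_assoc, mul_smul_comm, map_smul, map_smul, hx]

theorem Cyc.sum {J : Type*} {s : Finset J} {x : J → A} (hx : ∀ j ∈ s, Cyc τ (x j)) :
    Cyc τ (∑ j ∈ s, x j) := fun F => by
  rw [Finset.sum_mul, Finset.mul_sum, map_sum, map_sum]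
  exact Finset.sum_congr rfl fun j hj => hx j hj F

theorem Cyc.list_prod {l : List A} (hx : ∀ x ∈ l, Cyc τ x) : Cyc τ l.prod := by
  induction l with
  | nil => exact Cyc.one
  | cons a l ih =>
    rw [List.prod_cons]
    exact (hx a (by simp)).mul (ih fun x h => hx x (by simp [h]))

theorem Cyc.cross {f : I → I → A} {l m : List I} (h : ∀ i ∈ l, ∀ j ∈ m, Cyc τ (f i j)) :
    Cyc τ (cross f l m) := by
  refine Cyc.list_prod fun x hx => ?_
  obtain ⟨i, hi, rfl⟩ := List.mem_map.1 hx
  refine Cyc.list_prod fun x hx => ?_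
  obtain ⟨j, hj, rfl⟩ := List.mem_map.1 hx
  exact h i hi j hj

theorem Cyc.contR (hτ : ∀ i k l, Cyc τ (e i k l)) (h : K) (x : I → I → K) (i j : I) :
    Cyc τ (contR e h x i j) :=
  (Cyc.one.smul _).sub ((Cyc.sum fun k _ => Cyc.sum fun l _ => (hτ i k l).mul (hτ j k l)).smul h)

theorem Cyc.permR (hτ : ∀ i k l, Cyc τ (e i k l)) (d ε : K) (i j : I) :
    Cyc τ (permR e d ε i j) :=
  (Cyc.one.smul _).sub ((Cyc.sum fun k _ => Cyc.sum fun l _ => (hτ i k l).mul (hτ j l k)).smul ε)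

variable (he : MatrixUnits e) (hτ : ∀ i k l, Cyc τ (e i k l))

include he hτ

/-- In each summand of the transposed permutation, the unit at `i` passes through `F₂` directly, and
the unit at `j` passes through `F₁` and returns at the other end by cyclicity. -/
theorem trace_mul_cont_mul {F₁ F₂ : A} {i j : I} (hij : i ≠ j)
    (h₁ : ∀ k l, Commute F₁ (e j k l)) (h₂ : ∀ k l, Commute F₂ (e i k l)) :
    τ (F₁ * cont e i j * F₂) = τ (F₁ * F₂ * cont e i j) := by
  simp only [cont, Finset.mul_sum, Finset.sum_mul, map_sum]
  refine Finset.sum_congr rfl fun k _ => Finset.sum_congr rfl fun l _ => ?_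
  have hc := he.comm i j k l k l hij
  calc _ = τ (F₁ * (e i k l * e j k l * F₂)) := by rw [mul_assoc]
    _ = τ (F₁ * (e j k l * (F₂ * e i k l))) := by rw [hc.eq, mul_assoc, (h₂ k l).eq]
    _ = τ (e j k l * (F₁ * F₂ * e i k l)) := by
      rw [← mul_assoc, (h₁ k l).eq]; simp only [mul_assoc]
    _ = _ := by rw [hτ]; simp only [mul_assoc]

/-- A trace version of `P² = 1` after transposition in one factor. In the algebra itself the square
is `N` times the operator; the contrast between the two rules is what singles out a level. -/
theorem trace_mul_cont_mul_cont {F₁ F₂ : A} {i j : I} (hij : i ≠ j)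
    (h₁ : ∀ k l, Commute F₁ (e j k l)) (h₂ : ∀ k l, Commute F₂ (e i k l)) :
    τ (F₁ * cont e i j * F₂ * cont e i j) = τ (F₁ * F₂) := by
  have h3 : ∀ k l, F₁ * (e i k l * e j k l) * F₂ * cont e i j =
      ∑ b, F₁ * e j k l * F₂ * e i k b * e j l b := by
    intro k l
    have h4 : e i k l * cont e i j = ∑ b, e i k b * e j l b := by
      rw [he.cont_comm hij, he.unit_mul_cont hij.symm]
      exact Finset.sum_congr rfl fun b _ => he.comm _ _ _ _ _ _ hij.symm
    rw [(he.comm i j k l k l hij).eq, mul_assoc (F₁ * _), ← mul_assoc F₁, mul_assoc (F₁ * _),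
      ← mul_assoc (e i k l), ← (h₂ k l).eq, mul_assoc F₂, h4]
    simp only [Finset.mul_sum, mul_assoc]
  have h5 : ∀ k l b, τ (F₁ * e j k l * F₂ * e i k b * e j l b) =
      if b = k then τ (F₁ * e j l l * F₂ * e i k k) else 0 := by
    intro k l b
    rw [← hτ]
    simp only [← mul_assoc]
    rw [← (h₁ l b).eq, mul_assoc F₁, he.mul]
    split_ifs with h6
    · rw [h6]
    · simp
  conv_lhs => enter [2, 1, 1, 2]; rw [cont]
  simp only [Finset.mul_sum, Finset.sum_mul, h3, map_sum, h5, Finset.sum_ite_eq', Finset.mem_univ,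
    if_true]
  simp only [← map_sum, ← Finset.mul_sum, ← Finset.sum_mul, he.one, mul_one]

/-- The terms linear in the transposed permutation have equal traces and opposite signs, because the
arguments are `x` and `-x`; a scalar remains. -/
theorem trace_mul_contR_mul_contR {F₁ F₂ : A} {i j : I} (hij : i ≠ j)
    (h₁ : ∀ k l, Commute F₁ (e j k l)) (h₂ : ∀ k l, Commute F₂ (e i k l)) (h : K)
    (x : I → I → K) :
    τ (F₁ * contR e h x i j * F₂ * contR e h (fun i j => -x i j) i j) =
      (h * h - x i j * x i j) • τ (F₁ * F₂) := by
  have h3 := trace_mul_cont_mul he hτ hij h₁ h₂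
  have h4 := trace_mul_cont_mul_cont he hτ hij h₁ h₂
  simp only [contR, mul_sub, sub_mul, smul_mul_assoc, mul_smul_comm, mul_one, map_sub, map_smul,
    h3, h4, smul_sub, smul_smul]
  module

/-- The last element of the row is removed first, since its two factors surround `F₂` directly. The
remaining factors of the second row are moved cyclically to the front, where they commute with the
units at the site being removed, and back again. -/
theorem trace_row {F₁ F₂ : A} {i : I} (m : List I) (hm : m.Nodup) (hi : i ∉ m)
    (h₁ : ∀ j ∈ m, ∀ k l, Commute F₁ (e j k l)) (h₂ : ∀ k l, Commute F₂ (e i k l)) (h : K)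
    (x : I → I → K) :
    τ (F₁ * (m.map (contR e h x i)).prod * F₂ *
      (m.reverse.map (contR e h (fun i j => -x i j) i)).prod) =
      (m.map fun j => h * h - x i j * x i j).prod • τ (F₁ * F₂) := by
  induction m using List.reverseRecOn generalizing F₁ with
  | nil => simp
  | append_singleton m b ih =>
    simp only [List.map_append, List.prod_append, List.map_cons, List.map_nil, List.prod_cons,
      List.prod_nil, mul_one, List.reverse_append, List.reverse_cons, List.reverse_nil,
      List.nil_append, List.cons_append]
    set y := (m.map (contR e h x i)).prod
    set y' := (m.reverse.map (contR e h (fun i j => -x i j) i)).prod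
    have hcyc : Cyc τ y' := Cyc.list_prod fun x hx => by
      obtain ⟨j, _, rfl⟩ := List.mem_map.1 hx
      exact Cyc.contR hτ _ _ _ _
    simp only [List.mem_append, List.mem_singleton, not_or] at hi h₁
    have hbm : ∀ j ∈ m, b ≠ j := by
      intro j hj hbj
      exact (List.nodup_append.1 hm).2.2 j hj b (by simp) hbj.symm
    have hcb : ∀ z : I → I → K, ∀ l' : List I, (∀ j ∈ l', b ≠ j) → ∀ k l,
        Commute (l'.map (contR e h z i)).prod (e b k l) := by
      intro z l' hl' k l
      refine Commute.list_prod_left _ _ fun w hw => ?_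
      obtain ⟨j, hj, rfl⟩ := List.mem_map.1 hw
      exact (commute_contR (he.cont_commute_unit (Ne.symm hi.2) (hl' j hj) k l).symm).symm
    calc _ = τ (F₁ * y * contR e h x i b * F₂ * contR e h (fun i j => -x i j) i b * y') := by
          simp only [mul_assoc]
      _ = τ (y' * F₁ * y * contR e h x i b * F₂ * contR e h (fun i j => -x i j) i b) := by
        rw [← hcyc]; simp only [mul_assoc]
      _ = (h * h - x i b * x i b) • τ (y' * F₁ * y * F₂) := by
        refine trace_mul_contR_mul_contR he hτ hi.2 (fun k l => ?_) h₂ h x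
        exact ((hcb _ _ (fun j hj => hbm j (List.mem_reverse.1 hj)) k l).mul_left
          (h₁ b (Or.inr rfl) k l)).mul_left (hcb _ _ hbm k l)
      _ = (h * h - x i b * x i b) • τ (F₁ * y * F₂ * y') := by
        rw [← hcyc]; simp only [mul_assoc]
      _ = _ := by
        rw [ih (List.nodup_append.1 hm).1 hi.1 fun j hj => h₁ j (Or.inl hj), smul_smul, mul_comm]

/-- The first row is the outermost pair, and everything between its two factors commutes with the
units at its site; so `trace_row` peels off one site of `l` at a time. -/
theorem trace_cross {F₁ F₂ : A} (l m : List I) (hlm : (l ++ m).Nodup)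
    (h₁ : ∀ j ∈ m, ∀ k l, Commute F₁ (e j k l)) (h₂ : ∀ i ∈ l, ∀ k l, Commute F₂ (e i k l)) (h : K)
    (x : I → I → K) :
    τ (F₁ * cross (contR e h x) l m * F₂ *
      cross (contR e h fun i j => -x i j) l.reverse m.reverse) =
      cross (fun i j => h * h - x i j * x i j) l m • τ (F₁ * F₂) := by
  induction l with
  | nil => simp
  | cons a l ih =>
    have hrev : ∀ (f : I → I → A) (l m : List I), cross f (l ++ [a]) m = cross f l m *
        (m.map (f a)).prod := by
      intro f l m
      simp [cross]
    rw [List.reverse_cons, hrev, cross_cons_left, cross_cons_left]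
    rw [List.cons_append, List.nodup_cons, List.mem_append, not_or] at hlm
    have hlm' := List.nodup_append.1 hlm.2
    have hc : ∀ z : I → I → K, ∀ l' m' : List I, (∀ j ∈ l', a ≠ j) → (∀ j ∈ m', a ≠ j) → ∀ k l,
        Commute (cross (contR e h z) l' m') (e a k l) := by
      intro z l' m' hl' hm' k l
      refine Commute.list_prod_left _ _ fun w hw => ?_
      obtain ⟨i, hi, rfl⟩ := List.mem_map.1 hw
      refine Commute.list_prod_left _ _ fun w hw => ?_
      obtain ⟨j, hj, rfl⟩ := List.mem_map.1 hw
      exact (commute_contR (he.cont_commute_unit (hl' i hi) (hm' j hj) k l).symm).symm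
    have hal : ∀ j ∈ l, a ≠ j := fun j hj e' => hlm.1.1 (e' ▸ hj)
    have ham : ∀ j ∈ m, a ≠ j := fun j hj e' => hlm.1.2 (e' ▸ hj)
    have key := trace_row he hτ (F₁ := F₁) (F₂ := cross (contR e h x) l m * F₂ *
      cross (contR e h fun i j => -x i j) l.reverse m.reverse) m hlm'.2.1 hlm.1.2 h₁
      (fun k n => ((hc _ _ _ hal ham k n).mul_left (h₂ a (by simp) k n)).mul_left
        (hc _ _ _ (fun j hj => hal j (List.mem_reverse.1 hj))
          (fun j hj => ham j (List.mem_reverse.1 hj)) k n)) h x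
    rw [mul_smul, ← ih hlm.2 fun i hi => h₂ i (by simp [hi])]
    simp only [mul_assoc] at key ⊢
    exact key

end Traces

/-! ### The commutativity argument for two disjoint sets of sites -/

section Commutativity

variable {K A I M : Type*} [CommRing K] [Ring A] [Algebra K A] {N : ℕ}
  [AddCommGroup M] [Module K M] {τ : A →ₗ[K] M} {e : I → Fin N → Fin N → A}

theorem cross_absorb {E : A} (hE : E * E = E) (f : I → I → A) (l m : List I)
    (h : ∀ i ∈ l, E * (m.map (f i)).prod = E * (m.map (f i)).prod * E) :
    E * cross f l m = E * cross f l m * E := by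
  refine list_prod_absorb hE _ fun x hx => ?_
  obtain ⟨i, hi, rfl⟩ := List.mem_map.1 hx
  exact h i hi

theorem absorb_of_commute {E x : A} (hE : E * E = E) (h : Commute E x) : E * x = E * x * E := by
  rw [mul_assoc, ← h.eq, ← mul_assoc, hE]

theorem mul_absorb {E F x : A} (hc : Commute E F) (h₁ : E * x = E * x * E)
    (h₂ : F * x = F * x * F) : E * F * x = E * F * x * (E * F) := by
  have h3 : E * F * x = E * F * x * F := by
    conv_lhs => rw [mul_assoc, h₂]
    simp only [mul_assoc]
  have h4 : E * F * x = E * F * x * E := by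
    rw [hc.eq]
    conv_lhs => rw [mul_assoc, h₁]
    simp only [mul_assoc]
  rw [← mul_assoc, ← h4, ← h3]

theorem cross_reverse_right (σ : I → I → K) (l m : List I) :
    cross σ l m.reverse = cross σ l m := by
  rw [cross, cross]
  congr 1
  exact List.map_congr_left fun i _ => (m.reverse_perm.map _).prod_eq

theorem cross_reverse_left (σ : I → I → K) (l m : List I) :
    cross σ l.reverse m = cross σ l m :=
  (l.reverse_perm.map _).prod_eq

theorem IsUnit.add_mul_nilpotent {w h : K} (hw : IsUnit w) (hh : IsNilpotent h) (a : K) :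
    IsUnit (w + h * a) := by
  refine IsNilpotent.isUnit_add_left_of_commute ?_ hw (Commute.all _ _)
  obtain ⟨k, hk⟩ := hh
  exact ⟨k, by rw [mul_pow, hk, zero_mul]⟩

/-- An idempotent on the sites in `l` on which the Jucys–Murphy elements act by the contents `c`. -/
structure ContentIdempotent (e : I → Fin N → Fin N → A) (l : List I) (c : I → K) (E : A) :
    Prop where
  idem : E * E = E
  contents : HasContents e E l c
  comm_unit : ∀ i ∉ l, ∀ k n, Commute E (e i k n)
  comm_perm : ∀ b ∉ l, Commute E (l.map fun i => perm e i b).sum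
  comm_cont : ∀ b ∉ l, Commute E (l.map fun i => cont e i b).sum

variable {l : List I} {c : I → K} {E : A}

/-- Crossing symmetry: the linear and quadratic terms in the transposed permutation add up to `h (h
N - x - y)` times this operator. The inverse of the factor with argument `h N - x` thus has argument
`x`. -/
theorem contR_mul_contR (he : MatrixUnits e) (h : K) {x y : I → I → K} {i j : I} (hij : i ≠ j)
    (hxy : x i j + y i j = h * N) :
    contR e h x i j * contR e h y i j = (x i j * y i j) • 1 := by
  have h1 := he.cont_mul_self (K := K) hij
  simp only [contR, mul_sub, sub_mul, smul_mul_assoc, mul_smul_comm, mul_one, one_mul, h1]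
  have h2 : h * N * h = h * (x i j + y i j) := by rw [hxy]; ring
  linear_combination (norm := module) (h • hxy.symm) • cont e i j

theorem permR_mul_permR (he : MatrixUnits e) (h d : K) {i j : I} (hij : i ≠ j) :
    permR e d h i j * permR e (-d) h i j = (h * h - d * d) • 1 := by
  have h1 := he.perm_mul_self hij
  simp only [permR, mul_sub, sub_mul, smul_mul_assoc, mul_smul_comm, mul_one, one_mul, h1]
  module

namespace ContentIdempotent

variable (he : MatrixUnits e) (hE : ContentIdempotent e l c E) (hl : l.Nodup)

include he hE hl

/-- By `HasContents.mul_prod_cont` the row acts on `E` as a unit multiple of an invertible element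
commuting with `E`. Such an action preserves the range of `E`, and so does that of any `G` inverting
the row up to a scalar. -/
theorem absorb_cont {b : I} (hb : b ∉ l) {w h : K} (hw : IsUnit w) (hh : IsNilpotent h)
    {G : A} {σ : K}
    (hG : (l.map fun i => (w - h * c i) • (1 : A) - h • cont e i b).prod * G = σ • 1) :
    (E * (l.map fun i => (w - h * c i) • 1 - h • cont e i b).prod =
      E * (l.map fun i => (w - h * c i) • 1 - h • cont e i b).prod * E) ∧ E * G = E * G * E := by
  have h1 := hE.contents.mul_prod_cont he hl hb w h
  obtain ⟨V, hV⟩ := isUnit_smul_one_sub (A := A) hw hh (l.map fun i => cont e i b).sum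
  rw [← hV] at h1
  have hc : Commute E (V : A) := by
    rw [hV]
    exact ((Commute.one_right E).smul_right w).sub_right ((hE.comm_cont b hb).smul_right h)
  have hu : IsUnit (l.map fun i => w - h * c i).prod := by
    refine isUnit_list_prod _ fun x hx => ?_
    obtain ⟨i, _, rfl⟩ := List.mem_map.1 hx
    have := IsUnit.add_mul_nilpotent hw hh (-c i)
    rwa [mul_neg, ← sub_eq_add_neg] at this
  obtain ⟨w, rfl⟩ := hw
  refine absorb_of_mul_eq (V := (↑V⁻¹ : A)) (κ := ↑w⁻¹ * (l.map fun i => w - h * c i).prod)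
    hE.idem (Units.isUnit _) hc.units_inv_right ((Units.isUnit _).mul hu) ?_ hG
  have h2 : E * (l.map fun i => ((w : K) - h * c i) • (1 : A) - h • cont e i b).prod =
      (↑w⁻¹ : K) • (l.map fun i => (w : K) - h * c i).prod • (E * (V : A)) := by
    rw [← h1, smul_smul, Units.inv_mul, one_smul]
  rw [h2, smul_mul_assoc, smul_mul_assoc, Units.mul_inv_cancel_right, smul_smul]

theorem absorb_perm {b : I} (hb : b ∉ l) {w h : K} (hw : IsUnit w) (hh : IsNilpotent h)
    {G : A} {σ : K}
    (hG : (l.map fun i => (w + h * c i) • (1 : A) - h • perm e i b).prod * G = σ • 1) :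
    (E * (l.map fun i => (w + h * c i) • 1 - h • perm e i b).prod =
      E * (l.map fun i => (w + h * c i) • 1 - h • perm e i b).prod * E) ∧ E * G = E * G * E := by
  obtain ⟨κ, hκ, h1⟩ := HasContents.mul_prod_perm he hl hb hw hh
    (c := c) fun i _ => IsUnit.add_mul_nilpotent hw hh (c i)
  refine absorb_of_mul_eq hE.idem (isUnit_smul_one_sub hw hh.neg _)
    (((Commute.one_right E).smul_right w).sub_right ((hE.comm_perm b hb).smul_right (-h)))
    hκ (h1 E hE.contents) hG

end ContentIdempotent

/-- Operators on a list `l` of sites: an idempotent `E`, and an inverse `D` of the ordered product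
of numerical operators. -/
structure Block (τ : A →ₗ[K] M) (e : I → Fin N → Fin N → A) (s g : I → A) (h : K)
    (x y : I → I → K) (l : List I) (c : I → K) (E D : A) : Prop extends
    ContentIdempotent e l c E where
  comm_s : ∀ i ∉ l, Commute E (s i)
  absorb_s : E * br s (contR e h x) l = E * br s (contR e h x) l * E
  absorb_inv : E * D = E * D * E
  inv_comm_unit : ∀ i ∉ l, ∀ k n, Commute D (e i k n)
  inv_comm_s : ∀ i ∉ l, Commute D (s i)
  cyc : Cyc τ E
  cyc_inv : Cyc τ D
  mul_inv : br g (contR e h y) l * D = 1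
  inv_mul : D * br g (contR e h y) l = 1

variable {s g : I → A} {h : K} {x y : I → I → K} {m : List I} {c' : I → K} {D E' D' : A}

/-- The relations between the operators on two disjoint lists of sites. -/
structure BlockPair (τ : A →ₗ[K] M) (e : I → Fin N → Fin N → A) (s g : I → A) (h : K)
    (l : List I) (c : I → K) (E D : A) (m : List I) (c' : I → K) (E' D' : A) (z : I → K)
    (u v : K) : Prop where
  units : MatrixUnits e
  cycUnits : ∀ i k n, Cyc τ (e i k n)
  s_comm : ∀ i j, i ≠ j → ∀ k n, Commute (s i) (e j k n)
  nodup : (l ++ m).Nodup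
  left : Block τ e s g h (fun i j => -z i - z j) (fun i j => h * N - z i - z j) l c E D
  right : Block τ e s g h (fun i j => -z i - z j) (fun i j => h * N - z i - z j) m c' E' D'
  comm_idem : Commute E E'
  comm_idem_inv : Commute E D'
  comm_inv_idem : Commute D E'
  comm_inv : Commute D D'
  nilpotent : IsNilpotent h
  arg_left : ∀ i ∈ l, z i = u + h * c i
  arg_right : ∀ j ∈ m, z j = v + h * c' j
  isUnit_sub : IsUnit (u - v)
  isUnit_add : IsUnit (u + v)

namespace BlockPair

variable {z : I → K} {u v : K}

theorem symm (H : BlockPair τ e s g h l c E D m c' E' D' z u v) :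
    BlockPair τ e s g h m c' E' D' l c E D z v u where
  units := H.units
  cycUnits := H.cycUnits
  s_comm := H.s_comm
  nodup := (List.perm_append_comm.nodup_iff).1 H.nodup
  left := H.right
  right := H.left
  comm_idem := H.comm_idem.symm
  comm_idem_inv := H.comm_inv_idem.symm
  comm_inv_idem := H.comm_idem_inv.symm
  comm_inv := H.comm_inv.symm
  nilpotent := H.nilpotent
  arg_left := H.arg_right
  arg_right := H.arg_left
  isUnit_sub := by rw [← neg_sub]; exact H.isUnit_sub.neg
  isUnit_add := by rw [add_comm]; exact H.isUnit_add

variable (H : BlockPair τ e s g h l c E D m c' E' D' z u v)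

include H

theorem isUnit_arg_sub {i j : I} (hi : i ∈ l) (hj : j ∈ m) : IsUnit (z i - z j) := by
  have h1 := IsUnit.add_mul_nilpotent H.isUnit_sub H.nilpotent (c i - c' j)
  rw [H.arg_left i hi, H.arg_right j hj]
  convert h1 using 1
  ring

theorem isUnit_arg_add {i j : I} (hi : i ∈ l) (hj : j ∈ m) (a : K) :
    IsUnit (h * a - z i - z j) := by
  have h1 := IsUnit.add_mul_nilpotent H.isUnit_add H.nilpotent (c i + c' j - a)
  rw [H.arg_left i hi, H.arg_right j hj]
  convert h1.neg using 1
  ring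

theorem disjoint {i j : I} (hi : i ∈ l) (hj : j ∈ m) : i ≠ j :=
  (List.nodup_append.1 H.nodup).2.2 i hi j hj

theorem notMem_right {i : I} (hi : i ∈ l) : i ∉ m := fun hm => H.disjoint hi hm rfl

theorem notMem_left {j : I} (hj : j ∈ m) : j ∉ l := fun hm => H.disjoint hm hj rfl

theorem siteOps_cross {x : I → I → K} (i i' j j' : I) (hi : i ∈ l) (hi' : i' ∈ l) (hj : j ∈ m)
    (hj' : j' ∈ m) (hii : i ≠ i') (hjj : j ≠ j') :
    Commute (contR e h x i j) (contR e h x i' j') :=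
  (siteOps_contR H.units H.s_comm h x).comm_q i j i' j' (H.disjoint hi hj) (H.disjoint hi' hj') hii
    (H.disjoint hi hj') (H.disjoint hi' hj).symm hjj

/-- The idempotent of the second list absorbs the rows of the transposed R-matrices. -/
theorem absorb_row {i : I} (hi : i ∈ l) :
    (E' * (m.map (contR e h (fun i j => -z i - z j) i)).prod =
      E' * (m.map (contR e h (fun i j => -z i - z j) i)).prod * E') ∧
    E' * (m.reverse.map (contR e h (fun i j => -(-z i - z j)) i)).prod =
      E' * (m.reverse.map (contR e h (fun i j => -(-z i - z j)) i)).prod * E' := by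
  have hmn := (List.nodup_append.1 H.nodup).2.1
  have key : ∀ a : K, m.map (contR e h (fun i j => h * a - z i - z j) i) =
      m.map fun j => ((h * a - z i - v) - h * c' j) • (1 : A) - h • cont e j i := by
    intro a
    refine List.map_congr_left fun j hj => ?_
    rw [contR, H.units.cont_comm (H.disjoint hi hj), H.arg_right j hj]
    congr 2
    ring
  have hw : ∀ a : K, IsUnit (h * a - z i - v) := by
    intro a
    have h1 := IsUnit.add_mul_nilpotent H.isUnit_add H.nilpotent (c i - a)
    rw [H.arg_left i hi]
    convert h1.neg using 1
    ring
  constructor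
  · have k0 := key 0
    -- The parameter `a = 0` gives the row itself. Only the first half of the conclusion is wanted,
    -- so the inverse is taken to be zero with scalar zero.
    have h0 := H.right.absorb_cont H.units hmn (H.notMem_right hi) (hw 0) H.nilpotent (G := 0)
      (σ := 0) (by simp)
    rw [← k0] at h0
    simpa using h0.1
  -- The parameter `a = N` gives the row with the numerical arguments; by crossing, its inverse up
  -- to a scalar is the reversed row with the negated arguments, the one needed in the trace.
  · have k1 := key N
    have h1 := H.right.absorb_cont H.units hmn (H.notMem_right hi) (hw N) H.nilpotent
      (G := (m.reverse.map (contR e h (fun i j => -(-z i - z j)) i)).prod)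
      (σ := (m.map fun j => (h * N - z i - z j) * (-(-z i - z j))).prod) (by
        rw [← k1]
        refine prod_map_mul_reverse_prod _ _ _ m fun j hj => ?_
        refine contR_mul_contR H.units h (H.disjoint hi hj) ?_
        ring)
    exact h1.2

theorem absorb_cross_right :
    (E' * cross (contR e h (fun i j => -z i - z j)) l m =
      E' * cross (contR e h (fun i j => -z i - z j)) l m * E') ∧
    E' * cross (contR e h (fun i j => -(-z i - z j))) l.reverse m.reverse =
      E' * cross (contR e h (fun i j => -(-z i - z j))) l.reverse m.reverse * E' :=
  ⟨cross_absorb H.right.idem _ _ _ fun _ hi => (H.absorb_row hi).1,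
    cross_absorb H.right.idem _ _ _ fun _ hi => (H.absorb_row (List.mem_reverse.1 hi)).2⟩

theorem cross_flip (x : I → I → K) (hx : ∀ i j, x i j = x j i) {l' m' : List I} (hl : l' ⊆ l)
    (hm : m' ⊆ m) (hl' : l'.Nodup) (hm' : m'.Nodup) :
    cross (contR e h x) l' m' = cross (contR e h x) m' l' := by
  rw [cross_comm _ _ _ hl' hm' fun i hi i' hi' j hj j' hj' =>
    H.siteOps_cross i i' j j' (hl hi) (hl hi') (hm hj) (hm hj')]
  rw [cross, cross]
  congr 1
  refine List.map_congr_left fun j hj => ?_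
  congr 1
  refine List.map_congr_left fun i hi => ?_
  rw [contR, contR, hx, H.units.cont_comm (H.disjoint (hl hi) (hm hj))]

theorem absorb_cross_left :
    (E * cross (contR e h (fun i j => -z i - z j)) l m =
      E * cross (contR e h (fun i j => -z i - z j)) l m * E) ∧
    E * cross (contR e h (fun i j => -(-z i - z j))) l.reverse m.reverse =
      E * cross (contR e h (fun i j => -(-z i - z j))) l.reverse m.reverse * E := by
  have hn := List.nodup_append.1 H.nodup
  rw [H.cross_flip _ (fun i j => by ring) (List.Subset.refl _) (List.Subset.refl _) hn.1 hn.2.1,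
    H.cross_flip _ (fun i j => by ring) (fun _ => List.mem_reverse.1)
    (fun _ => List.mem_reverse.1) (List.nodup_reverse.2 hn.1) (List.nodup_reverse.2 hn.2.1)]
  exact H.symm.absorb_cross_right

/-- `absorb_perm` concerns the row in the order of `m` with negated arguments; the reversed row with
the original arguments is its inverse up to a scalar, by unitarity. Hence one statement is the first
half of `absorb_perm` and the other is the second half. -/
theorem absorb_permR_right :
    (E' * cross (fun i j => permR e (z i - z j) h i j) l m.reverse =
      E' * cross (fun i j => permR e (z i - z j) h i j) l m.reverse * E') ∧
    E' * cross (fun i j => permR e (-(z i - z j)) h i j) l.reverse m =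
      E' * cross (fun i j => permR e (-(z i - z j)) h i j) l.reverse m * E' := by
  have hmn := (List.nodup_append.1 H.nodup).2.1
  have key : ∀ i ∈ l, (m.map fun j => permR e (-(z i - z j)) h i j) =
      m.map fun j => ((v - z i) + h * c' j) • (1 : A) - h • perm e j i := by
    intro i hi
    refine List.map_congr_left fun j hj => ?_
    rw [permR, H.units.perm_comm (H.disjoint hi hj), H.arg_right j hj]
    congr 2
    ring
  have hw : ∀ i ∈ l, IsUnit (v - z i) := by
    intro i hi
    have h1 := IsUnit.add_mul_nilpotent H.isUnit_sub H.nilpotent (c i)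
    rw [H.arg_left i hi]
    convert h1.neg using 1
    ring
  have h1 := fun i hi => H.right.absorb_perm H.units hmn (H.notMem_right hi) (hw i hi) H.nilpotent
      (G := (m.reverse.map fun j => permR e (z i - z j) h i j).prod)
      (σ := (m.map fun j => h * h - (z i - z j) * (z i - z j)).prod) (by
        rw [← key i hi]
        refine prod_map_mul_reverse_prod _ _ _ m fun j hj => ?_
        have h2 := permR_mul_permR H.units h (-(z i - z j)) (H.disjoint hi hj)
        rwa [neg_neg, neg_mul_neg] at h2)
  refine ⟨cross_absorb H.right.idem _ _ _ fun i hi => (h1 i hi).2,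
    cross_absorb H.right.idem _ _ _ fun i hi => ?_⟩
  rw [key i (List.mem_reverse.1 hi)]
  exact (h1 i (List.mem_reverse.1 hi)).1

theorem absorb_permR_left :
    (E * cross (fun i j => permR e (z i - z j) h i j) l m.reverse =
      E * cross (fun i j => permR e (z i - z j) h i j) l m.reverse * E) ∧
    E * cross (fun i j => permR e (-(z i - z j)) h i j) l.reverse m =
      E * cross (fun i j => permR e (-(z i - z j)) h i j) l.reverse m * E := by
  have hn := List.nodup_append.1 H.nodup
  have key : ∀ (w : I → I → K) (l' m' : List I), l' ⊆ l → m' ⊆ m → l'.Nodup → m'.Nodup →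
      cross (fun i j => permR e (w i j) h i j) l' m' =
        cross (fun j i => permR e (w i j) h j i) m' l' := by
    intro w l' m' hl hm hl' hm'
    rw [cross_comm _ _ _ hl' hm' fun i hi i' hi' j hj j' hj' hii hjj => commute_permR
      (commute_perm
        (fun a b => (commute_permR (H.units.perm_commute_unit (Ne.symm hii)
          (H.disjoint (hl hi') (hm hj)) a b).symm).symm)
        fun a b => (commute_permR (H.units.perm_commute_unit
          (H.disjoint (hl hi) (hm hj')).symm (Ne.symm hjj) a b).symm).symm)]
    rw [cross, cross]
    congr 1
    refine List.map_congr_left fun j hj => ?_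
    congr 1
    refine List.map_congr_left fun i hi => ?_
    rw [permR, permR, H.units.perm_comm (H.disjoint (hl hi) (hm hj))]
  rw [key (fun i j => z i - z j) _ _ (List.Subset.refl _) (fun _ => List.mem_reverse.1) hn.1
    (List.nodup_reverse.2 hn.2.1), key (fun i j => -(z i - z j)) _ _ (fun _ => List.mem_reverse.1)
    (List.Subset.refl _) (List.nodup_reverse.2 hn.1) hn.2.1]
  have h1 := H.symm.absorb_permR_right
  simp only [neg_sub] at h1 ⊢
  exact ⟨h1.2, h1.1⟩

/-- The product of the inverses, up to a scalar. -/
theorem br_mul_inv (hg : ∀ i j, i ≠ j → ∀ k n, Commute (g i) (e j k n)) :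
    br g (contR e h (fun i j => h * N - z i - z j)) (l ++ m) *
      (D' * cross (contR e h (fun i j => -(-z i - z j))) l.reverse m.reverse * D) =
    cross (fun i j => (h * N - z i - z j) * (z i + z j)) l m • 1 := by
  rw [br_append (siteOps_contR H.units hg h _) l m H.nodup]
  have h1 := cross_mul_reverse (contR e h (fun i j => h * N - z i - z j))
    (contR e h (fun i j => -(-z i - z j))) (fun i j => (h * N - z i - z j) * (z i + z j)) l m
    fun i hi j hj => by
      rw [contR_mul_contR H.units h (H.disjoint hi hj) (by ring)]
      congr 2
      ring
  calc _ = br g (contR e h (fun i j => h * N - z i - z j)) l *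
        (cross (contR e h (fun i j => h * N - z i - z j)) l m *
          (br g (contR e h (fun i j => h * N - z i - z j)) m * D') *
          cross (contR e h (fun i j => -(-z i - z j))) l.reverse m.reverse) * D := by
        simp only [mul_assoc]
    _ = _ := by rw [H.right.mul_inv, mul_one, h1, mul_smul_comm, smul_mul_assoc, mul_one,
        H.left.mul_inv]

theorem inv_mul_br (hg : ∀ i j, i ≠ j → ∀ k n, Commute (g i) (e j k n)) :
    (D' * cross (contR e h (fun i j => -(-z i - z j))) l.reverse m.reverse * D) *
      br g (contR e h (fun i j => h * N - z i - z j)) (l ++ m) =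
    cross (fun i j => (h * N - z i - z j) * (z i + z j)) l m • 1 := by
  rw [br_append (siteOps_contR H.units hg h _) l m H.nodup]
  have h1 := cross_mul_reverse (contR e h (fun i j => -(-z i - z j)))
    (contR e h (fun i j => h * N - z i - z j))
    (fun i j => (h * N - z i - z j) * (z i + z j)) l.reverse m.reverse fun i hi j hj => by
      rw [contR_mul_contR H.units h
        (H.disjoint (List.mem_reverse.1 hi) (List.mem_reverse.1 hj)) (by ring)]
      congr 1
      ring
  rw [List.reverse_reverse, List.reverse_reverse, cross_reverse_left, cross_reverse_right] at h1
  calc _ = D' * (cross (contR e h (fun i j => -(-z i - z j))) l.reverse m.reverse *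
          (D * br g (contR e h (fun i j => h * N - z i - z j)) l) *
          cross (contR e h (fun i j => h * N - z i - z j)) l m) *
            br g (contR e h (fun i j => h * N - z i - z j)) m := by
        simp only [mul_assoc]
    _ = _ := by rw [H.left.inv_mul, mul_one, h1, mul_smul_comm, smul_mul_assoc, mul_one,
        H.right.inv_mul]

theorem commute_br_right {w : A} (x : I → I → K) (hw : ∀ j ∈ m, ∀ k n, Commute w (e j k n))
    (hs : ∀ j ∈ m, Commute w (s j)) : Commute w (br s (contR e h x) m) :=
  commute_br m (List.nodup_append.1 H.nodup).2.1 hs fun i hi j hj _ =>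
    commute_contR (commute_cont (hw i hi) (hw j hj))

theorem commute_br_unit (x : I → I → K) {j : I} (hj : j ∈ m) (k n : Fin N) :
    Commute (br s (contR e h x) l) (e j k n) :=
  (commute_br l (List.nodup_append.1 H.nodup).1
    (fun i hi => (H.s_comm i j (H.disjoint hi hj) k n).symm) fun i hi i' hi' _ =>
    commute_contR (H.units.cont_commute_unit (H.disjoint hi hj).symm (H.disjoint hi' hj).symm
      k n).symm).symm

/-- The product of the two traces as one trace over both lists of sites. -/
theorem trace_br :
    τ (E * E' * (br s (contR e h (fun i j => -z i - z j)) (l ++ m) *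
      (D' * cross (contR e h (fun i j => -(-z i - z j))) l.reverse m.reverse * D))) =
    cross (fun i j => h * h - (-z i - z j) * (-z i - z j)) l m •
      τ (E * br s (contR e h (fun i j => -z i - z j)) l * D *
        (E' * br s (contR e h (fun i j => -z i - z j)) m * D')) := by
  rw [br_append (siteOps_contR H.units H.s_comm h _) l m H.nodup]
  obtain ⟨hQ, hQ'⟩ := H.absorb_cross_right
  set S := br s (contR e h (fun i j => -z i - z j)) l
  set S' := br s (contR e h (fun i j => -z i - z j)) m
  set Q := cross (contR e h (fun i j => -z i - z j)) l m
  set Q' := cross (contR e h (fun i j => -(-z i - z j))) l.reverse m.reverse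
  have hE'S : Commute E' S := H.symm.commute_br_right _
    (fun i hi => H.right.comm_unit i (H.notMem_right hi))
    fun i hi => H.right.comm_s i (H.notMem_right hi)
  have hDS' : Commute D S' := H.commute_br_right _
    (fun j hj => H.left.inv_comm_unit j (H.notMem_left hj))
    fun j hj => H.left.inv_comm_s j (H.notMem_left hj)
  -- The second block ends with its idempotent as well. A copy of `E'` can thus be passed to the
  -- right through `Q'` and cyclically to the front; afterwards the inner copy is superfluous
  -- because `E'` absorbs `Q`.
  have hW : E' * S' * D' = E' * S' * D' * E' := by
    have h1 := H.right.absorb_s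
    have h2 := H.right.absorb_inv
    conv_lhs => rw [h1, mul_assoc, h2]
    conv_rhs => rw [h1]
    simp only [mul_assoc]
  have hDW : Commute D (E' * S' * D') := (H.comm_inv_idem.mul_right hDS').mul_right H.comm_inv
  have hF₁ : ∀ j ∈ m, ∀ k n, Commute (D * E * S) (e j k n) := fun j hj k n =>
    ((H.left.inv_comm_unit j (H.notMem_left hj) k n).mul_left
      (H.left.comm_unit j (H.notMem_left hj) k n)).mul_left (H.commute_br_unit _ hj k n)
  have hF₂ : ∀ i ∈ l, ∀ k n, Commute (E' * S' * D') (e i k n) := fun i hi k n =>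
    ((H.right.comm_unit i (H.notMem_right hi) k n).mul_left
      (H.symm.commute_br_unit _ hi k n)).mul_left (H.right.inv_comm_unit i (H.notMem_right hi) k n)
  have h1 := trace_cross H.units H.cycUnits l m H.nodup hF₁ hF₂ h fun i j => -z i - z j
  have hE'E := H.right.idem
  symm
  -- The factor `D` is brought to the front so that all factors in front of the insertion commute
  -- with the units on `m`, and the second block commutes with those on `l`, as `trace_cross`
  -- requires.
  calc _ = cross (fun i j => h * h - (-z i - z j) * (-z i - z j)) l m •
        τ (D * E * S * (E' * S' * D')) := by
        congr 1
        rw [mul_assoc (E * S), hDW.eq, mul_assoc D, mul_assoc D, H.left.cyc_inv]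
        simp only [mul_assoc]
    _ = τ (D * (E * S * Q * (E' * S' * D') * Q')) := by
        rw [← h1]; simp only [mul_assoc]; rfl
    _ = τ (E * S * Q * (E' * S' * D') * (E' * Q') * D) := by
        rw [H.left.cyc_inv, hW]; simp only [mul_assoc]
        rw [← mul_assoc E' E', hE'E]
    _ = τ (E' * (E * S * Q * (E' * S' * D') * Q' * D)) := by
        rw [H.right.cyc, hQ']
        have h2 : E * S * Q * (E' * S' * D') * (E' * Q' * E') * D =
            E * S * Q * (E' * S' * D' * E') * Q' * (E' * D) := by simp only [mul_assoc]
        rw [h2, ← hW, ← H.comm_inv_idem.eq]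
        simp only [mul_assoc]
    _ = τ (E * S * (E' * Q * E') * S' * D' * Q' * D) := by
        congr 1
        have h2 : E' * (E * S) = E * S * E' := (H.comm_idem.symm.mul_right hE'S).eq
        simp only [← mul_assoc] at h2 ⊢
        rw [h2]
    _ = _ := by
        rw [← hQ]
        congr 1
        rw [← mul_assoc (E * S), mul_assoc E S, ← hE'S.eq]
        simp only [mul_assoc]

/-- Each of the six factors is absorbed by `E`: those on `m` commute with it, the others are
absorbed by the properties of the block and by `absorb_cross_left`. -/
theorem absorb_br_left :
    E * (br s (contR e h (fun i j => -z i - z j)) (l ++ m) *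
      (D' * cross (contR e h (fun i j => -(-z i - z j))) l.reverse m.reverse * D)) =
    E * (br s (contR e h (fun i j => -z i - z j)) (l ++ m) *
      (D' * cross (contR e h (fun i j => -(-z i - z j))) l.reverse m.reverse * D)) * E := by
  rw [br_append (siteOps_contR H.units H.s_comm h _) l m H.nodup]
  obtain ⟨hQ, hQ'⟩ := H.absorb_cross_left
  have h1 : Commute E (br s (contR e h (fun i j => -z i - z j)) m) := H.commute_br_right _
    (fun j hj => H.left.comm_unit j (H.notMem_left hj))
    fun j hj => H.left.comm_s j (H.notMem_left hj)
  have h2 := list_prod_absorb H.left.idem [_, _, _, _, _, _] (by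
    simp only [List.mem_cons, List.not_mem_nil, or_false, forall_eq_or_imp, forall_eq]
    exact ⟨H.left.absorb_s, hQ, absorb_of_commute H.left.idem h1,
      absorb_of_commute H.left.idem H.comm_idem_inv, hQ', H.left.absorb_inv⟩)
  simp only [List.prod_cons, List.prod_nil, mul_one] at h2
  simpa only [mul_assoc] using h2

theorem absorb_br_right :
    E' * (br s (contR e h (fun i j => -z i - z j)) (l ++ m) *
      (D' * cross (contR e h (fun i j => -(-z i - z j))) l.reverse m.reverse * D)) =
    E' * (br s (contR e h (fun i j => -z i - z j)) (l ++ m) *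
      (D' * cross (contR e h (fun i j => -(-z i - z j))) l.reverse m.reverse * D)) * E' := by
  rw [br_append (siteOps_contR H.units H.s_comm h _) l m H.nodup]
  obtain ⟨hQ, hQ'⟩ := H.absorb_cross_right
  have h1 : Commute E' (br s (contR e h (fun i j => -z i - z j)) l) :=
    H.symm.commute_br_right _ (fun j hj => H.right.comm_unit j (H.notMem_right hj))
    fun j hj => H.right.comm_s j (H.notMem_right hj)
  have h2 := list_prod_absorb H.right.idem [_, _, _, _, _, _] (by
    simp only [List.mem_cons, List.not_mem_nil, or_false, forall_eq_or_imp, forall_eq]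
    exact ⟨absorb_of_commute H.right.idem h1, hQ, H.right.absorb_s, H.right.absorb_inv, hQ',
      absorb_of_commute H.right.idem H.comm_inv_idem.symm⟩)
  simp only [List.prod_cons, List.prod_nil, mul_one] at h2
  simpa only [mul_assoc] using h2

/-- The two traces commute, if the reflection equations hold. -/
theorem trace_mul_comm (hg : ∀ i j, i ≠ j → ∀ k n, Commute (g i) (e j k n))
    (hs : ∀ i ∈ l, ∀ j ∈ m, permR e (z i - z j) h i j *
      (s i * contR e h (fun i j => -z i - z j) i j * s j) =
      s j * contR e h (fun i j => -z i - z j) i j * s i * permR e (z i - z j) h i j)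
    (hg' : ∀ i ∈ l, ∀ j ∈ m, permR e (z i - z j) h i j *
      (g i * contR e h (fun i j => h * N - z i - z j) i j * g j) =
      g j * contR e h (fun i j => h * N - z i - z j) i j * g i * permR e (z i - z j) h i j) :
    τ (E * br s (contR e h (fun i j => -z i - z j)) l * D *
        (E' * br s (contR e h (fun i j => -z i - z j)) m * D')) =
    τ (E' * br s (contR e h (fun i j => -z i - z j)) m * D' *
        (E * br s (contR e h (fun i j => -z i - z j)) l * D)) := by
  have hn := List.nodup_append.1 H.nodup
  have t1 := H.trace_br
  have t2 := H.symm.trace_br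
  have a1 := H.absorb_br_left
  have a2 := H.absorb_br_right
  obtain ⟨r1, r2⟩ := H.absorb_permR_left
  obtain ⟨r3, r4⟩ := H.absorb_permR_right
  have hR := cross_mul_br (siteOps_contR H.units H.s_comm h (fun i j => -z i - z j)) l m
    (r := fun i j => permR e (z i - z j) h i j) (fun i hi j hj => swaps_permR H.units H.s_comm
      (fun i j => by ring) (H.disjoint hi hj) (fun k => by ring) (hs i hi j hj)) H.nodup
  -- The numerical product satisfies the same exchange relation, because `G` obeys the reflection
  -- equation for any arguments.
  have hR' := cross_mul_br (siteOps_contR H.units hg h (fun i j => h * N - z i - z j)) l m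
    (r := fun i j => permR e (z i - z j) h i j) (fun i hi j hj => swaps_permR H.units hg
      (fun i j => by ring) (H.disjoint hi hj) (fun k => by ring) (hg' i hi j hj)) H.nodup
  have hD := H.br_mul_inv hg
  have hD' := H.symm.inv_mul_br hg
  have hcr : Cyc τ (cross (fun i j => permR e (-(z i - z j)) h i j) l.reverse m) :=
    Cyc.cross fun i _ j _ => Cyc.permR H.cycUnits _ _ _ _
  have hrr := cross_mul_reverse (fun i j => permR e (z i - z j) h i j)
    (fun i j => permR e (-(z i - z j)) h i j)
    (fun i j => h * h - (z i - z j) * (z i - z j)) l m.reverse fun i hi j hj =>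
      permR_mul_permR H.units h _ (H.disjoint hi (List.mem_reverse.1 hj))
  have hrr' := cross_mul_reverse (fun i j => permR e (-(z i - z j)) h i j)
    (fun i j => permR e (z i - z j) h i j)
    (fun i j => h * h - (z i - z j) * (z i - z j)) l.reverse m fun i hi j hj => by
      have := permR_mul_permR H.units h (-(z i - z j)) (H.disjoint (List.mem_reverse.1 hi) hj)
      rwa [neg_neg, neg_mul_neg] at this
  rw [List.reverse_reverse, cross_reverse_right] at hrr
  rw [List.reverse_reverse, cross_reverse_left] at hrr'
  have hcomm : ∀ f : I → I → K, (∀ i j, f i j = f j i) → cross f m l = cross f l m := by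
    intro f hf
    rw [cross_comm f m l hn.2.1 hn.1 fun _ _ _ _ _ _ _ _ _ _ => Commute.all _ _]
    congr 1
    funext i j
    exact hf j i
  rw [hcomm _ fun i j => by ring] at hD' t2
  have u1 : IsUnit (cross (fun i j => (h * N - z i - z j) * (z i + z j)) l m) := by
    refine isUnit_cross _ _ _ fun i hi j hj => (H.isUnit_arg_add hi hj N).mul ?_
    have := (H.isUnit_arg_add hi hj 0).neg
    convert this using 1
    ring
  have u2 : IsUnit (cross (fun i j => h * h - (z i - z j) * (z i - z j)) l m) := by
    refine isUnit_cross _ _ _ fun i hi j hj => ?_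
    have h1 := (H.isUnit_arg_sub hi hj).mul (H.isUnit_arg_sub hi hj)
    have h2 := (IsUnit.add_mul_nilpotent h1 H.nilpotent (-h)).neg
    convert h2 using 1
    ring
  have u3 : IsUnit (cross (fun i j => h * h - (-z i - z j) * (-z i - z j)) l m) := by
    refine isUnit_cross _ _ _ fun i hi j hj => ?_
    have h1 := (H.isUnit_arg_add hi hj 0).mul (H.isUnit_arg_add hi hj 0)
    have h2 := (IsUnit.add_mul_nilpotent h1 H.nilpotent (-h)).neg
    convert h2 using 1
    ring
  set R := cross (fun i j => permR e (z i - z j) h i j) l m.reverse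
  set R' := cross (fun i j => permR e (-(z i - z j)) h i j) l.reverse m
  set S := br s (contR e h (fun i j => -z i - z j)) (l ++ m)
  set S' := br s (contR e h (fun i j => -z i - z j)) (m ++ l)
  set W := D' * cross (contR e h (fun i j => -(-z i - z j))) l.reverse m.reverse * D
  set W' := D * cross (contR e h (fun i j => -(-z i - z j))) m.reverse l.reverse * D'
  set ρ := cross (fun i j => (h * N - z i - z j) * (z i + z j)) l m
  set σ := cross (fun i j => h * h - (z i - z j) * (z i - z j)) l m
  clear_value R R' S S' W W' ρ σ
  -- The exchange relation for the numerical products, multiplied by `W'` on the left and `W` on the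
  -- right. These are inverses only up to the unit `ρ`, which is cancelled at the end.
  have hRW : R * W = W' * R := by
    have h1 : ρ • (R * W) = ρ • (W' * R) := by
      calc ρ • (R * W) = (ρ • 1) * (R * W) := by rw [smul_mul_assoc, one_mul]
        _ = W' * (R * br g (contR e h (fun i j => h * N - z i - z j)) (l ++ m)) * W := by
          rw [← hD', hR']; simp only [mul_assoc]
        _ = ρ • (W' * R) := by
          rw [mul_assoc, mul_assoc R, hD, mul_smul_comm, mul_one, mul_smul_comm]
    exact u1.smul_left_cancel.1 h1
  have hRX : R * (S * W) = S' * W' * R := by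
    rw [← mul_assoc, hR, mul_assoc, hRW, mul_assoc]
  have hX := mul_absorb H.comm_idem a1 a2
  have hr := mul_absorb H.comm_idem r1 r3
  have hr' := mul_absorb H.comm_idem r2 r4
  set F := E * E' with hF
  have hFF : F * F = F := by
    rw [hF, mul_assoc, ← mul_assoc E', ← H.comm_idem.eq, mul_assoc, H.right.idem, ← mul_assoc,
      H.left.idem]
  have hcF : Cyc τ F := H.left.cyc.mul H.right.cyc
  -- Insert the scalar `R R'`, turn `S' W' R` into `R S W`, and use absorption to place copies of
  -- `F` in front of `S W` and of `R'`. Then `F R'` is cyclic for the trace, moves to the front, and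
  -- meets `R` there.
  have hfin : σ • τ (F * (S' * W')) = σ • τ (F * (S * W)) := by
    calc σ • τ (F * (S' * W')) = τ (F * (S' * W' * (R * R'))) := by
          rw [hrr, mul_smul_comm, mul_one, mul_smul_comm, map_smul]
      _ = τ (F * R * (S * W) * R') := by
          rw [← mul_assoc (S' * W'), ← hRX]; simp only [mul_assoc]
      _ = τ (F * R * (F * (S * W)) * R') := by
          conv_lhs => rw [hr]
          simp only [mul_assoc]
      _ = τ (F * R * (F * (S * W)) * (F * R')) := by
          conv_lhs => rw [hX]
          simp only [mul_assoc]
      _ = τ (F * R' * (F * R * (F * (S * W)))) := (hcF.mul hcr _).symm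
      _ = τ (F * (R' * R) * (F * (S * W))) := by
          rw [← mul_assoc (F * R'), ← mul_assoc (F * R'), ← hr']
          simp only [mul_assoc]
      _ = σ • τ (F * (S * W)) := by
          rw [hrr', mul_smul_comm, mul_one, smul_mul_assoc, map_smul, ← mul_assoc F F, hFF]
  rw [u2.smul_left_cancel, hF, t1, H.comm_idem.eq, t2] at hfin
  exact (u3.smul_left_cancel.1 hfin).symm

end BlockPair

end Commutativity

/-! ### Operators on tensor products -/

section Embedding

variable {I J L κ R : Type*} [Ring R]

open Classical in
/-- The operator `X` on the tensor factors in the range of `f`. -/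
def emb (f : J → I) (X : Matrix (J → κ) (J → κ) R) : Matrix (I → κ) (I → κ) R :=
  Matrix.of fun a b => if ∀ i, i ∉ Set.range f → a i = b i then X (a ∘ f) (b ∘ f) else 0

variable {f : J → I}

theorem emb_add (X Y : Matrix (J → κ) (J → κ) R) : emb f (X + Y) = emb f X + emb f Y := by
  ext a b
  simp only [emb, Matrix.of_apply, Matrix.add_apply]
  split_ifs <;> simp

theorem emb_zero : emb f (0 : Matrix (J → κ) (J → κ) R) = 0 := by
  ext a b
  simp [emb]

theorem emb_emb {g : L → J} (hf : Function.Injective f) (X : Matrix (L → κ) (L → κ) R) :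
    emb f (emb g X) = emb (f ∘ g) X := by
  ext a b
  simp only [emb, Matrix.of_apply]
  by_cases h : ∀ i, i ∉ Set.range (f ∘ g) → a i = b i
  · rw [if_pos h, if_pos, if_pos]
    · rfl
    · intro j hj
      refine h _ ?_
      rintro ⟨k, hk⟩
      exact hj ⟨k, hf hk⟩
    · intro i hi
      refine h i ?_
      rintro ⟨k, rfl⟩
      exact hi ⟨g k, rfl⟩
  · rw [if_neg h]
    split_ifs with h1 h2
    · refine absurd (fun i hi => ?_) h
      by_cases hi' : i ∈ Set.range f
      · obtain ⟨j, rfl⟩ := hi'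
        refine h2 j ?_
        rintro ⟨k, rfl⟩
        exact hi ⟨k, rfl⟩
      · exact h1 i hi'
    · rfl
    · rfl

theorem emb_one [DecidableEq (I → κ)] [DecidableEq (J → κ)] :
    emb f (1 : Matrix (J → κ) (J → κ) R) = 1 := by
  ext a b
  simp only [emb, Matrix.of_apply, Matrix.one_apply]
  by_cases h : a = b
  · subst h; simp
  · rw [if_neg h]
    split_ifs with h1 h2
    · refine absurd (funext fun i => ?_) h
      by_cases hi : i ∈ Set.range f
      · obtain ⟨j, rfl⟩ := hi
        exact congrFun h2 j
      · exact h1 i hi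
    · rfl
    · rfl

variable [Fintype I] [DecidableEq I] [Fintype J] [DecidableEq J] [Fintype L] [DecidableEq L]
  [Fintype κ] [DecidableEq κ]

theorem emb_mul (hf : Function.Injective f) (X Y : Matrix (J → κ) (J → κ) R) :
    emb f (X * Y) = emb f X * emb f Y := by
  classical
  ext a b
  rw [Matrix.mul_apply]
  simp only [emb, Matrix.of_apply]
  by_cases h : ∀ i, i ∉ Set.range f → a i = b i
  · rw [if_pos h, Matrix.mul_apply]
    have hc : ∀ d : J → κ, Function.extend f d a ∘ f = d := fun d =>
      funext fun j => hf.extend_apply d a j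
    -- An intermediate index contributes only if it agrees with `a` outside the range of `f`, so it
    -- is the extension by `a` of its restriction.
    refine Fintype.sum_of_injective (fun d => Function.extend f d a) (fun d d' hd => ?_) _ _
      (fun c hcr => ?_) fun d => ?_
    · rw [← hc d, ← hc d']
      exact congrArg (· ∘ f) hd
    · rw [if_neg, zero_mul]
      intro hac
      refine hcr ⟨c ∘ f, funext fun i => ?_⟩
      by_cases hi : i ∈ Set.range f
      · obtain ⟨j, rfl⟩ := hi
        exact hf.extend_apply _ _ _
      · rw [← hac i hi]
        exact Function.extend_apply' _ _ _ hi
    · have h1 : ∀ i, i ∉ Set.range f → Function.extend f d a i = a i := fun i hi =>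
        Function.extend_apply' _ _ _ hi
      rw [if_pos fun i hi => (h1 i hi).symm, if_pos fun i hi => (h1 i hi).trans (h i hi), hc]
  · rw [if_neg h, Finset.sum_eq_zero]
    intro c _
    split_ifs with h1 h2
    · exact absurd (fun i hi => (h1 i hi).trans (h2 i hi)) h
    · simp
    · simp
    · simp

/-- The embedding of operators as a ring homomorphism. -/
def embHom (hf : Function.Injective f) :
    Matrix (J → κ) (J → κ) R →+* Matrix (I → κ) (I → κ) R where
  toFun := emb f
  map_one' := emb_one
  map_mul' := emb_mul hf
  map_zero' := emb_zero
  map_add' := emb_add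

theorem emb_mul_emb_apply {g : L → I} (hfg : ∀ j l, f j ≠ g l) (X : Matrix (J → κ) (J → κ) R)
    (Y : Matrix (L → κ) (L → κ) R) (a b : I → κ) :
    (emb f X * emb g Y) a b = open Classical in
      if ∀ i, i ∉ Set.range f → i ∉ Set.range g → a i = b i then
        X (a ∘ f) (b ∘ f) * Y (a ∘ g) (b ∘ g) else 0 := by
  classical
  have hd : ∀ i, i ∈ Set.range f → i ∉ Set.range g := by
    rintro _ ⟨j, rfl⟩ ⟨l, hl⟩
    exact hfg j l hl.symm
  rw [Matrix.mul_apply]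
  simp only [emb, Matrix.of_apply]
  -- The only intermediate index which contributes: the first operator fixes it to `a` off the range
  -- of `f`, the second one to `b` off the range of `g`.
  set c : I → κ := fun i => if i ∈ Set.range f then b i else a i with hc
  rw [Finset.sum_eq_single c]
  · have h1 : c ∘ f = b ∘ f := funext fun j => if_pos ⟨j, rfl⟩
    have h2 : c ∘ g = a ∘ g := funext fun l => if_neg fun ⟨j, hj⟩ => hfg j l hj
    rw [if_pos fun i hi => (if_neg hi).symm, h1, h2]
    split_ifs with h3 h4 h4
    · rfl
    · refine absurd (fun i hi hi' => ?_) h4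
      rw [← h3 i hi']
      exact (if_neg hi).symm
    · refine absurd (fun i hi => ?_) h3
      by_cases hif : i ∈ Set.range f
      · exact if_pos hif
      · rw [← h4 i hif hi]
        exact if_neg hif
    · simp
  · intro d _ hdc
    split_ifs with h3 h4
    · refine absurd (funext fun i => ?_) hdc
      by_cases hif : i ∈ Set.range f
      · rw [h4 i (hd i hif)]
        exact (if_pos hif).symm
      · rw [← h3 i hif]
        exact (if_neg hif).symm
    · simp
    · simp
    · simp
  · simp

theorem emb_commute_emb {g : L → I} (hfg : ∀ j l, f j ≠ g l) {X : Matrix (J → κ) (J → κ) R}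
    {Y : Matrix (L → κ) (L → κ) R} (h : ∀ a b c d, Commute (X a b) (Y c d)) :
    Commute (emb f X) (emb g Y) := by
  classical
  ext a b
  rw [emb_mul_emb_apply hfg, emb_mul_emb_apply fun l j => (hfg j l).symm, (h _ _ _ _).eq]
  congr 1
  exact propext ⟨fun h i h1 h2 => h i h2 h1, fun h i h1 h2 => h i h2 h1⟩

theorem trace_emb_mul_emb (X : Matrix (J → κ) (J → κ) R) (Y : Matrix (L → κ) (L → κ) R) :
    Matrix.trace (emb (Sum.inl : J → J ⊕ L) X * emb (Sum.inr : L → J ⊕ L) Y) =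
      X.trace * Y.trace := by
  classical
  have h1 : ∀ a : J ⊕ L → κ, (emb (Sum.inl : J → J ⊕ L) X * emb (Sum.inr : L → J ⊕ L) Y) a a =
      X (a ∘ Sum.inl) (a ∘ Sum.inl) * Y (a ∘ Sum.inr) (a ∘ Sum.inr) := by
    intro a
    rw [emb_mul_emb_apply (fun _ _ => Sum.inl_ne_inr), if_pos fun _ _ _ => rfl]
  simp only [Matrix.trace, Matrix.diag_apply, h1, Finset.sum_mul_sum]
  rw [← Finset.sum_product', Finset.univ_product_univ]
  exact Fintype.sum_equiv (Equiv.sumArrowEquivProdArrow J L κ) _ _ fun a => rfl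

/-- The entries do not commute, so the opposite order needs its own statement; the two versions
become the two sides of the commutation relation. -/
theorem trace_emb_mul_emb' (X : Matrix (J → κ) (J → κ) R) (Y : Matrix (L → κ) (L → κ) R) :
    Matrix.trace (emb (Sum.inr : L → J ⊕ L) Y * emb (Sum.inl : J → J ⊕ L) X) =
      Y.trace * X.trace := by
  classical
  have h1 : ∀ a : J ⊕ L → κ, (emb (Sum.inr : L → J ⊕ L) Y * emb (Sum.inl : J → J ⊕ L) X) a a =
      Y (a ∘ Sum.inr) (a ∘ Sum.inr) * X (a ∘ Sum.inl) (a ∘ Sum.inl) := by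
    intro a
    rw [emb_mul_emb_apply (fun _ _ => Sum.inr_ne_inl), if_pos fun _ _ _ => rfl]
  simp only [Matrix.trace, Matrix.diag_apply, h1, Finset.sum_mul_sum]
  rw [Finset.sum_comm, ← Finset.sum_product', Finset.univ_product_univ]
  exact Fintype.sum_equiv (Equiv.sumArrowEquivProdArrow J L κ) _ _ fun a => rfl

end Embedding

/-! ### Operators on one and two tensor factors -/

section Sites

variable {I J R : Type*} [Ring R] [Fintype I] [DecidableEq I] [Fintype J] [DecidableEq J] {N : ℕ}

/-- The operator `X` on the tensor factor `i`, as a ring homomorphism. -/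
def siteHom (i : I) : Matrix (Fin N) (Fin N) R →+* Matrix (I → Fin N) (I → Fin N) R :=
  (embHom (f := fun _ : Unit => i) (Function.injective_of_subsingleton _)).comp
    (Matrix.reindexRingEquiv R (Equiv.funUnique Unit (Fin N)).symm).toRingHom

/-- The injection of two sites. -/
theorem pair_injective {i j : I} (h : i ≠ j) : Function.Injective ![i, j] := by
  intro a b hab
  fin_cases a <;> fin_cases b <;> simp_all

/-- The operator `X` on the tensor factors `i ≠ j`, as a ring homomorphism. -/
def sitesHom {i j : I} (h : i ≠ j) : Matrix (Fin N × Fin N) (Fin N × Fin N) R →+*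
    Matrix (I → Fin N) (I → Fin N) R :=
  (embHom (pair_injective h)).comp
    (Matrix.reindexRingEquiv R (finTwoArrowEquiv (Fin N)).symm).toRingHom

theorem siteHom_apply (i : I) (X : Matrix (Fin N) (Fin N) R) (a b : I → Fin N) :
    siteHom i X a b = if ∀ k, k ≠ i → a k = b k then X (a i) (b i) else 0 := by
  change emb _ _ a b = _
  rw [emb, Matrix.of_apply]
  simp only [Set.mem_range, exists_const, ne_comm (a := i), ← ne_eq]
  congr 1

theorem sitesHom_apply {i j : I} (h : i ≠ j) (X : Matrix (Fin N × Fin N) (Fin N × Fin N) R)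
    (a b : I → Fin N) : sitesHom h X a b =
      if ∀ k, k ≠ i → k ≠ j → a k = b k then X (a i, a j) (b i, b j) else 0 := by
  change emb _ _ a b = _
  rw [emb, Matrix.of_apply]
  have h1 : ∀ k : I, k ∉ Set.range ![i, j] ↔ k ≠ i ∧ k ≠ j := by
    intro k
    simp [eq_comm, and_comm]
  simp only [h1, and_imp]
  congr 1

theorem site_eq_siteHom {n : ℕ} (i : Fin n) (X : Matrix (Fin N) (Fin N) R) :
    site i X = siteHom i X := by
  ext a b
  rw [siteHom_apply]
  simp only [site, Matrix.of_apply]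
  split_ifs <;> rfl

theorem sites_eq_sitesHom {n : ℕ} {i j : Fin n} (h : i ≠ j)
    (X : Matrix (Fin N × Fin N) (Fin N × Fin N) R) : sites i j X = sitesHom h X := by
  ext a b
  rw [sitesHom_apply]
  simp only [sites, Matrix.of_apply]
  split_ifs <;> rfl

theorem siteHom_mul_siteHom {i j : I} (h : i ≠ j) (X Y : Matrix (Fin N) (Fin N) R) :
    siteHom i X * siteHom j Y = sitesHom h (Matrix.kroneckerMap (· * ·) X Y) := by
  ext a b
  rw [sitesHom_apply]
  refine (emb_mul_emb_apply (f := fun _ : Unit => i) (g := fun _ : Unit => j)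
    (fun _ _ => h) _ _ a b).trans ?_
  simp only [Set.mem_range, exists_const, ne_comm (b := i), ne_comm (b := j), ← ne_eq]
  simp only [ne_comm (a := i), ne_comm (a := j)]
  congr 1

theorem siteHom_commute {i j : I} (h : i ≠ j) {X Y : Matrix (Fin N) (Fin N) R}
    (hXY : ∀ a b c d, Commute (X a b) (Y c d)) : Commute (siteHom i X) (siteHom j Y) :=
  emb_commute_emb (fun _ _ => h) fun _ _ _ _ => hXY _ _ _ _

theorem emb_siteHom {f : J → I} (hf : Function.Injective f) (i : J)
    (X : Matrix (Fin N) (Fin N) R) : emb f (siteHom i X) = siteHom (f i) X :=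
  emb_emb hf _

/-- The matrix units on the sites. -/
def unitAt (N : ℕ) (R : Type*) [Ring R] (i : I) (k l : Fin N) : Matrix (I → Fin N) (I → Fin N) R :=
  siteHom i (Matrix.single k l 1)

theorem commute_single_one (k l : Fin N) (a b : Fin N) (x : R) :
    Commute (Matrix.single k l (1 : R) a b) x := by
  rw [Matrix.single_apply]
  split_ifs
  · exact Commute.one_left x
  · exact Commute.zero_left x

theorem matrixUnits_unitAt : MatrixUnits (unitAt (I := I) N R) where
  mul i k l m n := by
    rw [unitAt, unitAt, ← map_mul]
    split_ifs with h
    · rw [h, Matrix.single_mul_single_same, one_mul, unitAt]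
    · rw [Matrix.single_mul_single_of_ne _ _ _ _ h, map_zero]
  one i := by
    simp only [unitAt]
    rw [← map_sum, Matrix.sum_single_one, map_one]
  comm i j k l m n h := siteHom_commute h fun _ _ _ _ => commute_single_one _ _ _ _ _

theorem siteHom_commute_unitAt {i j : I} (h : i ≠ j) (X : Matrix (Fin N) (Fin N) R)
    (k l : Fin N) : Commute (siteHom i X) (unitAt N R j k l) :=
  siteHom_commute h fun _ _ _ _ => (commute_single_one _ _ _ _ _).symm

theorem perm_unitAt {i j : I} (h : i ≠ j) :
    perm (unitAt N R) i j = sitesHom h (permMat N R) := by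
  simp only [perm, unitAt, siteHom_mul_siteHom h, ← map_sum]
  congr 1
  ext p q
  simp only [Matrix.sum_apply, Matrix.kroneckerMap_apply, Matrix.single_apply, permMat,
    Matrix.of_apply]
  rw [Finset.sum_eq_single p.1, Finset.sum_eq_single q.1]
  · simp only [true_and, and_true, mul_ite, mul_one, mul_zero]
    by_cases h1 : p.1 = q.2 <;> by_cases h2 : p.2 = q.1 <;> simp [h1, h2, eq_comm (a := q.1)]
  · intro b _ hb; simp [hb]
  · simp
  · intro b _ hb; simp [hb]
  · simp

/-- The transposed permutation operator. -/
def contMat (N : ℕ) (R : Type*) [Ring R] : Matrix (Fin N × Fin N) (Fin N × Fin N) R :=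
  Matrix.of fun p q => if p.1 = p.2 ∧ q.1 = q.2 then 1 else 0

theorem cont_unitAt {i j : I} (h : i ≠ j) :
    cont (unitAt N R) i j = sitesHom h (contMat N R) := by
  simp only [cont, unitAt, siteHom_mul_siteHom h, ← map_sum]
  congr 1
  ext p q
  simp only [Matrix.sum_apply, Matrix.kroneckerMap_apply, Matrix.single_apply, contMat,
    Matrix.of_apply]
  rw [Finset.sum_eq_single p.1, Finset.sum_eq_single q.1]
  · simp only [true_and, and_true, mul_ite, mul_one, mul_zero]
    by_cases h1 : p.1 = p.2 <;> by_cases h2 : q.1 = q.2 <;> simp [h1, h2, eq_comm]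
  · intro b _ hb; simp [hb]
  · simp
  · intro b _ hb; simp [hb]
  · simp

theorem emb_unitAt {f : J → I} (hf : Function.Injective f) (i : J) (k l : Fin N) :
    emb f (unitAt N R i k l) = unitAt N R (f i) k l := emb_siteHom hf _ _

end Sites

/-! ### Weights of the Jucys–Murphy elements -/

section Weights

open Polynomial

variable {C : Type*} [Ring C] {n : ℕ}

/-- The relations between the Jucys–Murphy elements `x` and the adjacent transpositions, with
semisimple action of the `x k`. -/
structure JucysMurphy (s : Fin n → Fin n → C) (x : Fin n → C) : Prop where
  zero : ∀ k : Fin n, (k : ℕ) = 0 → x k = 0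
  sq : ∀ a b : Fin n, (b : ℕ) = a + 1 → s a b * s a b = 1
  succ : ∀ a b : Fin n, (b : ℕ) = a + 1 → s a b * x b = x a * s a b + 1
  comm_s : ∀ a b : Fin n, (b : ℕ) = a + 1 → ∀ j, j ≠ a → j ≠ b → Commute (s a b) (x j)
  comm : ∀ i j, Commute (x i) (x j)
  semisimple : ∀ (k : Fin n) (a : ℤ) y, y * (x k - a) * (x k - a) = 0 → y * (x k - a) = 0

/-- The polynomial with the given list of roots. -/
def rootsPoly (L : List ℤ) : ℤ[X] := (L.map fun a => X - Polynomial.C a).prod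

theorem aeval_rootsPoly_cons (b : C) (a : ℤ) (L : List ℤ) :
    aeval b (rootsPoly (a :: L)) = (b - a) * aeval b (rootsPoly L) := by
  rw [rootsPoly, List.map_cons, List.prod_cons, map_mul, map_sub, aeval_X, aeval_C,
    eq_intCast]
  rfl

theorem aeval_rootsPoly_cons' (b : C) (a : ℤ) (L : List ℤ) :
    aeval b (rootsPoly (a :: L)) = aeval b (rootsPoly L) * (b - a) := by
  rw [rootsPoly, List.map_cons, List.prod_cons, mul_comm, map_mul, map_sub, aeval_X, aeval_C,
    eq_intCast]
  rfl

theorem commute_aeval {x y : C} (h : Commute x y) (p : ℤ[X]) : Commute x (aeval y p) := by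
  induction p using Polynomial.induction_on' with
  | add p q hp hq => rw [map_add]; exact hp.add_right hq
  | monomial m a =>
    rw [aeval_monomial]
    have h1 : Commute x (algebraMap ℤ C a) := (Algebra.commutes a x).symm
    exact h1.mul_right (h.pow_right m)

theorem semiconj_aeval {φ a b : C} (h : φ * a = b * φ) (p : ℤ[X]) :
    φ * aeval a p = aeval b p * φ := by
  have h1 : SemiconjBy φ a b := h
  change SemiconjBy φ _ _
  induction p using Polynomial.induction_on' with
  | add p q hp hq => rw [map_add, map_add]; exact hp.add_right hq
  | monomial m c =>
    rw [aeval_monomial, aeval_monomial]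
    have h2 : SemiconjBy φ (algebraMap ℤ C c) (algebraMap ℤ C c) := (Algebra.commutes c φ).symm
    exact h2.mul_right (h1.pow_right m)

/-- Repeated roots are immaterial for semisimple elements. -/
theorem mul_aeval_rootsPoly_eq_zero {b : C}
    (hss : ∀ (a : ℤ) y, y * (b - a) * (b - a) = 0 → y * (b - a) = 0) {L M : List ℤ}
    (hLM : ∀ a ∈ L, a ∈ M) {y : C} (hy : y * aeval b (rootsPoly L) = 0) :
    y * aeval b (rootsPoly M) = 0 := by
  induction L generalizing y with
  | nil =>
    have : y = 0 := by simpa [rootsPoly] using hy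
    rw [this, zero_mul]
  | cons a L ih =>
    rw [aeval_rootsPoly_cons, ← mul_assoc] at hy
    have h1 := ih (fun c hc => hLM c (by simp [hc])) hy
    have hp : rootsPoly M = rootsPoly (a :: M.erase a) :=
      ((List.perm_cons_erase (hLM a (by simp))).map _).prod_eq
    rw [hp, aeval_rootsPoly_cons', ← mul_assoc]
    rw [hp, mul_assoc, ← aeval_rootsPoly_cons, ] at h1
    refine hss a _ ?_
    rw [← h1, aeval_rootsPoly_cons, aeval_rootsPoly_cons]
    have hc : Commute (b - a) (aeval b (rootsPoly (M.erase a))) :=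
      commute_aeval (Commute.refl b) _ |>.sub_left (Int.cast_commute _ _)
    simp only [mul_assoc]
    rw [← hc.left_comm, ← hc.eq]

/-- The hypotheses say that on `y` the commuting elements `a` and `b` differ by `±1`, and that `a`
has its eigenvalues in `L`. Then those of `b` lie in the two shifted lists. -/
theorem mul_aeval_shift_eq_zero {a b y : C} (hab : Commute a b)
    (h1 : y * ((b - a - 1) * (b - a + 1)) = 0) {L : List ℤ}
    (h2 : y * aeval a (rootsPoly L) = 0) :
    y * aeval b (rootsPoly (L.map (· + 1) ++ L.map (· - 1))) = 0 := by
  have hcons : ∀ (α : ℤ) (L : List ℤ),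
      aeval b (rootsPoly ((α :: L).map (· + 1) ++ (α :: L).map (· - 1))) =
        aeval b (rootsPoly (L.map (· + 1) ++ L.map (· - 1))) * ((b - α - 1) * (b - α + 1)) := by
    intro α L
    have hp : rootsPoly ((α :: L).map (· + 1) ++ (α :: L).map (· - 1)) =
        rootsPoly ((α - 1) :: (α + 1) :: (L.map (· + 1) ++ L.map (· - 1))) := by
      refine (List.Perm.map _ ?_).prod_eq
      simp only [List.map_cons, List.cons_append]
      refine (List.Perm.cons _ List.perm_middle).trans (List.Perm.swap _ _ _)
    rw [hp, aeval_rootsPoly_cons', aeval_rootsPoly_cons', mul_assoc]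
    push_cast
    congr 2 <;> abel
  induction L generalizing y with
  | nil => simpa [rootsPoly] using h2
  | cons α L ih =>
    rw [hcons, ← mul_assoc]
    rw [aeval_rootsPoly_cons', ← mul_assoc] at h2
    have hab' : Commute (a - α) (b - a) :=
      (hab.sub_right (Commute.refl a)).sub_left (Int.cast_commute _ _)
    have h3 := ih (y := y * (a - α)) (by
      have h4 : Commute (a - α) ((b - a - 1) * (b - a + 1)) :=
        (hab'.sub_right (Commute.one_right _)).mul_right (hab'.add_right (Commute.one_right _))
      rw [mul_assoc, h4.eq, ← mul_assoc, h1, zero_mul]) (by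
      have h4 : Commute (a - α) (aeval a (rootsPoly L)) :=
        commute_aeval ((Commute.refl a).sub_left (Int.cast_commute _ _)) _
      rw [mul_assoc, h4.eq, ← mul_assoc, h2])
    set Q := aeval b (rootsPoly (L.map (· + 1) ++ L.map (· - 1)))
    have ha : Commute a Q := commute_aeval hab _
    have hb : Commute b Q := commute_aeval (Commute.refl b) _
    have h4 : y * Q * (a - α) = 0 := by
      rw [mul_assoc, ← (ha.sub_left (Int.cast_commute _ _)).eq, ← mul_assoc, h3]
    have h5 : y * Q * ((b - a - 1) * (b - a + 1)) = 0 := by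
      have h6 : Commute ((b - a - 1) * (b - a + 1)) Q :=
        ((hb.sub_left ha).sub_left (Commute.one_left _)).mul_left
          ((hb.sub_left ha).add_left (Commute.one_left _))
      rw [mul_assoc, ← h6.eq, ← mul_assoc, h1, zero_mul]
    -- The difference of the squares `(b - α)²` and `(b - a)²` has the factor `a - α`, which
    -- annihilates `y * Q`.
    have h6 : (b - α - 1) * (b - α + 1) = (b - a - 1) * (b - a + 1) + (a - α) * (2 * b - a - α) := by
      have e1 : b * a = a * b := hab.eq.symm
      have e2 : (α : C) * a = a * α := Int.cast_commute _ _
      have e3 : (α : C) * b = b * α := Int.cast_commute _ _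
      simp only [two_mul, sub_mul, mul_sub, add_mul, mul_add, e1, e2, e3, mul_one, one_mul]
      abel
    rw [h6, mul_add, h5, ← mul_assoc, h4, zero_mul, add_zero]

/-- The integers from `-k` to `k`. -/
def contentRange (k : ℕ) : List ℤ := (List.range (2 * k + 1)).map fun m : ℕ => (m : ℤ) - k

theorem mem_contentRange {k : ℕ} {a : ℤ} : a ∈ contentRange k ↔ -(k : ℤ) ≤ a ∧ a ≤ k := by
  simp only [contentRange, List.mem_map, List.mem_range]
  constructor
  · rintro ⟨m, hm, rfl⟩
    omega
  · intro h
    exact ⟨(a + k).toNat, by omega, by omega⟩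

namespace JucysMurphy

variable {s : Fin n → Fin n → C} {x : Fin n → C} (H : JucysMurphy s x)

include H

theorem succ' {a b : Fin n} (hab : (b : ℕ) = a + 1) : s a b * x a = x b * s a b - 1 := by
  have h1 := H.sq a b hab
  have h2 := H.succ a b hab
  calc s a b * x a = s a b * (x a * s a b + 1) * s a b - s a b * s a b := by
        rw [mul_add, add_mul, mul_one, add_sub_cancel_right, mul_assoc, mul_assoc, h1, mul_one]
    _ = _ := by rw [← h2, h1, ← mul_assoc, h1, one_mul]

/-- Induction on `k`, with `a`, `b` two consecutive Jucys–Murphy elements and `t` the transposition.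
The element `φ = t (b - a) - 1` satisfies `φ a = b φ`, so `p(a) = 0` implies `p(b) φ = 0`. Wherever
`p(b)` does not vanish, `t (b - a) = 1`, therefore `(b - a)² = 1` and `b = a ± 1`. The eigenvalues
of `b` are thus among those of `a` and their two neighbours, and semisimplicity removes
multiplicities. -/
theorem aeval_contentRange (k : Fin n) : aeval (x k) (rootsPoly (contentRange k)) = 0 := by
  obtain ⟨m, hm⟩ : ∃ m, m = (k : ℕ) := ⟨_, rfl⟩
  induction m generalizing k with
  | zero =>
    rw [← hm, H.zero k hm.symm]
    simp [rootsPoly, contentRange]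
  | succ m ih =>
    have hk := k.2
    set i : Fin n := ⟨m, by omega⟩ with hi
    have hik : (k : ℕ) = i + 1 := by rw [← hm]
    have h1 := H.sq i k hik
    have h2 := H.succ i k hik
    have h3 := H.succ' hik
    have h0 := ih i rfl
    have hc := H.comm i k
    generalize hP : rootsPoly (contentRange i) = p at h0
    generalize hs : s i k = t at *
    generalize ha : x i = a at *
    generalize hb : x k = b at *
    have e1 : t * (b - a) - 1 = 1 - (b - a) * t := by
      rw [mul_sub, sub_mul, h2, h3]; abel
    have e2 : (t * (b - a) - 1) * a = b * (t * (b - a) - 1) := by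
      have : t * (b - a) * a = t * a * (b - a) := by
        rw [mul_assoc, mul_assoc, ← (hc.sub_right (Commute.refl a)).eq]
      rw [sub_mul, this, h3]
      noncomm_ring
    have e3 := semiconj_aeval e2 p
    rw [h0, mul_zero] at e3
    have e4 : aeval b p * (t * (b - a)) = aeval b p := by
      rw [mul_sub, mul_one] at e3
      exact sub_eq_zero.1 e3.symm
    have e5 : aeval b p * ((b - a) * t) = aeval b p := by
      rw [e1, mul_sub, mul_one] at e3
      exact (sub_eq_zero.1 e3.symm).symm
    have e6 : aeval b p * (b - a) = aeval b p * t := by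
      conv_rhs => rw [← e5]
      rw [mul_assoc, mul_assoc, h1, mul_one]
    have hcb : Commute (b - a) (aeval b p) :=
      (commute_aeval (Commute.refl b) p).sub_left (commute_aeval hc p)
    have e7 : aeval b p * ((b - a) * (b - a)) = aeval b p := by
      rw [← mul_assoc, ← hcb.eq, mul_assoc, e6, ← mul_assoc, hcb.eq, mul_assoc, e5]
    have e8 : aeval b p * ((b - a - 1) * (b - a + 1)) = 0 := by
      have : (b - a - 1) * (b - a + 1) = (b - a) * (b - a) - 1 := by noncomm_ring
      rw [this, mul_sub, e7, mul_one, sub_self]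
    have e9 := mul_aeval_shift_eq_zero hc e8 (L := contentRange i) (by rw [hP, h0, mul_zero])
    rw [← hP, ← map_mul] at e9
    have e10 : rootsPoly (contentRange i) * rootsPoly ((contentRange i).map (· + 1) ++
        (contentRange i).map (· - 1)) = rootsPoly (contentRange i ++ ((contentRange i).map (· + 1) ++
        (contentRange i).map (· - 1))) := by
      rw [rootsPoly, rootsPoly, rootsPoly, List.map_append (l₁ := contentRange i), List.prod_append]
    rw [e10] at e9
    have hss := H.semisimple k
    rw [hb] at hss
    have := mul_aeval_rootsPoly_eq_zero (y := 1) (M := contentRange k) hss (fun c hc' => ?_)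
      (by rw [one_mul]; exact e9)
    · rwa [one_mul] at this
    · simp only [List.mem_append, List.mem_map] at hc'
      rw [mem_contentRange, hik]
      rcases hc' with h | ⟨d, h, rfl⟩ | ⟨d, h, rfl⟩ <;>
      · rw [mem_contentRange] at h
        push_cast
        omega

/-- Weights are preserved by operators intertwined by the elements `d s + 1`. -/
theorem weight_mul {A : Type*} [Ring A] (Ψ : C →+* A) (F : (Fin n → ℤ) → A)
    (hunit : ∀ d : ℤ, d ≠ 0 → IsUnit (d : A))
    (hF : ∀ (a b : Fin n), (b : ℕ) = a + 1 → ∀ α : Fin n → ℤ,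
      F α * Ψ ((α a - α b) • s a b + 1) = Ψ ((α a - α b) • s a b + 1) * F (α ∘ Equiv.swap a b))
    (k : Fin n) (α : Fin n → ℤ) (y : C) (hy : ∀ j, y * x j = α j • y) :
    Ψ y * F α * Ψ (x k) = α k • (Ψ y * F α) := by
  obtain ⟨m, hm⟩ : ∃ m, m = (k : ℕ) := ⟨_, rfl⟩
  induction m generalizing k α y with
  | zero =>
    have h1 := hy k
    rw [H.zero k hm.symm, mul_zero] at h1
    rw [H.zero k hm.symm, map_zero, mul_zero, ← smul_mul_assoc, ← map_zsmul, ← h1, map_zero,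
      zero_mul]
  | succ m ih =>
    have hk := k.2
    set i : Fin n := ⟨m, by omega⟩ with hi
    have hik : (k : ℕ) = i + 1 := by rw [← hm]
    have hne : i ≠ k := fun h => by rw [← h] at hik; omega
    have h1 := H.sq i k hik
    have h2 := H.succ i k hik
    have h3 := H.succ' hik
    -- Two consecutive entries of a weight cannot coincide: then `y s (x_i - α_i) = -y` is
    -- annihilated by `x_i - α_i`, and semisimplicity forces `y = 0`.
    by_cases hd : α i - α k = 0
    · have hz : y * s i k * (x i - α i) = -y := by
        have : α k = α i := by omega
        rw [mul_sub, mul_assoc, h3, mul_sub, ← mul_assoc, hy k, this, mul_one,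
          ← Int.cast_comm, ← zsmul_eq_mul, smul_mul_assoc]
        abel
      have hz2 := H.semisimple i (α i) (y * s i k) (by
        rw [hz, neg_mul, mul_sub, hy i, ← Int.cast_comm, ← zsmul_eq_mul, sub_self, neg_zero])
      rw [hz, neg_eq_zero] at hz2
      simp [hz2]
    · set d := α i - α k with hdd
      -- The element `d s + 1` exchanges two weight entries. The induction hypothesis at the index
      -- `i` is used for `y` and for `y (d s + 1)`; as `(d s + 1) x_i = d x_k s - d + x_i`, the
      -- comparison determines the action of `x_k` up to the factor `d`, which is invertible.
      have hz : ∀ j, y * (d • s i k + 1) * x j = (α ∘ Equiv.swap i k) j • (y * (d • s i k + 1)) := by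
        intro j
        rcases eq_or_ne j i with hji | hji
        · rw [hji, Function.comp_apply, Equiv.swap_apply_left, mul_assoc, add_mul, smul_mul_assoc, h3,
            one_mul, mul_add, mul_smul_comm, mul_sub, ← mul_assoc, hy k, hy i, mul_one, mul_add,
            mul_smul_comm, mul_one, smul_mul_assoc]
          rw [hdd]
          module
        rcases eq_or_ne j k with hjk | hjk
        · rw [hjk, Function.comp_apply, Equiv.swap_apply_right, mul_assoc, add_mul, smul_mul_assoc, h2,
            one_mul, mul_add, mul_smul_comm, mul_add, ← mul_assoc, hy i, hy k, mul_one, mul_add,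
            mul_smul_comm, mul_one, smul_mul_assoc]
          rw [hdd]
          module
        · have hc := H.comm_s i k hik j hji hjk
          rw [Function.comp_apply, Equiv.swap_apply_of_ne_of_ne hji hjk, mul_assoc, add_mul,
            smul_mul_assoc, hc.eq, one_mul, mul_add, mul_smul_comm, ← mul_assoc, hy j, mul_add,
            mul_smul_comm, mul_one, smul_mul_assoc]
          module
      have h4 := ih i (α ∘ Equiv.swap i k) _ hz rfl
      rw [map_mul, mul_assoc (Ψ y), ← hF i k hik α, ← mul_assoc, Function.comp_apply,
        Equiv.swap_apply_left] at h4
      have h5 := ih i α y hy rfl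
      set V := Ψ y * F α
      have h6 : (d • s i k + 1) * x i = d • (x k * s i k) - d • 1 + x i := by
        rw [add_mul, smul_mul_assoc, h3, one_mul, smul_sub]
      rw [mul_assoc, ← map_mul, h6] at h4
      simp only [map_add, map_sub, map_zsmul, map_mul, map_one, mul_add, mul_sub, mul_smul_comm,
        mul_one, h5, smul_add] at h4
      have h7 : d • (V * (Ψ (x k) * Ψ (s i k)) - α k • (V * Ψ (s i k))) = 0 := by
        rw [smul_sub, sub_eq_zero]
        rw [hdd] at h4 ⊢
        linear_combination (norm := module) h4
      rw [zsmul_eq_mul] at h7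
      have h8 := (hunit d hd).mul_right_eq_zero.1 h7
      rw [sub_eq_zero, ← mul_assoc] at h8
      have h9 := congrArg (· * Ψ (s i k)) h8
      simp only [smul_mul_assoc, mul_assoc] at h9
      rwa [← map_mul, h1, map_one, mul_one, mul_one] at h9

end JucysMurphy

end Weights

/-! ### The idempotent of a weight as a product over the spectrum -/

section Idempotent

open Polynomial

variable {C : Type*} [Ring C] [Algebra ℂ C] {n : ℕ}

/-- The product of the `(x k - a) / (c k - a)` over all integers `a ≠ c k` between `-k` and `k`. -/
def contentProd (x : Fin n → C) (c : Fin n → ℤ) : C :=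
  ((List.finRange n).map fun k : Fin n =>
    (((contentRange k).filter fun a : ℤ => a ≠ c k).map fun a : ℤ =>
        ((c k : ℂ) - (a : ℂ))⁻¹ • (x k - algebraMap ℂ C (a : ℂ))).prod).prod

theorem isUnit_intCast_of_algebra {d : ℤ} (hd : d ≠ 0) : IsUnit (d : C) := by
  have h : IsUnit (d : ℂ) := (Int.cast_ne_zero.2 hd).isUnit
  have := h.map (algebraMap ℂ C)
  rwa [map_intCast] at this

/-- On an element of weight `c` each factor `(x_k - a) / (c_k - a)` acts by one. -/
theorem mul_contentProd {A : Type*} [Ring A] (Ψ : C →+* A) {x : Fin n → C} {c : Fin n → ℤ} {W : A}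
    (hW : ∀ j, W * Ψ (x j) = c j • W) : W * Ψ (contentProd x c) = W := by
  have key : ∀ l : List C, (∀ f ∈ l, W * Ψ f = W) → W * Ψ l.prod = W := by
    intro l
    induction l with
    | nil => simp
    | cons f l ih =>
      intro h
      rw [List.prod_cons, map_mul, ← mul_assoc, h f (by simp), ih fun g hg => h g (by simp [hg])]
  refine key _ fun f hf => ?_
  obtain ⟨k, _, rfl⟩ := List.mem_map.1 hf
  refine key _ fun f hf => ?_
  obtain ⟨a, ha, rfl⟩ := List.mem_map.1 hf
  have hne : c k - a ≠ 0 := by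
    have := (List.mem_filter.1 ha).2
    simp only [ne_eq, decide_eq_true_eq] at this
    omega
  have hu : IsUnit ((c k - a : ℤ) : A) := by
    have := (isUnit_intCast_of_algebra (C := C) hne).map Ψ
    rwa [map_intCast] at this
  have hC : ((c k - a : ℤ) : ℂ) ≠ 0 := Int.cast_ne_zero.2 hne
  refine hu.mul_left_cancel ?_
  rw [← zsmul_eq_mul, ← zsmul_eq_mul, ← mul_smul_comm, ← map_zsmul, ← Int.cast_smul_eq_zsmul ℂ,
    smul_smul, ← Int.cast_sub, mul_inv_cancel₀ hC, one_smul, map_sub, mul_sub, hW, map_intCast,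
    map_intCast, ← Int.cast_comm, ← zsmul_eq_mul, sub_smul]

theorem contentProd_mem (T : Subring C) (hT : ∀ z : ℂ, algebraMap ℂ C z ∈ T) {x : Fin n → C}
    (hx : ∀ k, x k ∈ T) (c : Fin n → ℤ) : contentProd x c ∈ T := by
  refine T.list_prod_mem fun f hf => ?_
  obtain ⟨k, _, rfl⟩ := List.mem_map.1 hf
  refine T.list_prod_mem fun f hf => ?_
  obtain ⟨a, ha, rfl⟩ := List.mem_map.1 hf
  rw [Algebra.smul_def]
  exact T.mul_mem (hT _) (T.sub_mem (hx k) (hT _))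

/-- The factors belonging to `k`, multiplied by `x k - c k`, make up the polynomial with all
possible eigenvalues of `x k` as roots, which vanishes at `x k`; the other factors commute with it.
-/
theorem JucysMurphy.contentProd_mul {s : Fin n → Fin n → C} {x : Fin n → C}
    (H : JucysMurphy s x) {c : Fin n → ℤ} (hc : ∀ k : Fin n, -(k : ℤ) ≤ c k ∧ c k ≤ k) (k : Fin n) :
    contentProd x c * x k = c k • contentProd x c := by
  have hcent : ∀ a : ℤ, Commute (x k - c k) (x k - (a : C)) := fun a =>
    ((Commute.refl _).sub_right (Int.cast_commute _ _).symm).sub_left (Int.cast_commute _ _)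
  have hk0 : (((contentRange k).filter fun a : ℤ => a ≠ c k).map fun a : ℤ =>
        ((c k : ℂ) - (a : ℂ))⁻¹ • (x k - algebraMap ℂ C (a : ℂ))).prod * (x k - c k) = 0 := by
    have h1 : ∀ L : List ℤ, ∃ z : ℂ, (L.map fun a : ℤ =>
        ((c k : ℂ) - (a : ℂ))⁻¹ • (x k - algebraMap ℂ C (a : ℂ))).prod =
          z • aeval (x k) (rootsPoly L) := by
      intro L
      induction L with
      | nil => exact ⟨1, by simp [rootsPoly]⟩
      | cons a L ih =>
        obtain ⟨z, hz⟩ := ih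
        refine ⟨((c k : ℂ) - (a : ℂ))⁻¹ * z, ?_⟩
        rw [List.map_cons, List.prod_cons, hz, aeval_rootsPoly_cons, map_intCast,
          smul_mul_smul_comm]
    obtain ⟨z, hz⟩ := h1 ((contentRange k).filter fun a => a ≠ c k)
    rw [hz, smul_mul_assoc, ← aeval_rootsPoly_cons']
    have h2 := mul_aeval_rootsPoly_eq_zero (y := 1)
      (M := c k :: ((contentRange k).filter fun a => a ≠ c k)) (H.semisimple k)
      (fun a _ => ?_) (by rw [one_mul]; exact H.aeval_contentRange k)
    · rw [one_mul] at h2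
      rw [h2, smul_zero]
    · by_cases h : a = c k
      · simp [h]
      · simp_all
  have key : ∀ l : List (Fin n), k ∈ l → (l.map fun k : Fin n =>
      (((contentRange k).filter fun a : ℤ => a ≠ c k).map fun a : ℤ =>
        ((c k : ℂ) - (a : ℂ))⁻¹ • (x k - algebraMap ℂ C (a : ℂ))).prod).prod * (x k - c k) = 0 := by
    intro l
    induction l with
    | nil => simp
    | cons j l ih =>
      intro hk
      have hcomm : Commute (x k - c k) (l.map fun k : Fin n =>
          (((contentRange k).filter fun a : ℤ => a ≠ c k).map fun a : ℤ =>
          ((c k : ℂ) - (a : ℂ))⁻¹ • (x k - algebraMap ℂ C (a : ℂ))).prod).prod := by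
        refine Commute.list_prod_right _ _ fun f hf => ?_
        obtain ⟨i, _, rfl⟩ := List.mem_map.1 hf
        refine Commute.list_prod_right _ _ fun f hf => ?_
        obtain ⟨a, ha, rfl⟩ := List.mem_map.1 hf
        refine Commute.smul_right ?_ _
        exact ((H.comm k i).sub_left (Int.cast_commute _ _)).sub_right
          (Algebra.commutes _ _).symm
      rw [List.map_cons, List.prod_cons, mul_assoc]
      rcases List.mem_cons.1 hk with rfl | hk
      · rw [← hcomm.eq, ← mul_assoc, hk0, zero_mul]
      · rw [ih hk, mul_zero]
  have h3 := key (List.finRange n) (List.mem_finRange k)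
  rw [mul_sub, sub_eq_zero, ← Int.cast_comm, ← zsmul_eq_mul] at h3
  exact h3

theorem JucysMurphy.contentProd_idem {s : Fin n → Fin n → C} {x : Fin n → C}
    (H : JucysMurphy s x) {c : Fin n → ℤ} (hc : ∀ k : Fin n, -(k : ℤ) ≤ c k ∧ c k ≤ k) :
    contentProd x c * contentProd x c = contentProd x c :=
  mul_contentProd (RingHom.id C) (H.contentProd_mul hc)

/-- The idempotent has weight `c` under right multiplication, `weight_mul` transfers this weight to
its product with `F c`, and the idempotent fixes all elements of weight `c`. -/
theorem JucysMurphy.contentProd_absorb {s : Fin n → Fin n → C} {x : Fin n → C}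
    (H : JucysMurphy s x) {c : Fin n → ℤ} (hc : ∀ k : Fin n, -(k : ℤ) ≤ c k ∧ c k ≤ k)
    {A : Type*} [Ring A] (Ψ : C →+* A) (F : (Fin n → ℤ) → A)
    (hF : ∀ (a b : Fin n), (b : ℕ) = a + 1 → ∀ α : Fin n → ℤ,
      F α * Ψ ((α a - α b) • s a b + 1) = Ψ ((α a - α b) • s a b + 1) * F (α ∘ Equiv.swap a b)) :
    Ψ (contentProd x c) * F c = Ψ (contentProd x c) * F c * Ψ (contentProd x c) := by
  refine (mul_contentProd Ψ fun k => H.weight_mul Ψ F (fun d hd => ?_) hF k c _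
    (H.contentProd_mul hc)).symm
  have := (isUnit_intCast_of_algebra (C := C) hd).map Ψ
  rwa [map_intCast] at this

end Idempotent

/-! ### Contents of standard tableaux -/

section Tableaux

variable {ν : YoungDiagram} (U : StandardTableau ν)

/-- The `j` cells to the left of the box `(i, j)`, and likewise the `i` cells above it, carry
smaller entries. Entries start at zero, so there are only `k` smaller ones, and both coordinates are
at most `k`. -/
theorem StandardTableau.content_mem (k : Fin ν.card) :
    -(k : ℤ) ≤ U.content k ∧ U.content k ≤ k := by
  obtain ⟨⟨i, j⟩, hb⟩ : ∃ b : ℕ × ℕ, (U.box k : ℕ × ℕ) = b := ⟨_, rfl⟩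
  have hcell : (i, j) ∈ ν.cells := hb ▸ (U.box k).2
  have key : ∀ (m : ℕ) (f : Fin m → ℕ × ℕ), Function.Injective f → (∀ a, f a ≤ (i, j)) →
      (∀ a, f a ≠ (i, j)) → m ≤ k := by
    intro m f hf hle hne
    have hmem : ∀ a, f a ∈ ν.cells := fun a => ν.isLowerSet (hle a) hcell
    let g : Fin m → Fin ν.card := fun a => U.box.symm ⟨f a, hmem a⟩
    have hg : Function.Injective g := fun a b h => hf (by simpa [g] using h)
    have hlt : ∀ a, g a < k := by
      intro a
      refine lt_of_le_of_ne (U.increasing _ _ ?_) fun h => hne a ?_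
      · rw [hb, Equiv.apply_symm_apply]
        exact hle a
      · rw [← hb, ← h, Equiv.apply_symm_apply]
    have hcard := Finset.card_le_card_of_injOn (s := Finset.univ) (t := Finset.Iio k) g
      (fun a _ => by simpa using hlt a) hg.injOn
    simpa using hcard
  have h1 := key j (fun a => (i, a)) (fun a b h => by simpa [Fin.ext_iff] using h)
    (fun a => ⟨le_rfl, a.2.le⟩) fun a h => a.2.ne (Prod.ext_iff.1 h).2
  have h2 := key i (fun a => (a, j)) (fun a b h => by simpa [Fin.ext_iff] using h)
    (fun a => ⟨a.2.le, le_rfl⟩) fun a h => a.2.ne (Prod.ext_iff.1 h).1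
  rw [StandardTableau.content, hb]
  dsimp only
  omega

theorem StandardTableau.map_idempotent {C : Type*} [Ring C] [Algebra ℂ C]
    (φ : MonoidAlgebra ℂ (Equiv.Perm (Fin ν.card)) →ₐ[ℂ] C) :
    φ U.idempotent = contentProd (fun k => φ (StandardTableau.jucysMurphy k)) U.content := by
  simp only [StandardTableau.idempotent, contentProd, map_list_prod, List.map_map]
  congr 1
  refine List.map_congr_left fun k _ => ?_
  rw [Function.comp_apply, map_list_prod, List.map_map]
  congr 1
  -- List coercions in the definition of the idempotent unfold to binds in the list monad; these are
  -- rewritten as maps.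
  have hb : ∀ {α β : Type} (f : α → β) (L : List α), (do let a ← L; pure (f a)) = L.map f :=
    fun f L => List.flatMap_pure_eq_map f L
  rw [hb, hb, List.map_map, List.map_map]
  refine List.map_congr_left fun a _ => ?_
  simp only [Function.comp_apply, map_smul, map_sub, AlgHom.commutes]

end Tableaux

/-! ### Permutation operators -/

section Permutations

variable {I R : Type*} [Ring R] [Fintype I] [DecidableEq I] {N : ℕ}

/-- The operator which permutes the tensor factors. -/
def permOp (N : ℕ) (R : Type*) [Ring R] (σ : Equiv.Perm I) : Matrix (I → Fin N) (I → Fin N) R :=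
  Matrix.of fun a b => if a = b ∘ σ.symm then 1 else 0

theorem permOp_mul_apply (σ : Equiv.Perm I) (X : Matrix (I → Fin N) (I → Fin N) R)
    (a b : I → Fin N) : (permOp N R σ * X) a b = X (a ∘ σ) b := by
  rw [Matrix.mul_apply, Finset.sum_eq_single (a ∘ σ)]
  · simp [permOp, Function.comp_assoc]
  · intro c _ hc
    rw [permOp, Matrix.of_apply, if_neg, zero_mul]
    rintro rfl
    exact hc (by simp [Function.comp_assoc])
  · simp

theorem mul_permOp_apply (σ : Equiv.Perm I) (X : Matrix (I → Fin N) (I → Fin N) R)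
    (a b : I → Fin N) : (X * permOp N R σ) a b = X a (b ∘ σ.symm) := by
  rw [Matrix.mul_apply, Finset.sum_eq_single (b ∘ σ.symm)]
  · simp [permOp]
  · intro c _ hc
    rw [permOp, Matrix.of_apply, if_neg hc, mul_zero]
  · simp

variable (N R) in
/-- The action of the symmetric group on the tensor power. -/
def permHom : Equiv.Perm I →* Matrix (I → Fin N) (I → Fin N) R where
  toFun := permOp N R
  map_one' := by
    ext a b
    simp [permOp, Matrix.one_apply, Equiv.Perm.one_def]
  map_mul' σ τ := by
    ext a b
    rw [permOp_mul_apply, permOp, permOp, Matrix.of_apply, Matrix.of_apply]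
    congr 1
    refine propext ⟨?_, ?_⟩
    · rintro rfl
      funext i
      simp [Equiv.Perm.mul_def]
    · intro h
      funext i
      have := congrFun h (σ.symm i)
      simpa [Equiv.Perm.mul_def] using this

theorem permOp_mul_siteHom (σ : Equiv.Perm I) (i : I) (X : Matrix (Fin N) (Fin N) R) :
    permOp N R σ * siteHom i X = siteHom (σ i) X * permOp N R σ := by
  ext a b
  rw [permOp_mul_apply, mul_permOp_apply, siteHom_apply, siteHom_apply]
  simp only [Function.comp_apply, Equiv.symm_apply_apply]
  congr 1
  refine propext ⟨fun h k hk => ?_, fun h k hk => ?_⟩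
  · have := h (σ.symm k) fun e => hk (by rw [← e, Equiv.apply_symm_apply])
    rwa [Equiv.apply_symm_apply] at this
  · have := h (σ k) fun e => hk (σ.injective e)
    rwa [Equiv.symm_apply_apply] at this

theorem permOp_mul_unitAt (σ : Equiv.Perm I) (i : I) (k l : Fin N) :
    permOp N R σ * unitAt N R i k l = unitAt N R (σ i) k l * permOp N R σ :=
  permOp_mul_siteHom σ i _

theorem permOp_mul_cont (σ : Equiv.Perm I) (i j : I) :
    permOp N R σ * cont (unitAt N R) i j = cont (unitAt N R) (σ i) (σ j) * permOp N R σ := by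
  simp only [cont, Finset.mul_sum, Finset.sum_mul]
  refine Finset.sum_congr rfl fun k _ => Finset.sum_congr rfl fun l _ => ?_
  rw [← mul_assoc, permOp_mul_unitAt, mul_assoc, permOp_mul_unitAt, mul_assoc]

theorem permOp_swap {i j : I} (h : i ≠ j) :
    permOp N R (Equiv.swap i j) = perm (unitAt N R) i j := by
  rw [perm_unitAt h]
  ext a b
  rw [sitesHom_apply, permOp, Matrix.of_apply, Equiv.symm_swap, permMat, Matrix.of_apply,
    ← ite_and]
  congr 1
  refine propext ⟨?_, ?_⟩
  · rintro rfl
    refine ⟨fun k h1 h2 => ?_, ?_, ?_⟩ <;> simp [*, Equiv.swap_apply_of_ne_of_ne]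
  · rintro ⟨h1, h2, h3⟩
    funext k
    rw [Function.comp_apply]
    rcases eq_or_ne k i with rfl | hi
    · rw [Equiv.swap_apply_left]; exact h2
    rcases eq_or_ne k j with rfl | hj
    · rw [Equiv.swap_apply_right]; exact h3
    rw [Equiv.swap_apply_of_ne_of_ne hi hj]
    exact h1 k hi hj

end Permutations

/-! ### Jucys–Murphy elements on tensor powers -/

section JucysMurphyMatrices

variable {n N : ℕ}

theorem exists_finRange_eq {a b : Fin n} (hab : (b : ℕ) = a + 1) :
    ∃ p t, List.finRange n = p ++ a :: b :: t := by
  have h1 : (List.finRange n).drop a = a :: (List.finRange n).drop (a + 1) := by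
    rw [List.drop_eq_getElem_cons (by simp)]
    simp
  have h2 : (List.finRange n).drop (a + 1) = b :: (List.finRange n).drop (b + 1) := by
    rw [← hab, List.drop_eq_getElem_cons (by simp)]
    simp
  refine ⟨(List.finRange n).take a, (List.finRange n).drop (b + 1), ?_⟩
  rw [← h2, ← h1, List.take_append_drop]

theorem map_swap_append {I : Type*} [DecidableEq I] {p t : List I} {a b : I}
    (hl : (p ++ a :: b :: t).Nodup) :
    (p ++ b :: a :: t).map (Equiv.swap a b) = p ++ a :: b :: t := by
  have hn := List.nodup_append.1 hl
  have h2 := hn.2.1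
  simp only [List.nodup_cons, List.mem_cons, not_or] at h2
  rw [List.map_append, List.map_cons, List.map_cons, Equiv.swap_apply_left,
    Equiv.swap_apply_right]
  congr 2
  · conv_rhs => rw [← List.map_id p]
    refine List.map_congr_left fun i hi => ?_
    exact Equiv.swap_apply_of_ne_of_ne (hn.2.2 i hi a (by simp)) (hn.2.2 i hi b (by simp))
  · congr 1
    conv_rhs => rw [← List.map_id t]
    refine List.map_congr_left fun i hi => ?_
    exact Equiv.swap_apply_of_ne_of_ne (fun e => h2.1.2 (e ▸ hi)) fun e => h2.2.1 (e ▸ hi)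

/-- The sites before `k`. -/
def below (k : Fin n) : List (Fin n) := (List.finRange n).filter (· < k)

theorem mem_below {i k : Fin n} : i ∈ below k ↔ i < k := by simp [below]

theorem nodup_below (k : Fin n) : (below k).Nodup := (List.nodup_finRange n).filter _

theorem eq_below {p s : List (Fin n)} {k : Fin n} (h : List.finRange n = p ++ k :: s) :
    p = below k := by
  have hs := List.pairwise_lt_finRange n
  rw [h, List.pairwise_append] at hs
  rw [below, h, List.filter_append, List.filter_eq_self.2, List.filter_eq_nil_iff.2,
    List.append_nil]
  · intro i hi
    rcases List.mem_cons.1 hi with rfl | hi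
    · simp
    · have := (List.pairwise_cons.1 hs.2.1).1 i hi
      simpa using this.le
  · intro i hi
    simpa using hs.2.2 i hi k (by simp)

variable {K A : Type*} [CommRing K] [Ring A] [Algebra K A] {e : Fin n → Fin N → Fin N → A}

/-- The Jucys–Murphy element acting on the tensor power. -/
def jm (e : Fin n → Fin N → Fin N → A) (k : Fin n) : A := ((below k).map fun i => perm e i k).sum

theorem MatrixUnits.jucysMurphy (he : MatrixUnits e)
    (hss : ∀ (k : Fin n) (a : ℤ) y, y * (jm e k - a) * (jm e k - a) = 0 → y * (jm e k - a) = 0) :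
    JucysMurphy (perm e) (jm e) where
  zero k hk := by
    have : below k = [] := List.eq_nil_iff_forall_not_mem.2 fun i hi => by
      have := mem_below.1 hi
      rw [Fin.lt_def] at this
      omega
    rw [jm, this, List.map_nil, List.sum_nil]
  sq a b hab := he.perm_mul_self fun h => by rw [h] at hab; omega
  succ a b hab := by
    have hne : a ≠ b := fun h => by rw [h] at hab; omega
    have hp : (below b).Perm (a :: below a) := by
      refine (List.perm_ext_iff_of_nodup (nodup_below b) ?_).2 fun i => ?_
      · rw [List.nodup_cons, mem_below]
        exact ⟨lt_irrefl a, nodup_below a⟩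
      · rw [List.mem_cons, mem_below, mem_below, Fin.lt_def, Fin.lt_def, Fin.ext_iff]
        omega
    rw [jm, (hp.map _).sum_eq, List.map_cons, List.sum_cons, mul_add, he.perm_mul_self hne,
      add_comm, jm, ← List.sum_map_mul_left, ← List.sum_map_mul_right]
    congr 2
    refine List.map_congr_left fun i hi => ?_
    have hi := mem_below.1 hi
    have hib : i ≠ b := fun h => by rw [Fin.lt_def, h] at hi; omega
    rw [he.perm_comm hne, he.perm_comm hib, he.perm_mul_perm hne.symm hib.symm hi.ne',
      he.perm_comm hi.ne']
  comm_s a b hab j hja hjb := by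
    have hne : a ≠ b := fun h => by rw [h] at hab; omega
    rcases lt_or_gt_of_ne hja with h | h
    · refine Commute.list_sum_right _ _ fun x hx => ?_
      obtain ⟨i, hi, rfl⟩ := List.mem_map.1 hx
      have hi := mem_below.1 hi
      have hia : i ≠ a := (hi.trans h).ne
      have hib : i ≠ b := fun e' => by rw [e', Fin.lt_def] at hi; rw [Fin.lt_def] at h; omega
      exact commute_perm (he.perm_commute_unit hia hib) (he.perm_commute_unit hja hjb)
    · refine he.perm_commute_sum_perm (nodup_below j) (mem_below.2 h) (mem_below.2 ?_) hne
        fun hj => lt_irrefl j (mem_below.1 hj)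
      rw [Fin.lt_def] at h ⊢
      have : (j : ℕ) ≠ b := fun e' => hjb (Fin.ext e')
      omega
  comm := by
    have key : ∀ i j : Fin n, i < j → Commute (jm e i) (jm e j) := by
      intro i j hij
      refine Commute.list_sum_left _ _ fun x hx => ?_
      obtain ⟨k, hk, rfl⟩ := List.mem_map.1 hx
      have hk := mem_below.1 hk
      exact he.perm_commute_sum_perm (nodup_below j) (mem_below.2 (hk.trans hij))
        (mem_below.2 hij) hk.ne fun hj => lt_irrefl j (mem_below.1 hj)
    intro i j
    rcases lt_trichotomy i j with h | rfl | h
    · exact key i j h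
    · exact Commute.refl _
    · exact (key j i h).symm
  semisimple := hss

theorem conjTranspose_permOp_swap {a b : Fin n} :
    (permOp N ℂ (Equiv.swap a b)).conjTranspose = permOp N ℂ (Equiv.swap a b) := by
  ext x y
  have hiff : y = x ∘ (Equiv.swap a b).symm ↔ x = y ∘ (Equiv.swap a b).symm := by
    constructor <;>
    · rintro rfl
      funext i
      simp
  simp only [Matrix.conjTranspose_apply, permOp, Matrix.of_apply]
  by_cases h : x = y ∘ (Equiv.swap a b).symm
  · rw [if_pos h, if_pos (hiff.2 h), star_one]
  · rw [if_neg h, if_neg fun h' => h (hiff.1 h'), star_zero]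

open scoped ComplexOrder in
-- Semisimplicity comes from positivity: over `ℂ` the matrix `H` of a Jucys–Murphy element minus an
-- integer is hermitian, so `y H H = 0` yields `(y H) (y H)* = 0` and then `y H = 0`.
theorem jucysMurphy_unitAt : JucysMurphy (perm (unitAt (I := Fin n) N ℂ)) (jm (unitAt N ℂ)) := by
  refine matrixUnits_unitAt.jucysMurphy fun k a y hy => ?_
  have hH : (jm (unitAt (I := Fin n) N ℂ) k - (a : Matrix _ _ ℂ)).conjTranspose =
      jm (unitAt N ℂ) k - (a : Matrix _ _ ℂ) := by
    rw [Matrix.conjTranspose_sub]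
    congr 1
    · have key : ∀ l : List (Fin n), k ∉ l →
          ((l.map fun i => perm (unitAt N ℂ) i k).sum).conjTranspose =
            (l.map fun i => perm (unitAt N ℂ) i k).sum := by
        intro l
        induction l with
        | nil => simp
        | cons i l ih =>
          intro h
          rw [List.mem_cons, not_or] at h
          rw [List.map_cons, List.sum_cons, Matrix.conjTranspose_add, ih h.2,
            ← permOp_swap (Ne.symm h.1), conjTranspose_permOp_swap]
      exact key _ fun h => lt_irrefl k (mem_below.1 h)
    · exact Matrix.conjTranspose_intCast a
  refine Matrix.self_mul_conjTranspose_eq_zero.1 ?_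
  rw [Matrix.conjTranspose_mul, hH, ← mul_assoc, hy, zero_mul]

variable {ν : YoungDiagram} (U : StandardTableau ν)

theorem idempotentMat_eq (N : ℕ) :
    U.idempotentMat N = contentProd (jm (unitAt N ℂ)) U.content := by
  have h1 : ∀ k, MonoidAlgebra.lift ℂ _ _ (permHom ℂ N) (StandardTableau.jucysMurphy k) =
      jm (unitAt (I := Fin ν.card) N ℂ) k := by
    intro k
    rw [StandardTableau.jucysMurphy, map_sum, jm, ← List.sum_toFinset _ (nodup_below k)]
    refine Finset.sum_congr ?_ fun i hi => ?_
    · ext i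
      simp [mem_below]
    · rw [List.mem_toFinset, mem_below] at hi
      rw [MonoidAlgebra.lift_single, one_smul, ← permOp_swap hi.ne]
      rfl
  have h2 := U.map_idempotent (MonoidAlgebra.lift ℂ _ _ (permHom (I := Fin ν.card) ℂ N))
  simp only [h1] at h2
  rw [← h2, MonoidAlgebra.lift_apply]
  rw [Finsupp.sum_fintype]
  swap
  · exact fun σ => zero_smul _ _
  ext a b
  rw [Matrix.sum_apply]
  refine Finset.sum_congr rfl fun σ _ => ?_
  rw [Matrix.smul_apply]
  change _ = _ • (if _ then (1 : ℂ) else 0)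
  rw [smul_eq_mul, mul_ite, mul_one, mul_zero]

end JucysMurphyMatrices

/-! ### Ordered products under homomorphisms, permutations and rescaling -/

section Maps

variable {A A' I J : Type*} [Ring A] [Ring A']

theorem map_br (Φ : A →+* A') (f : J → I) {s : J → A} {q : J → J → A} {s' : I → A'}
    {q' : I → I → A'} {l : List J} (hl : l.Nodup) (hs : ∀ i ∈ l, Φ (s i) = s' (f i))
    (hq : ∀ i ∈ l, ∀ j ∈ l, i ≠ j → Φ (q i j) = q' (f i) (f j)) :
    Φ (br s q l) = br s' q' (l.map f) := by
  induction l with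
  | nil => exact map_one Φ
  | cons i l ih =>
    rw [List.nodup_cons] at hl
    rw [List.map_cons, br, br, map_mul, map_mul, hs i (by simp), map_list_prod, List.map_map,
      List.map_map, ih hl.2 (fun j hj => hs j (by simp [hj]))
        fun j hj k hk => hq j (by simp [hj]) k (by simp [hk])]
    congr 3
    refine List.map_congr_left fun j hj => ?_
    exact hq i (by simp) j (by simp [hj]) fun e => hl.1 (e ▸ hj)

theorem mul_br_map {p : A} (f : I → I) {s s' : I → A} {q q' : I → I → A} {l : List I}
    (hl : l.Nodup) (hs : ∀ i, p * s i = s' (f i) * p)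
    (hq : ∀ i j, i ≠ j → p * q i j = q' (f i) (f j) * p) :
    p * br s q l = br s' q' (l.map f) * p := by
  induction l with
  | nil => simp [br]
  | cons i l ih =>
    rw [List.nodup_cons] at hl
    have h1 : ∀ m : List I, i ∉ m → p * (m.map (q i)).prod = ((m.map f).map (q' (f i))).prod * p := by
      intro m
      induction m with
      | nil => simp
      | cons j m ihm =>
        intro hi
        rw [List.mem_cons, not_or] at hi
        simp only [List.map_cons, List.prod_cons]
        rw [← mul_assoc, hq i j hi.1, mul_assoc, ihm hi.2, mul_assoc]
    rw [List.map_cons, br, br, ← mul_assoc, ← mul_assoc, hs, mul_assoc (s' (f i)), h1 l hl.1,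
      mul_assoc, mul_assoc, ih hl.2]
    simp only [mul_assoc]

theorem isUnit_br {s : I → A} {q : I → I → A} {l : List I} (hl : l.Nodup) (hs : ∀ i, IsUnit (s i))
    (hq : ∀ i j, i ≠ j → IsUnit (q i j)) : IsUnit (br s q l) := by
  induction l with
  | nil => exact isUnit_one
  | cons i l ih =>
    rw [List.nodup_cons] at hl
    refine ((hs i).mul ?_).mul (ih hl.2)
    have h1 : ∀ m : List I, i ∉ m → IsUnit (m.map (q i)).prod := by
      intro m
      induction m with
      | nil => simp
      | cons j m ihm =>
        intro hi
        rw [List.mem_cons, not_or] at hi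
        rw [List.map_cons, List.prod_cons]
        exact (hq i j hi.1).mul (ihm hi.2)
    exact h1 l hl.1

theorem br_smul {K : Type*} [CommRing K] [Algebra K A] {s : I → A} {q q' : I → I → A}
    {l : List I} (hl : l.Nodup)
    (hq : ∀ i j, i ≠ j → ∃ κ : K, IsUnit κ ∧ q i j = κ • q' i j) :
    ∃ κ : K, IsUnit κ ∧ br s q l = κ • br s q' l := by
  induction l with
  | nil => exact ⟨1, isUnit_one, (one_smul K _).symm⟩
  | cons i l ih =>
    rw [List.nodup_cons] at hl
    obtain ⟨κ, hκ, h⟩ := ih hl.2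
    have h1 : ∀ m : List I, i ∉ m → ∃ κ : K, IsUnit κ ∧
        (m.map (q i)).prod = κ • (m.map (q' i)).prod := by
      intro m
      induction m with
      | nil => exact fun _ => ⟨1, isUnit_one, (one_smul K _).symm⟩
      | cons j m ihm =>
        intro hi
        rw [List.mem_cons, not_or] at hi
        obtain ⟨κ, hκ, h⟩ := ihm hi.2
        obtain ⟨κ', hκ', h'⟩ := hq i j hi.1
        exact ⟨κ' * κ, hκ'.mul hκ, by
          rw [List.map_cons, List.prod_cons, h, h', smul_mul_smul_comm]; rfl⟩
    obtain ⟨κ', hκ', h'⟩ := h1 l hl.1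
    exact ⟨κ' * κ, hκ'.mul hκ, by rw [br, br, h, h', mul_smul_comm κ', smul_mul_smul_comm]⟩

/-- In a Dedekind-finite ring, compressions of inverses are inverses. -/
theorem absorb_inverse (hA : ∀ a b : A, a * b = 1 → b * a = 1) {E F V : A} (hE : E * E = E)
    (hF : E * F = E * F * E) (hFV : F * V = 1) : E * V = E * V * E := by
  -- The compressions to the corner of `E`, completed by `1 - E`, are one-sided inverses in the
  -- whole ring, where Dedekind finiteness makes them two-sided.
  have h1 : (E * F * E + (1 - E)) * (E * V * E + (1 - E)) = 1 := by
    have h2 : E * F * E * (E * V * E) = E := by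
      calc E * F * E * (E * V * E) = E * F * (E * E) * V * E := by simp only [mul_assoc]
        _ = E * F * V * E := by rw [hE, ← hF]
        _ = E := by rw [mul_assoc E, hFV, mul_one, hE]
    have h3 : E * F * E * (1 - E) = 0 := by rw [mul_sub, mul_one, mul_assoc (E * F), hE, sub_self]
    have h4 : (1 - E) * (E * V * E) = 0 := by
      rw [sub_mul, one_mul, ← mul_assoc, ← mul_assoc, hE, sub_self]
    have h5 : (1 - E) * (1 - E) = 1 - E := by
      rw [mul_sub, sub_mul, sub_mul, hE]; simp
    rw [add_mul, mul_add, mul_add, h2, h3, h4, h5]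
    abel
  have h2 := hA _ _ h1
  have h3 : E * V * E * F * E = E := by
    have h4 := congrArg (fun x => E * x * E) h2
    have h5 : E * (1 - E) = 0 := by rw [mul_sub, mul_one, hE, sub_self]
    have h6 : (1 - E) * E = 0 := by rw [sub_mul, one_mul, hE, sub_self]
    have hEE : ∀ x, E * (E * x) = E * x := fun x => by rw [← mul_assoc, hE]
    have h7 : E * ((E * V * E + (1 - E)) * (E * F * E + (1 - E))) * E =
        E * (E * V * E + (1 - E)) * ((E * F * E + (1 - E)) * E) := by simp only [mul_assoc]
    rw [h7, mul_add E, h5, add_zero, add_mul _ _ E, h6, add_zero, mul_one, hE] at h4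
    simpa only [mul_assoc, hE, hEE] using h4
  have h4 : E * V * (E * F) = E := by
    conv_rhs => rw [← h3]
    rw [hF]; simp only [mul_assoc]
  have h5 := congrArg (· * V) h4
  rw [mul_assoc, mul_assoc E F, hFV, mul_one] at h5
  exact h5.symm

end Maps

/-! ### The ordered product over all sites and its transport to larger tensor powers -/

section Bracket

variable {R : Type*} [Ring R] {N : ℕ}

theorem filter_lt_of_cons {n : ℕ} {p s : List (Fin n)} {k : Fin n}
    (h : List.finRange n = p ++ k :: s) : (List.finRange n).filter (fun j => k < j) = s := by
  have hs := List.pairwise_lt_finRange n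
  rw [h, List.pairwise_append] at hs
  rw [h, List.filter_append, List.filter_eq_nil_iff.2, List.nil_append, List.filter_cons,
    if_neg (by simp), List.filter_eq_self.2]
  · intro i hi
    simpa using (List.pairwise_cons.1 hs.2.1).1 i hi
  · intro i hi
    simpa using (hs.2.2 i hi k (by simp)).le

theorem bracket_eq_br {n : ℕ} (S : Fin n → Matrix (Fin N) (Fin N) R)
    (Q : Fin n → Fin n → Matrix (Fin N × Fin N) (Fin N × Fin N) R) :
    bracket S Q = br (fun i => siteHom i (S i)) (fun i j => sites i j (Q i j))
      (List.finRange n) := by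
  have key : ∀ s p : List (Fin n), List.finRange n = p ++ s → (s.map fun i =>
      site i (S i) * (((List.finRange n).filter fun j => i < j).map fun j =>
        sites i j (Q i j)).prod).prod =
      br (fun i => siteHom i (S i)) (fun i j => sites i j (Q i j)) s := by
    intro s
    induction s with
    | nil => intro p _; rfl
    | cons k s ih =>
      intro p hp
      rw [List.map_cons, List.prod_cons, br, filter_lt_of_cons hp, ih (p ++ [k]) (by simpa using hp),
        site_eq_siteHom]
  exact key _ [] rfl

variable {I J : Type*} [Fintype I] [DecidableEq I] [Fintype J] [DecidableEq J]

theorem map_siteHom {R' : Type*} [Ring R'] (φ : R →+* R') (i : I) (X : Matrix (Fin N) (Fin N) R) :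
    (siteHom i X).map φ = siteHom i (X.map φ) := by
  ext a b
  rw [Matrix.map_apply, siteHom_apply, siteHom_apply]
  split_ifs <;> simp

theorem map_unitAt {R' : Type*} [Ring R'] (φ : R →+* R') (i : I) (k l : Fin N) :
    (unitAt N R i k l).map φ = unitAt N R' i k l := by
  rw [unitAt, map_siteHom, unitAt]
  congr 1
  ext a b
  rw [Matrix.map_apply, Matrix.single_apply, Matrix.single_apply]
  split_ifs <;> simp

theorem map_cont {A A' : Type*} [Ring A] [Ring A'] (Φ : A →+* A') {f : J → I}
    {e : J → Fin N → Fin N → A} {e' : I → Fin N → Fin N → A'}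
    (h : ∀ i k l, Φ (e i k l) = e' (f i) k l) (i j : J) :
    Φ (cont e i j) = cont e' (f i) (f j) := by
  simp only [cont, map_sum, map_mul, h]

theorem map_perm {A A' : Type*} [Ring A] [Ring A'] (Φ : A →+* A') {f : J → I}
    {e : J → Fin N → Fin N → A} {e' : I → Fin N → Fin N → A'}
    (h : ∀ i k l, Φ (e i k l) = e' (f i) k l) (i j : J) :
    Φ (perm e i j) = perm e' (f i) (f j) := by
  simp only [perm, map_sum, map_mul, h]

variable {K : Type*} [CommRing K] [Algebra K R]

theorem emb_smul {κ' : Type*} {f : J → I} (a : K) (X : Matrix (J → κ') (J → κ') R) :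
    emb f (a • X) = a • emb f X := by
  ext x y
  simp only [emb, Matrix.of_apply, Matrix.smul_apply]
  split_ifs
  · rfl
  · rw [smul_zero]

theorem emb_contR {f : J → I} (hf : Function.Injective f) (h : K) {x : J → J → K} {x' : I → I → K}
    (i j : J) (hx : x i j = x' (f i) (f j)) :
    embHom hf (contR (unitAt N R) h x i j) = contR (unitAt N R) h x' (f i) (f j) := by
  have h1 : ∀ (a : K) X, embHom hf (κ := Fin N) (R := R) (a • X) = a • embHom hf X :=
    fun a X => emb_smul a X
  have h2 := map_cont (embHom hf) (e := unitAt N R) (e' := unitAt N R)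
    (fun i k l => emb_unitAt hf i k l) i j
  rw [contR, contR, map_sub, h1, h1, map_one, h2, hx]

theorem emb_commute_siteHom {f : J → I} {i : I} (hi : ∀ j, f j ≠ i)
    {Y : Matrix (J → Fin N) (J → Fin N) R} (hY : ∀ a b r, Commute (Y a b) r)
    (X : Matrix (Fin N) (Fin N) R) : Commute (emb f Y) (siteHom i X) :=
  emb_commute_emb (fun j _ => hi j) fun a b _ _ => hY a b _

end Bracket

/-! ### The tableau idempotent absorbs the ordered product -/

section Absorption

variable {R K : Type*} [Ring R] [CommRing K] [Algebra K R] {N : ℕ} {ν : YoungDiagram}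
  (U : StandardTableau ν)

/-- The idempotent absorbs the ordered product, if the reflection equations hold. -/
theorem idempotentMat_absorb (φ : ℂ →+* R) (ξ h : K) (X : ℤ → Matrix (Fin N) (Fin N) R)
    (hX : ∀ (i j : Fin ν.card), i ≠ j → ∀ α β : ℤ,
      permR (unitAt N R) ((α - β : ℤ) : K) 1 i j *
        (siteHom i (X α) * contR (unitAt N R) h (fun _ _ => ξ - h * (α + β)) i j *
          siteHom j (X β)) =
      siteHom j (X β) * contR (unitAt N R) h (fun _ _ => ξ - h * (α + β)) i j * siteHom i (X α) *
        permR (unitAt N R) ((α - β : ℤ) : K) 1 i j) :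
    (U.idempotentMat N).map φ * br (fun i => siteHom i (X (U.content i)))
        (contR (unitAt N R) h fun i j => ξ - h * (U.content i + U.content j))
          (List.finRange ν.card) =
      (U.idempotentMat N).map φ * br (fun i => siteHom i (X (U.content i)))
        (contR (unitAt N R) h fun i j => ξ - h * (U.content i + U.content j))
          (List.finRange ν.card) * (U.idempotentMat N).map φ := by
  have hΨ : ∀ Y : Matrix (Fin ν.card → Fin N) (Fin ν.card → Fin N) ℂ, Y.map φ = φ.mapMatrix Y :=
    fun _ => rfl
  rw [hΨ, idempotentMat_eq]
  -- The ordered product is regarded as a function of an arbitrary integral vector `α` of shifts,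
  -- because the weight argument passes through vectors that are not contents of tableaux.
  refine jucysMurphy_unitAt.contentProd_absorb U.content_mem φ.mapMatrix
    (fun α => br (fun i => siteHom i (X (α i)))
        (contR (unitAt N R) h fun i j => ξ - h * (α i + α j)) (List.finRange ν.card)) ?_
  intro a b hab α
  have hne : a ≠ b := fun h => by rw [h] at hab; omega
  obtain ⟨p, t, hpt⟩ := exists_finRange_eq hab
  have hnd := List.nodup_finRange ν.card
  have he := matrixUnits_unitAt (I := Fin ν.card) (N := N) (R := R)
  have hs : ∀ X : Fin ν.card → Matrix (Fin N) (Fin N) R, ∀ i j, i ≠ j → ∀ k l,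
      Commute (siteHom i (X i)) (unitAt N R j k l) := fun X i j hij k l =>
    siteHom_commute_unitAt hij _ _ _
  set α' := α ∘ Equiv.swap a b with hα'
  have ha' : α' a = α b := by rw [hα', Function.comp_apply, Equiv.swap_apply_left]
  have hb' : α' b = α a := by rw [hα', Function.comp_apply, Equiv.swap_apply_right]
  have hsw := swaps_permR (K := K) he (hs fun i => X (α' i)) (h := h) (d := ((α' a - α' b : ℤ) : K))
    (ε := 1) (x := fun i j => ξ - h * (α' i + α' j)) (fun i j => by ring) hne
    (fun j => by push_cast; ring) (hX a b hne (α' a) (α' b))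
  rw [hpt] at hnd ⊢
  have h1 := hsw.mul_br (siteOps_contR he (hs fun i => X (α' i)) h _) p t hnd
  have hnd' : (p ++ b :: a :: t).Nodup :=
    (List.Perm.nodup_iff (List.Perm.append_left p (List.Perm.swap b a t))).1 hnd
  have h2 := mul_br_map (p := permOp N R (Equiv.swap a b)) (Equiv.swap a b)
    (s := fun i => siteHom i (X (α' i))) (s' := fun i => siteHom i (X (α i)))
    (q := contR (unitAt N R) h fun i j => ξ - h * (α' i + α' j))
    (q' := contR (unitAt N R) h fun i j => ξ - h * (α i + α j)) hnd'
    (fun i => permOp_mul_siteHom _ _ _) (fun i j _ => by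
      simp only [contR, mul_sub, sub_mul, mul_smul_comm, smul_mul_assoc, permOp_mul_cont, mul_one,
        one_mul]
      rfl)
  rw [map_swap_append hnd] at h2
  rw [permOp_swap hne] at h2
  -- Since `P² = 1`, the intertwiner `d P + 1` equals `-P (-d - P)`. The factor `-d - P` is the
  -- cleared R-matrix for the exchanged shifts, which reverses the order of the adjacent sites `a`,
  -- `b`; the remaining `P` restores the names of the sites.
  have h3 : φ.mapMatrix ((α a - α b) • perm (unitAt N ℂ) a b + 1) =
      -(perm (unitAt N R) a b * permR (unitAt N R) ((α' a - α' b : ℤ) : K) 1 a b) := by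
    have h4 := map_perm (f := id) φ.mapMatrix (e := unitAt N ℂ) (e' := unitAt N R)
      (fun i k l => map_unitAt φ i k l) a b
    rw [map_add, map_zsmul, map_one, h4, permR, mul_sub, mul_smul_comm, mul_smul_comm,
      he.perm_mul_self hne, ha', hb', one_smul, mul_one, Int.cast_smul_eq_zsmul, id, id,
      ← neg_sub (α a) (α b), neg_smul]
    abel
  rw [h3, mul_neg, neg_mul, mul_assoc (perm _ _ _), h1, ← mul_assoc, ← mul_assoc, h2]

variable {I : Type*} [Fintype I] [DecidableEq I] {f : Fin ν.card → I} (hf : Function.Injective f)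

include hf in
-- The idempotent is a polynomial in the Jucys–Murphy elements, so it commutes with whatever
-- commutes with the transpositions of its own sites; sums that are symmetric in these sites are of
-- this kind.
theorem contentIdempotent_emb (φ : ℂ →+* R) (hφ : ∀ z r, Commute (φ z) r) {c : I → K}
    (hc : ∀ k, c (f k) = U.content k) :
    ContentIdempotent (unitAt N R) ((List.finRange ν.card).map f) c
      (emb f ((U.idempotentMat N).map φ)) := by
  have he := matrixUnits_unitAt (I := I) (N := N) (R := R)
  set Ψ : Matrix (Fin ν.card → Fin N) (Fin ν.card → Fin N) ℂ →+* Matrix (I → Fin N) (I → Fin N) R :=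
    (embHom hf).comp φ.mapMatrix with hΨ
  have hu : ∀ i k l, Ψ (unitAt N ℂ i k l) = unitAt N R (f i) k l := fun i k l => by
    change emb f ((unitAt N ℂ i k l).map φ) = _
    rw [map_unitAt, emb_unitAt hf]
  have hscal : ∀ (z : ℂ) Y, Commute (Ψ (algebraMap ℂ _ z)) Y := by
    intro z Y
    have h1 : Ψ (algebraMap ℂ _ z) =
        (⟨φ z, Subring.mem_center_iff.2 fun g => (hφ z g).symm⟩ : Subring.center R) • 1 := by
      rw [← emb_one (f := f), ← emb_smul]
      change emb f _ = _
      congr 1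
      ext a b
      rw [RingHom.mapMatrix_apply, Matrix.map_apply, Matrix.algebraMap_matrix_apply,
        Matrix.smul_apply, Matrix.one_apply]
      split_ifs
      · simp [Subring.smul_def]
      · simp
    rw [h1]
    exact (Commute.one_left Y).smul_left _
  have hmem : ∀ Z, (∀ k, ∀ i < k, Commute (perm (unitAt N R) (f i) (f k)) Z) →
      Commute (Ψ (U.idempotentMat N)) Z := by
    intro Z hZ
    have h1 := contentProd_mem ((Subring.centralizer {Z}).comap Ψ) (fun z => ?_)
      (x := jm (unitAt (I := Fin ν.card) N ℂ)) (fun k => ?_) U.content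
    · rw [← idempotentMat_eq, Subring.mem_comap, Subring.mem_centralizer_iff] at h1
      exact (h1 Z rfl).symm
    · rw [Subring.mem_comap, Subring.mem_centralizer_iff]
      rintro _ rfl
      exact (hscal z _).symm
    · refine Subring.list_sum_mem _ fun y hy => ?_
      obtain ⟨i, hi, rfl⟩ := List.mem_map.1 hy
      rw [Subring.mem_comap, Subring.mem_centralizer_iff, map_perm Ψ hu]
      rintro _ rfl
      exact (hZ k i (mem_below.1 hi)).symm
  have hnd : ((List.finRange ν.card).map f).Nodup := (List.nodup_finRange _).map hf
  refine ⟨?_, ?_, ?_, ?_, ?_⟩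
  · change Ψ _ * Ψ _ = Ψ _
    rw [← map_mul, idempotentMat_eq, jucysMurphy_unitAt.contentProd_idem U.content_mem]
  · intro p n s hl
    obtain ⟨p, s', hps, rfl, hs⟩ := List.map_eq_append_iff.1 hl
    obtain ⟨k, s, rfl, rfl, rfl⟩ := List.map_eq_cons_iff.1 hs
    have h1 := (jucysMurphy_unitAt (N := N)).contentProd_mul U.content_mem k
    have h2 := congrArg Ψ h1
    rw [← idempotentMat_eq, map_mul, map_zsmul, jm, ← eq_below hps, map_list_sum, List.map_map] at h2
    rw [hc, Int.cast_smul_eq_zsmul, List.map_map]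
    refine Eq.trans ?_ h2
    congr 2
    refine List.map_congr_left fun i _ => ?_
    exact (map_perm Ψ hu i k).symm
  · intro i hi k n
    exact emb_commute_siteHom (fun j hj => hi (List.mem_map.2 ⟨j, List.mem_finRange j, hj⟩))
      (fun a b r => hφ _ r) _
  · intro b hb
    exact hmem _ fun k i hik => he.perm_commute_sum_perm hnd
      (List.mem_map_of_mem (List.mem_finRange i)) (List.mem_map_of_mem (List.mem_finRange k))
      (hf.ne hik.ne) hb
  · intro b hb
    exact hmem _ fun k i hik => he.perm_commute_sum_cont hnd
      (List.mem_map_of_mem (List.mem_finRange i)) (List.mem_map_of_mem (List.mem_finRange k))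
      (hf.ne hik.ne) hb

end Absorption

/-! ### Reflection equations -/

section Reflection

variable {R : Type*} [Ring R] {N : ℕ}

/-- The matrix `X` on the first tensor factor. -/
def onFirst (X : Matrix (Fin N) (Fin N) R) : Matrix (Fin N × Fin N) (Fin N × Fin N) R :=
  Matrix.of fun p q => if p.2 = q.2 then X p.1 q.1 else 0

/-- The matrix `X` on the second tensor factor. -/
def onSecond (X : Matrix (Fin N) (Fin N) R) : Matrix (Fin N × Fin N) (Fin N × Fin N) R :=
  Matrix.of fun p q => if p.1 = q.1 then X p.2 q.2 else 0

theorem onFirst_mul_apply (X : Matrix (Fin N) (Fin N) R)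
    (Y : Matrix (Fin N × Fin N) (Fin N × Fin N) R) (p q : Fin N × Fin N) :
    (onFirst X * Y) p q = ∑ k, X p.1 k * Y (k, p.2) q := by
  rw [Matrix.mul_apply, Fintype.sum_prod_type]
  refine Finset.sum_congr rfl fun k _ => ?_
  rw [Finset.sum_eq_single p.2] <;> simp +contextual [onFirst, eq_comm]

theorem onSecond_mul_apply (X : Matrix (Fin N) (Fin N) R)
    (Y : Matrix (Fin N × Fin N) (Fin N × Fin N) R) (p q : Fin N × Fin N) :
    (onSecond X * Y) p q = ∑ k, X p.2 k * Y (p.1, k) q := by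
  rw [Matrix.mul_apply, Fintype.sum_prod_type, Finset.sum_comm]
  refine Finset.sum_congr rfl fun k _ => ?_
  rw [Finset.sum_eq_single p.1] <;> simp +contextual [onSecond, eq_comm]

theorem mul_onFirst_apply (X : Matrix (Fin N) (Fin N) R)
    (Y : Matrix (Fin N × Fin N) (Fin N × Fin N) R) (p q : Fin N × Fin N) :
    (Y * onFirst X) p q = ∑ k, Y p (k, q.2) * X k q.1 := by
  rw [Matrix.mul_apply, Fintype.sum_prod_type]
  refine Finset.sum_congr rfl fun k _ => ?_
  rw [Finset.sum_eq_single q.2] <;> simp +contextual [onFirst]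

theorem mul_onSecond_apply (X : Matrix (Fin N) (Fin N) R)
    (Y : Matrix (Fin N × Fin N) (Fin N × Fin N) R) (p q : Fin N × Fin N) :
    (Y * onSecond X) p q = ∑ k, Y p (q.1, k) * X k q.2 := by
  rw [Matrix.mul_apply, Fintype.sum_prod_type, Finset.sum_comm]
  refine Finset.sum_congr rfl fun k _ => ?_
  rw [Finset.sum_eq_single q.1] <;> simp +contextual [onSecond]

theorem onFirst_mul_onFirst (X Y : Matrix (Fin N) (Fin N) R) :
    onFirst X * onFirst Y = onFirst (X * Y) := by
  ext p q
  rw [onFirst_mul_apply, onFirst, onFirst, Matrix.of_apply]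
  split_ifs with h
  · simp [Matrix.mul_apply, h]
  · simp [h]

theorem onSecond_mul_onSecond (X Y : Matrix (Fin N) (Fin N) R) :
    onSecond X * onSecond Y = onSecond (X * Y) := by
  ext p q
  rw [onSecond_mul_apply, onSecond, onSecond, Matrix.of_apply]
  split_ifs with h
  · simp [Matrix.mul_apply, h]
  · simp [h]

theorem onFirst_mul_onSecond_apply (X Y : Matrix (Fin N) (Fin N) R) (p q : Fin N × Fin N) :
    (onFirst X * onSecond Y) p q = X p.1 q.1 * Y p.2 q.2 := by
  rw [onFirst_mul_apply, Finset.sum_eq_single q.1] <;> simp +contextual [onSecond]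

theorem onSecond_mul_onFirst_apply (X Y : Matrix (Fin N) (Fin N) R) (p q : Fin N × Fin N) :
    (onSecond Y * onFirst X) p q = Y p.2 q.2 * X p.1 q.1 := by
  rw [onSecond_mul_apply, Finset.sum_eq_single q.2] <;> simp +contextual [onFirst]

theorem permMat_mul_apply (Y : Matrix (Fin N × Fin N) (Fin N × Fin N) R) (p q : Fin N × Fin N) :
    (permMat N R * Y) p q = Y (p.2, p.1) q := by
  rw [Matrix.mul_apply, Finset.sum_eq_single (p.2, p.1)]
  · simp [permMat]
  · rintro ⟨a, b⟩ _ h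
    rw [permMat, Matrix.of_apply, if_neg, zero_mul]
    rintro ⟨h1, h2⟩
    exact h (Prod.ext h2.symm h1.symm)
  · simp

theorem mul_permMat_apply (Y : Matrix (Fin N × Fin N) (Fin N × Fin N) R) (p q : Fin N × Fin N) :
    (Y * permMat N R) p q = Y p (q.2, q.1) := by
  rw [Matrix.mul_apply, Finset.sum_eq_single (q.2, q.1)]
  · simp [permMat]
  · rintro ⟨a, b⟩ _ h
    rw [permMat, Matrix.of_apply, if_neg, mul_zero]
    rintro ⟨h1, h2⟩
    exact h (Prod.ext h1 h2)
  · simp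

theorem permMat_mul_onFirst (X : Matrix (Fin N) (Fin N) R) :
    permMat N R * onFirst X = onSecond X * permMat N R := by
  ext p q
  rw [permMat_mul_apply, mul_permMat_apply]
  rfl

theorem permMat_mul_onSecond (X : Matrix (Fin N) (Fin N) R) :
    permMat N R * onSecond X = onFirst X * permMat N R := by
  ext p q
  rw [permMat_mul_apply, mul_permMat_apply]
  rfl

theorem permMat_mul_contMat : permMat N R * contMat N R = contMat N R * permMat N R := by
  ext p q
  rw [permMat_mul_apply, mul_permMat_apply, contMat, Matrix.of_apply, Matrix.of_apply]
  simp only [eq_comm]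

/-- The reflection equation with parameters: `d - ε P` is the cleared R-matrix and `x - h Pᵗ` its
cleared transposed counterpart. -/
def ReflEq (d ε x h : R) (X Y : Matrix (Fin N) (Fin N) R) : Prop :=
  (d • 1 - ε • permMat N R) * (onFirst X * (x • 1 - h • contMat N R) * onSecond Y) =
    onSecond Y * (x • 1 - h • contMat N R) * onFirst X * (d • 1 - ε • permMat N R)

theorem map_onFirst {R' : Type*} [Ring R'] (f : R →+* R') (X : Matrix (Fin N) (Fin N) R) :
    (onFirst X).map f = onFirst (X.map f) := by
  ext p q
  simp only [onFirst, Matrix.map_apply, Matrix.of_apply]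
  split_ifs <;> simp

theorem map_onSecond {R' : Type*} [Ring R'] (f : R →+* R') (X : Matrix (Fin N) (Fin N) R) :
    (onSecond X).map f = onSecond (X.map f) := by
  ext p q
  simp only [onSecond, Matrix.map_apply, Matrix.of_apply]
  split_ifs <;> simp

theorem map_permMat {R' : Type*} [Ring R'] (f : R →+* R') :
    (permMat N R).map f = permMat N R' := by
  ext p q
  simp only [permMat, Matrix.map_apply, Matrix.of_apply]
  split_ifs <;> simp

theorem map_contMat {R' : Type*} [Ring R'] (f : R →+* R') :
    (contMat N R).map f = contMat N R' := by
  ext p q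
  simp only [contMat, Matrix.map_apply, Matrix.of_apply]
  split_ifs <;> simp

theorem mapMatrix_smul {m R' : Type*} [Ring R'] [Fintype m] [DecidableEq m] (f : R →+* R') (a : R)
    (M : Matrix m m R) : f.mapMatrix (a • M) = f a • f.mapMatrix M := by
  ext p q
  simp

theorem ReflEq.map {R' : Type*} [Ring R'] (f : R →+* R') {d ε x h : R}
    {X Y : Matrix (Fin N) (Fin N) R} (H : ReflEq d ε x h X Y) :
    ReflEq (f d) (f ε) (f x) (f h) (X.map f) (Y.map f) := by
  have h1 := congrArg f.mapMatrix H
  simp only [map_mul, map_sub, mapMatrix_smul, map_one] at h1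
  simp only [RingHom.mapMatrix_apply, map_onFirst, map_onSecond, map_permMat, map_contMat] at h1
  exact h1

theorem ReflEq.of_map {R' : Type*} [Ring R'] (f : R →+* R') (hf : Function.Injective f)
    {d ε x h : R} {X Y : Matrix (Fin N) (Fin N) R}
    (H : ReflEq (f d) (f ε) (f x) (f h) (X.map f) (Y.map f)) : ReflEq d ε x h X Y := by
  have hinj : Function.Injective (f.mapMatrix (m := Fin N × Fin N)) := fun A B h =>
    Matrix.ext fun i j => hf (congrFun (congrFun h i) j)
  refine hinj ?_
  simp only [map_mul, map_sub, mapMatrix_smul, map_one]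
  simp only [RingHom.mapMatrix_apply, map_onFirst, map_onSecond, map_permMat, map_contMat]
  exact H

theorem onFirst_contMat_onSecond_apply (X Y : Matrix (Fin N) (Fin N) R) (p q : Fin N × Fin N) :
    (onFirst X * contMat N R * onSecond Y) p q = X p.1 p.2 * Y q.1 q.2 := by
  rw [mul_onSecond_apply, Finset.sum_eq_single q.1]
  · rw [onFirst_mul_apply, Finset.sum_eq_single p.2] <;> simp +contextual [contMat]
  · intro k _ hk
    rw [onFirst_mul_apply, Finset.sum_eq_zero, zero_mul]
    intro l _
    simp [contMat, hk.symm]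
  · simp

theorem onSecond_contMat_onFirst_apply (X Y : Matrix (Fin N) (Fin N) R) (p q : Fin N × Fin N) :
    (onSecond X * contMat N R * onFirst Y) p q = X p.2 p.1 * Y q.2 q.1 := by
  rw [mul_onFirst_apply, Finset.sum_eq_single q.2]
  · rw [onSecond_mul_apply, Finset.sum_eq_single p.1] <;> simp +contextual [contMat, eq_comm]
  · intro k _ hk
    rw [onSecond_mul_apply, Finset.sum_eq_zero, zero_mul]
    intro l _
    simp [contMat, hk]
  · simp

theorem smul_comm_of_central {m : Type*} [Fintype m] [DecidableEq m] {a : R} (ha : ∀ r, Commute a r)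
    (M L : Matrix m m R) : M * (a • L) = a • (M * L) := by
  ext p q
  simp only [Matrix.mul_apply, Matrix.smul_apply, smul_eq_mul, Finset.mul_sum]
  exact Finset.sum_congr rfl fun k _ => ((ha (M p k)).left_comm _).symm

/-- Symmetric and antisymmetric scalar matrices satisfy the reflection equation. -/
theorem reflEq_of_transpose {d ε x h : R} (hd : ∀ r, Commute d r) (hε : ∀ r, Commute ε r)
    (hx : ∀ r, Commute x r) (hh : ∀ r, Commute h r) {X : Matrix (Fin N) (Fin N) R}
    (hc : ∀ i j r, Commute (X i j) r) (hX : X.transpose = X ∨ X.transpose = -X) :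
    ReflEq d ε x h X X := by
  have h1 : onFirst X * onSecond X = onSecond X * onFirst X := by
    ext p q
    rw [onFirst_mul_onSecond_apply, onSecond_mul_onFirst_apply, (hc _ _ _).eq]
  have h2 : onFirst X * contMat N R * onSecond X = onSecond X * contMat N R * onFirst X := by
    ext p q
    rw [onFirst_contMat_onSecond_apply, onSecond_contMat_onFirst_apply]
    -- Two entries are transposed at once, so the sign enters squared and the symmetric and
    -- antisymmetric cases agree.
    have key : ∀ ε : R, ε * ε = 1 → (∀ r, Commute ε r) → X.transpose = ε • X →
        X p.1 p.2 * X q.1 q.2 = X p.2 p.1 * X q.2 q.1 := by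
      intro ε h1 h2 h3
      have h4 : ∀ i j, X j i = ε * X i j := fun i j => congrFun (congrFun h3 i) j
      rw [h4 p.1 p.2, h4 q.1 q.2, (h2 _).symm.mul_mul_mul_comm, h1, one_mul]
    rcases hX with h | h
    · exact key 1 (by simp) (fun r => Commute.one_left r) (by rw [h, one_smul])
    · exact key (-1) (by simp) (fun r => (Commute.one_left r).neg_left) (by rw [h, neg_smul, one_smul])
  set Z := onFirst X * (x • 1 - h • contMat N R) * onSecond X with hZ
  have h3 : onSecond X * (x • 1 - h • contMat N R) * onFirst X = Z := by
    rw [hZ, mul_sub, mul_sub, sub_mul, sub_mul, smul_comm_of_central hx, smul_comm_of_central hx,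
      smul_comm_of_central hh, smul_comm_of_central hh, smul_mul_assoc, smul_mul_assoc,
      smul_mul_assoc, smul_mul_assoc, h2, mul_one, mul_one, h1]
  -- Exchanging the two tensor factors turns one side of the numerical equation into the other, and
  -- these are equal by `h3`. So `Z` commutes with `P`, and the coefficients `d` and `ε` play no
  -- role.
  have h4 : permMat N R * Z = Z * permMat N R := by
    have h5 : permMat N R * (x • 1 - h • contMat N R) =
        (x • 1 - h • contMat N R) * permMat N R := by
      rw [mul_sub, sub_mul, smul_comm_of_central hx, smul_comm_of_central hh, smul_mul_assoc,
        smul_mul_assoc, permMat_mul_contMat, mul_one, one_mul]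
    conv_rhs => rw [← h3]
    rw [hZ, ← mul_assoc, ← mul_assoc, permMat_mul_onFirst, mul_assoc (onSecond X), h5, mul_assoc,
      mul_assoc, permMat_mul_onSecond]
    simp only [mul_assoc]
  rw [ReflEq, h3, ← hZ, sub_mul, mul_sub, smul_comm_of_central hd, smul_comm_of_central hε,
    smul_mul_assoc, smul_mul_assoc, h4, one_mul, mul_one]

variable {I : Type*} [Fintype I] [DecidableEq I]

theorem siteHom_eq_sitesHom_onFirst {i j : I} (h : i ≠ j) (X : Matrix (Fin N) (Fin N) R) :
    siteHom i X = sitesHom h (onFirst X) := by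
  have h1 := siteHom_mul_siteHom h X 1
  rw [map_one, mul_one] at h1
  rw [h1]
  congr 1
  ext p q
  simp [onFirst, Matrix.one_apply]

theorem siteHom_eq_sitesHom_onSecond {i j : I} (h : i ≠ j) (X : Matrix (Fin N) (Fin N) R) :
    siteHom j X = sitesHom h (onSecond X) := by
  have h1 := siteHom_mul_siteHom h 1 X
  rw [map_one, one_mul] at h1
  rw [h1]
  congr 1
  ext p q
  simp [onSecond, Matrix.one_apply]

theorem sitesHom_smul {K : Type*} [CommRing K] [Algebra K R] {i j : I} (h : i ≠ j) (a : K)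
    (X : Matrix (Fin N × Fin N) (Fin N × Fin N) R) : sitesHom h (a • X) = a • sitesHom h X := by
  ext p q
  rw [Matrix.smul_apply, sitesHom_apply, sitesHom_apply]
  split_ifs
  · rfl
  · rw [smul_zero]

variable {K : Type*} [CommRing K] [Algebra K R]

theorem sitesHom_contR {i j : I} (hij : i ≠ j) (h : K) (x : I → I → K) :
    contR (unitAt N R) h x i j = sitesHom hij (x i j • 1 - h • contMat N R) := by
  rw [map_sub, sitesHom_smul, sitesHom_smul, map_one, ← cont_unitAt, contR]

theorem sitesHom_permR {i j : I} (hij : i ≠ j) (d ε : K) :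
    permR (unitAt N R) d ε i j = sitesHom hij (d • 1 - ε • permMat N R) := by
  rw [map_sub, sitesHom_smul, sitesHom_smul, map_one, ← perm_unitAt, permR]

/-- The reflection equation on two sites. -/
theorem ReflEq.sites {d ε h : K} {x : I → I → K} {i j : I} (hij : i ≠ j)
    {X Y : Matrix (Fin N) (Fin N) R}
    (H : ReflEq (algebraMap K R d) (algebraMap K R ε) (algebraMap K R (x i j)) (algebraMap K R h)
      X Y) :
    permR (unitAt N R) d ε i j * (siteHom i X * contR (unitAt N R) h x i j * siteHom j Y) =
      siteHom j Y * contR (unitAt N R) h x i j * siteHom i X * permR (unitAt N R) d ε i j := by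
  rw [siteHom_eq_sitesHom_onFirst hij, siteHom_eq_sitesHom_onSecond hij, sitesHom_contR hij,
    sitesHom_permR hij]
  simp only [← map_mul]
  congr 1
  simp only [ReflEq, algebraMap_smul] at H
  exact H

end Reflection

/-! ### The numerical product at the critical level and its inverse -/

section VacuumFactor

variable {N : ℕ}

theorem constantCoeff_substSeries_gSeries (N : ℕ) (y : PowerSeries ℂ) :
    PowerSeries.constantCoeff (substSeries (RingHom.id ℂ) (gSeries N) y) = 1 := by
  rw [← PowerSeries.coeff_zero_eq_constantCoeff_apply, substSeries, PowerSeries.coeff_mk]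
  simp [gSeries, gCoeff]

/-- The transposed R-matrix is a multiple of its cleared form. -/
theorem exists_RBarT_eq (N : ℕ) {a : ℂ} (ha : a ≠ 0) (β : ℂ) :
    ∃ κ : PowerSeries ℂ, IsUnit κ ∧ RBarT N a β =
      κ • ((PowerSeries.C a + PowerSeries.C β * PowerSeries.X) • 1 -
        (PowerSeries.X : PowerSeries ℂ) • contMat N (PowerSeries ℂ)) := by
  have h1 : (PowerSeries.C a + PowerSeries.C β * PowerSeries.X) * shiftInv a β = 1 :=
    PowerSeries.mul_inv_cancel _ (by simpa using ha)
  refine ⟨substSeries (RingHom.id ℂ) (gSeries N) (PowerSeries.X * shiftInv a β) * shiftInv a β,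
    (PowerSeries.isUnit_iff_constantCoeff.2 ?_).mul (IsUnit.of_mul_eq_one_right _ h1), ?_⟩
  · rw [constantCoeff_substSeries_gSeries]
    exact isUnit_one
  · ext1 p q
    simp only [RBarT, partialTranspose, normR, Matrix.of_apply, Matrix.smul_apply, Matrix.sub_apply,
      smul_eq_mul, permMat, contMat, Matrix.one_apply, Prod.ext_iff]
    simp only [eq_comm (a := q.2) (b := p.2), eq_comm (a := q.2) (b := q.1)]
    split_ifs <;> first
      | ring1
      | linear_combination (-substSeries (RingHom.id ℂ) (gSeries N)
          (PowerSeries.X * shiftInv a β)) * h1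

theorem isUnit_siteHom {I R : Type*} [Fintype I] [DecidableEq I] [Ring R] (φ : ℂ →+* R)
    {G : Matrix (Fin N) (Fin N) ℂ} (hG : IsUnit G.det) (i : I) :
    IsUnit (siteHom i (G.map φ)) := by
  have h1 := ((Matrix.isUnit_iff_isUnit_det G).2 hG).map φ.mapMatrix
  exact h1.map (siteHom i)

variable (G : Matrix (Fin N) (Fin N) ℂ) {ν : YoungDiagram} (U : StandardTableau ν)

/-- The cleared form of the vacuum factor. -/
def clearedVacuum : Matrix (Fin ν.card → Fin N) (Fin ν.card → Fin N) (PowerSeries ℂ) :=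
  br (fun i => siteHom i (G.map PowerSeries.C)) (contR (unitAt N (PowerSeries ℂ)) PowerSeries.X
    fun i j => (PowerSeries.C (-2) + (N : PowerSeries ℂ) * PowerSeries.X) -
      PowerSeries.X *
        ((U.content i : PowerSeries ℂ) + (U.content j : PowerSeries ℂ))) (List.finRange ν.card)

variable {G}

/-- The site factors are invertible with `G`, and each two-site factor is inverted by its crossing
partner with argument `h N - x`. -/
theorem isUnit_clearedVacuum (hG : IsUnit G.det) : IsUnit (clearedVacuum G U) := by
  refine isUnit_br (List.nodup_finRange _) (fun i => isUnit_siteHom PowerSeries.C hG i)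
    fun i j hij => ?_
  have he := matrixUnits_unitAt (I := Fin ν.card) (N := N) (R := PowerSeries ℂ)
  set x : Fin ν.card → Fin ν.card → PowerSeries ℂ := fun i j =>
    (PowerSeries.C (-2) + (N : PowerSeries ℂ) * PowerSeries.X) - PowerSeries.X *
        ((U.content i : PowerSeries ℂ) + (U.content j : PowerSeries ℂ))
  have h1 := contR_mul_contR he PowerSeries.X (x := x)
    (y := fun i j => (PowerSeries.X : PowerSeries ℂ) * (N : PowerSeries ℂ) - x i j) hij (by ring)
  have h2 := contR_mul_contR he PowerSeries.X (x := fun i j => (PowerSeries.X : PowerSeries ℂ) * (N : PowerSeries ℂ) - x i j)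
    (y := x) hij (by ring)
  -- The two factors have constant terms `-2` and `2`.
  have h3 : IsUnit (x i j * ((PowerSeries.X : PowerSeries ℂ) * (N : PowerSeries ℂ) - x i j)) := by
    rw [PowerSeries.isUnit_iff_constantCoeff]
    simp [x]
  obtain ⟨w, hw⟩ := h3
  rw [← hw] at h1
  rw [mul_comm (_ - x i j) (x i j), ← hw] at h2
  refine isUnit_iff_exists.2 ⟨(↑w⁻¹ : PowerSeries ℂ) • contR (unitAt N (PowerSeries ℂ))
    PowerSeries.X (fun i j => (PowerSeries.X : PowerSeries ℂ) * (N : PowerSeries ℂ) - x i j) i j, ?_, ?_⟩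
  · rw [mul_smul_comm, h1, smul_smul, Units.inv_mul, one_smul]
  · rw [smul_mul_assoc, h2, smul_smul, Units.inv_mul, one_smul]

/-- The constant matrix `G` satisfies all reflection equations, so the idempotent absorbs the
numerical product. Square matrices over a commutative ring are Dedekind-finite, and absorption
passes to the inverse. -/
theorem clearedVacuum_inv_absorb (hG : IsUnit G.det)
    (hGt : G.transpose = G ∨ G.transpose = -G) :
    (U.idempotentMat N).map PowerSeries.C * (clearedVacuum G U)⁻¹ =
      (U.idempotentMat N).map PowerSeries.C * (clearedVacuum G U)⁻¹ *
        (U.idempotentMat N).map PowerSeries.C := by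
  have hd := (Matrix.isUnit_iff_isUnit_det _).1 (isUnit_clearedVacuum U hG)
  refine absorb_inverse (fun a b => mul_eq_one_comm.1) (F := clearedVacuum G U) ?_ ?_
    (Matrix.mul_nonsing_inv _ hd)
  · have h1 := congrArg (PowerSeries.C (R := ℂ)).mapMatrix
      ((jucysMurphy_unitAt (N := N)).contentProd_idem U.content_mem)
    rwa [map_mul, ← idempotentMat_eq] at h1
  · refine idempotentMat_absorb U PowerSeries.C _ _ (fun _ => G.map PowerSeries.C)
      fun i j hij α β => ReflEq.sites hij ?_
    refine reflEq_of_transpose (fun r => Commute.all _ _) (fun r => Commute.all _ _)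
      (fun r => Commute.all _ _) (fun r => Commute.all _ _) (fun i j r => Commute.all _ _) ?_
    refine hGt.imp (fun h => ?_) fun h => ?_
    · rw [← Matrix.transpose_map, h]
    · rw [← Matrix.transpose_map, h]
      ext1 i j
      simp

/-- At `c = -N/2` the shift `-2 h c` equals `h N`, the shift required by crossing symmetry. -/
theorem exists_vacuumFactor_eq : ∃ κ : PowerSeries ℂ, IsUnit κ ∧
    vacuumFactor G (-(N : ℂ) / 2) U = κ • clearedVacuum G U := by
  rw [vacuumFactor, bracket_eq_br]
  refine br_smul (List.nodup_finRange _) fun i j hij => ?_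
  obtain ⟨κ, hκ, h⟩ := exists_RBarT_eq N (a := -2) (by norm_num)
    (-((U.content i : ℂ) + U.content j) - 2 * (-(N : ℂ) / 2))
  refine ⟨κ, hκ, ?_⟩
  rw [h, sites_eq_sitesHom hij, sitesHom_smul, sitesHom_contR hij]
  congr 5
  have : -((U.content i : ℂ) + U.content j) - 2 * (-(N : ℂ) / 2) =
    N - (U.content i + U.content j) := by ring
  rw [this]
  simp only [map_sub, map_add, map_intCast, map_natCast]
  ring

theorem isUnit_vacuumFactor (hG : IsUnit G.det) : IsUnit (vacuumFactor G (-(N : ℂ) / 2) U) := by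
  obtain ⟨κ, ⟨κ, rfl⟩, h⟩ := exists_vacuumFactor_eq (G := G) U
  rw [h]
  exact (isUnit_clearedVacuum U hG).smul κ

theorem exists_vacuumFactor_inv (hG : IsUnit G.det) :
    ∃ κ : PowerSeries ℂ, IsUnit κ ∧
      (vacuumFactor G (-(N : ℂ) / 2) U)⁻¹ = κ • (clearedVacuum G U)⁻¹ := by
  obtain ⟨κ, ⟨κ, rfl⟩, h⟩ := exists_vacuumFactor_eq (G := G) U
  have hd := (Matrix.isUnit_iff_isUnit_det _).1 (isUnit_clearedVacuum U hG)
  refine ⟨(κ⁻¹ : (PowerSeries ℂ)ˣ), Units.isUnit _, ?_⟩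
  rw [h]
  refine Matrix.inv_eq_right_inv ?_
  rw [smul_mul_smul_comm, Units.mul_inv, one_smul, Matrix.mul_nonsing_inv _ hd]

end VacuumFactor

/-! ### Numerical series with values in the centre of a noncommutative ring -/

section CentralParameters

variable {R : Type*} [Ring R] {N : ℕ} {G : Matrix (Fin N) (Fin N) ℂ} {ν : YoungDiagram}
  (U : StandardTableau ν)

/-- A ring homomorphism to the centre as a ring homomorphism to the ring. -/
def coeHom {S : Type*} [Ring S] (ω : S →+* Subring.center R) : S →+* R :=
  (Subring.subtype _).comp ω

theorem coeHom_commute {S : Type*} [Ring S] (ω : S →+* Subring.center R) (x : S) (r : R) :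
    Commute (coeHom ω x) r :=
  (Subring.mem_center_iff.1 (ω x).2 r).symm

theorem map_smul_coeHom {S m : Type*} [CommRing S] (ω : S →+* Subring.center R) (x : S)
    (Y : Matrix m m S) : (x • Y).map (coeHom ω) = ω x • Y.map (coeHom ω) := by
  ext i j
  simp [coeHom, Subring.smul_def]

theorem coeHom_mapMatrix_contR {I S : Type*} [CommRing S] [Fintype I] [DecidableEq I]
    (ω : S →+* Subring.center R) (h : S) (x : I → I → S) (i j : I) :
    (coeHom ω).mapMatrix (contR (unitAt N S) h x i j) =
      contR (unitAt N R) (ω h) (fun i j => ω (x i j)) i j := by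
  have h1 : ∀ (a : S) (Y : Matrix (I → Fin N) (I → Fin N) S),
      (coeHom ω).mapMatrix (a • Y) = ω a • (coeHom ω).mapMatrix Y := fun a Y =>
    map_smul_coeHom ω a Y
  have h2 := map_cont (f := id) (coeHom ω).mapMatrix (e := unitAt N S) (e' := unitAt N R)
    (fun i k l => map_unitAt (coeHom ω) i k l) i j
  rw [contR, contR, map_sub, h1, h1, map_one, h2]
  rfl

theorem contR_mul_left {K A I : Type*} [CommRing K] [Ring A] [Algebra K A]
    (e : I → Fin N → Fin N → A) (a h : K) (x : I → I → K) (i j : I) :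
    contR e (a * h) (fun i j => a * x i j) i j = a • contR e h x i j := by
  rw [contR, contR, smul_sub, smul_smul, smul_smul]

variable (ω : PowerSeries ℂ →+* Subring.center R) (υ : Subring.center R)

/-- The parameter `h` in terms of `w = h / u`. -/
def hOf : Subring.center R := υ * ω PowerSeries.X

variable {υ}

/-- The inverse of the numerical product with central parameters. -/
theorem exists_vacuum_inverse (hυ : IsUnit υ) (hG : IsUnit G.det)
    (hGt : G.transpose = G ∨ G.transpose = -G) :
    ∃ (κ : Subring.center R) (D : Matrix (Fin ν.card → Fin N) (Fin ν.card → Fin N) R),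
      (∀ a b r, Commute (D a b) r) ∧
      (U.idempotentMat N).map (coeHom (ω.comp PowerSeries.C)) * D =
        (U.idempotentMat N).map (coeHom (ω.comp PowerSeries.C)) * D *
          (U.idempotentMat N).map (coeHom (ω.comp PowerSeries.C)) ∧
      br (fun i => siteHom i (G.map (coeHom (ω.comp PowerSeries.C))))
        (contR (unitAt N R) (hOf ω υ) fun i j => hOf ω υ * N - (υ + hOf ω υ * U.content i) -
          (υ + hOf ω υ * U.content j)) (List.finRange ν.card) * D = 1 ∧
      D * br (fun i => siteHom i (G.map (coeHom (ω.comp PowerSeries.C))))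
        (contR (unitAt N R) (hOf ω υ) fun i j => hOf ω υ * N - (υ + hOf ω υ * U.content i) -
          (υ + hOf ω υ * U.content j)) (List.finRange ν.card) = 1 ∧
      ((vacuumFactor G (-(N : ℂ) / 2) U)⁻¹).map (coeHom ω) = κ • D := by
  set Ω := (coeHom ω).mapMatrix (m := Fin ν.card → Fin N) with hΩ
  set F := br (fun i => siteHom i (G.map (coeHom (ω.comp PowerSeries.C))))
        (contR (unitAt N R) (hOf ω υ) fun i j => hOf ω υ * N - (υ + hOf ω υ * U.content i) -
          (υ + hOf ω υ * U.content j)) (List.finRange ν.card) with hF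
  have h1 : ∃ κ : Subring.center R, IsUnit κ ∧ F = κ • Ω (clearedVacuum G U) := by
    have h2 := map_br Ω id (s := fun i => siteHom i (G.map PowerSeries.C))
      (q := contR (unitAt N (PowerSeries ℂ)) PowerSeries.X
        fun i j => (PowerSeries.C (-2) + (N : PowerSeries ℂ) * PowerSeries.X) -
          PowerSeries.X *
        ((U.content i : PowerSeries ℂ) + (U.content j : PowerSeries ℂ)))
      (s' := fun i => siteHom i (G.map (coeHom (ω.comp PowerSeries.C))))
      (q' := contR (unitAt N R) (ω PowerSeries.X) fun i j => ω ((PowerSeries.C (-2) +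
        (N : PowerSeries ℂ) * PowerSeries.X) - PowerSeries.X *
        ((U.content i : PowerSeries ℂ) + (U.content j : PowerSeries ℂ))))
      (List.nodup_finRange _)
      (fun i _ => (map_siteHom (coeHom ω) i _).trans rfl)
      (fun i _ j _ _ => coeHom_mapMatrix_contR ω _ _ _ _)
    rw [clearedVacuum, h2, List.map_id, hF]
    -- Multiplication by `υ`, which stands for `u`, clears denominators: `υ` times the image of `-2
    -- + (N - c_i - c_j) w` is `h N - z_i - z_j` with `z_i = υ + h c_i`.
    refine br_smul (List.nodup_finRange _) fun i j hij => ⟨υ, hυ, ?_⟩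
    rw [← contR_mul_left]
    congr 1
    funext i j
    simp only [hOf, map_sub, map_add, map_mul, map_intCast, map_natCast, map_neg, map_ofNat]
    ring
  obtain ⟨κ, hκ, hF'⟩ := h1
  obtain ⟨κ, rfl⟩ := hκ
  obtain ⟨κ', hκ', hV⟩ := exists_vacuumFactor_inv U hG
  have hd := (Matrix.isUnit_iff_isUnit_det _).1 (isUnit_clearedVacuum U hG)
  have hE : (U.idempotentMat N).map (coeHom (ω.comp PowerSeries.C)) =
      Ω ((U.idempotentMat N).map PowerSeries.C) := rfl
  refine ⟨ω κ' * κ, (↑κ⁻¹ : Subring.center R) • Ω (clearedVacuum G U)⁻¹, ?_, ?_, ?_, ?_, ?_⟩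
  · intro a b r
    rw [Matrix.smul_apply, Subring.smul_def, smul_eq_mul]
    have h3 : Commute ((↑κ⁻¹ : Subring.center R) : R) r :=
      (Subring.mem_center_iff.1 (Subtype.prop _) r).symm
    exact h3.mul_left (coeHom_commute ω _ r)
  · rw [hE, mul_smul_comm, smul_mul_assoc, ← map_mul, ← map_mul, ← clearedVacuum_inv_absorb U hG hGt]
  · rw [hF', smul_mul_smul_comm, Units.mul_inv, one_smul, ← map_mul, Matrix.mul_nonsing_inv _ hd,
      map_one]
  · rw [hF', smul_mul_smul_comm, Units.inv_mul, one_smul, ← map_mul, Matrix.nonsing_inv_mul _ hd,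
      map_one]
  · rw [hV, map_smul_coeHom, smul_smul, mul_assoc, Units.mul_inv, mul_one]
    rfl

/-- The ordered product of normalized operators is a multiple of the product of cleared ones. -/
theorem exists_bracket_eq (hυ : IsUnit υ) (X : ℤ → Matrix (Fin N) (Fin N) R) :
    ∃ κ : Subring.center R, bracket (fun i => X (U.content i))
        (fun i j => (RBarT N (-2) (-((U.content i : ℂ) + U.content j))).map (coeHom ω)) =
      κ • br (fun i => siteHom i (X (U.content i)))
        (contR (unitAt N R) (hOf ω υ) fun i j => -(υ + hOf ω υ * U.content i) -
          (υ + hOf ω υ * U.content j)) (List.finRange ν.card) := by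
  obtain ⟨u, rfl⟩ := hυ
  rw [bracket_eq_br]
  obtain ⟨κ, _, h⟩ := br_smul (K := Subring.center R) (s := fun i => siteHom i (X (U.content i)))
    (q := fun i j => sites i j ((RBarT N (-2) (-((U.content i : ℂ) + U.content j))).map (coeHom ω)))
    (q' := contR (unitAt N R) (hOf ω (u : Subring.center R)) fun i j => -(u + hOf ω u * U.content i) -
          (u + hOf ω u * U.content j)) (List.nodup_finRange ν.card) fun i j hij => by
      obtain ⟨κ, hκ, h⟩ := exists_RBarT_eq N (a := -2) (by norm_num)
        (-((U.content i : ℂ) + U.content j))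
      refine ⟨ω κ * ↑u⁻¹, (hκ.map ω).mul (Units.isUnit _), ?_⟩
      have h1 := coeHom_mapMatrix_contR (N := N) ω PowerSeries.X (fun _ _ : Fin ν.card => PowerSeries.C (-2) +
        PowerSeries.C (-((U.content i : ℂ) + U.content j)) * PowerSeries.X) i j
      have h2 : sites i j ((RBarT N (-2) (-((U.content i : ℂ) + U.content j))).map (coeHom ω)) =
          (coeHom ω).mapMatrix (sites i j (RBarT N (-2) (-((U.content i : ℂ) + U.content j)))) :=
        (map_sites (coeHom ω) i j _).symm
      rw [h2, h, sites_eq_sitesHom hij, sitesHom_smul]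
      rw [sitesHom_contR hij] at h1
      refine (map_smul_coeHom ω κ _).trans ?_
      rw [mul_smul]
      congr 1
      refine h1.trans ?_
      rw [← one_smul (Subring.center R) (contR _ _ _ i j), ← Units.inv_mul u, mul_smul,
        ← contR_mul_left]
      congr 1
      rw [contR, contR]
      congr 2
      simp only [hOf, map_add, map_mul, map_intCast, map_neg, map_ofNat]
      ring
  exact ⟨κ, h⟩

end CentralParameters

/-! ### Commuting traces of two tableaux -/

section CommutingTraces

variable {R : Type*} [Ring R] {N : ℕ} {G : Matrix (Fin N) (Fin N) ℂ}

theorem cyc_of_commute {m : Type*} [Fintype m] [DecidableEq m] {Y : Matrix m m R}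
    (hY : ∀ a b r, Commute (Y a b) r) : Cyc (Matrix.traceLinearMap m (Subring.center R) R) Y := by
  intro F
  simp only [Matrix.traceLinearMap_apply, Matrix.trace, Matrix.diag_apply, Matrix.mul_apply]
  rw [Finset.sum_comm]
  exact Finset.sum_congr rfl fun a _ => Finset.sum_congr rfl fun b _ => (hY _ _ _).eq

theorem emb_apply_commute {I J : Type*} {f : J → I} {Y : Matrix (J → Fin N) (J → Fin N) R}
    (hY : ∀ a b r, Commute (Y a b) r) (a b : I → Fin N) (r : R) : Commute (emb f Y a b) r := by
  rw [emb, Matrix.of_apply]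
  split_ifs
  · exact hY _ _ r
  · exact Commute.zero_left r

theorem emb_br {I J : Type*} [Fintype I] [DecidableEq I] [Fintype J] [DecidableEq J] {f : J → I}
    (hf : Function.Injective f) {X : J → Matrix (Fin N) (Fin N) R}
    {Y : I → Matrix (Fin N) (Fin N) R} (h : Subring.center R) {x : J → J → Subring.center R}
    {y : I → I → Subring.center R} {l : List J} (hl : l.Nodup) (hX : ∀ i, X i = Y (f i))
    (hx : ∀ i j, x i j = y (f i) (f j)) :
    embHom hf (br (fun i => siteHom i (X i)) (contR (unitAt N R) h x) l) =
      br (fun i => siteHom i (Y i)) (contR (unitAt N R) h y) (l.map f) := by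
  refine map_br (embHom (κ := Fin N) (R := R) hf) f hl (fun i _ => ?_) fun i _ j _ _ => ?_
  · rw [hX]
    exact emb_siteHom hf i _
  · exact emb_contR hf h i j (hx i j)

/-- The normalized trace attached to a standard tableau. -/
def tableauTrace (G : Matrix (Fin N) (Fin N) ℂ) {ν : YoungDiagram} (U : StandardTableau ν)
    (ω : PowerSeries ℂ →+* Subring.center R) (X : ℤ → Matrix (Fin N) (Fin N) R) : R :=
  Matrix.trace ((U.idempotentMat N).map (coeHom (ω.comp PowerSeries.C)) *
    bracket (fun i => X (U.content i))
      (fun i j => (RBarT N (-2) (-((U.content i : ℂ) + U.content j))).map (coeHom ω)) *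
    ((vacuumFactor G (-(N : ℂ) / 2) U)⁻¹).map (coeHom ω))

/-- The reflection equations for all integral shifts of the arguments. -/
def ShiftReflEq (h υ : Subring.center R) (X : ℤ → Matrix (Fin N) (Fin N) R) : Prop :=
  ∀ α β : ℤ, ReflEq ((α - β : ℤ) : R) 1 ((-(υ + h * α) - (υ + h * β) : Subring.center R) : R)
    (h : R) (X α) (X β)

variable {ν μ : YoungDiagram} (U : StandardTableau ν) (V : StandardTableau μ)

/-- The data attached to a tableau, transported to a larger set of sites. -/
theorem exists_block (hG : IsUnit G.det) (hGt : G.transpose = G ∨ G.transpose = -G)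
    {ω : PowerSeries ℂ →+* Subring.center R} {υ : Subring.center R} (hυ : IsUnit υ)
    {X : ℤ → Matrix (Fin N) (Fin N) R} (hX : ShiftReflEq (hOf ω υ) υ X) {h : Subring.center R}
    (hh : hOf ω υ = h) {φ : ℂ →+* R} (hφ : coeHom (ω.comp PowerSeries.C) = φ) :
    ∃ (κ : Subring.center R) (D : Matrix (Fin ν.card → Fin N) (Fin ν.card → Fin N) R),
      (∀ a b r, Commute (D a b) r) ∧
      tableauTrace G U ω X = κ • Matrix.trace ((U.idempotentMat N).map φ *
        br (fun i => siteHom i (X (U.content i)))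
          (contR (unitAt N R) h fun i j => -(υ + h * U.content i) - (υ + h * U.content j))
            (List.finRange ν.card) * D) ∧
      ∀ {I : Type} [Fintype I] [DecidableEq I] {f : Fin ν.card → I}
        (_ : Function.Injective f) (Y : I → Matrix (Fin N) (Fin N) R) (z c : I → Subring.center R),
        (∀ k, Y (f k) = X (U.content k)) → (∀ k, z (f k) = υ + h * c (f k)) →
        (∀ k, c (f k) = U.content k) →
        Block (Matrix.traceLinearMap (I → Fin N) (Subring.center R) R) (unitAt N R)
          (fun i => siteHom i (Y i)) (fun i => siteHom i (G.map φ)) h (fun i j => -z i - z j)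
          (fun i j => h * N - z i - z j) ((List.finRange ν.card).map f) c
          (emb f ((U.idempotentMat N).map φ)) (emb f D) := by
  subst hh hφ
  obtain ⟨κ, D, hD, hED, hFD, hDF, hV⟩ := exists_vacuum_inverse U ω hυ hG hGt
  obtain ⟨κ', hS⟩ := exists_bracket_eq U ω hυ X
  have hEc : ∀ a b r, Commute ((U.idempotentMat N).map (coeHom (ω.comp PowerSeries.C)) a b) r :=
    fun a b r => coeHom_commute (ω.comp PowerSeries.C) _ r
  refine ⟨κ * κ', D, hD, ?_, ?_⟩
  · rw [tableauTrace, hS, hV, mul_smul_comm, mul_smul_comm, smul_mul_assoc, smul_smul,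
      Matrix.trace_smul]
  · intro I _ _ f hf Y z c hY hz hc
    have hz' : ∀ k, z (f k) = υ + hOf ω υ * U.content k := fun k => by rw [hz, hc]
    have hl : ∀ i, i ∉ (List.finRange ν.card).map f → ∀ j, f j ≠ i := fun i hi j hj =>
      hi (List.mem_map.2 ⟨j, List.mem_finRange j, hj⟩)
    have hnd := List.nodup_finRange ν.card
    have hbs : embHom hf (br (fun i => siteHom i (X (U.content i)))
        (contR (unitAt N R) (hOf ω υ) fun i j => -(υ + hOf ω υ * U.content i) -
          (υ + hOf ω υ * U.content j)) (List.finRange ν.card)) =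
        br (fun i => siteHom i (Y i)) (contR (unitAt N R) (hOf ω υ) fun i j => -z i - z j)
          ((List.finRange ν.card).map f) :=
      emb_br hf _ hnd (fun i => (hY i).symm) fun i j => by rw [hz', hz']
    have hbg : embHom hf (br (fun i => siteHom i (G.map (coeHom (ω.comp PowerSeries.C))))
        (contR (unitAt N R) (hOf ω υ) fun i j => hOf ω υ * N - (υ + hOf ω υ * U.content i) -
          (υ + hOf ω υ * U.content j)) (List.finRange ν.card)) =
        br (fun i => siteHom i (G.map (coeHom (ω.comp PowerSeries.C))))
          (contR (unitAt N R) (hOf ω υ) fun i j => hOf ω υ * N - z i - z j)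
          ((List.finRange ν.card).map f) :=
      emb_br hf _ hnd (X := fun _ => G.map (coeHom (ω.comp PowerSeries.C)))
        (Y := fun _ => G.map (coeHom (ω.comp PowerSeries.C))) (fun i => rfl)
        fun i j => by rw [hz', hz']
    -- The arguments `-(υ + h α) - (υ + h β)` have the form `ξ - h (α + β)` with `ξ = -2 υ`.
    have habs := idempotentMat_absorb U (coeHom (ω.comp PowerSeries.C)) (-2 * υ) (hOf ω υ) X
      fun i j hij α β => ReflEq.sites hij (by
        have h1 := hX α β
        convert h1 using 1
        · simp
        · simp
        · refine congrArg (algebraMap (Subring.center R) R)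
            (?_ : _ = -(υ + hOf ω υ * (α : Subring.center R)) - (υ + hOf ω υ * β))
          ring
        · rfl)
    have hx : (fun i j : Fin ν.card => -2 * υ - hOf ω υ * ((U.content i : Subring.center R) +
        U.content j)) = fun i j => -(υ + hOf ω υ * U.content i) - (υ + hOf ω υ * U.content j) := by
      funext i j
      ring
    rw [hx] at habs
    refine { contentIdempotent_emb U hf (coeHom (ω.comp PowerSeries.C)) (coeHom_commute _) hc with
      comm_s := fun i hi => emb_commute_siteHom (hl i hi) hEc _
      absorb_s := ?_
      absorb_inv := ?_
      inv_comm_unit := fun i hi k n => emb_commute_siteHom (hl i hi) hD _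
      inv_comm_s := fun i hi => emb_commute_siteHom (hl i hi) hD _
      cyc := cyc_of_commute (emb_apply_commute hEc)
      cyc_inv := cyc_of_commute (emb_apply_commute hD)
      mul_inv := ?_
      inv_mul := ?_ }
    · have h1 := congrArg (embHom hf) habs
      rwa [map_mul, map_mul, map_mul, hbs] at h1
    · have h1 := congrArg (embHom hf) hED
      rwa [map_mul, map_mul, map_mul] at h1
    · have h1 := congrArg (embHom hf) hFD
      rwa [map_mul, hbg, map_one] at h1
    · have h1 := congrArg (embHom hf) hDF
      rwa [map_mul, hbg, map_one] at h1

set_option maxHeartbeats 1000000 in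
/-- Normalized traces in independent variables commute, if the reflection equations hold. -/
theorem tableauTrace_commute (hG : IsUnit G.det) (hGt : G.transpose = G ∨ G.transpose = -G)
    {ω ω' : PowerSeries ℂ →+* Subring.center R} {υ υ' : Subring.center R} (hυ : IsUnit υ)
    (hυ' : IsUnit υ') {X X' : ℤ → Matrix (Fin N) (Fin N) R} (hX : ShiftReflEq (hOf ω υ) υ X)
    (hX' : ShiftReflEq (hOf ω' υ') υ' X') {h : Subring.center R} (hh : hOf ω υ = h)
    (hh' : hOf ω' υ' = h) (hC : ω.comp PowerSeries.C = ω'.comp PowerSeries.C)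
    (hnil : IsNilpotent h) (hsub : IsUnit (υ - υ')) (hadd : IsUnit (υ + υ'))
    (hXX' : ∀ α β : ℤ, ReflEq (((υ + h * α) - (υ' + h * β) : Subring.center R) : R) (h : R)
      ((-(υ + h * α) - (υ' + h * β) : Subring.center R) : R) (h : R) (X α) (X' β)) :
    tableauTrace G U ω X * tableauTrace G V ω' X' =
      tableauTrace G V ω' X' * tableauTrace G U ω X := by
  obtain ⟨φ, hφ⟩ : ∃ φ, coeHom (ω.comp PowerSeries.C) = φ := ⟨_, rfl⟩
  have hφ' : coeHom (ω'.comp PowerSeries.C) = φ := by rw [← hC, hφ]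
  obtain ⟨κ, D, hD, htr, hB⟩ := exists_block U hG hGt hυ hX hh hφ
  obtain ⟨κ', D', hD', htr', hB'⟩ := exists_block V hG hGt hυ' hX' hh' hφ'
  have hφc : ∀ z r, Commute (φ z) r := by rw [← hφ]; exact coeHom_commute _
  -- The sites of both tableaux side by side; each of the two sets carries its own variable.
  set I := Fin ν.card ⊕ Fin μ.card
  set Y : I → Matrix (Fin N) (Fin N) R :=
    Sum.elim (fun i => X (U.content i)) fun j => X' (V.content j)
  set c : I → Subring.center R := Sum.elim (fun i => U.content i) fun j => V.content j with hc
  set z : I → Subring.center R := Sum.elim (fun i => υ + h * c (Sum.inl i))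
    fun j => υ' + h * c (Sum.inr j) with hz
  have b := hB (f := (Sum.inl : _ → I)) Sum.inl_injective Y z c (fun k => rfl) (fun k => rfl)
    fun k => rfl
  have b' := hB' (f := (Sum.inr : _ → I)) Sum.inr_injective Y z c (fun k => rfl) (fun k => rfl)
    fun k => rfl
  have hEc : ∀ a b r, Commute ((U.idempotentMat N).map φ a b) r := fun a b r => hφc _ r
  have hEc' : ∀ a b r, Commute ((V.idempotentMat N).map φ a b) r := fun a b r => hφc _ r
  have hlr : ∀ (i : Fin ν.card) (j : Fin μ.card), (Sum.inl i : I) ≠ Sum.inr j :=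
    fun i j => Sum.inl_ne_inr
  have hsc : ∀ (Y : I → Matrix (Fin N) (Fin N) R) i j, i ≠ j → ∀ k l,
      Commute (siteHom i (Y i)) (unitAt N R j k l) := fun Y i j hij k l =>
    siteHom_commute_unitAt hij _ _ _
  have H : BlockPair (Matrix.traceLinearMap (I → Fin N) (Subring.center R) R) (unitAt N R)
      (fun i => siteHom i (Y i)) (fun i => siteHom i (G.map φ)) h
      ((List.finRange ν.card).map Sum.inl) c (emb Sum.inl ((U.idempotentMat N).map φ))
      (emb Sum.inl D) ((List.finRange μ.card).map Sum.inr) c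
      (emb Sum.inr ((V.idempotentMat N).map φ)) (emb Sum.inr D') z υ υ' :=
    { units := matrixUnits_unitAt
      cycUnits := fun i k n => cyc_of_commute (emb_apply_commute fun a b r =>
        commute_single_one _ _ _ _ r)
      s_comm := hsc _
      nodup := by
        rw [List.nodup_append]
        refine ⟨(List.nodup_finRange _).map Sum.inl_injective,
          (List.nodup_finRange _).map Sum.inr_injective, ?_⟩
        intro a ha b hb
        obtain ⟨i, _, rfl⟩ := List.mem_map.1 ha
        obtain ⟨j, _, rfl⟩ := List.mem_map.1 hb
        exact hlr i j
      left := b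
      right := b'
      comm_idem := emb_commute_emb hlr fun _ _ _ _ => hEc _ _ _
      comm_idem_inv := emb_commute_emb hlr fun _ _ _ _ => hEc _ _ _
      comm_inv_idem := emb_commute_emb hlr fun _ _ _ _ => hD _ _ _
      comm_inv := emb_commute_emb hlr fun _ _ _ _ => hD _ _ _
      nilpotent := hnil
      arg_left := by
        intro i hi
        obtain ⟨i, _, rfl⟩ := List.mem_map.1 hi
        rfl
      arg_right := by
        intro i hi
        obtain ⟨i, _, rfl⟩ := List.mem_map.1 hi
        rfl
      isUnit_sub := hsub
      isUnit_add := hadd }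
  have key := H.trace_mul_comm (fun i j hij k l => siteHom_commute_unitAt hij _ _ _) (by
      intro i hi j hj
      obtain ⟨i, _, rfl⟩ := List.mem_map.1 hi
      obtain ⟨j, _, rfl⟩ := List.mem_map.1 hj
      exact ReflEq.sites (hlr i j) (hXX' (U.content i) (V.content j))) (by
      intro i hi j hj
      obtain ⟨i, _, rfl⟩ := List.mem_map.1 hi
      obtain ⟨j, _, rfl⟩ := List.mem_map.1 hj
      refine ReflEq.sites (hlr i j) (reflEq_of_transpose (Algebra.commutes _) (Algebra.commutes _)
        (Algebra.commutes _) (Algebra.commutes _)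
        (fun i j r => by rw [Matrix.map_apply]; exact hφc _ r) ?_)
      refine hGt.imp (fun h => ?_) fun h => ?_
      · rw [← Matrix.transpose_map, h]
      · rw [← Matrix.transpose_map, h]
        ext1 i j
        simp)
  -- Both ordered products are images of products on the separate tensor powers, so that the traces
  -- over all the sites factor.
  have hW : embHom Sum.inl_injective (br (fun i => siteHom i (X (U.content i)))
      (contR (unitAt N R) h fun i j => -(υ + h * U.content i) - (υ + h * U.content j))
        (List.finRange ν.card)) =
      br (fun i => siteHom i (Y i)) (contR (unitAt N R) h fun i j => -z i - z j)
        ((List.finRange ν.card).map (Sum.inl : _ → I)) :=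
    emb_br Sum.inl_injective h (List.nodup_finRange _) (fun i => rfl) fun i j => rfl
  have hW' : embHom Sum.inr_injective (br (fun i => siteHom i (X' (V.content i)))
      (contR (unitAt N R) h fun i j => -(υ' + h * V.content i) - (υ' + h * V.content j))
        (List.finRange μ.card)) =
      br (fun i => siteHom i (Y i)) (contR (unitAt N R) h fun i j => -z i - z j)
        ((List.finRange μ.card).map (Sum.inr : _ → I)) :=
    emb_br Sum.inr_injective h (List.nodup_finRange _) (fun i => rfl) fun i j => rfl
  have hE : ∀ Z : Matrix (Fin ν.card → Fin N) (Fin ν.card → Fin N) R,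
      (emb Sum.inl Z : Matrix (I → Fin N) (I → Fin N) R) = embHom Sum.inl_injective Z := fun _ => rfl
  have hE' : ∀ Z : Matrix (Fin μ.card → Fin N) (Fin μ.card → Fin N) R,
      (emb Sum.inr Z : Matrix (I → Fin N) (I → Fin N) R) = embHom Sum.inr_injective Z := fun _ => rfl
  rw [← hW, ← hW', hE, hE, hE', hE', ← map_mul, ← map_mul, ← map_mul, ← map_mul, ← hE, ← hE',
    Matrix.traceLinearMap_apply, Matrix.traceLinearMap_apply, trace_emb_mul_emb,
    trace_emb_mul_emb'] at key
  rw [htr, htr', smul_mul_smul_comm, smul_mul_smul_comm, key, mul_comm κ]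

end CommutingTraces

/-! ### From the `RTT` relations to the reflection equation -/

section RTT

variable {R : Type*} [Ring R] {N : ℕ}

/-- The `RTT` relation `(d - h P) X₁ Y₂ = Y₂ X₁ (d - h P)`, written with matrix entries. -/
def RTT (d h : R) (X Y : Matrix (Fin N) (Fin N) R) : Prop :=
  ∀ i j k l, d * (X i k * Y j l - Y j l * X i k) = h * (X j k * Y i l - Y j k * X i l)

theorem rtt_iff {d h : R} (hd : ∀ r, Commute d r) (hh : ∀ r, Commute h r)
    {X Y : Matrix (Fin N) (Fin N) R} : RTT d h X Y ↔
      (d • 1 - h • permMat N R) * onFirst X * onSecond Y =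
        onSecond Y * onFirst X * (d • 1 - h • permMat N R) := by
  have h1 : ∀ p q, ((d • 1 - h • permMat N R) * onFirst X * onSecond Y) p q =
      d * (X p.1 q.1 * Y p.2 q.2) - h * (X p.2 q.1 * Y p.1 q.2) := by
    intro p q
    rw [mul_assoc, sub_mul, smul_mul_assoc, smul_mul_assoc, one_mul, Matrix.sub_apply,
      Matrix.smul_apply, Matrix.smul_apply, permMat_mul_apply, onFirst_mul_onSecond_apply,
      onFirst_mul_onSecond_apply, smul_eq_mul, smul_eq_mul]
  have h2 : ∀ p q, (onSecond Y * onFirst X * (d • 1 - h • permMat N R)) p q =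
      d * (Y p.2 q.2 * X p.1 q.1) - h * (Y p.2 q.1 * X p.1 q.2) := by
    intro p q
    rw [mul_sub, smul_comm_of_central hd, smul_comm_of_central hh, mul_one, Matrix.sub_apply,
      Matrix.smul_apply, Matrix.smul_apply, mul_permMat_apply, onSecond_mul_onFirst_apply,
      onSecond_mul_onFirst_apply, smul_eq_mul, smul_eq_mul]
  constructor
  · intro H
    ext p q
    rw [h1, h2]
    have h3 := H p.1 p.2 q.1 q.2
    rw [mul_sub, mul_sub] at h3
    rw [sub_eq_sub_iff_add_eq_add] at h3 ⊢
    rw [h3]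
    exact add_comm _ _
  · intro H i j k l
    have h3 := congrFun (congrFun H (i, j)) (k, l)
    rw [h1, h2, sub_eq_sub_iff_add_eq_add] at h3
    rw [mul_sub, mul_sub, sub_eq_sub_iff_add_eq_add, h3]
    exact add_comm _ _

theorem RTT.map {R' : Type*} [Ring R'] (f : R →+* R') {d h : R} {X Y : Matrix (Fin N) (Fin N) R}
    (H : RTT d h X Y) : RTT (f d) (f h) (X.map f) (Y.map f) := fun i j k l => by
  have h1 := congrArg f (H i j k l)
  simpa only [map_mul, map_sub, Matrix.map_apply] using h1

/-- The `RTT` relation with the R-matrix on the other side. -/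
theorem RTT.swap {d h : R} (hd : ∀ r, Commute d r)
    (hreg : ∀ x, (d * d - h * h) * x = 0 → x = 0) {X Y : Matrix (Fin N) (Fin N) R}
    (H : RTT d h X Y) : RTT (-d) h X.transpose Y.transpose := by
  intro i j k l
  simp only [Matrix.transpose_apply]
  have h1 := H k l i j
  have h2 := H l k j i
  have h3 := H l k i j
  have h4 := H k l j i
  set a := X k i * Y l j - Y l j * X k i
  set b := X l j * Y k i - Y k i * X l j
  have e1 : d * (a + b) = -(h * ((X k j * Y l i - Y l i * X k j) +
      (X l i * Y k j - Y k j * X l i))) * (-1) := by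
    rw [mul_add, h1, h2]
    noncomm_ring
  have e2 : d * ((X k j * Y l i - Y l i * X k j) + (X l i * Y k j - Y k j * X l i)) =
      h * (a + b) := by
    rw [mul_add, h3, h4]
    simp only [a, b]
    noncomm_ring
  -- The symmetrized commutator is annihilated by `d² - h²`: by the relations, multiplication by `d`
  -- takes each of two such sums to `h` times the other.
  have e3 : (X k j * Y l i - Y l i * X k j) + (X l i * Y k j - Y k j * X l i) = 0 := by
    refine hreg _ ?_
    rw [sub_mul, mul_assoc, e2, (hd h).left_comm, e1, mul_assoc]
    noncomm_ring
  rw [neg_mul, h1, ← sub_eq_zero]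
  have e4 := congrArg (h * ·) e3
  simp only [mul_zero] at e4
  rw [← neg_eq_zero, ← e4]
  noncomm_ring

/-- The `RTT` relation after a transposition in the first tensor factor. -/
theorem RTT.transpose_first {d h : R} (hd : ∀ r, Commute d r) (hh : ∀ r, Commute h r)
    {X Y : Matrix (Fin N) (Fin N) R} (H : RTT d h X Y) :
    onFirst X.transpose * (d • 1 - h • contMat N R) * onSecond Y =
      onSecond Y * (d • 1 - h • contMat N R) * onFirst X.transpose := by
  rw [mul_sub, sub_mul, mul_sub, sub_mul, smul_comm_of_central hd, smul_comm_of_central hd,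
    smul_comm_of_central hh, smul_comm_of_central hh]
  ext p q
  simp only [smul_mul_assoc, mul_one, Matrix.sub_apply, Matrix.smul_apply, smul_eq_mul,
    onFirst_mul_onSecond_apply, onSecond_mul_onFirst_apply, onFirst_contMat_onSecond_apply,
    onSecond_contMat_onFirst_apply, Matrix.transpose_apply]
  have h3 := H q.1 p.2 p.1 q.2
  rw [mul_sub, mul_sub, sub_eq_sub_iff_add_eq_add] at h3
  rw [sub_eq_sub_iff_add_eq_add, h3]
  exact add_comm _ _

theorem onFirst_commute_onSecond {X Y : Matrix (Fin N) (Fin N) R}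
    (h : ∀ i j k l, Commute (X i j) (Y k l)) : Commute (onFirst X) (onSecond Y) := by
  ext p q
  rw [onFirst_mul_onSecond_apply, onSecond_mul_onFirst_apply, (h _ _ _ _).eq]

/-- Sklyanin's construction: the matrices `X G X'ᵗ` and `Y G Y'ᵗ` satisfy the reflection
equation. -/
theorem reflEq_of_rtt {d x h : R} (hd : ∀ r, Commute d r) (hx : ∀ r, Commute x r)
    (hh : ∀ r, Commute h r) {X X' Y Y' G : Matrix (Fin N) (Fin N) R}
    (hG : ∀ i j r, Commute (G i j) r) (hGt : G.transpose = G ∨ G.transpose = -G)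
    (h1 : RTT d h X Y) (h2 : RTT x h X' Y) (h3 : RTT x h X.transpose Y'.transpose)
    (h4 : RTT d h X'.transpose Y'.transpose) :
    ReflEq d h x h (X * G * X'.transpose) (Y * G * Y'.transpose) := by
  have e1 := (rtt_iff hd hh).1 h1
  have e2 := h2.transpose_first hx hh
  have e3 := h3.transpose_first hx hh
  have e4 := (rtt_iff hd hh).1 h4
  have e5 := reflEq_of_transpose hd hh hx hh hG hGt
  rw [Matrix.transpose_transpose] at e3
  have c1 : onFirst G * onSecond Y = onSecond Y * onFirst G :=
    onFirst_commute_onSecond fun i j k l => hG i j _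
  have c2 : onFirst G * onSecond Y'.transpose = onSecond Y'.transpose * onFirst G :=
    onFirst_commute_onSecond fun i j k l => hG i j _
  have c3 : onFirst X * onSecond G = onSecond G * onFirst X :=
    onFirst_commute_onSecond fun i j k l => (hG k l _).symm
  have c4 : onFirst X'.transpose * onSecond G = onSecond G * onFirst X'.transpose :=
    onFirst_commute_onSecond fun i j k l => (hG k l _).symm
  rw [ReflEq] at e5 ⊢
  simp only [← onFirst_mul_onFirst, ← onSecond_mul_onSecond]
  set D := d • 1 - h • permMat N R
  set K := x • 1 - h • contMat N R
  -- The R-matrix moves from left to right through the product. It passes `X`, `Y` by `e1`, the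
  -- matrices `G` by the numerical reflection equation `e5`, and the transposed matrices by `e4`;
  -- the relations `e2` and `e3` bring the factors into position.
  calc D * (onFirst X * onFirst G * onFirst X'.transpose * K *
        (onSecond Y * onSecond G * onSecond Y'.transpose))
      = D * onFirst X * onFirst G * (onFirst X'.transpose * K * onSecond Y) * onSecond G *
          onSecond Y'.transpose := by simp only [mul_assoc]
    _ = D * onFirst X * (onFirst G * onSecond Y) * K * (onFirst X'.transpose * onSecond G) *
          onSecond Y'.transpose := by rw [e2]; simp only [mul_assoc]
    _ = (D * onFirst X * onSecond Y) * onFirst G * K * onSecond G * onFirst X'.transpose *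
          onSecond Y'.transpose := by rw [c1, c4]; simp only [mul_assoc]
    _ = onSecond Y * onFirst X * (D * (onFirst G * K * onSecond G)) * onFirst X'.transpose *
          onSecond Y'.transpose := by rw [e1]; simp only [mul_assoc]
    _ = onSecond Y * onFirst X * (onSecond G * K * onFirst G) *
          (D * onFirst X'.transpose * onSecond Y'.transpose) := by rw [e5]; simp only [mul_assoc]
    _ = onSecond Y * (onFirst X * onSecond G) * K * (onFirst G * onSecond Y'.transpose) *
          onFirst X'.transpose * D := by rw [e4]; simp only [mul_assoc]
    _ = onSecond Y * onSecond G * (onFirst X * K * onSecond Y'.transpose) * onFirst G *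
          onFirst X'.transpose * D := by rw [c2, c3]; simp only [mul_assoc]
    _ = _ := by rw [e3]; simp only [mul_assoc]

end RTT

/-! ### The substitution `u ↦ -u` and regularity -/

section NegVar

variable {A : Type*} [Ring A]

/-- The substitution `u ↦ -u` in a power series. -/
def negVar (A : Type*) [Ring A] : PowerSeries A →+* PowerSeries A where
  toFun f := PowerSeries.mk fun n => (-1) ^ n * PowerSeries.coeff n f
  map_one' := by
    ext n
    by_cases h : n = 0 <;> simp [PowerSeries.coeff_one, h]
  map_mul' f g := by
    ext n
    simp only [PowerSeries.coeff_mk, PowerSeries.coeff_mul, Finset.mul_sum]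
    refine Finset.sum_congr rfl fun p hp => ?_
    rw [← Finset.HasAntidiagonal.mem_antidiagonal.1 hp, pow_add, mul_assoc, mul_assoc]
    congr 1
    rw [← mul_assoc, ← mul_assoc, ((Commute.neg_one_left (PowerSeries.coeff p.1 f)).pow_left _).eq]
  map_zero' := by ext n; simp
  map_add' f g := by ext n; simp [mul_add]

theorem coeff_negVar (f : PowerSeries A) (n : ℕ) :
    PowerSeries.coeff n (negVar A f) = (-1) ^ n * PowerSeries.coeff n f :=
  PowerSeries.coeff_mk n fun n => (-1) ^ n * PowerSeries.coeff n f

theorem negVar_X : negVar A PowerSeries.X = -PowerSeries.X := by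
  ext n
  rw [coeff_negVar, map_neg, PowerSeries.coeff_X]
  split_ifs with h <;> simp [h]

theorem negVar_C (a : A) : negVar A (PowerSeries.C a) = PowerSeries.C a := by
  ext n
  rw [coeff_negVar, PowerSeries.coeff_C]
  split_ifs with h <;> simp [h]

theorem negVar_map {A' : Type*} [Ring A'] (f : A →+* A') (x : PowerSeries A) :
    negVar A' (PowerSeries.map f x) = PowerSeries.map f (negVar A x) := by
  ext n
  simp [coeff_negVar]

/-- The coefficients vanish one after another, starting from the lowest: each is annihilated by `y`
once the preceding one is zero. -/
theorem eq_zero_of_X_add_C_mul {y : A} (hy : ∀ a, y * a = 0 → a = 0) {x : PowerSeries A}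
    (h : (PowerSeries.X + PowerSeries.C y) * x = 0) : x = 0 := by
  ext n
  have h0 := fun n => congrArg (PowerSeries.coeff n) h
  simp only [add_mul, map_add, PowerSeries.coeff_C_mul, map_zero] at h0
  rw [map_zero]
  induction n with
  | zero =>
    refine hy _ ?_
    simpa using h0 0
  | succ n ih =>
    have h1 := h0 (n + 1)
    rw [PowerSeries.coeff_succ_X_mul, ih, zero_add] at h1
    exact hy _ h1

theorem X_commute (f : PowerSeries A) : Commute PowerSeries.X f :=
  (PowerSeries.commute_X f).symm

theorem C_commute {a : A} (ha : ∀ b, Commute a b) (f : PowerSeries A) :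
    Commute (PowerSeries.C a) f := by
  ext n
  rw [PowerSeries.coeff_C_mul, PowerSeries.coeff_mul_C, (ha _).eq]

end NegVar

/-! ### Absence of torsion in the double Yangian -/

section DoubleYangian

variable {N : ℕ}

theorem outerVar_commute {A : Type*} [Ring A] (f : PowerSeries (PowerSeries A)) :
    Commute (outerVar A) f := X_commute f

theorem innerVar_commute {A : Type*} [Ring A] (f : PowerSeries (PowerSeries A)) :
    Commute (innerVar A) f := C_commute X_commute f

theorem hPar_commute {A : Type*} [Ring A] [Algebra Ch A] (a : A) : Commute (hPar A) a :=
  hPar_mul_comm A a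

theorem cst_commute {A : Type*} [Ring A] [Algebra Ch A] (z : ℂ) (a : A) : Commute (cst A z) a :=
  Algebra.commutes _ a

theorem const2_commute {A : Type*} [Ring A] {a : A} (ha : ∀ b, Commute a b)
    (f : PowerSeries (PowerSeries A)) : Commute (const2 a) f := C_commute (C_commute ha) f

/-- The relation up to torsion is a congruence. -/
def torsionCon (N : ℕ) : RingCon (FreeDY N) where
  r := TorsionRel N
  iseqv :=
    { refl := fun x => ⟨0, rfl⟩
      symm := fun ⟨k, h⟩ => ⟨k, h.symm⟩
      trans := by
        rintro x y z ⟨k, h1⟩ ⟨l, h2⟩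
        refine ⟨k + l, ?_⟩
        rw [pow_add, (Commute.refl (hPar (FreeDY N))).pow_pow k l |>.eq, mul_assoc, mul_assoc,
          map_mul, h1, ← map_mul, ← mul_assoc, ← ((Commute.refl (hPar (FreeDY N))).pow_pow k l).eq,
          mul_assoc, map_mul, h2, ← map_mul, ← mul_assoc,
          ((Commute.refl (hPar (FreeDY N))).pow_pow k l).eq, mul_assoc] }
  add' := by
    rintro w x y z ⟨k, h1⟩ ⟨l, h2⟩
    refine ⟨l + k, ?_⟩
    have e1 := congrArg (RingQuot.mkRingHom (DYRel N) (hPar _ ^ l) * ·) h1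
    have e2 := congrArg (RingQuot.mkRingHom (DYRel N) (hPar _ ^ k) * ·) h2
    simp only [← map_mul, ← mul_assoc, ← pow_add] at e1 e2
    rw [mul_add, mul_add, map_add, map_add, e1, add_comm l k, e2]
  mul' := by
    rintro w x y z ⟨k, h1⟩ ⟨l, h2⟩
    refine ⟨k + l, ?_⟩
    have e : ∀ a b : FreeDY N, hPar (FreeDY N) ^ (k + l) * (a * b) =
        (hPar (FreeDY N) ^ k * a) * (hPar (FreeDY N) ^ l * b) := fun a b => by
      rw [pow_add, mul_assoc, mul_assoc, ← mul_assoc _ a b, hPar_pow_mul_comm _ l a]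
      simp only [mul_assoc]
    rw [e, e, map_mul, h1, h2, ← map_mul]

theorem toDY_eq_mkRingHom (x : FreeDY N) : toDY N x = RingQuot.mkRingHom (TorsionRel N) x := by
  have h := RingQuot.mkAlgHom_coe Ch (TorsionRel N)
  exact congrArg (fun f : FreeDY N →+* RingQuot (TorsionRel N) => f x) h

/-- The relation up to torsion is already a congruence, so passing to the quotient generated by it
introduces no further identifications. -/
theorem toDY_eq_iff {x y : FreeDY N} : toDY N x = toDY N y ↔ TorsionRel N x y := by
  rw [toDY_eq_mkRingHom, toDY_eq_mkRingHom]
  constructor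
  · intro h
    have hl := RingQuot.lift_mkRingHom_apply (torsionCon N).mk' (r := TorsionRel N)
      fun a b hab => (torsionCon N).eq.2 hab
    have h1 := (hl x).symm.trans ((congrArg _ h).trans (hl y))
    exact (torsionCon N).eq.1 h1
  · exact fun h => RingQuot.mkRingHom_rel h

theorem toDY_surjective : Function.Surjective (toDY N) :=
  RingQuot.mkAlgHom_surjective Ch (TorsionRel N)

/-- The double Yangian has no `h`-torsion. -/
theorem eq_zero_of_hPar_mul {x : DY N} (h : hPar (DY N) * x = 0) : x = 0 := by
  obtain ⟨y, rfl⟩ := toDY_surjective x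
  have e : hPar (DY N) * toDY N y = toDY N (hPar (FreeDY N) * y) := by
    rw [map_mul]
    congr 1
    exact ((toDY N).commutes _).symm
  rw [e, ← map_zero (toDY N), toDY_eq_iff] at h
  rw [← map_zero (toDY N), toDY_eq_iff]
  obtain ⟨k, h⟩ := h
  exact ⟨k + 1, by rw [pow_succ, mul_assoc, h, mul_zero, mul_zero]⟩

end DoubleYangian

/-! ### The reflection equation over the double Yangian -/

section DoubleYangian

variable {N : ℕ}

theorem map_negSeries {A A' : Type*} [Ring A] [Algebra Ch A] [Ring A'] [Algebra Ch A']
    (f : A →ₐ[Ch] A') (t : Fin N → Fin N → ℕ → A) :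
    (negSeries t).map (PowerSeries.map (f : A →+* A')) = negSeries fun i j r => f (t i j r) := by
  ext i j n
  have h : f (hPar A) = hPar A' := f.commutes _
  simp only [negSeries, Matrix.map_apply, Matrix.of_apply, map_sub]
  congr 1
  · split_ifs <;> simp
  · simp [h]

theorem map_outerVar {A A' : Type*} [Ring A] [Ring A'] (f : A →+* A') :
    PowerSeries.map (PowerSeries.map f) (outerVar A) = outerVar A' := by simp [outerVar]

theorem map_innerVar {A A' : Type*} [Ring A] [Ring A'] (f : A →+* A') :
    PowerSeries.map (PowerSeries.map f) (innerVar A) = innerVar A' := by simp [innerVar]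

theorem map_const2_hPar {A A' : Type*} [Ring A] [Algebra Ch A] [Ring A'] [Algebra Ch A']
    (f : A →ₐ[Ch] A') :
    PowerSeries.map (PowerSeries.map (f : A →+* A')) (const2 (hPar A)) = const2 (hPar A') := by
  have h : f (hPar A) = hPar A' := f.commutes _
  simp [const2, h]

/-- A matrix of series in the outer variable. -/
def inOuter {A : Type*} [Ring A] (X : Matrix (Fin N) (Fin N) (PowerSeries A)) :
    Matrix (Fin N) (Fin N) (PowerSeries (PowerSeries A)) :=
  X.map (PowerSeries.map PowerSeries.C)

/-- A matrix of series in the inner variable. -/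
def inInner {A : Type*} [Ring A] (X : Matrix (Fin N) (Fin N) (PowerSeries A)) :
    Matrix (Fin N) (Fin N) (PowerSeries (PowerSeries A)) :=
  X.map PowerSeries.C

theorem map_inOuter {A A' : Type*} [Ring A] [Ring A'] (f : A →+* A')
    (X : Matrix (Fin N) (Fin N) (PowerSeries A)) :
    (inOuter X).map (PowerSeries.map (PowerSeries.map f)) = inOuter (X.map (PowerSeries.map f)) := by
  ext i j n m
  simp [inOuter]

theorem map_inInner {A A' : Type*} [Ring A] [Ring A'] (f : A →+* A')
    (X : Matrix (Fin N) (Fin N) (PowerSeries A)) :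
    (inInner X).map (PowerSeries.map (PowerSeries.map f)) = inInner (X.map (PowerSeries.map f)) := by
  ext i j n m
  simp [inInner]

/-- The relations of the double Yangian for `T⁺(u)`. -/
theorem rtt_tNeg : RTT (outerVar (DY N) - innerVar (DY N)) (const2 (hPar (DY N)))
    (inOuter (negSeries tNeg)) (inInner (negSeries tNeg)) := by
  rw [rtt_iff (fun r => (outerVar_commute r).sub_left (innerVar_commute r))
    (const2_commute hPar_commute)]
  set F := PowerSeries.map (PowerSeries.map (toDY N : FreeDY N →+* DY N)) with hF
  have h1 : clearedRNeg N (FreeDY N) * first (freeTPlus N) * second (freeTPlus N) =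
      ((outerVar (FreeDY N) - innerVar (FreeDY N)) • 1 -
        const2 (hPar (FreeDY N)) • permMat N _) * onFirst (inOuter (freeTPlus N)) *
          onSecond (inInner (freeTPlus N)) := rfl
  have h2 : second (freeTPlus N) * first (freeTPlus N) * clearedRNeg N (FreeDY N) =
      onSecond (inInner (freeTPlus N)) * onFirst (inOuter (freeTPlus N)) *
        ((outerVar (FreeDY N) - innerVar (FreeDY N)) • 1 -
          const2 (hPar (FreeDY N)) • permMat N _) := rfl
  have h3 : (clearedRNeg N (FreeDY N) * first (freeTPlus N) * second (freeTPlus N)).map F =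
      (second (freeTPlus N) * first (freeTPlus N) * clearedRNeg N (FreeDY N)).map F := by
    ext p q a b
    have h : ∀ {x y}, DYRel N x y → toDY N x = toDY N y := fun {x y} hxy =>
      toDY_eq_iff.2 ⟨0, by rw [pow_zero, one_mul, one_mul, RingQuot.mkRingHom_rel hxy]⟩
    simp only [hF, Matrix.map_apply, PowerSeries.coeff_map]
    exact h (DYRel.neg p q a b)
  have hT : (freeTPlus N).map (PowerSeries.map (toDY N : FreeDY N →+* DY N)) = negSeries tNeg :=
    map_negSeries (toDY N) _
  rw [h1, h2] at h3
  have h4 : F.mapMatrix _ = F.mapMatrix _ := h3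
  simp only [map_mul, map_sub, mapMatrix_smul, map_one] at h4
  simp only [RingHom.mapMatrix_apply, map_onFirst, map_onSecond, map_permMat, hF, map_outerVar,
    map_innerVar, map_const2_hPar, map_inOuter, map_inInner, hT] at h4
  exact h4

/-- Factor `(u - v)² - h²` into `u - v + h` and `u - v - h`. As a series in `u`, and then in `v`,
each factor is of the form treated in `eq_zero_of_X_add_C_mul`, so regularity reduces to that of
`h`, which is absence of torsion. -/
theorem eq_zero_of_quadratic {x : PowerSeries (PowerSeries (DY N))}
    (h : ((outerVar (DY N) - innerVar (DY N)) * (outerVar (DY N) - innerVar (DY N)) -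
      const2 (hPar (DY N)) * const2 (hPar (DY N))) * x = 0) : x = 0 := by
  have key : ∀ a : DY N, (∀ y, a * y = 0 → y = 0) → ∀ x : PowerSeries (PowerSeries (DY N)),
      (outerVar (DY N) - innerVar (DY N) - const2 a) * x = 0 → x = 0 := by
    intro a ha x hx
    have e : outerVar (DY N) - innerVar (DY N) - const2 a =
        PowerSeries.X + PowerSeries.C (-(PowerSeries.X + PowerSeries.C a)) := by
      rw [map_neg, map_add, outerVar, innerVar, const2]
      abel
    rw [e] at hx
    refine eq_zero_of_X_add_C_mul (fun f hf => ?_) hx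
    rw [neg_mul, neg_eq_zero] at hf
    exact eq_zero_of_X_add_C_mul ha hf
  refine key (-hPar (DY N)) (fun y hy => ?_) _ (key (hPar (DY N))
    (fun y hy => eq_zero_of_hPar_mul hy) _ ?_)
  · rw [neg_mul, neg_eq_zero] at hy
    exact eq_zero_of_hPar_mul hy
  · rw [← h, ← mul_assoc]
    congr 1
    have h1 : const2 (-hPar (DY N)) = -const2 (hPar (DY N)) := by simp [const2]
    rw [h1, sub_neg_eq_add, mul_add, sub_mul, sub_mul _ _ (const2 (hPar (DY N))),
      ((const2_commute hPar_commute _).eq : const2 (hPar (DY N)) *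
        (outerVar (DY N) - innerVar (DY N)) = _)]
    abel

variable {A : Type*} [Ring A]

theorem negVar_outerVar : negVar (PowerSeries A) (outerVar A) = -outerVar A := negVar_X

theorem negVar_innerVar : negVar (PowerSeries A) (innerVar A) = innerVar A := negVar_C _

theorem negVar_const2 (a : A) : negVar (PowerSeries A) (const2 a) = const2 a := negVar_C _

theorem map_negVar_outerVar : PowerSeries.map (negVar A) (outerVar A) = outerVar A := by
  simp [outerVar]

theorem map_negVar_innerVar : PowerSeries.map (negVar A) (innerVar A) = -innerVar A := by
  simp [innerVar, negVar_X]

theorem map_negVar_const2 (a : A) : PowerSeries.map (negVar A) (const2 a) = const2 a := by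
  simp [const2, negVar_C]

theorem negVar_inOuter (X : Matrix (Fin N) (Fin N) (PowerSeries A)) :
    (inOuter X).map (negVar (PowerSeries A)) = inOuter (X.map (negVar A)) := by
  ext1 i j
  simp [inOuter, negVar_map]

theorem negVar_inInner (X : Matrix (Fin N) (Fin N) (PowerSeries A)) :
    (inInner X).map (negVar (PowerSeries A)) = inInner X := by
  ext1 i j
  simp [inInner, negVar_C]

theorem map_negVar_inOuter (X : Matrix (Fin N) (Fin N) (PowerSeries A)) :
    (inOuter X).map (PowerSeries.map (negVar A)) = inOuter X := by
  ext i j n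
  simp [inOuter, negVar_C]

theorem map_negVar_inInner (X : Matrix (Fin N) (Fin N) (PowerSeries A)) :
    (inInner X).map (PowerSeries.map (negVar A)) = inInner (X.map (negVar A)) := by
  ext1 i j
  simp [inInner]

theorem inOuter_mul (X Y : Matrix (Fin N) (Fin N) (PowerSeries A)) :
    inOuter (X * Y) = inOuter X * inOuter Y := Matrix.map_mul

theorem inInner_mul (X Y : Matrix (Fin N) (Fin N) (PowerSeries A)) :
    inInner (X * Y) = inInner X * inInner Y := Matrix.map_mul

variable (G : Matrix (Fin N) (Fin N) ℂ)

/-- The reflection equation for `S⁺(u)` over the double Yangian. -/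
theorem reflEq_sPlusSeries (hGt : G.transpose = G ∨ G.transpose = -G) :
    ReflEq (outerVar (DY N) - innerVar (DY N)) (const2 (hPar (DY N)))
      (-outerVar (DY N) - innerVar (DY N)) (const2 (hPar (DY N)))
      (inOuter (sPlusSeries G)) (inInner (sPlusSeries G)) := by
  set u := outerVar (DY N) with hu
  set v := innerVar (DY N) with hv
  set h := const2 (hPar (DY N)) with hh
  have cu : ∀ r, Commute u r := outerVar_commute
  have cv : ∀ r, Commute v r := innerVar_commute
  have ch : ∀ r, Commute h r := const2_commute hPar_commute
  set T := negSeries (A := DY N) tNeg with hT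
  set T' := T.map (negVar (DY N)) with hT'
  set nO := negVar (PowerSeries (DY N))
  set nI := PowerSeries.map (negVar (DY N))
  set H := G.map (fun z => PowerSeries.C (cst (DY N) z)) with hH
  have hS : sPlusSeries G = T * H * T'.transpose := rfl
  -- The four relations of Sklyanin's argument are obtained from `r1` by `u ↦ -u` and `v ↦ -v`, and
  -- by moving the R-matrix to the other side. The last operation transposes both matrices and
  -- negates the argument.
  have r1 : RTT (u - v) h (inOuter T) (inInner T) := rtt_tNeg
  have r2 : RTT (-u - v) h (inOuter T') (inInner T) := by
    have := r1.map nO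
    rwa [map_sub, negVar_outerVar, negVar_innerVar, negVar_const2, negVar_inOuter,
      negVar_inInner] at this
  have r3 : RTT (-(u - v)) h (inOuter T).transpose (inInner T).transpose :=
    r1.swap (fun r => (cu r).sub_left (cv r)) fun x => eq_zero_of_quadratic
  have r4 : RTT (-u - v) h (inOuter T).transpose (inInner T').transpose := by
    have := r3.map nI
    rwa [map_neg, map_sub, map_negVar_outerVar, map_negVar_innerVar, map_negVar_const2,
      Matrix.transpose_map, Matrix.transpose_map, map_negVar_inOuter, map_negVar_inInner,
      sub_neg_eq_add, neg_add'] at this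
  have r5 : RTT (u - v) h (inOuter T').transpose (inInner T').transpose := by
    have := r4.map nO
    rwa [map_sub, map_neg, negVar_outerVar, negVar_innerVar, negVar_const2, neg_neg,
      Matrix.transpose_map, Matrix.transpose_map, negVar_inOuter, negVar_inInner] at this
  have hHO : inOuter H = inInner H := by
    ext1 i j
    simp [inOuter, inInner, hH]
  have hHc : ∀ i j r, Commute (inInner H i j) r := fun i j r =>
    const2_commute (cst_commute (G i j)) r
  have hHt : (inInner H).transpose = inInner H ∨ (inInner H).transpose = -inInner H := by
    refine hGt.imp (fun e => ?_) fun e => ?_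
    · ext1 i j
      have := congrFun (congrFun e i) j
      rw [Matrix.transpose_apply] at this
      simp [inInner, hH, this]
    · ext1 i j
      have := congrFun (congrFun e i) j
      rw [Matrix.transpose_apply, Matrix.neg_apply] at this
      simp [inInner, hH, this]
  have := reflEq_of_rtt (fun r => (cu r).sub_left (cv r)) (fun r => (cu r).neg_left.sub_left (cv r))
    ch hHc hHt r1 r2 r4 r5
  rw [hS, inOuter_mul, inOuter_mul, inInner_mul, inInner_mul, hHO]
  exact this

/-- `S⁺(u) = G - h ∑ s^{(-r-1)} u^r`; `s r` stands for `s^{(-r-1)}`. -/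
def sSeries {B : Type*} [Ring B] [Algebra Ch B] (s : Fin N → Fin N → ℕ → B) :
    Matrix (Fin N) (Fin N) (PowerSeries B) :=
  Matrix.of fun i j => PowerSeries.C (cst B (G i j)) - PowerSeries.mk fun m => hPar B * s i j m

theorem map_sSeries {B B' : Type*} [Ring B] [Algebra Ch B] [Ring B'] [Algebra Ch B']
    (f : B →ₐ[Ch] B') (s : Fin N → Fin N → ℕ → B) :
    (sSeries G s).map (PowerSeries.map (f : B →+* B')) = sSeries G fun i j r => f (s i j r) := by
  ext i j n
  simp only [sSeries, Matrix.map_apply, Matrix.of_apply, map_sub]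
  congr 1
  · simp [map_cst]
  · simp [map_hPar]

theorem sSeries_sNeg : sSeries G (sNeg G) = sPlusSeries G := by
  ext i j n
  rw [coeff_sPlusSeries, sSeries, Matrix.of_apply, map_sub, PowerSeries.coeff_C,
    PowerSeries.coeff_mk]

/-- The reflection equation for `S⁺(u)` over the algebra `Y⁺(g_N)`. -/
theorem reflEq_sGen (hGt : G.transpose = G ∨ G.transpose = -G) :
    ReflEq (outerVar (YPlus G) - innerVar (YPlus G)) (const2 (hPar (YPlus G)))
      (-outerVar (YPlus G) - innerVar (YPlus G)) (const2 (hPar (YPlus G)))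
      (inOuter (sSeries G (sGen G))) (inInner (sSeries G (sGen G))) := by
  refine ReflEq.of_map (PowerSeries.map (PowerSeries.map ((YPlus G).val : YPlus G →+* DY N)))
    ?_ ?_
  · intro f g hfg
    ext n m
    have := congrArg (fun x => PowerSeries.coeff m (PowerSeries.coeff n x)) hfg
    simpa using this
  · have hs : (sSeries G (sGen G)).map (PowerSeries.map ((YPlus G).val : YPlus G →+* DY N)) =
        sPlusSeries G := (map_sSeries G (YPlus G).val (sGen G)).trans (sSeries_sNeg G)
    rw [map_sub, map_sub, map_neg, map_outerVar, map_innerVar, map_const2_hPar, map_inOuter,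
      map_inInner, hs]
    exact reflEq_sPlusSeries G hGt

/-- The algebra `Y⁺(g_N)` has no `h`-torsion. -/
theorem YPlus.eq_zero_of_hPar_mul {x : YPlus G} (h : hPar (YPlus G) * x = 0) : x = 0 := by
  refine Subtype.ext (TwistedYangian.eq_zero_of_hPar_mul ?_)
  have := congrArg Subtype.val h
  exact this

theorem map_reflEq_sGen (hGt : G.transpose = G ∨ G.transpose = -G) {B : Type*} [Ring B]
    [Algebra Ch B] (f : YPlus G →ₐ[Ch] B) :
    ReflEq (outerVar B - innerVar B) (const2 (hPar B)) (-outerVar B - innerVar B)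
      (const2 (hPar B)) (inOuter (sSeries G fun i j r => f (sGen G i j r)))
      (inInner (sSeries G fun i j r => f (sGen G i j r))) := by
  have := (reflEq_sGen G hGt).map (PowerSeries.map (PowerSeries.map (f : YPlus G →+* B)))
  rwa [map_sub, map_sub, map_neg, map_outerVar, map_innerVar, map_const2_hPar, map_inOuter,
      map_inInner, map_sSeries] at this

end DoubleYangian

/-! ### Substitutions in power series -/

section Substitution

variable {R : Type*} [Ring R]

theorem pow_eq_zero_of_le' {η : R} {k n : ℕ} (hk : η ^ k = 0) (h : k ≤ n) : η ^ n = 0 := by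
  rw [← Nat.sub_add_cancel h, pow_add, hk, mul_zero]

/-- The value of a power series at a central element `η` with `η ^ k = 0`. -/
def evalNil (η : R) (hη : ∀ r, Commute η r) (k : ℕ) (hk : η ^ k = 0) : PowerSeries R →+* R where
  toFun f := ∑ n ∈ Finset.range k, PowerSeries.coeff n f * η ^ n
  map_one' := by
    rcases k with _ | k
    · rw [pow_zero] at hk
      have := subsingleton_of_zero_eq_one hk.symm
      exact Subsingleton.elim _ _
    · rw [Finset.sum_range_succ']
      simp [PowerSeries.coeff_one]
  map_mul' f g := by
    rw [Finset.sum_mul_sum, ← Finset.sum_product']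
    simp only [PowerSeries.coeff_mul, Finset.sum_mul]
    rw [Finset.sum_sigma']
    -- The pairs missing from the triangular sum are those of total degree at least `k`, where the
    -- power of `η` vanishes.
    refine Finset.sum_of_injOn (fun x => x.2) ?_ ?_ ?_ ?_
    · rintro ⟨n, p⟩ h1 ⟨m, q⟩ h2 (rfl : p = q)
      simp only [Finset.coe_sigma, Set.mem_sigma_iff, Finset.mem_coe,
        Finset.HasAntidiagonal.mem_antidiagonal] at h1 h2
      obtain rfl : n = m := h1.2.symm.trans h2.2
      rfl
    · rintro ⟨n, i, j⟩ h1
      simp only [Finset.coe_sigma, Set.mem_sigma_iff, Finset.mem_coe, Finset.mem_range,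
        Finset.HasAntidiagonal.mem_antidiagonal, Finset.coe_product, Set.mem_prod] at h1 ⊢
      omega
    · rintro ⟨i, j⟩ _ h2
      have h3 : k ≤ i + j := by
        by_contra h4
        exact h2 ⟨⟨i + j, i, j⟩, by simpa using h4, rfl⟩
      dsimp only
      rw [((hη _).pow_left i).mul_mul_mul_comm, ← pow_add, pow_eq_zero_of_le' hk h3, mul_zero]
    · rintro ⟨n, i, j⟩ h1
      simp only [Finset.mem_sigma, Finset.HasAntidiagonal.mem_antidiagonal] at h1
      dsimp only
      rw [((hη _).pow_left i).mul_mul_mul_comm, ← pow_add, h1.2]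
  map_zero' := by simp
  map_add' f g := by simp [add_mul, Finset.sum_add_distrib]

section

variable (η : R) (hη : ∀ r, Commute η r) (k : ℕ) (hk : η ^ k = 0)

theorem evalNil_apply (f : PowerSeries R) :
    evalNil η hη k hk f = ∑ n ∈ Finset.range k, PowerSeries.coeff n f * η ^ n := rfl

theorem evalNil_C (a : R) : evalNil η hη k hk (PowerSeries.C a) = a := by
  rcases k with _ | k
  · rw [pow_zero] at hk
    have := subsingleton_of_zero_eq_one hk.symm
    exact Subsingleton.elim _ _
  · rw [evalNil_apply, Finset.sum_range_succ']
    simp [PowerSeries.coeff_C]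

theorem evalNil_X : evalNil η hη k hk PowerSeries.X = η := by
  rcases k with _ | _ | k
  · rw [pow_zero] at hk
    have := subsingleton_of_zero_eq_one hk.symm
    exact Subsingleton.elim _ _
  · rw [pow_one] at hk
    simp [evalNil_apply, hk]
  · rw [evalNil_apply, Finset.sum_range_succ', Finset.sum_range_succ']
    simp [PowerSeries.coeff_X]

end

/-- Taylor's expansion `f(u + w)`; the outer variable is `w`. -/
def taylorHom (R : Type*) [Ring R] : PowerSeries R →+* PowerSeries (PowerSeries R) where
  toFun f := PowerSeries.mk fun d => PowerSeries.mk fun m =>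
    ((m + d).choose m : R) * PowerSeries.coeff (m + d) f
  map_one' := by
    ext d m
    simp only [PowerSeries.coeff_mk, PowerSeries.coeff_one]
    by_cases hd : d = 0
    · subst hd
      simp [PowerSeries.coeff_one]
    · simp [hd]
  map_mul' f g := by
    ext d m
    simp only [PowerSeries.coeff_mk, PowerSeries.coeff_mul, map_sum]
    -- Vandermonde's identity distributes the binomial coefficient over the two factors.
    have h1 : ∀ p ∈ Finset.HasAntidiagonal.antidiagonal (m + d),
        ((m + d).choose m : R) * (PowerSeries.coeff p.1 f * PowerSeries.coeff p.2 g) =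
          ∑ q ∈ Finset.HasAntidiagonal.antidiagonal m, (p.1.choose q.1 : R) * p.2.choose q.2 *
            (PowerSeries.coeff p.1 f * PowerSeries.coeff p.2 g) := fun p hp => by
      rw [← Finset.HasAntidiagonal.mem_antidiagonal.1 hp, Nat.add_choose_eq, Nat.cast_sum,
        Finset.sum_mul]
      simp only [Nat.cast_mul]
    rw [Finset.mul_sum, Finset.sum_congr rfl h1, Finset.sum_comm]
    conv_rhs => rw [Finset.sum_comm]
    refine Finset.sum_congr rfl ?_
    rintro ⟨i, j⟩ hij
    obtain rfl := Finset.HasAntidiagonal.mem_antidiagonal.1 hij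
    symm
    refine Finset.sum_of_injOn (fun p => (i + p.1, j + p.2)) ?_ ?_ ?_ ?_
    · rintro ⟨p, q⟩ _ ⟨p', q'⟩ _ h
      simpa using h
    · rintro ⟨p, q⟩ h
      simp only [Finset.mem_coe, Finset.HasAntidiagonal.mem_antidiagonal] at h ⊢
      omega
    · rintro ⟨a, b⟩ hab h
      rw [Finset.HasAntidiagonal.mem_antidiagonal] at hab
      rcases lt_or_ge a i with ha | ha
      · simp [Nat.choose_eq_zero_of_lt ha]
      · rcases lt_or_ge b j with hb | hb
        · simp [Nat.choose_eq_zero_of_lt hb]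
        · refine (h ⟨(a - i, b - j), ?_, ?_⟩).elim
          · simp only [Finset.mem_coe, Finset.HasAntidiagonal.mem_antidiagonal]
            omega
          · simp [ha, hb]
    · rintro ⟨p, q⟩ _
      dsimp only
      rw [mul_assoc, mul_assoc, (Nat.commute_cast (PowerSeries.coeff (i + p) f) _).left_comm]
  map_zero' := by ext d m; simp
  map_add' f g := by ext d m; simp [mul_add]

theorem coeff_taylorHom (f : PowerSeries R) (d m : ℕ) :
    PowerSeries.coeff m (PowerSeries.coeff d (taylorHom R f)) =
      ((m + d).choose m : R) * PowerSeries.coeff (m + d) f := by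
  change PowerSeries.coeff m (PowerSeries.coeff d (PowerSeries.mk fun d => PowerSeries.mk fun m =>
    ((m + d).choose m : R) * PowerSeries.coeff (m + d) f)) = _
  rw [PowerSeries.coeff_mk, PowerSeries.coeff_mk]

theorem taylorHom_C (a : R) : taylorHom R (PowerSeries.C a) = PowerSeries.C (PowerSeries.C a) := by
  ext d m
  rw [coeff_taylorHom, PowerSeries.coeff_C, PowerSeries.coeff_C]
  by_cases hd : d = 0
  · subst hd
    simp [PowerSeries.coeff_C]
  · simp [hd]

theorem taylorHom_X :
    taylorHom R PowerSeries.X = PowerSeries.C PowerSeries.X + PowerSeries.X := by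
  ext d m
  rw [coeff_taylorHom, map_add, PowerSeries.coeff_C, PowerSeries.coeff_X, PowerSeries.coeff_X]
  rcases d with _ | _ | d
  · simp [PowerSeries.coeff_X]
  · rcases m with _ | m <;> simp [PowerSeries.coeff_one]
  · rw [if_neg (by omega)]
    simp

section Shift

variable (η : R) (hη : ∀ r, Commute η r) (k : ℕ) (hk : η ^ k = 0)

/-- The substitution `f(u) ↦ f(u + η)`, where `η` is central and `η ^ k = 0`. -/
def shiftHom : PowerSeries R →+* PowerSeries R :=
  (evalNil (PowerSeries.C η) (C_commute hη) k (by rw [← map_pow, hk, map_zero])).comp (taylorHom R)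

theorem coeff_shiftHom (f : PowerSeries R) (m : ℕ) :
    PowerSeries.coeff m (shiftHom η hη k hk f) =
      ∑ d ∈ Finset.range k, ((m + d).choose m : R) * PowerSeries.coeff (m + d) f * η ^ d := by
  rw [shiftHom, RingHom.comp_apply, evalNil_apply, map_sum]
  refine Finset.sum_congr rfl fun d _ => ?_
  rw [← map_pow, PowerSeries.coeff_mul_C, coeff_taylorHom]

theorem shiftHom_C (a : R) : shiftHom η hη k hk (PowerSeries.C a) = PowerSeries.C a := by
  rw [shiftHom, RingHom.comp_apply, taylorHom_C, evalNil_C]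

theorem shiftHom_X : shiftHom η hη k hk PowerSeries.X = PowerSeries.X + PowerSeries.C η := by
  rw [shiftHom, RingHom.comp_apply, taylorHom_X, map_add, evalNil_C, evalNil_X]

theorem map_shiftHom {R' : Type*} [Ring R'] (f : R →+* R') {η' : R'} (hη' : ∀ r, Commute η' r)
    {k' : ℕ} (hk' : η' ^ k' = 0) (hkk : k' ≤ k) (h : f η = η') (x : PowerSeries R) :
    PowerSeries.map f (shiftHom η hη k hk x) = shiftHom η' hη' k' hk' (PowerSeries.map f x) := by
  ext m
  rw [PowerSeries.coeff_map, coeff_shiftHom, coeff_shiftHom, map_sum]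
  refine (Finset.sum_subset (Finset.range_subset_range.2 hkk) fun d _ hd => ?_).symm.trans ?_
  · rw [map_mul, map_pow, h, pow_eq_zero_of_le' hk' (by simpa using hd), mul_zero]
  · refine Finset.sum_congr rfl fun d _ => ?_
    simp [h]

end Shift

/-- The diagonal `f(u, u)` of a power series in two variables. -/
def diagHom (R : Type*) [Ring R] : PowerSeries (PowerSeries R) →+* PowerSeries R where
  toFun f := PowerSeries.mk fun n => ∑ p ∈ Finset.HasAntidiagonal.antidiagonal n,
    PowerSeries.coeff p.2 (PowerSeries.coeff p.1 f)
  map_one' := by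
    ext n
    rw [PowerSeries.coeff_mk, Finset.sum_eq_single (0, n)]
    · simp
    · rintro ⟨a, b⟩ h1 h2
      have : a ≠ 0 := by
        rintro rfl
        rw [Finset.HasAntidiagonal.mem_antidiagonal] at h1
        simp_all
      simp [PowerSeries.coeff_one, this]
    · simp
  map_mul' f g := by
    ext n
    simp only [PowerSeries.coeff_mk, PowerSeries.coeff_mul, map_sum, Finset.sum_mul_sum]
    simp only [Finset.sum_sigma']
    refine Finset.sum_nbij'
      (fun x => ⟨(x.2.1.1 + x.2.2.1, x.2.1.2 + x.2.2.2), (x.2.1.1, x.2.2.1), (x.2.1.2, x.2.2.2)⟩)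
      (fun x => ⟨(x.2.1.1 + x.2.2.1, x.2.1.2 + x.2.2.2), (x.2.1.1, x.2.2.1), (x.2.1.2, x.2.2.2)⟩)
      ?_ ?_ ?_ ?_ fun x _ => rfl
    · rintro ⟨⟨a, b⟩, ⟨a₁, a₂⟩, b₁, b₂⟩ h
      simp only [Finset.mem_sigma, Finset.HasAntidiagonal.mem_antidiagonal] at h ⊢
      refine ⟨?_, trivial, trivial⟩
      omega
    · rintro ⟨⟨a, b⟩, ⟨a₁, a₂⟩, b₁, b₂⟩ h
      simp only [Finset.mem_sigma, Finset.HasAntidiagonal.mem_antidiagonal] at h ⊢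
      refine ⟨?_, trivial, trivial⟩
      omega
    · rintro ⟨⟨a, b⟩, ⟨a₁, a₂⟩, b₁, b₂⟩ h
      simp only [Finset.mem_sigma, Finset.HasAntidiagonal.mem_antidiagonal] at h ⊢
      obtain ⟨_, rfl, rfl⟩ := h
      rfl
    · rintro ⟨⟨a, b⟩, ⟨a₁, a₂⟩, b₁, b₂⟩ h
      simp only [Finset.mem_sigma, Finset.HasAntidiagonal.mem_antidiagonal] at h ⊢
      obtain ⟨_, rfl, rfl⟩ := h
      rfl
  map_zero' := by ext n; simp
  map_add' f g := by ext n; simp [Finset.sum_add_distrib]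

theorem coeff_diagHom (f : PowerSeries (PowerSeries R)) (n : ℕ) :
    PowerSeries.coeff n (diagHom R f) = ∑ p ∈ Finset.HasAntidiagonal.antidiagonal n,
      PowerSeries.coeff p.2 (PowerSeries.coeff p.1 f) :=
  PowerSeries.coeff_mk n fun n => ∑ p ∈ Finset.HasAntidiagonal.antidiagonal n,
    PowerSeries.coeff p.2 (PowerSeries.coeff p.1 f)

theorem diagHom_C (f : PowerSeries R) : diagHom R (PowerSeries.C f) = f := by
  ext n
  rw [coeff_diagHom, Finset.sum_eq_single (0, n)]
  · simp
  · rintro ⟨a, b⟩ h1 h2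
    have : a ≠ 0 := by
      rintro rfl
      rw [Finset.HasAntidiagonal.mem_antidiagonal] at h1
      simp_all
    simp [PowerSeries.coeff_C, this]
  · simp

theorem diagHom_map_C (f : PowerSeries R) : diagHom R (PowerSeries.map PowerSeries.C f) = f := by
  ext n
  rw [coeff_diagHom, Finset.sum_eq_single (n, 0)]
  · simp
  · rintro ⟨a, b⟩ h1 h2
    have : b ≠ 0 := by
      rintro rfl
      rw [Finset.HasAntidiagonal.mem_antidiagonal] at h1
      simp_all
    simp [PowerSeries.coeff_C, this]
  · simp

end Substitution

/-! ### Shifted reflection equations -/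

section Shifted

variable {N : ℕ} {B : Type*} [Ring B] [Algebra Ch B] {k : ℕ} (hk : hPar B ^ k = 0)

theorem cst_mul_hPar_commute (β : ℂ) (r : B) : Commute (cst B β * hPar B) r :=
  (cst_commute β r).mul_left (hPar_commute r)

include hk in
theorem cst_mul_hPar_pow (β : ℂ) : (cst B β * hPar B) ^ k = 0 := by
  rw [(cst_commute β _).mul_pow, hk, mul_zero]

/-- The substitution `f(u) ↦ f(u + β h)`. -/
def uShift (β : ℂ) : PowerSeries B →+* PowerSeries B :=
  shiftHom (cst B β * hPar B) (cst_mul_hPar_commute β) k (cst_mul_hPar_pow hk β)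

/-- The two variables are shifted separately: first `u`, as the variable of a series over series in
`v`, then `v` in the coefficients. -/
theorem shifted_reflEq {X Y : Matrix (Fin N) (Fin N) (PowerSeries B)}
    (H : ReflEq (outerVar B - innerVar B) (const2 (hPar B)) (-outerVar B - innerVar B)
      (const2 (hPar B)) (inOuter X) (inInner Y)) (α β : ℂ) :
    ReflEq ((outerVar B + const2 (cst B α * hPar B)) - (innerVar B + const2 (cst B β * hPar B)))
      (const2 (hPar B))
      (-(outerVar B + const2 (cst B α * hPar B)) - (innerVar B + const2 (cst B β * hPar B)))
      (const2 (hPar B)) (inOuter (X.map (uShift hk α))) (inInner (Y.map (uShift hk β))) := by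
  set f : PowerSeries (PowerSeries B) →+* PowerSeries (PowerSeries B) :=
    shiftHom (PowerSeries.C (cst B α * hPar B)) (C_commute (cst_mul_hPar_commute α)) k
      (by rw [← map_pow, cst_mul_hPar_pow hk, map_zero]) with hf
  have h1 := (H.map f).map (PowerSeries.map (uShift hk β))
  have e1 : f (outerVar B) = outerVar B + const2 (cst B α * hPar B) := shiftHom_X _ _ _ _
  have e2 : f (innerVar B) = innerVar B := shiftHom_C _ _ _ _ _
  have e3 : f (const2 (hPar B)) = const2 (hPar B) := shiftHom_C _ _ _ _ _
  have e4 : (inOuter X).map f = inOuter (X.map (uShift hk α)) := by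
    ext1 i j
    exact (map_shiftHom _ (cst_mul_hPar_commute α) k (cst_mul_hPar_pow hk α) PowerSeries.C
      (C_commute (cst_mul_hPar_commute α)) (by rw [← map_pow, cst_mul_hPar_pow hk, map_zero])
      le_rfl rfl (X i j)).symm
  have e5 : (inInner Y).map f = inInner Y := by
    ext1 i j
    rw [Matrix.map_apply, inInner, Matrix.map_apply, hf, shiftHom_C]
  have i1 : PowerSeries.map (uShift hk β) (outerVar B) = outerVar B := by simp [outerVar]
  have i2 : PowerSeries.map (uShift hk β) (innerVar B) =
      innerVar B + const2 (cst B β * hPar B) := by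
    rw [innerVar, PowerSeries.map_C, uShift, shiftHom_X, map_add, const2]
  have i3 : ∀ a, PowerSeries.map (uShift hk β) (const2 a) = const2 a := fun a => by
    rw [const2, PowerSeries.map_C, uShift, shiftHom_C]
  have i4 : ∀ Z : Matrix (Fin N) (Fin N) (PowerSeries B),
      (inOuter Z).map (PowerSeries.map (uShift hk β)) = inOuter Z := fun Z => by
    ext1 i j
    ext1 n
    simp only [inOuter, Matrix.map_apply, PowerSeries.coeff_map]
    exact shiftHom_C _ _ _ _ _
  have i5 : (inInner Y).map (PowerSeries.map (uShift hk β)) = inInner (Y.map (uShift hk β)) := by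
    ext1 i j
    simp [inInner]
  simp only [map_sub, map_neg, e1, e2, e3, e4, e5, map_add, i1, i2, i3, i4, i5] at h1
  exact h1

omit [Algebra Ch B] in
-- Only nonnegative powers of `u` and `v` occur, so setting `v = u` is a ring homomorphism.
theorem diagonal_reflEq {X Y : Matrix (Fin N) (Fin N) (PowerSeries B)} {d ε x h : _}
    (H : ReflEq d ε x h (inOuter X) (inInner Y)) :
    ReflEq (diagHom B d) (diagHom B ε) (diagHom B x) (diagHom B h) X Y := by
  have h1 := H.map (diagHom B)
  have e1 : (inOuter X).map (diagHom B) = X := by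
    ext1 i j
    exact diagHom_map_C _
  have e2 : (inInner Y).map (diagHom B) = Y := by
    ext1 i j
    exact diagHom_C _
  rwa [e1, e2] at h1

/-- Cancellation of a central factor in the reflection equation. -/
theorem ReflEq.cancel {R R' : Type*} [Ring R] [Ring R'] (f : R →+* R') {η : R}
    (hη : ∀ r, Commute η r) (hf : ∀ x, η * x = 0 → f x = 0) {d ε ε' x h : R}
    {X Y : Matrix (Fin N) (Fin N) R} (hε : ε' = η * ε) (H : ReflEq (η * d) ε' x h X Y) :
    ReflEq (f d) (f ε) (f x) (f h) (X.map f) (Y.map f) := by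
  have e : (η * d) • (1 : Matrix (Fin N × Fin N) (Fin N × Fin N) R) - (η * ε) • permMat N R =
      η • (d • 1 - ε • permMat N R) := by
    rw [smul_sub, smul_smul, smul_smul]
  rw [ReflEq, hε, e, smul_mul_assoc, smul_comm_of_central hη, ← sub_eq_zero, ← smul_sub] at H
  have h1 : f.mapMatrix ((d • 1 - ε • permMat N R) *
      (onFirst X * (x • 1 - h • contMat N R) * onSecond Y) -
        onSecond Y * (x • 1 - h • contMat N R) * onFirst X * (d • 1 - ε • permMat N R)) = 0 := by
    ext1 p q
    exact hf _ (congrFun (congrFun H p) q)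
  rw [map_sub, sub_eq_zero] at h1
  simp only [map_mul, map_sub, mapMatrix_smul, map_one] at h1
  simp only [RingHom.mapMatrix_apply, map_onFirst, map_onSecond, map_permMat, map_contMat] at h1
  exact h1

include hk in
/-- The diagonal of the reflection equation, in which the common factor `h` is cancelled. -/
theorem shift_reflEq {B' : Type*} [Ring B'] [Algebra Ch B'] (σ : B →ₐ[Ch] B')
    (hσ : ∀ x, hPar B * x = 0 → σ x = 0) {k' : ℕ} (hk' : hPar B' ^ k' = 0) (hkk : k' ≤ k)
    {X : Matrix (Fin N) (Fin N) (PowerSeries B)}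
    (H : ReflEq (outerVar B - innerVar B) (const2 (hPar B)) (-outerVar B - innerVar B)
      (const2 (hPar B)) (inOuter X) (inInner X)) (α β : ℤ) :
    ReflEq ((α - β : ℤ) : PowerSeries B') 1
      (-(PowerSeries.X + PowerSeries.C (cst B' (α : ℂ) * hPar B')) -
        (PowerSeries.X + PowerSeries.C (cst B' (β : ℂ) * hPar B')))
      (PowerSeries.C (hPar B'))
      ((X.map (PowerSeries.map (σ : B →+* B'))).map (uShift hk' (α : ℂ)))
      ((X.map (PowerSeries.map (σ : B →+* B'))).map (uShift hk' (β : ℂ))) := by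
  have h1 := diagonal_reflEq (shifted_reflEq hk H (α : ℂ) (β : ℂ))
  have e1 : diagHom B (outerVar B) = PowerSeries.X := by
    have := diagHom_map_C (PowerSeries.X : PowerSeries B)
    rwa [PowerSeries.map_X] at this
  have e2 : diagHom B (innerVar B) = PowerSeries.X := diagHom_C _
  have e3 : ∀ b, diagHom B (const2 b) = PowerSeries.C b := fun b => diagHom_C _
  simp only [map_sub, map_neg, map_add, e1, e2, e3] at h1
  -- At `v = u` the argument of the R-matrix is `h (α - β)`, so its cleared form is `h` times `(α -
  -- β) - P`. Cancelling this `h` is possible only after the map `σ`, which kills the annihilator of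
  -- `h`.
  have e4 : (PowerSeries.X + PowerSeries.C (cst B (α : ℂ) * hPar B)) -
      (PowerSeries.X + PowerSeries.C (cst B (β : ℂ) * hPar B)) =
        PowerSeries.C (hPar B) * ((α - β : ℤ) : PowerSeries B) := by
    rw [add_sub_add_left_eq_sub, ← map_sub, ← sub_mul, ← map_sub, ← Int.cast_sub, map_intCast,
      map_mul, map_intCast]
    exact (C_commute hPar_commute _).symm.eq
  rw [e4] at h1
  have h3 := h1.cancel (PowerSeries.map (σ : B →+* B')) (C_commute hPar_commute)
    (fun x hx => by
      ext n
      rw [PowerSeries.coeff_map, map_zero]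
      refine hσ _ ?_
      rw [← PowerSeries.coeff_C_mul, hx, map_zero]) (mul_one _).symm
  have hσc : ∀ z, σ (cst B z) = cst B' z := map_cst σ
  have hσh : σ (hPar B) = hPar B' := map_hPar σ
  have e5 : ∀ α : ℂ, (X.map (uShift hk α)).map (PowerSeries.map (σ : B →+* B')) =
      (X.map (PowerSeries.map (σ : B →+* B'))).map (uShift hk' α) := by
    intro α
    ext1 i j
    exact map_shiftHom _ (cst_mul_hPar_commute α) k (cst_mul_hPar_pow hk α) (σ : B →+* B')
      (cst_mul_hPar_commute α) (cst_mul_hPar_pow hk' α) hkk (by rw [RingHom.coe_coe, map_mul, hσc, hσh]) _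
  simpa only [e5, map_intCast, map_one, map_sub, map_neg, map_add, PowerSeries.map_X,
    PowerSeries.map_C, RingHom.coe_coe, map_mul σ, hσc, hσh] using h3

end Shifted

/-! ### Division by `h` at the cost of one power of `h` -/

section ModH

variable {N : ℕ} {A : Type*} [Ring A] [Algebra Ch A]

/-- If `h a` lies in `h ^ (k + 1) A`, then `a` lies in `h ^ k A` because `A` has no torsion. -/
theorem ModH.step_eq_zero (hA : ∀ a : A, hPar A * a = 0 → a = 0) {k : ℕ} {x : ModH A (k + 1)}
    (hx : hPar (ModH A (k + 1)) * x = 0) : ModH.step A k x = 0 := by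
  obtain ⟨a, rfl⟩ := Ideal.Quotient.mk_surjective x
  have e : hPar (ModH A (k + 1)) = Ideal.Quotient.mk (hIdeal A (k + 1)) (hPar A) :=
    (map_hPar (Ideal.Quotient.mkₐ Ch (hIdeal A (k + 1)))).symm
  rw [e, ← map_mul, Ideal.Quotient.eq_zero_iff_mem, mem_hIdeal] at hx
  obtain ⟨y, hy⟩ := hx
  have h1 : a = hPar A ^ k * y := by
    rw [← sub_eq_zero]
    refine hA _ ?_
    rw [mul_sub, hy, pow_succ', mul_assoc, sub_self]
  exact Ideal.Quotient.eq_zero_iff_mem.2 ((mem_hIdeal A).2 ⟨y, h1⟩)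

/-- The reflection equations for integral shifts modulo `h ^ k`. -/
theorem shift_reflEq_modH (G : Matrix (Fin N) (Fin N) ℂ)
    (hGt : G.transpose = G ∨ G.transpose = -G) (k : ℕ) (α β : ℤ) :
    ReflEq ((α - β : ℤ) : PowerSeries (ModH (YPlus G) k)) 1
      (-(PowerSeries.X + PowerSeries.C (cst _ (α : ℂ) * hPar _)) -
        (PowerSeries.X + PowerSeries.C (cst _ (β : ℂ) * hPar _)))
      (PowerSeries.C (hPar _))
      ((sSeries G (sGenModH G k)).map (uShift (hPar_pow_modH (YPlus G) k) (α : ℂ)))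
      ((sSeries G (sGenModH G k)).map (uShift (hPar_pow_modH (YPlus G) k) (β : ℂ))) := by
  have h1 := shift_reflEq (hPar_pow_modH (YPlus G) (k + 1)) (ModH.step (YPlus G) k)
    (fun x hx => ModH.step_eq_zero (fun a => YPlus.eq_zero_of_hPar_mul G) hx)
    (hPar_pow_modH (YPlus G) k) (Nat.le_succ k)
    (map_reflEq_sGen G hGt (Ideal.Quotient.mkₐ Ch (hIdeal (YPlus G) (k + 1)))) α β
  rw [map_sSeries] at h1
  exact h1

end ModH

/-! ### Laurent series -/

section Laurent

/-- The coefficientwise map of Laurent series. -/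
def hahnMap {R R' : Type*} [Ring R] [Ring R'] (f : R →+* R') :
    LaurentSeries R →+* LaurentSeries R' where
  toFun x := HahnSeries.map x f
  map_one' := by
    ext n
    simp only [HahnSeries.map_coeff, HahnSeries.coeff_one]
    split_ifs <;> simp
  map_mul' x y := HahnSeries.map_mul (f : R →ₙ+* R')
  map_zero' := by ext n; simp
  map_add' x y := by ext n; simp

theorem coeff_hahnMap {R R' : Type*} [Ring R] [Ring R'] (f : R →+* R') (x : LaurentSeries R)
    (n : ℤ) : (hahnMap f x).coeff n = f (x.coeff n) := rfl

theorem hahnMap_single {R R' : Type*} [Ring R] [Ring R'] (f : R →+* R') (n : ℤ) (a : R) :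
    hahnMap f (HahnSeries.single n a) = HahnSeries.single n (f a) := by
  ext m
  rw [coeff_hahnMap, HahnSeries.coeff_single, HahnSeries.coeff_single]
  split_ifs <;> simp

theorem ofPowerSeries_map {R R' : Type*} [Ring R] [Ring R'] (f : R →+* R') (x : PowerSeries R) :
    HahnSeries.ofPowerSeries ℤ R' (PowerSeries.map f x) =
      hahnMap f (HahnSeries.ofPowerSeries ℤ R x) := by
  ext n
  rw [coeff_hahnMap]
  by_cases hn : 0 ≤ n
  · lift n to ℕ using hn
    rw [HahnSeries.ofPowerSeries_apply_coeff, HahnSeries.ofPowerSeries_apply_coeff,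
      PowerSeries.coeff_map]
  · have hm : n ∉ Set.range (Nat.castOrderEmbedding : ℕ ↪o ℤ) := by
      rintro ⟨m, hm⟩
      apply hn
      rw [← hm]
      exact Int.natCast_nonneg m
    rw [HahnSeries.ofPowerSeries_apply, HahnSeries.ofPowerSeries_apply,
      HahnSeries.embDomain_of_notMem_range hm, HahnSeries.embDomain_of_notMem_range hm, map_zero]

theorem single_commute {R : Type*} [Ring R] {a : R} (ha : ∀ r, Commute a r) (n : ℤ)
    (x : LaurentSeries R) : Commute (HahnSeries.single n a) x := by
  ext m
  rw [HahnSeries.coeff_single_mul, HahnSeries.coeff_mul_single, (ha _).eq]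

theorem sum_single_pow {R : Type*} [Ring R] (n : ℕ) (a : R) :
    (HahnSeries.single (-1 : ℤ) a) ^ n = HahnSeries.single (-(n : ℤ)) (a ^ n) := by
  rw [HahnSeries.single_pow]
  simp

variable {N : ℕ} {B : Type*} [Ring B] [Algebra Ch B] {k : ℕ} (hk : hPar B ^ k = 0)

/-- The substitution `w = h / u` as a ring homomorphism. -/
def wHom : PowerSeries ℂ →+* LaurentSeries B :=
  (evalNil (HahnSeries.single (-1 : ℤ) (hPar B)) (single_commute hPar_commute _) k
    (by rw [sum_single_pow, hk, map_zero])).comp (PowerSeries.map (HahnSeries.C.comp (cst B)))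

theorem wHom_apply (f : PowerSeries ℂ) : wHom hk f = wLaurent k B f := by
  rw [wHom, RingHom.comp_apply, evalNil_apply, wLaurent]
  refine Finset.sum_congr rfl fun n _ => ?_
  rw [PowerSeries.coeff_map, sum_single_pow, RingHom.comp_apply, HahnSeries.C_apply,
    HahnSeries.single_mul_single, zero_add]

theorem wHom_X : wHom hk PowerSeries.X = HahnSeries.single (-1 : ℤ) (hPar B) := by
  rw [wHom, RingHom.comp_apply, PowerSeries.map_X, evalNil_X]

theorem wHom_C (z : ℂ) : wHom hk (PowerSeries.C z) = HahnSeries.C (cst B z) := by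
  rw [wHom, RingHom.comp_apply, PowerSeries.map_C, evalNil_C, RingHom.comp_apply]

/-- Laurent series in `u` with coefficients in Laurent series in `v`; series in `u`. -/
def inU (B : Type*) [Ring B] : LaurentSeries B →+* LaurentSeries (LaurentSeries B) :=
  hahnMap HahnSeries.C

/-- Laurent series in `u` with coefficients in Laurent series in `v`; series in `v`. -/
def inV (B : Type*) [Ring B] : LaurentSeries B →+* LaurentSeries (LaurentSeries B) :=
  HahnSeries.C

theorem C_hahn_commute {R : Type*} [Ring R] {a : R} (ha : ∀ r, Commute a r) (x : LaurentSeries R) :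
    Commute (HahnSeries.C a) x := single_commute ha 0 x

theorem inU_wHom_commute (f : PowerSeries ℂ) (x : LaurentSeries (LaurentSeries B)) :
    Commute (inU B (wHom hk f)) x := by
  rw [wHom_apply, wLaurent, map_sum]
  refine Commute.sum_left _ _ _ fun n _ => ?_
  rw [inU, hahnMap_single]
  exact single_commute (fun r => C_hahn_commute
    (fun b => (cst_commute _ b).mul_left ((hPar_commute b).pow_left n)) r) _ _

theorem inV_wHom_commute (f : PowerSeries ℂ) (x : LaurentSeries (LaurentSeries B)) :
    Commute (inV B (wHom hk f)) x := by
  rw [wHom_apply, wLaurent, map_sum]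
  refine Commute.sum_left _ _ _ fun n _ => ?_
  exact C_hahn_commute (single_commute
    (fun b => (cst_commute _ b).mul_left ((hPar_commute b).pow_left n)) _) _

/-- The substitution `w = h / u` with values in the center. -/
def wU : PowerSeries ℂ →+* Subring.center (LaurentSeries (LaurentSeries B)) :=
  ((inU B).comp (wHom hk)).codRestrict _ fun f =>
    Subring.mem_center_iff.2 fun x => (inU_wHom_commute hk f x).symm.eq

/-- The substitution `w = h / v` with values in the center. -/
def wV : PowerSeries ℂ →+* Subring.center (LaurentSeries (LaurentSeries B)) :=
  ((inV B).comp (wHom hk)).codRestrict _ fun f =>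
    Subring.mem_center_iff.2 fun x => (inV_wHom_commute hk f x).symm.eq

/-- The variable `u` as a central element. -/
def varU (B : Type*) [Ring B] : Subring.center (LaurentSeries (LaurentSeries B)) :=
  ⟨HahnSeries.single 1 1, Subring.mem_center_iff.2 fun x =>
    (single_commute Commute.one_left 1 x).symm.eq⟩

/-- The variable `v` as a central element. -/
def varV (B : Type*) [Ring B] : Subring.center (LaurentSeries (LaurentSeries B)) :=
  ⟨HahnSeries.C (HahnSeries.single 1 1), Subring.mem_center_iff.2 fun x =>
    (C_hahn_commute (single_commute Commute.one_left 1) x).symm.eq⟩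

/-- The parameter `h` as a central element. -/
def hCenter (B : Type*) [Ring B] [Algebra Ch B] :
    Subring.center (LaurentSeries (LaurentSeries B)) :=
  ⟨HahnSeries.C (HahnSeries.C (hPar B)), Subring.mem_center_iff.2 fun x =>
    (C_hahn_commute (C_hahn_commute hPar_commute) x).symm.eq⟩

theorem coe_wU (f : PowerSeries ℂ) :
    (wU hk f : LaurentSeries (LaurentSeries B)) = inU B (wHom hk f) := rfl

theorem coe_wV (f : PowerSeries ℂ) :
    (wV hk f : LaurentSeries (LaurentSeries B)) = inV B (wHom hk f) := rfl

theorem coe_varU : (varU B : LaurentSeries (LaurentSeries B)) = HahnSeries.single 1 1 := rfl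

theorem coe_varV :
    (varV B : LaurentSeries (LaurentSeries B)) = HahnSeries.C (HahnSeries.single 1 1) := rfl

theorem coe_hCenter : (hCenter B : LaurentSeries (LaurentSeries B)) =
    HahnSeries.C (HahnSeries.C (hPar B)) := rfl

theorem coe_hOf {R : Type*} [Ring R] (ω : PowerSeries ℂ →+* Subring.center R)
    (υ : Subring.center R) : (hOf ω υ : R) = υ * ω PowerSeries.X := rfl

theorem hOf_wU : hOf (R := LaurentSeries (LaurentSeries B)) (wU hk) (varU B) = hCenter B := by
  have h : (hOf (R := LaurentSeries (LaurentSeries B)) (wU hk) (varU B) :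
      LaurentSeries (LaurentSeries B)) = hCenter B := by
    rw [coe_hOf, coe_wU, coe_varU, coe_hCenter, wHom_X, inU, hahnMap_single,
      HahnSeries.single_mul_single, one_mul, add_neg_cancel, HahnSeries.C_apply, HahnSeries.C_apply]
  exact Subtype.ext h

theorem hOf_wV : hOf (R := LaurentSeries (LaurentSeries B)) (wV hk) (varV B) = hCenter B := by
  have h : (hOf (R := LaurentSeries (LaurentSeries B)) (wV hk) (varV B) :
      LaurentSeries (LaurentSeries B)) = hCenter B := by
    rw [coe_hOf, coe_wV, coe_varV, coe_hCenter, wHom_X, inV, ← map_mul,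
      HahnSeries.single_mul_single, one_mul, add_neg_cancel, HahnSeries.C_apply (hPar B)]
  exact Subtype.ext h

include hk in
theorem isNilpotent_hCenter : IsNilpotent (hCenter B) := by
  refine ⟨k, Subtype.ext ?_⟩
  rw [SubmonoidClass.coe_pow, coe_hCenter, ← map_pow, ← map_pow, hk, map_zero, map_zero, ZeroMemClass.coe_zero]

theorem wU_comp_C : (wU hk).comp PowerSeries.C = (wV hk).comp PowerSeries.C := by
  refine RingHom.ext fun z => Subtype.ext ?_
  rw [RingHom.comp_apply, RingHom.comp_apply, coe_wU, coe_wV, wHom_C, HahnSeries.C_apply, inU, hahnMap_single]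
  rfl

theorem isUnit_of_coe {R : Type*} [Ring R] {x : Subring.center R} (h : IsUnit (x : R)) :
    IsUnit x := by
  obtain ⟨y, h1, h2⟩ := isUnit_iff_exists.1 h
  have hy : y ∈ Subring.center R := Subring.mem_center_iff.2 fun r => by
    have h3 := Subring.mem_center_iff.1 x.2
    calc r * y = y * (x * r) * y := by rw [← mul_assoc, h2, one_mul]
      _ = y * r := by rw [← h3 r, mul_assoc, mul_assoc, h1, mul_one]
  exact isUnit_iff_exists.2 ⟨⟨y, hy⟩, Subtype.ext h1, Subtype.ext h2⟩

theorem isUnit_single_one {R : Type*} [Ring R] :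
    IsUnit (HahnSeries.single (1 : ℤ) (1 : R) : LaurentSeries R) :=
  isUnit_iff_exists.2 ⟨HahnSeries.single (-1) 1, by
    rw [HahnSeries.single_mul_single]
    simp, by
    rw [HahnSeries.single_mul_single]
    simp⟩

/-- Inversion takes place among power series in `u` with invertible constant term. For `y = ±v` this
expands `1 / (u ± v)` in nonnegative powers of `u`. -/
theorem isUnit_single_add_C {R : Type*} [Ring R] {y : R} (hy : IsUnit y) :
    IsUnit (HahnSeries.single (1 : ℤ) (1 : R) + HahnSeries.C y : LaurentSeries R) := by
  have h : IsUnit (PowerSeries.X + PowerSeries.C y : PowerSeries R) := by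
    rw [PowerSeries.isUnit_iff_constantCoeff]
    simpa using hy
  have h1 := h.map (HahnSeries.ofPowerSeries ℤ R)
  rwa [map_add, HahnSeries.ofPowerSeries_X, HahnSeries.ofPowerSeries_C] at h1

section

variable {R : Type*} [Ring R]

theorem isUnit_varU : IsUnit (varU R) := isUnit_of_coe isUnit_single_one

theorem isUnit_varV : IsUnit (varV R) := isUnit_of_coe (isUnit_single_one.map HahnSeries.C)

theorem isUnit_varU_add_varV : IsUnit (varU R + varV R) :=
  isUnit_of_coe (isUnit_single_add_C isUnit_single_one)

theorem isUnit_varU_sub_varV : IsUnit (varU R - varV R) := by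
  refine isUnit_of_coe ?_
  have h := isUnit_single_add_C (y := -(HahnSeries.single (1 : ℤ) (1 : R) : LaurentSeries R))
    isUnit_single_one.neg
  rw [map_neg, ← sub_eq_add_neg] at h
  exact h

end

variable {G : Matrix (Fin N) (Fin N) ℂ} (s : Fin N → Fin N → ℕ → B)

theorem sPlusShift_eq (β : ℂ) :
    sPlusShift k G s β = ((sSeries G s).map (uShift hk β)).map (HahnSeries.ofPowerSeries ℤ B) := by
  ext1 i j
  rw [sPlusShift, Matrix.of_apply, Matrix.map_apply, Matrix.map_apply, sSeries, Matrix.of_apply,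
    map_sub (uShift hk β)]
  congr 1
  rw [uShift, shiftHom_C]
  congr 1
  ext m
  rw [coeff_shiftHom, PowerSeries.coeff_mk, Finset.mul_sum]
  refine Finset.sum_congr rfl fun d _ => ?_
  have h1 : Commute ((cst B β * hPar B) ^ d) (hPar B * s i j (m + d)) :=
    (cst_mul_hPar_commute β _).pow_left d
  rw [PowerSeries.coeff_mk, mul_assoc _ (hPar B * _), ← h1.eq, (cst_commute β _).mul_pow, map_mul,
    map_natCast, map_pow, mul_assoc, mul_assoc, mul_assoc (cst B β ^ d), (hPar_commute _).left_comm,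
    (hPar_commute (cst B β ^ d)).left_comm, ((hPar_commute (hPar B ^ d))).left_comm]

end Laurent

/-! ### Commutativity of the coefficients -/

section Commutativity

variable {N : ℕ} {B : Type*} [Ring B] [Algebra Ch B] {k : ℕ} (hk : hPar B ^ k = 0)
  {G : Matrix (Fin N) (Fin N) ℂ} (s : Fin N → Fin N → ℕ → B)
  {ν μ : YoungDiagram} (U : StandardTableau ν) (V : StandardTableau μ)

theorem map_trace {R R' m : Type*} [Ring R] [Ring R'] [Fintype m] (f : R →+* R')
    (X : Matrix m m R) : f X.trace = (X.map f).trace := by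
  simp [Matrix.trace]

theorem map_mLaurent {R : Type*} [Ring R] (f : LaurentSeries B →+* R)
    (ω : PowerSeries ℂ →+* Subring.center R) (hω : ∀ x, (ω x : R) = f (wHom hk x)) :
    f (mLaurent G (-(N : ℂ) / 2) U k s) =
      tableauTrace G U ω fun α => (sPlusShift k G s (α : ℂ)).map f := by
  have hw : ∀ (m : Type) (X : Matrix m m (PowerSeries ℂ)),
      (X.map (wLaurent k B)).map f = X.map (coeHom ω) := by
    intro m X
    ext1 a b
    change f (wLaurent k B (X a b)) = (ω (X a b) : R)
    rw [hω, wHom_apply]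
  have hE : ((U.idempotentMat N).map (fun z => HahnSeries.C (Γ := ℤ) (cst B z))).map f =
      (U.idempotentMat N).map (coeHom (ω.comp PowerSeries.C)) := by
    ext1 a b
    change f (HahnSeries.C (cst B (U.idempotentMat N a b))) =
      (ω (PowerSeries.C (U.idempotentMat N a b)) : R)
    rw [hω, wHom_C]
  rw [mLaurent, map_trace, sPlusPart, Matrix.map_mul, Matrix.map_mul, map_bracket, hE, hw]
  simp only [hw, tableauTrace]

/-- Power series in two variables, as Laurent series in the first one over Laurent series in the second. -/
def twoVar (B : Type*) [Ring B] :
    PowerSeries (PowerSeries B) →+* LaurentSeries (LaurentSeries B) :=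
  (HahnSeries.ofPowerSeries ℤ (LaurentSeries B)).comp
    (PowerSeries.map (HahnSeries.ofPowerSeries ℤ B))

theorem twoVar_C (f : PowerSeries B) :
    twoVar B (PowerSeries.C f) = inV B (HahnSeries.ofPowerSeries ℤ B f) := by
  rw [twoVar, RingHom.comp_apply, PowerSeries.map_C, HahnSeries.ofPowerSeries_C, inV]

theorem twoVar_map_C (f : PowerSeries B) :
    twoVar B (PowerSeries.map PowerSeries.C f) = inU B (HahnSeries.ofPowerSeries ℤ B f) := by
  have h : PowerSeries.map (HahnSeries.ofPowerSeries ℤ B) (PowerSeries.map PowerSeries.C f) =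
      PowerSeries.map (HahnSeries.C (Γ := ℤ)) f := by
    ext1 n
    rw [PowerSeries.coeff_map, PowerSeries.coeff_map, PowerSeries.coeff_map,
      HahnSeries.ofPowerSeries_C]
  rw [twoVar, RingHom.comp_apply, h, ofPowerSeries_map, inU]

/-- The variables are independent, so commutativity of all pairs of coefficients is the
commutativity of two elements of the ring of series in both variables. -/
theorem coeff_inU_mul_inV (x y : LaurentSeries B) (a b : ℤ) :
    ((inU B x * inV B y).coeff a).coeff b = x.coeff a * y.coeff b := by
  rw [inV, HahnSeries.C_apply, HahnSeries.coeff_mul_single_zero, inU, coeff_hahnMap,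
    HahnSeries.C_apply, HahnSeries.coeff_single_zero_mul]

theorem coeff_inV_mul_inU (x y : LaurentSeries B) (a b : ℤ) :
    ((inV B y * inU B x).coeff a).coeff b = y.coeff b * x.coeff a := by
  rw [inV, HahnSeries.C_apply, HahnSeries.coeff_single_zero_mul, inU, coeff_hahnMap,
    HahnSeries.C_apply, HahnSeries.coeff_mul_single_zero]

include hk in
/-- The coefficients of the series attached to tableaux commute, if the reflection equations
hold. -/
theorem mLaurent_coeff_commute (hG : IsUnit G.det) (hGt : G.transpose = G ∨ G.transpose = -G)
    (H : ReflEq (outerVar B - innerVar B) (const2 (hPar B)) (-outerVar B - innerVar B)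
      (const2 (hPar B)) (inOuter (sSeries G s)) (inInner (sSeries G s)))
    (H' : ∀ α β : ℤ, ReflEq ((α - β : ℤ) : PowerSeries B) 1
      (-(PowerSeries.X + PowerSeries.C (cst _ (α : ℂ) * hPar _)) -
        (PowerSeries.X + PowerSeries.C (cst _ (β : ℂ) * hPar _))) (PowerSeries.C (hPar _))
      ((sSeries G s).map (uShift hk (α : ℂ))) ((sSeries G s).map (uShift hk (β : ℂ))))
    (a b : ℤ) :
    (mLaurent G (-(N : ℂ) / 2) U k s).coeff a * (mLaurent G (-(N : ℂ) / 2) V k s).coeff b =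
      (mLaurent G (-(N : ℂ) / 2) V k s).coeff b * (mLaurent G (-(N : ℂ) / 2) U k s).coeff a := by
  rw [← coeff_inU_mul_inV, ← coeff_inV_mul_inU, map_mLaurent hk s U (inU B) (wU hk) (coe_wU hk),
    map_mLaurent hk s V (inV B) (wV hk) (coe_wV hk)]
  congr 2
  have hUX : inU B (HahnSeries.ofPowerSeries ℤ B PowerSeries.X) = varU B := by
    rw [HahnSeries.ofPowerSeries_X, inU, hahnMap_single, map_one, coe_varU]
  have hVX : inV B (HahnSeries.ofPowerSeries ℤ B PowerSeries.X) = varV B := by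
    rw [HahnSeries.ofPowerSeries_X, inV, coe_varV]
  have hUC : ∀ b, inU B (HahnSeries.ofPowerSeries ℤ B (PowerSeries.C b)) =
      HahnSeries.C (HahnSeries.C b) := fun b => by
    rw [HahnSeries.ofPowerSeries_C, inU, HahnSeries.C_apply, hahnMap_single, HahnSeries.C_apply,
      HahnSeries.C_apply]
  have hVC : ∀ b, inV B (HahnSeries.ofPowerSeries ℤ B (PowerSeries.C b)) =
      HahnSeries.C (HahnSeries.C b) := fun b => by
    rw [HahnSeries.ofPowerSeries_C, inV]
  have hsh : ∀ α : ℤ, HahnSeries.C (HahnSeries.C ((α : B) * hPar B)) =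
      ((hCenter B * α : Subring.center (LaurentSeries (LaurentSeries B))) :
        LaurentSeries (LaurentSeries B)) := fun α => by
    rw [MulMemClass.coe_mul, coe_hCenter, map_mul, map_mul, map_intCast, map_intCast]
    exact (Int.cast_commute α _).eq
  refine tableauTrace_commute (R := LaurentSeries (LaurentSeries B)) U V hG hGt isUnit_varU
    isUnit_varV ?_ ?_ (hOf_wU hk) (hOf_wV hk) (wU_comp_C hk) (isNilpotent_hCenter hk) isUnit_varU_sub_varV isUnit_varU_add_varV ?_
  · intro α β
    have h1 := (H' α β).map ((inU B).comp (HahnSeries.ofPowerSeries ℤ B))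
    simp only [map_intCast, map_one, map_sub, map_neg, map_add, RingHom.comp_apply, hUX, hUC,
      hsh] at h1
    beta_reduce
    rw [hOf_wU, sPlusShift_eq hk, sPlusShift_eq hk]
    exact h1
  · intro α β
    have h1 := (H' α β).map ((inV B).comp (HahnSeries.ofPowerSeries ℤ B))
    simp only [map_intCast, map_one, map_sub, map_neg, map_add, RingHom.comp_apply, hVX, hVC,
      hsh] at h1
    beta_reduce
    rw [hOf_wV, sPlusShift_eq hk, sPlusShift_eq hk]
    exact h1
  · intro α β
    have h1 := (shifted_reflEq hk H (α : ℂ) (β : ℂ)).map (twoVar B)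
    have e1 : twoVar B (outerVar B) = varU B := by
      rw [← hUX, ← twoVar_map_C, PowerSeries.map_X, outerVar]
    have e2 : twoVar B (innerVar B) = varV B := by
      rw [← hVX, ← twoVar_C, innerVar]
    have e3 : ∀ b, twoVar B (const2 b) = HahnSeries.C (HahnSeries.C b) := fun b => by
      rw [const2, twoVar_C, hVC]
    have e4 : ∀ X : Matrix (Fin N) (Fin N) (PowerSeries B), (inOuter X).map (twoVar B) =
        (X.map (HahnSeries.ofPowerSeries ℤ B)).map (inU B) := fun X => by
      ext1 i j
      exact twoVar_map_C _
    have e5 : ∀ X : Matrix (Fin N) (Fin N) (PowerSeries B), (inInner X).map (twoVar B) =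
        (X.map (HahnSeries.ofPowerSeries ℤ B)).map (inV B) := fun X => by
      ext1 i j
      exact twoVar_C _
    simp only [map_sub, map_neg, map_add, map_intCast, e1, e2, e3, e4, e5, hsh] at h1
    rw [sPlusShift_eq hk, sPlusShift_eq hk]
    exact h1

end Commutativity

/-- All coefficients of the series `M_ν(u)` commute. -/
theorem mCoeff_commute {N : ℕ} {G : Matrix (Fin N) (Fin N) ℂ} (hG : IsUnit G.det)
    (hGt : G.transpose = G ∨ G.transpose = -G) {ν μ : YoungDiagram} (U : StandardTableau ν)
    (V : StandardTableau μ) (a b : ℤ) :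
    mCoeff G (-(N : ℂ) / 2) U a * mCoeff G (-(N : ℂ) / 2) V b =
      mCoeff G (-(N : ℂ) / 2) V b * mCoeff G (-(N : ℂ) / 2) U a := by
  refine Subtype.ext (funext fun k => ?_)
  exact mLaurent_coeff_commute (hPar_pow_modH (YPlus G) k) (sGenModH G k) U V hG hGt
    (map_reflEq_sGen G hGt (Ideal.Quotient.mkₐ Ch (hIdeal (YPlus G) k)))
    (shift_reflEq_modH G hGt k) a b

/-! ### Power series with matrix coefficients -/

section MatrixSeries

variable {L m : Type*} [Ring L] [Fintype m] [DecidableEq m]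

/-- A power series with matrix coefficients as a matrix of power series. -/
def matrixOfSeries : PowerSeries (Matrix m m L) →+* Matrix m m (PowerSeries L) where
  toFun F := Matrix.of fun i j => PowerSeries.mk fun n => PowerSeries.coeff n F i j
  map_one' := by
    ext i j n
    rw [Matrix.of_apply, PowerSeries.coeff_mk, PowerSeries.coeff_one, Matrix.one_apply]
    split_ifs <;> simp_all [PowerSeries.coeff_one, Matrix.one_apply]
  map_mul' F H := by
    ext i j n
    simp only [Matrix.of_apply, PowerSeries.coeff_mk, PowerSeries.coeff_mul, Matrix.mul_apply,
      Matrix.sum_apply, map_sum]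
    rw [Finset.sum_comm]
  map_zero' := by ext i j n; simp
  map_add' F H := by ext i j n; simp

/-- A matrix of power series is invertible if its constant term is. -/
theorem isUnit_of_constantCoeff {Z : Matrix m m (PowerSeries L)}
    (h : IsUnit (Z.map PowerSeries.constantCoeff)) : IsUnit Z := by
  set F : PowerSeries (Matrix m m L) := PowerSeries.mk fun n => Z.map (PowerSeries.coeff n) with hF
  have h1 : IsUnit F := by
    rw [PowerSeries.isUnit_iff_constantCoeff]
    have h2 : PowerSeries.constantCoeff F = Z.map PowerSeries.constantCoeff := by
      rw [← PowerSeries.coeff_zero_eq_constantCoeff_apply, hF, PowerSeries.coeff_mk]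
      ext1 i j
      simp
    rwa [h2]
  have h3 : matrixOfSeries F = Z := by
    ext i j n
    change PowerSeries.coeff n (PowerSeries.mk fun n => PowerSeries.coeff n F i j) = _
    rw [PowerSeries.coeff_mk, hF, PowerSeries.coeff_mk, Matrix.map_apply]
  rw [← h3]
  exact h1.map matrixOfSeries

/-- Matrices of power series which coincide modulo a left ideal. -/
def CongrMod (J : Ideal L) {m : Type*} (X Y : Matrix m m (PowerSeries L)) : Prop :=
  ∀ i j n, PowerSeries.coeff n (X i j) - PowerSeries.coeff n (Y i j) ∈ J

variable {J : Ideal L}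

theorem CongrMod.refl {m : Type*} (X : Matrix m m (PowerSeries L)) : CongrMod J X X :=
  fun i j n => by simp

theorem CongrMod.mul_left {X Y : Matrix m m (PowerSeries L)} (Z : Matrix m m (PowerSeries L))
    (h : CongrMod J X Y) : CongrMod J (Z * X) (Z * Y) := fun i j n => by
  rw [← map_sub, ← Matrix.sub_apply, ← mul_sub, Matrix.mul_apply, map_sum]
  refine Submodule.sum_mem _ fun l _ => ?_
  rw [PowerSeries.coeff_mul]
  refine Submodule.sum_mem _ fun p _ => J.mul_mem_left _ ?_
  rw [Matrix.sub_apply, map_sub]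
  exact h _ _ _

/-- The ideal is only a left ideal; a factor on the right is harmless since its entries are central
and can be moved to the left. -/
theorem CongrMod.mul_right {X Y Z : Matrix m m (PowerSeries L)} (h : CongrMod J X Y)
    (hZ : ∀ i j r, Commute (Z i j) r) : CongrMod J (X * Z) (Y * Z) := fun i j n => by
  rw [← map_sub, ← Matrix.sub_apply, ← sub_mul, Matrix.mul_apply, map_sum]
  refine Submodule.sum_mem _ fun l _ => ?_
  rw [← (hZ l j _).eq, PowerSeries.coeff_mul]
  refine Submodule.sum_mem _ fun p _ => J.mul_mem_left _ ?_
  rw [Matrix.sub_apply, map_sub]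
  exact h _ _ _

theorem CongrMod.trans {m : Type*} {X Y Z : Matrix m m (PowerSeries L)} (h : CongrMod J X Y)
    (h' : CongrMod J Y Z) : CongrMod J X Z := fun i j n => by
  have := J.add_mem (h i j n) (h' i j n)
  rwa [sub_add_sub_cancel] at this

theorem CongrMod.symm {m : Type*} {X Y : Matrix m m (PowerSeries L)} (h : CongrMod J X Y) :
    CongrMod J Y X := fun i j n => by
  have := J.neg_mem (h i j n)
  rwa [neg_sub] at this

theorem CongrMod.mul {X Y X' Y' : Matrix m m (PowerSeries L)} (h : CongrMod J X Y)
    (h' : CongrMod J X' Y') (hY : ∀ i j r, Commute (Y' i j) r) :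
    CongrMod J (X * X') (Y * Y') := (h'.mul_left X).trans (h.mul_right hY)

/-- Modulo the left ideal, `X' = X' Y Y'` is congruent to `X' X Y' = Y'`; only the right factor `Y'`
has to be central. -/
theorem CongrMod.inverse {X Y X' Y' : Matrix m m (PowerSeries L)} (h : CongrMod J X Y)
    (hX : X' * X = 1) (hY : Y * Y' = 1) (hc : ∀ i j r, Commute (Y' i j) r) :
    CongrMod J X' Y' := by
  have h1 := ((h.mul_right hc).mul_left X').symm
  rwa [hY, mul_one, ← mul_assoc, hX, one_mul] at h1

theorem commute_matrix_mul {R : Type*} [Ring R] {X Y : Matrix m m R}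
    (hX : ∀ i j r, Commute (X i j) r) (hY : ∀ i j r, Commute (Y i j) r) (i j : m) (r : R) :
    Commute ((X * Y) i j) r := by
  rw [Matrix.mul_apply]
  exact Commute.sum_left _ _ _ fun l _ => (hX i l r).mul_left (hY l j r)

theorem commute_matrix_one {R : Type*} [Ring R] (i j : m) (r : R) :
    Commute ((1 : Matrix m m R) i j) r := by
  rw [Matrix.one_apply]
  split_ifs
  exacts [Commute.one_left r, Commute.zero_left r]

theorem CongrMod.list_prod {ι : Type*} {F H : ι → Matrix m m (PowerSeries L)} (l : List ι)
    (h : ∀ i, CongrMod J (F i) (H i)) (hc : ∀ i a b r, Commute (H i a b) r) :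
    CongrMod J (l.map F).prod (l.map H).prod ∧ ∀ a b r, Commute ((l.map H).prod a b) r := by
  induction l with
  | nil => exact ⟨CongrMod.refl _, fun a b r => commute_matrix_one a b r⟩
  | cons i l ih =>
    rw [List.map_cons, List.map_cons, List.prod_cons, List.prod_cons]
    exact ⟨(h i).mul ih.1 ih.2, commute_matrix_mul (hc i) ih.2⟩

theorem CongrMod.bracket {N n : ℕ} {S T : Fin n → Matrix (Fin N) (Fin N) (PowerSeries L)}
    {Q : Fin n → Fin n → Matrix (Fin N × Fin N) (Fin N × Fin N) (PowerSeries L)}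
    (h : ∀ i, CongrMod J (S i) (T i)) (hT : ∀ i a b r, Commute (T i a b) r)
    (hQ : ∀ i j a b r, Commute (Q i j a b) r) :
    CongrMod J (TwistedYangian.bracket S Q) (TwistedYangian.bracket T Q) ∧
      ∀ a b r, Commute (TwistedYangian.bracket T Q a b) r := by
  have h1 : ∀ i, CongrMod J (site i (S i)) (site i (T i)) := fun i a b m => by
    simp only [site, Matrix.of_apply]
    split_ifs
    · exact h i _ _ _
    · simp
  have h2 : ∀ i a b r, Commute (site i (T i) a b) r := fun i a b r => by
    simp only [site, Matrix.of_apply]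
    split_ifs
    exacts [hT i _ _ r, Commute.zero_left r]
  have h3 : ∀ i j a b r, Commute (sites i j (Q i j) a b) r := fun i j a b r => by
    simp only [sites, Matrix.of_apply]
    split_ifs
    exacts [hQ i j _ _ r, Commute.zero_left r]
  have h4 : ∀ i (l : List (Fin n)), _ := fun i l =>
    CongrMod.list_prod (J := J) l (fun j => CongrMod.refl (sites i j (Q i j))) (h3 i)
  exact CongrMod.list_prod _ (fun i => (h1 i).mul (h4 i _).1 (h4 i _).2)
    fun i => commute_matrix_mul (h2 i) (h4 i _).2

end MatrixSeries

/-! ### The action on the vacuum vector -/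

section Vacuum

variable {N : ℕ} {c : ℂ}

/-- The substitution `w = h / u` in the power series in `u⁻¹`. -/
def wPowerHom (N : ℕ) (c : ℂ) : PowerSeries ℂ →+* PowerSeries (DYLevel N c) where
  toFun := wPower N c
  map_one' := by
    ext n
    rw [wPower, PowerSeries.coeff_mk, PowerSeries.coeff_one, PowerSeries.coeff_one]
    split_ifs with h <;> simp [h]
  map_mul' f g := by
    ext n
    simp only [wPower, PowerSeries.coeff_mk, PowerSeries.coeff_mul, map_sum, Finset.sum_mul]
    refine Finset.sum_congr rfl fun p hp => ?_
    rw [← Finset.HasAntidiagonal.mem_antidiagonal.1 hp, map_mul,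
      pow_add, (cst_commute _ _).mul_mul_mul_comm]
  map_zero' := by ext n; simp [wPower]
  map_add' f g := by ext n; simp [wPower, add_mul]

theorem wPower_commute (f : PowerSeries ℂ) (r : PowerSeries (DYLevel N c)) :
    Commute (wPower N c f) r := by
  have h : ∀ n a, Commute (PowerSeries.coeff n (wPower N c f)) a := fun n a => by
    rw [wPower, PowerSeries.coeff_mk]
    exact (cst_commute _ _).mul_left ((hPar_commute _).pow_left n)
  ext n
  rw [PowerSeries.coeff_mul, PowerSeries.coeff_mul, Finset.Nat.sum_antidiagonal_swap.symm]
  exact Finset.sum_congr rfl fun p _ => (h _ _).eq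

/-- The elements of the double Yangian which annihilate the vacuum vector modulo `h ^ k`. -/
def vacuumAnnihilator (N : ℕ) (c : ℂ) (k : ℕ) : Ideal (DYLevel N c) :=
  (vacuumIdeal N c k).comap (Ideal.Quotient.mk (hIdeal (DYLevel N c) k))

theorem tPos_mem_vacuumAnnihilator (k : ℕ) (i j : Fin N) (r : ℕ) :
    toLevel N c (tPos i j r) ∈ vacuumAnnihilator N c k :=
  Ideal.subset_span ⟨i, j, r, rfl⟩

theorem vacuumClass_eq {k : ℕ} {x y : DYLevel N c} (h : x - y ∈ vacuumAnnihilator N c k) :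
    vacuumClass N c k x = vacuumClass N c k y := by
  rw [← sub_eq_zero, ← map_sub]
  exact (Submodule.Quotient.mk_eq_zero _).2 h

/-- Up to central factors each correction term is a generator `t_ij^{(r)}` of the left ideal. -/
theorem tShift_congr (k : ℕ) (a β : ℂ) :
    CongrMod (vacuumAnnihilator N c k) (tShift N c a β) 1 := fun i j n => by
  have e : PowerSeries.coeff n (tShift N c a β i j) -
      PowerSeries.coeff n ((1 : Matrix (Fin N) (Fin N) (PowerSeries (DYLevel N c))) i j) =
      hPar _ * ∑ r ∈ Finset.range n, toLevel N c (tPos i j r) *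
        (cst _ (PowerSeries.coeff (n - (r + 1)) (shiftInv a β ^ (r + 1))) *
          hPar _ ^ (n - (r + 1))) := by
    rw [tShift, Matrix.of_apply, map_add, Matrix.one_apply, add_sub_cancel_left,
      PowerSeries.coeff_mk]
  rw [e]
  refine Ideal.mul_mem_left _ _ (Submodule.sum_mem _ fun r _ => ?_)
  rw [← ((cst_commute _ _).mul_left ((hPar_commute _).pow_left _)).eq]
  exact Ideal.mul_mem_left _ _ (tPos_mem_vacuumAnnihilator k i j r)

variable (G : Matrix (Fin N) (Fin N) ℂ)

theorem constant_commute (z : ℂ) (r : PowerSeries (DYLevel N c)) :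
    Commute (PowerSeries.C (cst (DYLevel N c) z)) r := C_commute (cst_commute z) r

theorem sShift_congr (k : ℕ) (β : ℂ) :
    CongrMod (vacuumAnnihilator N c k) (sShift c G β)
      (G.map fun z => PowerSeries.C (cst (DYLevel N c) z)) := by
  have h1 : CongrMod (vacuumAnnihilator N c k) (tShift N c (-1) (-β)).transpose 1 :=
    fun i j n => by
      have := tShift_congr (N := N) (c := c) k (-1) (-β) j i n
      rwa [← Matrix.transpose_apply 1, Matrix.transpose_one] at this
  have h2 := ((tShift_congr k 1 (β + c)).mul_right
    (Z := G.map fun z => PowerSeries.C (cst (DYLevel N c) z))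
      (fun i j r => constant_commute _ r)).mul h1 commute_matrix_one
  rwa [one_mul, mul_one] at h2

theorem constantCoeff_tShift (a β : ℂ) :
    (tShift N c a β).map PowerSeries.constantCoeff = 1 := by
  ext1 i j
  rw [Matrix.map_apply, tShift, Matrix.of_apply, map_add, Matrix.one_apply,
    ← PowerSeries.coeff_zero_eq_constantCoeff_apply, ← PowerSeries.coeff_zero_eq_constantCoeff_apply,
    PowerSeries.coeff_mk]
  split_ifs <;> simp

theorem constantCoeff_sShift (β : ℂ) :
    (sShift c G β).map PowerSeries.constantCoeff =
      (G.map fun z => PowerSeries.C (cst (DYLevel N c) z)).map PowerSeries.constantCoeff := by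
  rw [sShift, Matrix.map_mul, Matrix.map_mul, constantCoeff_tShift, Matrix.transpose_map,
    constantCoeff_tShift, one_mul, Matrix.transpose_one, mul_one]

theorem scalar_bracket {ν : YoungDiagram} (U : StandardTableau ν) :
    bracket (fun _ => G.map fun z => PowerSeries.C (cst (DYLevel N c) z))
      (fun i j => (RBarT N (-2) (-((U.content i : ℂ) + U.content j) - 2 * c)).map (wPower N c)) =
        (vacuumFactor G c U).map (wPower N c) := by
  have h := map_bracket (wPowerHom N c) (fun _ : Fin ν.card => G.map PowerSeries.C)
    fun i j => RBarT N (-2) (-((U.content i : ℂ) + U.content j) - 2 * c)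
  have hC : (G.map PowerSeries.C).map (wPowerHom N c) =
      G.map fun z => PowerSeries.C (cst (DYLevel N c) z) := by
    ext i j n
    change PowerSeries.coeff n (wPower N c (PowerSeries.C (G i j))) = _
    rw [wPower, PowerSeries.coeff_mk, Matrix.map_apply, PowerSeries.coeff_C, PowerSeries.coeff_C]
    split_ifs with h0 <;> simp [h0]
  rw [hC] at h
  exact h.symm

/-- On the vacuum vector, `S_[n](u_ν + h c / 2)⁻¹` acts as the inverse of the vacuum factor. -/
theorem sBracketInv_congr {ν : YoungDiagram} (U : StandardTableau ν)
    (hU : IsUnit (vacuumFactor G c U)) (k : ℕ) :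
    CongrMod (vacuumAnnihilator N c k) (sBracketInv c G U)
      ((vacuumFactor G c U)⁻¹.map (wPower N c)) := by
  have hd := (Matrix.isUnit_iff_isUnit_det _).1 hU
  have hmul : (vacuumFactor G c U).map (wPower N c) * (vacuumFactor G c U)⁻¹.map (wPower N c) =
      1 := by
    have h := congrArg (wPowerHom N c).mapMatrix (Matrix.mul_nonsing_inv _ hd)
    rwa [map_mul, map_one] at h
  have hmul' : (vacuumFactor G c U)⁻¹.map (wPower N c) * (vacuumFactor G c U).map (wPower N c) =
      1 := by
    have h := congrArg (wPowerHom N c).mapMatrix (Matrix.nonsing_inv_mul _ hd)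
    rwa [map_mul, map_one] at h
  have hcongr := (CongrMod.bracket (J := vacuumAnnihilator N c k)
    (S := fun i => sShift c G ((U.content i : ℂ) + c / 2))
    (Q := fun i j => (RBarT N (-2) (-((U.content i : ℂ) + U.content j) - 2 * c)).map (wPower N c))
    (fun i => sShift_congr G k _) (fun i a b r => constant_commute _ r)
    fun i j a b r => wPower_commute _ r).1
  rw [scalar_bracket] at hcongr
  -- `Ring.inverse` is zero on nonunits, so invertibility must be known. It is visible at `u⁻¹ = 0`,
  -- where the product has the same constant term as the invertible numerical one.
  have hZ : IsUnit (bracket (fun i => sShift c G ((U.content i : ℂ) + c / 2))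
      (fun i j => (RBarT N (-2) (-((U.content i : ℂ) + U.content j) - 2 * c)).map
        (wPower N c))) := by
    refine isUnit_of_constantCoeff ?_
    rw [map_bracket]
    simp only [constantCoeff_sShift]
    have h1 := map_bracket PowerSeries.constantCoeff
      (fun _ : Fin ν.card => G.map fun z => PowerSeries.C (cst (DYLevel N c) z))
      fun i j => (RBarT N (-2) (-((U.content i : ℂ) + U.content j) - 2 * c)).map (wPower N c)
    rw [← h1, scalar_bracket]
    exact (isUnit_iff_exists.2 ⟨_, hmul, hmul'⟩).map
      (PowerSeries.constantCoeff (R := DYLevel N c)).mapMatrix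
  exact hcongr.inverse (Ring.inverse_mul_cancel _ hZ) hmul fun i j r => wPower_commute _ r

end Vacuum

/-! ### Comparison of the two series on the vacuum vector -/

section VacuumAction

variable {N : ℕ} (c : ℂ) (G : Matrix (Fin N) (Fin N) ℂ) {ν : YoungDiagram} (U : StandardTableau ν)

/-- `laurentMap_mLaurent` lowers the truncation order by one. Applied to the identity and to `f`, it
compares both sides with the truncation of order `k + 1`. -/
theorem laurentMap_mLaurent_same {B B' : Type*} [Ring B] [Algebra Ch B] [Ring B'] [Algebra Ch B']
    (f : B →ₐ[Ch] B') {k : ℕ} (hk : hPar B ^ k = 0) (hk' : hPar B' ^ k = 0)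
    (s : Fin N → Fin N → ℕ → B) :
    laurentMap f (mLaurent G c U k s) = mLaurent G c U k fun i j r => f (s i j r) := by
  have h1 := laurentMap_mLaurent (AlgHom.id Ch B) hk G c U s s fun i j r => rfl
  have h2 := laurentMap_mLaurent f hk' G c U s (fun i j r => f (s i j r)) fun i j r => rfl
  rw [← h2, ← h1]
  rfl

/-- The map `Y⁺(g_N) / h^k → DY_c(gl_N) / h^k` as a homomorphism of algebras. -/
def yPlusToLevelAlg (k : ℕ) : ModH (YPlus G) k →ₐ[Ch] ModH (DYLevel N c) k :=
  { yPlusToLevelModH c G k with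
    commutes' := fun r => by
      change Ideal.Quotient.mk _ (yPlusToLevel c G (algebraMap Ch (YPlus G) r)) = _
      rw [AlgHom.commutes]
      rfl }

theorem coeff_mul_wLaurent {B : Type*} [Ring B] [Algebra Ch B] (k : ℕ) (x : LaurentSeries B)
    (f : PowerSeries ℂ) (a : ℤ) :
    (x * wLaurent k B f).coeff a = ∑ m ∈ Finset.range k,
      x.coeff (a + m) * (cst B (PowerSeries.coeff m f) * hPar B ^ m) := by
  rw [wLaurent, Finset.mul_sum, HahnSeries.coeff_sum]
  refine Finset.sum_congr rfl fun m _ => ?_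
  rw [HahnSeries.coeff_mul_single, sub_neg_eq_add]

variable {c}

theorem vacuumClass_sBracketInv (hU : IsUnit (vacuumFactor G c U)) (k m : ℕ)
    (p q : Fin ν.card → Fin N) :
    vacuumClass N c k (PowerSeries.coeff m (sBracketInv c G U q p)) =
      Submodule.Quotient.mk (cst (ModH (DYLevel N c) k)
        (PowerSeries.coeff m ((vacuumFactor G c U)⁻¹ q p)) * hPar _ ^ m) := by
  rw [vacuumClass_eq (sBracketInv_congr G U hU k q p m), Matrix.map_apply, wPower,
    PowerSeries.coeff_mk]
  change Submodule.Quotient.mk (Ideal.Quotient.mkₐ Ch (hIdeal (DYLevel N c) k) _) = _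
  rw [map_mul, map_pow, map_cst, map_hPar]

/-- The series `M_ν(u)` acts on the vacuum vector as `A_ν(u)`. -/
theorem actOnVacuum_mCoeff (hU : IsUnit (vacuumFactor G c U)) (a : ℤ) :
    (actOnVacuum c G (mCoeff G c U a)).1 = aVacuumCoeff c G U a := by
  funext k
  have h1 := laurentMap_mLaurent_same c G U (yPlusToLevelAlg c G k) (hPar_pow_modH _ k)
    (hPar_pow_modH _ k) (sGenModH G k)
  have h2 : yPlusToLevelModH c G k ((mCoeff G c U a).1 k) =
      (mLaurent G c U k fun i j r => (Ideal.Quotient.mk (hIdeal (DYLevel N c) k)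
        (toLevel N c (sNeg G i j r)) : ModH (DYLevel N c) k)).coeff a :=
    congrArg (fun x => x.coeff a) h1
  change Submodule.Quotient.mk (yPlusToLevelModH c G k ((mCoeff G c U a).1 k)) = _
  rw [h2, aVacuumCoeff, mLaurent, Matrix.trace, HahnSeries.coeff_sum]
  simp only [Matrix.diag_apply, Matrix.mul_apply, HahnSeries.coeff_sum]
  set X := sPlusPart k G (fun i j r => (Ideal.Quotient.mk (hIdeal (DYLevel N c) k)
        (toLevel N c (sNeg G i j r)) : ModH (DYLevel N c) k)) U with hX
  change Submodule.mkQ (vacuumIdeal N c k) _ = _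
  rw [map_sum]
  refine Finset.sum_congr rfl fun p _ => ?_
  rw [map_sum]
  refine Finset.sum_congr rfl fun q _ => ?_
  -- On the vacuum the `m`-th coefficient of the inverse carries the factor `h ^ m`, so the sum over
  -- all `m` is supported on `m < k`.
  rw [Matrix.map_apply, coeff_mul_wLaurent, map_sum,
    finsum_eq_sum_of_support_subset (s := Finset.range k)]
  · refine Finset.sum_congr rfl fun m _ => ?_
    rw [vacuumClass_sBracketInv G U hU]
    rfl
  · intro m hm
    rw [Finset.mem_coe, Finset.mem_range]
    by_contra h
    refine hm ?_
    beta_reduce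
    rw [vacuumClass_sBracketInv G U hU, pow_eq_zero_of_le' (hPar_pow_modH _ k) (not_lt.1 h),
      mul_zero, Submodule.Quotient.mk_zero, smul_zero]

end VacuumAction

end TwistedYangian

end

theorem corollary4p5 (N : ℕ) (hN : 2 ≤ N) (G : Matrix (Fin N) (Fin N) ℂ) (hG : IsUnit G.det)
    (hGt : G.transpose = G ∨ G.transpose = -G) :
    (∀ (ν : YoungDiagram), ν.colLen 0 ≤ N → ∀ (U : TwistedYangian.StandardTableau ν) (a : ℤ),
      (TwistedYangian.actOnVacuum (-(N : ℂ) / 2) G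
          (TwistedYangian.mCoeff G (-(N : ℂ) / 2) U a)).1 =
        TwistedYangian.aVacuumCoeff (-(N : ℂ) / 2) G U a) ∧
    (∀ (ν μ : YoungDiagram), ν.colLen 0 ≤ N → μ.colLen 0 ≤ N →
      ∀ (U : TwistedYangian.StandardTableau ν) (V : TwistedYangian.StandardTableau μ) (a b : ℤ),
        TwistedYangian.mCoeff G (-(N : ℂ) / 2) U a * TwistedYangian.mCoeff G (-(N : ℂ) / 2) V b =
          TwistedYangian.mCoeff G (-(N : ℂ) / 2) V b *
            TwistedYangian.mCoeff G (-(N : ℂ) / 2) U a) ∧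
    (∀ x ∈ Algebra.adjoin TwistedYangian.Ch
        {m : TwistedYangian.HCompletion (TwistedYangian.YPlus G) |
          ∃ ν : YoungDiagram, ν.colLen 0 ≤ N ∧ ∃ (U : TwistedYangian.StandardTableau ν) (a : ℤ),
            m = TwistedYangian.mCoeff G (-(N : ℂ) / 2) U a},
      ∀ y ∈ Algebra.adjoin TwistedYangian.Ch
        {m : TwistedYangian.HCompletion (TwistedYangian.YPlus G) |
          ∃ ν : YoungDiagram, ν.colLen 0 ≤ N ∧ ∃ (U : TwistedYangian.StandardTableau ν) (a : ℤ),
            m = TwistedYangian.mCoeff G (-(N : ℂ) / 2) U a},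
        x * y = y * x) := by
  refine ⟨fun ν _ U a => TwistedYangian.actOnVacuum_mCoeff G U
      (TwistedYangian.isUnit_vacuumFactor U hG) a,
    fun ν μ _ _ U V a b => TwistedYangian.mCoeff_commute hG hGt U V a b, fun x hx y hy => ?_⟩
  -- Commutation spreads from the generators to the subalgebra in both arguments; constants are
  -- central.
  refine Algebra.adjoin_induction₂ (p := fun x y _ _ => x * y = y * x) ?_ ?_ ?_ ?_ ?_ ?_ ?_ ?_ hx hy
  · rintro _ _ ⟨ν, _, U, a, rfl⟩ ⟨μ, _, V, b, rfl⟩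
    exact TwistedYangian.mCoeff_commute hG hGt U V a b
  · exact fun r s => ((algebraMap TwistedYangian.Ch _).map_mul r s).symm.trans
      ((congrArg _ (mul_comm r s)).trans ((algebraMap TwistedYangian.Ch _).map_mul s r))
  · exact fun r x _ => Algebra.commutes r x
  · exact fun r x _ => (Algebra.commutes r x).symm
  · exact fun x y z _ _ _ h h' => by rw [add_mul, mul_add, h, h']
  · exact fun x y z _ _ _ h h' => by rw [add_mul, mul_add, h, h']
  · exact fun x y z _ _ _ h h' => by rw [mul_assoc, h', ← mul_assoc, h, mul_assoc]
  · exact fun x y z _ _ _ h h' => by rw [← mul_assoc, h, mul_assoc, h', mul_assoc]
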